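/- Notation and function spaces. Let $\mathscr Q=(-1/2,1/2)^2\subset\mathbb R^2$; for $1/\mu\in\mathbb N$ let $\mathcal T_\mu$ be the tiling of $\mathscr Q$ by $\mu^{-2}$ open squares of side $\mu$, and let $r_Q$ be the center of $Q$. For $s>0$ and $1\le p<\infty$, $\dot W^{s,p}(\mathbb R^2)$ is the space of $f\in\mathcal S'(\mathbb R^2)$ with $\hat f\in L^1_{\rm loc}$ and $\mathcal F^{-1}(|\xi|^s\hat f)\in L^p$, with norm $\|\mathcal F^{-1}(|\xi|^s\hat f)\|_{L^p}$, except that for $p=1$ and integer $s$ it is the space of $f\in L^1_{\rm loc}$ whose weak derivatives of order $s$ are in $L^1$, with norm $\|\nabla^s f\|_{L^1}$. For $p=\infty$, let $m$ be the largest integer smaller than $s$; $\dot W^{s,\infty}(\mathbb R^2)$ is the space of (functions a.e. equal to) $f\in C^m$ with $|\nabla^m f(x)-\nabla^m f(y)|\le C|x-y|^{s-m}$ for all $x,y$, with norm the least such $C$. A vector field is in the space if its components are. Hypotheses. Fix $s>0$ and $1\le p\le\infty$. For $j=1,\dots,N$ let $u^j$ be velocity fields and $\rho^j$ be (not identically zero)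 weak solutions of $\partial_t\rho^j+\mathrm{div}(u^j\rho^j)=0$, all defined for $0\le t\le1$, $x\in\mathbb R^2$, such that: (i) each $u^j$ is bounded, divergence-free, tangent to $\partial\mathscr Q$ (its distributional normal trace vanishes), and bounded in $\dot W^{\lceil s\rceil,p}(\mathbb R^2)$ uniformly in time; (ii) each $\rho^j$ is bounded and has zero average on $\mathscr Q$; (iii) there is $\lambda>0$ with $1/\lambda$ an integer $\ge2$ such that for every $j$ and every $Q\in\mathcal T_\lambda$ there is an index $i$ with $\rho^j(1,x)=\rho^i(0,(x-r_Q)/\lambda)$ for $x\in Q$. Let $1/\bar\lambda$ be an integer $\ge1$, let $\tau=\lambda^{1-s}$, and let $T_n=\sum_{i=0}^{n-1}\tau^i$ for $0\le n\le\infty$. Define $u$ and $\rho$ on $[0,T_\infty)\times\mathbb R^2$ step by step: for $n\ge0$, $Q\in\mathcal T_{\bar\lambda\lambda^n}$, $x\in Q$ and $T_n<t\le T_{n+1}$ (and also $t=0$ if $n=0$), $$u(t,x)=\frac{\bar\lambda\lambda^n}{\tau^n}\,u^{j}\Big(\frac{t-T_n}{\tau^n},\frac{x-r_Q}{\bar\lambda\lambda^n}\Big),\qquad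 \rho(t,x)=\rho^{j}\Big(\frac{t-T_n}{\tau^n},\frac{x-r_Q}{\bar\lambda\lambda^n}\Big),\qquad j=j(n,Q),$$ and $u=\rho=0$ outside $\mathscr Q$. Here $j(0,Q)$ is arbitrary and, for $n\ge1$, $j(n,Q)$ is any index with $\rho(T_n,x)=\rho^{j(n,Q)}\big(0,\frac{x-r_Q}{\bar\lambda\lambda^n}\big)$ for $x\in Q$. Assume moreover that $u(t,\cdot)\in\dot W^{\lceil s\rceil,p}(\mathbb R^2)$ for a.e. $t\in[0,T_\infty)$, with no uniformity in $t$. Conclusion. For a.e. $t\in[0,T_\infty)$ the field $u(t,\cdot)$ is divergence-free in the sense of distributions, and there is a constant $C<\infty$ such that $u(t,\cdot)\in\dot W^{s,p}(\mathbb R^2)$ with $\|u(t,\cdot)\|_{\dot W^{s,p}(\mathbb R^2)}\le C$ for a.e. $t\in[0,T_\infty)$. -/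

import Mathlib

open MeasureTheory Set
open scoped ENNReal NNReal ContDiff SchwartzMap FourierTransform

noncomputable section

namespace QuasiSelfSimilar

/-- The Euclidean plane. -/
abbrev Plane : Type := EuclideanSpace ℝ (Fin 2)

/-- Scalar test functions of class `C_c^∞`. -/
def IsTest {X : Type*} [NormedAddCommGroup X] [NormedSpace ℝ X] (φ : X → ℝ) : Prop :=
  ContDiff ℝ ∞ φ ∧ HasCompactSupport φ

/-! ### Homogeneous Sobolev spaces on the plane -/

/-- The tempered distribution `T` is the locally integrable function `h`
(test functions are dense in the Schwartz space, so `T` is determined by `h`). -/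
def Represents (T : 𝓢'(Plane, ℂ)) (h : Plane → ℂ) : Prop :=
  LocallyIntegrable h ∧ ∀ φ : 𝓢(Plane, ℂ), HasCompactSupport φ → T φ = ∫ x, φ x * h x

/-- `f` is a tempered distribution, its Fourier transform is a locally integrable function `h`, and
the inverse Fourier transform of `|ξ|^s h(ξ)` is a function in `L^p` of norm at most `C`. -/
def FourierSobolevBound (s : ℝ) (p : ℝ≥0∞) (f : Plane → ℝ) (C : ℝ≥0) : Prop :=
  ∃ (F S : 𝓢'(Plane, ℂ)) (h g : Plane → ℂ),
    Represents F (fun x => (f x : ℂ)) ∧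
    Represents (𝓕 F) h ∧
    Represents S (fun ξ => ((‖ξ‖ ^ s : ℝ) : ℂ) * h ξ) ∧
    Represents (𝓕⁻ S) g ∧
    MemLp g p ∧ eLpNorm g p ≤ C

/-- The partial derivative of `φ` of order `k` in the coordinate directions `α 0, …, α (k - 1)`. -/
def partialDeriv (k : ℕ) (α : Fin k → Fin 2) (φ : Plane → ℝ) (x : Plane) : ℝ :=
  iteratedFDeriv ℝ k φ x (fun i => EuclideanSpace.single (α i) 1)

/-- `f` is locally integrable and its weak derivatives of order `k` are functions; the `L^p` norm of
the tensor `∇^k f` of these derivatives is at most `C`. -/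
def WeakDerivBound (k : ℕ) (p : ℝ≥0∞) (f : Plane → ℝ) (C : ℝ≥0) : Prop :=
  LocallyIntegrable f ∧
  ∃ G : Plane → EuclideanSpace ℝ (Fin k → Fin 2),
    MemLp G p ∧ eLpNorm G p ≤ C ∧
    ∀ (α : Fin k → Fin 2) (φ : Plane → ℝ), IsTest φ →
      ∫ x, f x * partialDeriv k α φ x = (-1) ^ k * ∫ x, G x α * φ x

/-- The Lipschitz-Hölder class of order `s > 0`. With `m` the largest integer smaller than `s`, `f`
has a representative of class `C^m` whose `m`-th derivative is Hölder continuous of exponent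
`s - m ∈ (0, 1]` with constant `C`. -/
def HolderBound (s : ℝ) (f : Plane → ℝ) (C : ℝ≥0) : Prop :=
  ∃ f' : Plane → ℝ, f' =ᵐ[volume] f ∧ ContDiff ℝ (⌈s⌉₊ - 1 : ℕ) f' ∧
    ∀ x y, ‖iteratedFDeriv ℝ (⌈s⌉₊ - 1) f' x - iteratedFDeriv ℝ (⌈s⌉₊ - 1) f' y‖
      ≤ C * ‖x - y‖ ^ (s - (⌈s⌉₊ - 1 : ℕ))

open Classical in
/-- `f` belongs to the homogeneous space `Ẇ^{s,p}` of the plane, with norm at most `C`, for `s > 0`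
and `1 ≤ p ≤ ∞`. For `p = ∞` this is the Lipschitz-Hölder space. For `p < ∞` it is the space
defined by the Fourier multiplier `|ξ|^s`, except that for `p = 1` and an integer `s` it is the
space defined by weak derivatives of order `s`. -/
def SobolevBound (s : ℝ) (p : ℝ≥0∞) (f : Plane → ℝ) (C : ℝ≥0) : Prop :=
  if p = ⊤ then HolderBound s f C
  else if p = 1 ∧ s = ⌈s⌉₊ then WeakDerivBound ⌈s⌉₊ 1 f C
  else FourierSobolevBound s p f C

/-- The vector field `w` belongs to `Ẇ^{s,p}`, and each component has norm at most `C`. -/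
def FieldSobolevBound (s : ℝ) (p : ℝ≥0∞) (w : Plane → Plane) (C : ℝ≥0) : Prop :=
  ∀ i : Fin 2, SobolevBound s p (fun x => w x i) C

/-! ### Divergence, normal trace and the continuity equation -/

/-- The vector field `w` is divergence-free in the sense of distributions. -/
def IsDivFree (w : Plane → Plane) : Prop :=
  LocallyIntegrable w ∧ ∀ φ : Plane → ℝ, IsTest φ → ∫ x, fderiv ℝ φ x (w x) = 0

/-- The open unit square `(-1/2, 1/2)²`. -/
def unitSquare : Set Plane := {x | ∀ i, -1 / 2 < x i ∧ x i < 1 / 2}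

/-- A divergence-free field `w` is tangent to the boundary of the unit square: its distributional
normal trace `φ ↦ ∫_𝒬 w · ∇φ` (the boundary term in the Gauss-Green formula) vanishes. -/
def IsTangentToUnitSquare (w : Plane → Plane) : Prop :=
  ∀ φ : Plane → ℝ, IsTest φ → ∫ x in unitSquare, fderiv ℝ φ x (w x) = 0

/-- `ρ` is a weak solution of `∂ₜρ + div (w ρ) = 0` on the time interval `[0, 1]`, with initial
value `ρ 0` and final value `ρ 1`. -/
def IsWeakSolution (w : ℝ → Plane → Plane) (ρ : ℝ → Plane → ℝ) : Prop :=
  ∀ φ : ℝ × Plane → ℝ, IsTest φ →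
    (∫ x, ρ 1 x * φ (1, x)) - ∫ x, ρ 0 x * φ (0, x) =
      ∫ t in (0 : ℝ)..1, ∫ x, ρ t x * fderiv ℝ φ (t, x) (1, w t x)

/-! ### Tilings of the unit square -/

/-- The square with index `Q` in the tiling of the unit square by `K²` open squares of side
`1 / K`. -/
def tile (K : ℕ) (Q : Fin 2 → Fin K) : Set Plane :=
  {x | ∀ i, -1 / 2 + (Q i : ℝ) / K < x i ∧ x i < -1 / 2 + ((Q i : ℝ) + 1) / K}

/-- The center of the square with index `Q`. -/
def tileCenter (K : ℕ) (Q : Fin 2 → Fin K) : Plane :=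
  WithLp.toLp 2 (fun i => -1 / 2 + ((Q i : ℝ) + 1 / 2) / K)

/-! ### Almost self-similar basic families -/

/-- An almost self-similar basic family of velocity fields `v j` and densities `θ j`, with parameter
`λ = 1 / ℓ`. -/
structure IsBasicFamily (s : ℝ) (p : ℝ≥0∞) (ℓ : ℕ) {N : ℕ}
    (v : Fin N → ℝ → Plane → Plane) (θ : Fin N → ℝ → Plane → ℝ) : Prop where
  velocity_measurable : ∀ j, AEStronglyMeasurable (Function.uncurry (v j))
    (volume.restrict (Icc (0 : ℝ) 1 ×ˢ (univ : Set Plane)))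
  velocity_sobolev : ∀ j, ∃ C : ℝ≥0, ∀ᵐ t ∂volume.restrict (Icc (0 : ℝ) 1),
    FieldSobolevBound (⌈s⌉₊ : ℝ) p (v j t) C
  velocity_bounded : ∀ j, ∃ M : ℝ, ∀ᵐ t ∂volume.restrict (Icc (0 : ℝ) 1),
    ∀ᵐ x : Plane, ‖v j t x‖ ≤ M
  velocity_divFree : ∀ j, ∀ᵐ t ∂volume.restrict (Icc (0 : ℝ) 1), IsDivFree (v j t)
  velocity_tangent : ∀ j, ∀ᵐ t ∂volume.restrict (Icc (0 : ℝ) 1), IsTangentToUnitSquare (v j t)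
  density_measurable : ∀ j, AEStronglyMeasurable (Function.uncurry (θ j))
    (volume.restrict (Icc (0 : ℝ) 1 ×ˢ (univ : Set Plane)))
  density_slice_measurable : ∀ j, ∀ t ∈ Icc (0 : ℝ) 1, AEStronglyMeasurable (θ j t)
  density_bounded : ∀ j, ∃ M : ℝ, ∀ t ∈ Icc (0 : ℝ) 1, ∀ᵐ x : Plane, |θ j t x| ≤ M
  density_average : ∀ j, ∀ t ∈ Icc (0 : ℝ) 1, ∫ x in unitSquare, θ j t x = 0
  density_nonzero : ∀ j, ¬ Function.uncurry (θ j)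
    =ᵐ[volume.restrict (Icc (0 : ℝ) 1 ×ˢ (univ : Set Plane))] 0
  solution : ∀ j, IsWeakSolution (v j) (θ j)
  two_le : 2 ≤ ℓ
  self_similar : ∀ j, ∀ Q : Fin 2 → Fin ℓ, ∃ i : Fin N, ∀ᵐ x : Plane, x ∈ tile ℓ Q →
    θ j 1 x = θ i 0 ((ℓ : ℝ) • (x - tileCenter ℓ Q))

/-! ### The quasi self-similar construction -/

/-- The times `T_n = ∑_{i < n} τ^i`. -/
def switchTime (τ : ℝ) (n : ℕ) : ℝ := ∑ i ∈ Finset.range n, τ ^ i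

/-- The time interval of step `n`: `[0, T_1]` for `n = 0`, and `(T_n, T_{n+1}]` for `n ≥ 1`. -/
def stage (τ : ℝ) : ℕ → Set ℝ
  | 0 => Icc 0 (switchTime τ 1)
  | n + 1 => Ioc (switchTime τ (n + 1)) (switchTime τ (n + 2))

/-- The time interval `[0, T_∞)`. -/
def timeDomain (τ : ℝ) : Set ℝ := {t | 0 ≤ t ∧ ∃ n, t < switchTime τ n}

/-- A choice, for each step `n` and each square of the tiling of side `(1 / m) (1 / ℓ)^n`, of an
element of the basic family. -/
abbrev Choice (m ℓ N : ℕ) : Type := (n : ℕ) → (Fin 2 → Fin (m * ℓ ^ n)) → Fin N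

/-- The field obtained by patching rescaled copies of the basic elements `w j` according to the
choice `J`, multiplied by `c n` at step `n`. At step `n` the copy in the square `Q` of side
`1 / (m ℓ^n)` is `w (J n Q) ((t - T_n) / τ^n, m ℓ^n (x - r_Q))`. The field is `0` on the edges of
the tiling and outside the unit square. -/
def patched {E : Type*} [AddCommGroup E] [Module ℝ E] {N : ℕ} (m ℓ : ℕ) (τ : ℝ) (c : ℕ → ℝ)
    (w : Fin N → ℝ → Plane → E) (J : Choice m ℓ N) (t : ℝ) (x : Plane) : E :=
  ∑ᶠ n : ℕ, (stage τ n).indicator (fun t' =>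
    ∑ Q : Fin 2 → Fin (m * ℓ ^ n), (tile (m * ℓ ^ n) Q).indicator (fun x' =>
      c n • w (J n Q) ((t' - switchTime τ n) / τ ^ n)
        (((m : ℝ) * (ℓ : ℝ) ^ n) • (x' - tileCenter (m * ℓ ^ n) Q))) x) t

/-- The patched velocity field; the amplitude at step `n` is `(1 / m) (1 / ℓ)^n / τ^n`. -/
def velocity {N : ℕ} (m ℓ : ℕ) (τ : ℝ) (v : Fin N → ℝ → Plane → Plane) (J : Choice m ℓ N) :
    ℝ → Plane → Plane :=
  patched m ℓ τ (fun n => (1 / (m : ℝ)) * (1 / (ℓ : ℝ)) ^ n / τ ^ n) v J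

/-- The patched density. -/
def density {N : ℕ} (m ℓ : ℕ) (τ : ℝ) (θ : Fin N → ℝ → Plane → ℝ) (J : Choice m ℓ N) :
    ℝ → Plane → ℝ :=
  patched m ℓ τ (fun _ => 1) θ J

/-- The choice `J` follows the inductive rule: it is free at step `0`, and at each later step
`n + 1` the density already reached at time `T_{n+1}` is, on each square `Q` of the next tiling, the
rescaled translate of the initial density of the chosen element. -/
def IsAdmissible {N : ℕ} (m ℓ : ℕ) (τ : ℝ) (θ : Fin N → ℝ → Plane → ℝ) (J : Choice m ℓ N) :
    Prop :=
  ∀ (n : ℕ) (Q : Fin 2 → Fin (m * ℓ ^ (n + 1))), ∀ᵐ x : Plane, x ∈ tile (m * ℓ ^ (n + 1)) Q →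
    density m ℓ τ θ J (switchTime τ (n + 1)) x =
      θ (J (n + 1) Q) 0 (((m : ℝ) * (ℓ : ℝ) ^ (n + 1)) • (x - tileCenter (m * ℓ ^ (n + 1)) Q))

end QuasiSelfSimilar

end

namespace QuasiSelfSimilar

open Filter Topology

/-! At a time of step n the field is a patchwork (`snap`) of copies of slices of the basic fields on
the squares of side 1/K, K = mℓ^n, with an amplitude a. Since τ = ℓ^(s-1), the number a K^s is
m^(s-1) whatever n is (`amplitude_mul_rpow`). So it is enough that the Ẇ^{s,p} norm of a patchwork
is at most a constant times a K^s, with a constant that does not depend on K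
(`exists_sobolevBound_snap`).

Let p < ∞ and k = ⌈s⌉. The L^p norm of the patchwork is O(a), because the slices are bounded. The
regularity assumed at almost every time, although it carries no bound, says that the derivatives of
order k of the patchwork are functions; hence they do not charge the edges of the tiling, and they
are the patched derivatives of the slices (`HasWeak.ae_eq_snap`). The K^2 squares have area K^(-2)
each, so their number does not enter, and the norm of order k is O(a K^k) (`eLpNorm_snap_le`).
Interpolation between the orders 0 and k at the length 1/K gives O(a K^s)
(`exists_fourierSobolevBound`). For p = 1 and integer s, the estimate of order k is already the
conclusion.

For s < k the interpolation writes |ξ|^s as an average of dilations of Schwartz symbols, which are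
multipliers on every L^p with one bound for all dilations; the average is split at a scale t₀. Riesz
transforms are needed for s = k and 1 < p < ∞, and to extract weak derivatives from the Fourier
definition of Ẇ^{k,p}. They are averages over directions of projections to half planes of
frequencies. Such a projection F of a real function f extends holomorphically to complex
translations in one direction, has real part f/2, and satisfies ∫ G(F) ≥ 0 for suitable subharmonic
G (`integral_subharmonic_hol_nonneg`). A good choice of G bounds the L^q norm of F by that of Re F
for q ≥ 2; duality gives the other exponents.

For p = ∞ the derivative of order k - 1 is bounded by O(a K^(k-1)) and is Lipschitz on each closed
square with constant O(a K^k). Being continuous, it is Lipschitz on the plane with that constant,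
and the two bounds interpolate to the Hölder bound (`exists_holderBound_snap`).

The divergence vanishes because each rescaled copy, being tangent to the boundary of its square,
already integrates to zero against gradients over that square (`isDivFree_snap`). -/

/-! ### Duality between L^p norms and pairings with Schwartz functions. -/

/-- A bound against Schwartz functions extends to continuous functions of compact support. -/
theorem enorm_integral_mul_le_of_forall_schwartz {q : ℝ≥0∞} (hq1 : 1 ≤ q) {g : Plane → ℂ}
    (hg : Continuous g) {C : ℝ≥0∞}
    (h : ∀ ψ : 𝓢(Plane, ℂ), ‖∫ x, g x * ψ x‖ₑ ≤ C * eLpNorm ψ q)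
    {ψ : Plane → ℂ} (hψ : Continuous ψ) (hψc : HasCompactSupport ψ) :
    ‖∫ x, g x * ψ x‖ₑ ≤ C * eLpNorm ψ q := by
  -- An infinite `C` is set apart because multiplication by it is not continuous at zero, which the
  -- limit at the end needs.
  rcases eq_or_ne C ⊤ with rfl | hC
  · rcases eq_or_ne (eLpNorm ψ q) 0 with h0 | h0
    · have h1 : ψ =ᵐ[volume] 0 :=
        (eLpNorm_eq_zero_iff hψ.aestronglyMeasurable (by positivity)).1 h0
      have h2 : ∫ x, g x * ψ x = 0 := by
        rw [← integral_zero (α := Plane) (G := ℂ) (μ := volume)]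
        refine integral_congr_ae ?_
        filter_upwards [h1] with x hx
        simp [hx]
      simp [h2]
    · simp [ENNReal.top_mul h0]
  set K := tsupport ψ
  have hK : IsCompact K := hψc
  have hKm : MeasurableSet K := hK.measurableSet
  have hKf : volume K ≠ ⊤ := hK.measure_lt_top.ne
  have key : ∀ ε : ℝ, 0 < ε → ‖∫ x, g x * ψ x‖ₑ ≤
      C * (eLpNorm ψ q + ENNReal.ofReal ε * eLpNorm (K.indicator fun _ => (1 : ℂ)) q)
        + ENNReal.ofReal ε * ∫⁻ x in K, ‖g x‖ₑ := by
    intro ε hε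
    -- The approximation is uniform and keeps the support inside that of `ψ`, so every error is `ε`
    -- times a finite quantity on one compact set.
    obtain ⟨θ, hθ, hd, hsupp⟩ := hψ.exists_contDiff_approx ⊤ (ε := fun _ => ε) continuous_const
      (fun _ => hε)
    have hθc : HasCompactSupport θ := hψc.mono hsupp
    have hθcont : Continuous θ := hθ.continuous
    have h1 := h (hθc.toSchwartzMap hθ)
    have hco : ((hθc.toSchwartzMap hθ : 𝓢(Plane, ℂ)) : Plane → ℂ) = θ := rfl
    rw [hco] at h1
    have hdiff : ∀ x, ‖ψ x - θ x‖ₑ ≤ ENNReal.ofReal ε * ‖K.indicator (fun _ => (1 : ℂ)) x‖ₑ := by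
      intro x
      by_cases hx : x ∈ K
      · simp only [indicator_of_mem hx, enorm_one, mul_one]
        rw [← ofReal_norm]
        refine ENNReal.ofReal_le_ofReal ?_
        rw [← dist_eq_norm, dist_comm]
        exact (hd x).le
      · have e1 : ψ x = 0 := image_eq_zero_of_notMem_tsupport hx
        have e2 : θ x = 0 := by
          by_contra hne
          exact hx (subset_tsupport ψ (hsupp hne))
        simp [e1, e2]
    have hdn : eLpNorm (ψ - θ) q ≤
        ENNReal.ofReal ε * eLpNorm (K.indicator fun _ => (1 : ℂ)) q := by
      have : ENNReal.ofReal ε * eLpNorm (K.indicator fun _ => (1 : ℂ)) q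
          = eLpNorm ((ε : ℂ) • K.indicator fun _ => (1 : ℂ)) q := by
        rw [eLpNorm_const_smul]
        congr 1
        rw [← ofReal_norm]
        simp [abs_of_pos hε]
      rw [this]
      refine eLpNorm_mono_enorm fun x => ?_
      refine (hdiff x).trans (le_of_eq ?_)
      simp only [Pi.smul_apply, enorm_smul]
      congr 1
      rw [← ofReal_norm]
      simp [abs_of_pos hε]
    have hθn : eLpNorm θ q ≤ eLpNorm ψ q + ENNReal.ofReal ε *
        eLpNorm (K.indicator fun _ => (1 : ℂ)) q := by
      have h3 : AEStronglyMeasurable (ψ - θ) volume :=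
        hψ.aestronglyMeasurable.sub hθcont.aestronglyMeasurable
      have h9 := eLpNorm_sub_le (f := ψ) (g := ψ - θ) (μ := volume) hψ.aestronglyMeasurable h3 hq1
      rw [sub_sub_cancel] at h9
      exact h9.trans (add_le_add le_rfl hdn)
    have hi1 : Integrable (fun x => g x * ψ x) :=
      (hg.mul hψ).integrable_of_hasCompactSupport hψc.mul_left
    have hi2 : Integrable (fun x => g x * θ x) :=
      (hg.mul hθcont).integrable_of_hasCompactSupport hθc.mul_left
    have hsub : ∫ x, g x * ψ x = (∫ x, g x * θ x) + ∫ x, g x * (ψ x - θ x) := by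
      rw [← integral_add hi2 (by simp only [mul_sub]; exact hi1.sub hi2)]
      congr 1; ext x; ring
    have hrest : ‖∫ x, g x * (ψ x - θ x)‖ₑ ≤ ENNReal.ofReal ε * ∫⁻ x in K, ‖g x‖ₑ := by
      refine (enorm_integral_le_lintegral_enorm _).trans ?_
      rw [← lintegral_indicator hKm, ← lintegral_const_mul _ (hg.measurable.enorm.indicator hKm)]
      refine lintegral_mono fun x => ?_
      rw [enorm_mul]
      refine (mul_le_mul_right (hdiff x) _).trans (le_of_eq ?_)
      by_cases hx : x ∈ K <;> simp [hx, mul_comm]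
    rw [hsub]
    exact (enorm_add_le _ _).trans (add_le_add (h1.trans (mul_le_mul_right hθn C)) hrest)
  have hI : eLpNorm (K.indicator fun _ => (1 : ℂ)) q ≠ ⊤ :=
    (memLp_indicator_const q hKm (1 : ℂ) (Or.inr hKf)).2.ne
  have hgK : ∫⁻ x in K, ‖g x‖ₑ ≠ ⊤ :=
    (hg.continuousOn.integrableOn_compact hK).2.ne
  have ht : Tendsto (fun ε : ℝ => C * (eLpNorm ψ q + ENNReal.ofReal ε *
      eLpNorm (K.indicator fun _ => (1 : ℂ)) q) + ENNReal.ofReal ε * ∫⁻ x in K, ‖g x‖ₑ)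
      (𝓝[>] 0) (𝓝 (C * (eLpNorm ψ q + 0 * eLpNorm (K.indicator fun _ => (1 : ℂ)) q)
        + 0 * ∫⁻ x in K, ‖g x‖ₑ)) := by
    have h0 : Tendsto (fun ε : ℝ => ENNReal.ofReal ε) (𝓝[>] 0) (𝓝 0) := by
      have := (ENNReal.continuous_ofReal.tendsto 0).mono_left (nhdsWithin_le_nhds (s := Ioi 0))
      simpa using this
    refine Tendsto.add (ENNReal.Tendsto.const_mul (tendsto_const_nhds.add
      (ENNReal.Tendsto.mul_const h0 (Or.inr hI))) (Or.inr hC))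
      (ENNReal.Tendsto.mul_const h0 (Or.inr hgK))
  have := ge_of_tendsto ht (by filter_upwards [self_mem_nhdsWithin] with ε hε using key ε hε)
  simpa using this

/-- Duality: a continuous function is in `L^p` with norm at most `C` if its integrals against
Schwartz functions are bounded by `C` times the norm in the conjugate space. -/
theorem eLpNorm_le_of_forall_schwartz {p q : ℝ≥0∞} [hpq : p.HolderConjugate q] (hp : p ≠ ⊤)
    {g : Plane → ℂ} (hg : Continuous g) {C : ℝ≥0∞}
    (h : ∀ ψ : 𝓢(Plane, ℂ), ‖∫ x, g x * ψ x‖ₑ ≤ C * eLpNorm ψ q) :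
    eLpNorm g p ≤ C := by
  have hp1 : 1 ≤ p := ENNReal.HolderConjugate.one_le p q
  have hq1 : 1 ≤ q := ENNReal.HolderConjugate.one_le q p
  have hp0 : p ≠ 0 := (zero_lt_one.trans_le hp1).ne'
  set P := p.toReal
  have hP : 1 ≤ P := by
    rw [← ENNReal.toReal_one]; exact ENNReal.toReal_mono hp hp1
  have hP0 : 0 < P := by linarith
  have key : ∀ n : ℕ, ∫⁻ x in Metric.ball (0 : Plane) (n + 1), ‖g x‖ₑ ^ P ≤ C ^ P := by
    intro n
    -- The cutoff makes the truncated integral `X` of |g|^P finite, so that a power of `X` can be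
    -- cancelled below although `g` is not yet known to be in L^p.
    let χ : ContDiffBump (0 : Plane) := ⟨n + 1, n + 2, by positivity, by linarith⟩
    have hχ0 : ∀ x, 0 ≤ χ x := fun x => χ.nonneg
    have hχ1 : ∀ x, χ x ≤ 1 := fun x => χ.le_one
    have hχc : Continuous χ := χ.continuous
    set X : ℝ := ∫ x, χ x * ‖g x‖ ^ P with hX
    have hXi : Integrable (fun x => χ x * ‖g x‖ ^ P) :=
      (hχc.mul (hg.norm.rpow_const fun _ => Or.inr hP0.le)).integrable_of_hasCompactSupport
        χ.hasCompactSupport.mul_right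
    have hX0 : 0 ≤ X := integral_nonneg fun x => mul_nonneg (hχ0 x) (by positivity)
    have hXl : ENNReal.ofReal X = ∫⁻ x, ENNReal.ofReal (χ x * ‖g x‖ ^ P) :=
      ofReal_integral_eq_lintegral_ofReal hXi (Eventually.of_forall fun x =>
        mul_nonneg (hχ0 x) (by positivity))
    have step : ENNReal.ofReal X ≤ C * ENNReal.ofReal X ^ (1 / q.toReal) := by
      have hε : ∀ ε : ℝ, 0 < ε → ENNReal.ofReal (∫ x, χ x * (‖g x‖ ^ (P + 1) / (‖g x‖ + ε)))
          ≤ C * ENNReal.ofReal X ^ (1 / q.toReal) := by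
        intro ε hε
        -- This is the extremal function of Hölder's inequality, conj(g) |g|^(P-2), truncated by
        -- `χ`. One division by |g| is replaced by a division by |g| + ε to keep it continuous at
        -- the zeros of `g`.
        set ψ : Plane → ℂ := fun x =>
          (χ x : ℂ) * ((starRingEnd ℂ) (g x) * ((‖g x‖ ^ (P - 1) / (‖g x‖ + ε) : ℝ) : ℂ)) with hψd
        have hpos : ∀ x, 0 < ‖g x‖ + ε := fun x => by positivity
        have hψc : Continuous ψ := by
          refine (Complex.continuous_ofReal.comp hχc).mul
            ((Complex.continuous_conj.comp hg).mul (Complex.continuous_ofReal.comp ?_))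
          exact (hg.norm.rpow_const fun _ => Or.inr (by linarith)).div
            (hg.norm.add continuous_const) fun x => (hpos x).ne'
        have hψs : HasCompactSupport ψ := by
          refine HasCompactSupport.mul_right (χ.hasCompactSupport.comp_left (g := Complex.ofReal) ?_)
          simp
        have h1 := enorm_integral_mul_le_of_forall_schwartz hq1 hg h hψc hψs
        have e1 : ∫ x, g x * ψ x = ((∫ x, χ x * (‖g x‖ ^ (P + 1) / (‖g x‖ + ε)) : ℝ) : ℂ) := by
          rw [← integral_complex_ofReal]
          congr 1; ext x
          simp only [hψd]
          have : g x * (starRingEnd ℂ) (g x) = ((‖g x‖ ^ 2 : ℝ) : ℂ) := by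
            rw [Complex.mul_conj, Complex.normSq_eq_norm_sq]
          calc g x * ((χ x : ℂ) * ((starRingEnd ℂ) (g x) * ((‖g x‖ ^ (P - 1) / (‖g x‖ + ε) : ℝ) : ℂ)))
              = (χ x : ℂ) * ((g x * (starRingEnd ℂ) (g x)) *
                ((‖g x‖ ^ (P - 1) / (‖g x‖ + ε) : ℝ) : ℂ)) := by ring
            _ = _ := by
              rw [this, ← Complex.ofReal_mul, ← Complex.ofReal_mul]
              congr 2
              rw [mul_div_assoc']
              congr 1
              rcases (norm_nonneg (g x)).eq_or_lt with h0 | h0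
              · rw [← h0, Real.zero_rpow (by linarith : P + 1 ≠ 0)]; simp
              · rw [← Real.rpow_natCast, ← Real.rpow_add h0]; congr 1; push_cast; ring
        have hψn : ∀ x, ‖ψ x‖ ≤ χ x * ‖g x‖ ^ (P - 1) := by
          intro x
          simp only [hψd, norm_mul, Complex.norm_real, Real.norm_eq_abs, abs_of_nonneg (hχ0 x),
            RCLike.norm_conj, abs_div, abs_of_pos (hpos x)]
          rw [abs_of_nonneg (by positivity)]
          refine mul_le_mul_of_nonneg_left ?_ (hχ0 x)
          rw [mul_div_assoc', div_le_iff₀ (hpos x), mul_comm]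
          exact mul_le_mul_of_nonneg_left (by linarith) (by positivity)
        have hψq : eLpNorm ψ q ≤ ENNReal.ofReal X ^ (1 / q.toReal) := by
          rcases eq_or_ne q ⊤ with rfl | hq
          · have : p = 1 := by
              have := ENNReal.HolderConjugate.inv_add_inv_eq_one p ⊤
              simpa using this
            have hP1 : P = 1 := by simp [P, this]
            simp only [ENNReal.toReal_top, div_zero, ENNReal.rpow_zero]
            rw [eLpNorm_exponent_top]
            refine eLpNormEssSup_le_of_ae_enorm_bound (Eventually.of_forall fun x => ?_)
            rw [← ofReal_norm, ← ENNReal.ofReal_one]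
            refine ENNReal.ofReal_le_ofReal ((hψn x).trans ?_)
            simpa [hP1] using hχ1 x
          · have hp1' : p ≠ 1 := by
              rintro rfl
              have := ENNReal.HolderConjugate.inv_add_inv_eq_one 1 q
              simp at this
              exact hq this
            have hPgt : 1 < P := by
              rw [← ENNReal.toReal_one]
              exact (ENNReal.toReal_lt_toReal (by simp) hp).2 (lt_of_le_of_ne hp1 (Ne.symm hp1'))
            have hconj : P.HolderConjugate q.toReal := ENNReal.HolderConjugate.toReal hPgt
            have hq0 : q ≠ 0 := (zero_lt_one.trans_le hq1).ne'
            rw [eLpNorm_eq_lintegral_rpow_enorm_toReal hq0 hq, hXl]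
            refine ENNReal.rpow_le_rpow (lintegral_mono fun x => ?_) (by positivity)
            rw [← ofReal_norm, ENNReal.ofReal_rpow_of_nonneg (norm_nonneg _) hconj.symm.nonneg]
            refine ENNReal.ofReal_le_ofReal ?_
            refine (Real.rpow_le_rpow (norm_nonneg _) (hψn x) hconj.symm.nonneg).trans ?_
            rw [Real.mul_rpow (hχ0 x) (by positivity), ← Real.rpow_mul (norm_nonneg _)]
            have e2 : (P - 1) * q.toReal = P := by
              have := hconj.sub_one_mul_conj; linarith
            rw [e2]
            refine mul_le_mul_of_nonneg_right ?_ (by positivity)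
            calc χ x ^ q.toReal ≤ χ x ^ (1 : ℝ) :=
                  Real.rpow_le_rpow_of_exponent_ge_of_imp (hχ0 x) (hχ1 x) hconj.symm.lt.le
                    (fun _ h => absurd h hconj.symm.ne_zero)
              _ = χ x := Real.rpow_one _
        rw [e1] at h1
        have hnn : 0 ≤ ∫ x, χ x * (‖g x‖ ^ (P + 1) / (‖g x‖ + ε)) :=
          integral_nonneg fun x => mul_nonneg (hχ0 x) (by have := hpos x; positivity)
        rw [← ofReal_norm, Complex.norm_real, Real.norm_eq_abs, abs_of_nonneg hnn] at h1
        exact h1.trans (by gcongr)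
      have ht : Tendsto (fun ε : ℝ => ∫ x, χ x * (‖g x‖ ^ (P + 1) / (‖g x‖ + ε)))
          (𝓝[>] 0) (𝓝 X) := by
        refine tendsto_integral_filter_of_dominated_convergence
          (fun x => χ x * ‖g x‖ ^ P) ?_ ?_ hXi ?_
        · filter_upwards [self_mem_nhdsWithin] with ε (hε : 0 < ε)
          refine (hχc.mul (((hg.norm.rpow_const fun _ => Or.inr (by linarith))).div
            (hg.norm.add continuous_const) fun x => ?_)).aestronglyMeasurable
          exact (add_pos_of_nonneg_of_pos (norm_nonneg (g x)) hε).ne'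
        · filter_upwards [self_mem_nhdsWithin] with ε (hε : 0 < ε)
          refine Eventually.of_forall fun x => ?_
          have hp' : 0 < ‖g x‖ + ε := by positivity
          rw [Real.norm_eq_abs, abs_of_nonneg (mul_nonneg (hχ0 x) (by positivity))]
          refine mul_le_mul_of_nonneg_left ?_ (hχ0 x)
          rw [div_le_iff₀ hp', Real.rpow_add' (norm_nonneg _) (by linarith), Real.rpow_one]
          exact mul_le_mul_of_nonneg_left (by linarith) (by positivity)
        · refine Eventually.of_forall fun x => ?_
          refine Tendsto.const_mul _ ?_
          rcases (norm_nonneg (g x)).eq_or_lt with h0 | h0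
          · rw [← h0, Real.zero_rpow (by linarith), Real.zero_rpow hP0.ne']
            simp
          · have e3 : ‖g x‖ ^ P = ‖g x‖ ^ (P + 1) / (‖g x‖ + 0) := by
              rw [Real.rpow_add h0, Real.rpow_one]; field_simp; simp
            rw [e3]
            refine Tendsto.div tendsto_const_nhds ?_ (by simpa using h0.ne')
            exact tendsto_const_nhds.add (tendsto_id.mono_left nhdsWithin_le_nhds)
      exact le_of_tendsto ((ENNReal.continuous_ofReal.tendsto X).comp ht)
        (by filter_upwards [self_mem_nhdsWithin] with ε hε' using hε ε hε')
    have hXC : ENNReal.ofReal X ≤ C ^ P := by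
      rcases eq_or_ne (ENNReal.ofReal X) 0 with h0 | h0
      · rw [h0]; exact zero_le
      have hpq' : 1 / P + 1 / q.toReal = 1 := by
        have := ENNReal.HolderConjugate.inv_add_inv_eq_one p q
        have h2 := congrArg ENNReal.toReal this
        rw [ENNReal.toReal_add (by simpa using hp0)
          (by simpa using (zero_lt_one.trans_le hq1).ne')] at h2
        simpa [P] using h2
      -- From X ≤ C X^(1/q) and X = X^(1/P) X^(1/q), the finite nonzero factor X^(1/q) cancels.
      have hroot : ENNReal.ofReal X ^ (1 / P) ≤ C := by
        have e4 : ENNReal.ofReal X = ENNReal.ofReal X ^ (1 / P) *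
            ENNReal.ofReal X ^ (1 / q.toReal) := by
          rw [← ENNReal.rpow_add _ _ h0 ENNReal.ofReal_ne_top, hpq', ENNReal.rpow_one]
        refine (ENNReal.mul_le_mul_iff_left ?_ ?_).1 (e4.ge.trans step)
        · exact (ENNReal.rpow_pos (pos_iff_ne_zero.2 h0) ENNReal.ofReal_ne_top).ne'
        · exact ENNReal.rpow_ne_top_of_nonneg (by positivity) ENNReal.ofReal_ne_top
      calc ENNReal.ofReal X = (ENNReal.ofReal X ^ (1 / P)) ^ P := by
            rw [← ENNReal.rpow_mul]; simp [hP0.ne']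
        _ ≤ C ^ P := ENNReal.rpow_le_rpow hroot hP0.le
    refine le_trans ?_ hXC
    rw [hXl, ← lintegral_indicator Metric.isOpen_ball.measurableSet]
    refine lintegral_mono fun x => ?_
    by_cases hx : x ∈ Metric.ball (0 : Plane) (n + 1)
    · rw [indicator_of_mem hx]
      have : χ x = 1 := χ.one_of_mem_closedBall (Metric.ball_subset_closedBall hx)
      rw [this, one_mul, ← ofReal_norm, ENNReal.ofReal_rpow_of_nonneg (norm_nonneg _) hP0.le]
    · rw [indicator_of_notMem hx]; exact zero_le
  have hall : ∫⁻ x, ‖g x‖ₑ ^ P ≤ C ^ P := by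
    have hU : (⋃ n : ℕ, Metric.ball (0 : Plane) (n + 1)) = univ := by
      refine eq_univ_of_forall fun x => ?_
      obtain ⟨n, hn⟩ := exists_nat_gt ‖x‖
      exact mem_iUnion.2 ⟨n, by simpa using hn.trans (by linarith)⟩
    rw [← setLIntegral_univ, ← hU, setLIntegral_iUnion_of_directed]
    · exact iSup_le key
    · refine Monotone.directed_le fun a b hab => Metric.ball_subset_ball ?_
      have : (a : ℝ) ≤ b := by exact_mod_cast hab
      linarith
  rw [eLpNorm_eq_lintegral_rpow_enorm_toReal hp0 hp]
  calc (∫⁻ x, ‖g x‖ₑ ^ P) ^ (1 / P) ≤ (C ^ P) ^ (1 / P) :=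
        ENNReal.rpow_le_rpow hall (by positivity)
    _ = C := by rw [← ENNReal.rpow_mul]; simp [hP0.ne']

/-- Hölder's inequality for the integral of a product. -/
theorem enorm_integral_mul_le {p q : ℝ≥0∞} [hpq : p.HolderConjugate q] {f g : Plane → ℂ}
    (hf : AEStronglyMeasurable f) (hg : AEStronglyMeasurable g) :
    ‖∫ x, f x * g x‖ₑ ≤ eLpNorm f p * eLpNorm g q := by
  refine (enorm_integral_le_lintegral_enorm _).trans ?_
  rw [← eLpNorm_one_eq_lintegral_enorm]
  have := eLpNorm_le_eLpNorm_mul_eLpNorm_of_nnnorm (p := p) (q := q) (r := 1) hf hg (· * ·) 1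
    (Eventually.of_forall fun x => by simp)
  simpa using this

/-! ### Fourier multipliers as bilinear forms, and their averages. -/

/-- The bilinear form `∫ m (𝓕 f) (𝓕⁻ ψ)` of the Fourier multiplier `m`. -/
noncomputable def mform (m : Plane → ℂ) (f ψ : 𝓢(Plane, ℂ)) : ℂ := ∫ ξ, m ξ * (𝓕 f ξ * 𝓕⁻ ψ ξ)

/-- The Fourier multiplier `m` applied to `f`. -/
noncomputable def mfun (m : Plane → ℂ) (f : 𝓢(Plane, ℂ)) : Plane → ℂ := 𝓕⁻ (fun ξ => m ξ * 𝓕 f ξ)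

theorem continuous_fourierInv_of_integrable {h : Plane → ℂ} (hh : Integrable h) :
    Continuous (𝓕⁻ h) := by
  have : (𝓕⁻ h : Plane → ℂ) = fun x => 𝓕 h (-x) := by
    ext x; exact Real.fourierInv_eq_fourier_neg h x
  rw [this]
  exact (VectorFourier.fourierIntegral_continuous Real.continuous_fourierChar
    (by exact continuous_inner) hh).comp continuous_neg

theorem integral_fourier_mul {h : Plane → ℂ} (hh : Integrable h) (ψ : 𝓢(Plane, ℂ)) :
    ∫ x, 𝓕 h x * ψ x = ∫ ξ, h ξ * 𝓕 ψ ξ := by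
  simpa using! VectorFourier.integral_bilin_fourierIntegral_eq_flip (ContinuousLinearMap.mul ℂ ℂ)
    (L := innerₗ Plane) Real.continuous_fourierChar continuous_inner hh ψ.integrable

theorem integral_fourierInv_mul {h : Plane → ℂ} (hh : Integrable h) (ψ : 𝓢(Plane, ℂ)) :
    ∫ x, 𝓕⁻ h x * ψ x = ∫ ξ, h ξ * 𝓕⁻ ψ ξ := by
  have h1 : ∀ x, 𝓕⁻ h x = 𝓕 (fun ξ => h (-ξ)) x := fun x =>
    by rw [Real.fourierInv_eq_fourier_comp_neg h]
  simp only [h1]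
  rw [integral_fourier_mul hh.comp_neg, ← integral_neg_eq_self]
  congr 1; ext ξ
  rw [neg_neg, SchwartzMap.fourier_coe, SchwartzMap.fourierInv_coe,
    Real.fourierInv_eq_fourier_neg]

theorem integral_mfun_mul {m : Plane → ℂ} {f : 𝓢(Plane, ℂ)}
    (hm : Integrable fun ξ => m ξ * 𝓕 f ξ) (ψ : 𝓢(Plane, ℂ)) :
    ∫ x, mfun m f x * ψ x = mform m f ψ := by
  rw [mfun, integral_fourierInv_mul hm, mform]
  congr 1; ext ξ; ring

/-- This is the bridge from forms to operators. Multipliers are estimated through `mform`, where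
averaging over parameters is a plain use of Fubini, and only here do the estimates become L^p
bounds. -/
theorem eLpNorm_mfun_le {p q : ℝ≥0∞} [hpq : p.HolderConjugate q] (hp : p ≠ ⊤) {m : Plane → ℂ}
    {f : 𝓢(Plane, ℂ)} (hm : Integrable fun ξ => m ξ * 𝓕 f ξ) {C : ℝ≥0∞}
    (h : ∀ ψ : 𝓢(Plane, ℂ), ‖mform m f ψ‖ₑ ≤ C * eLpNorm ψ q) :
    eLpNorm (mfun m f) p ≤ C :=
  eLpNorm_le_of_forall_schwartz (q := q) hp (continuous_fourierInv_of_integrable hm) fun ψ => by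
    have := h ψ
    rwa [← integral_mfun_mul hm] at this

theorem integrable_mul_schwartz_of_bound {m : Plane → ℂ} (hm : AEStronglyMeasurable m) {B : ℝ}
    (hB : ∀ ξ, ‖m ξ‖ ≤ B) (φ : 𝓢(Plane, ℂ)) : Integrable fun ξ => m ξ * φ ξ :=
  φ.integrable.bdd_mul hm (Eventually.of_forall hB)

/-- For a multiplier of temperate growth the form is given by the multiplier operator. -/
theorem integral_fourierMultiplierCLM_mul {m : Plane → ℂ} (hm : m.HasTemperateGrowth)
    (f ψ : 𝓢(Plane, ℂ)) :
    ∫ x, SchwartzMap.fourierMultiplierCLM ℂ m f x * ψ x = mform m f ψ := by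
  rw [SchwartzMap.fourierMultiplierCLM_apply, SchwartzMap.integral_fourierInv_mul_eq, mform]
  congr 1; ext ξ
  rw [SchwartzMap.smulLeftCLM_apply_apply hm, smul_eq_mul]; ring

theorem mform_one (f ψ : 𝓢(Plane, ℂ)) : mform (fun _ => 1) f ψ = ∫ x, f x * ψ x := by
  simp only [mform, one_mul]
  rw [SchwartzMap.integral_fourier_mul_eq, FourierTransform.fourier_fourierInv_eq]

/-- A bound for an average of multipliers. -/
theorem enorm_mform_le_lintegral {Ω : Type*} [MeasurableSpace Ω] {ν : Measure Ω} [SFinite ν]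
    {M : Ω → Plane → ℂ} {m : Plane → ℂ} {f ψ : 𝓢(Plane, ℂ)}
    (hm : ∀ᵐ ξ : Plane, m ξ = ∫ a, M a ξ ∂ν)
    (hint : Integrable (Function.uncurry fun a ξ => M a ξ * (𝓕 f ξ * 𝓕⁻ ψ ξ)) (ν.prod volume))
    {B : Ω → ℝ≥0∞} (hB : ∀ᵐ a ∂ν, ‖mform (M a) f ψ‖ₑ ≤ B a) :
    ‖mform m f ψ‖ₑ ≤ ∫⁻ a, B a ∂ν := by
  have h1 : mform m f ψ = ∫ a, mform (M a) f ψ ∂ν := by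
    simp only [mform]
    rw [integral_integral_swap hint]
    refine integral_congr_ae ?_
    filter_upwards [hm] with ξ hξ
    rw [hξ, integral_mul_const]
  rw [h1]
  exact (enorm_integral_le_lintegral_enorm _).trans (lintegral_mono_ae hB)

/-- The character `ξ ↦ exp (2 π i ⟨y, ξ⟩)`. -/
noncomputable def echar (y ξ : Plane) : ℂ := Complex.exp ((2 * Real.pi * inner ℝ y ξ : ℝ) * Complex.I)

theorem norm_echar (y ξ : Plane) : ‖echar y ξ‖ = 1 := Complex.norm_exp_ofReal_mul_I _

theorem continuous_echar : Continuous fun z : Plane × Plane => echar z.1 z.2 := by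
  unfold echar; fun_prop

theorem echar_eq_fourierChar (y ξ : Plane) : echar y ξ = (Real.fourierChar (inner ℝ y ξ) : ℂ) := by
  rw [echar, Real.fourierChar_apply]

/-- The Fourier transform of a translate. -/
theorem fourier_compSubConstCLM (f : 𝓢(Plane, ℂ)) (y ξ : Plane) :
    𝓕 (SchwartzMap.compSubConstCLM ℂ (-y) f) ξ = echar y ξ * 𝓕 f ξ := by
  have h1 : ((SchwartzMap.compSubConstCLM ℂ (-y) f : 𝓢(Plane, ℂ)) : Plane → ℂ)
      = fun x => f (x + y) := by ext x; simp
  rw [SchwartzMap.fourier_coe, SchwartzMap.fourier_coe, h1, echar_eq_fourierChar]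
  have := VectorFourier.fourierIntegral_comp_add_right Real.fourierChar (volume : Measure Plane)
    (innerₗ Plane) f y
  have h2 := congrFun this ξ
  simpa [Circle.smul_def] using! h2

theorem mform_echar (y : Plane) (f ψ : 𝓢(Plane, ℂ)) :
    mform (echar y) f ψ = ∫ x, f (x + y) * ψ x := by
  have h1 : ∀ x, f (x + y) = SchwartzMap.compSubConstCLM ℂ (-y) f x := fun x => by simp
  simp only [h1]
  rw [← mform_one, mform, mform]
  congr 1; ext ξ
  rw [fourier_compSubConstCLM]; ring

/-- The multiplier is a translation, hence an isometry of L^p. This is the elementary building block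
from which the other L^p bounds for smooth symbols are averaged. -/
theorem enorm_mform_echar_le {p q : ℝ≥0∞} [hpq : p.HolderConjugate q] (y : Plane)
    (f ψ : 𝓢(Plane, ℂ)) : ‖mform (echar y) f ψ‖ₑ ≤ eLpNorm f p * eLpNorm ψ q := by
  rw [mform_echar]
  refine (enorm_integral_mul_le (p := p) (q := q) (f := fun x => f (x + y))
    (f.continuous.comp (continuous_add_const y)).aestronglyMeasurable
    ψ.continuous.aestronglyMeasurable).trans (le_of_eq ?_)
  congr 1
  exact eLpNorm_comp_measurePreserving f.continuous.aestronglyMeasurable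
    (measurePreserving_add_right volume y)

theorem integrable_fourier_mul_fourierInv (f ψ : 𝓢(Plane, ℂ)) :
    Integrable fun ξ => 𝓕 f ξ * 𝓕⁻ ψ ξ := by
  obtain ⟨C, -, hC⟩ := (𝓕 f).decay 0 0
  exact integrable_mul_schwartz_of_bound (𝓕 f).continuous.aestronglyMeasurable
    (B := C) (fun ξ => by simpa using hC ξ) _

/-- Integrability for an average of multipliers that are bounded in the frequency. -/
theorem integrable_uncurry_mform {Ω : Type*} [MeasurableSpace Ω] {ν : Measure Ω} [SFinite ν]
    {M : Ω → Plane → ℂ} (hM : AEStronglyMeasurable (Function.uncurry M) (ν.prod volume))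
    {κ : Ω → ℝ} (hκ : Integrable κ ν) (hb : ∀ᵐ a ∂ν, ∀ ξ, ‖M a ξ‖ ≤ κ a) (f ψ : 𝓢(Plane, ℂ)) :
    Integrable (Function.uncurry fun a ξ => M a ξ * (𝓕 f ξ * 𝓕⁻ ψ ξ)) (ν.prod volume) := by
  have h1 := integrable_fourier_mul_fourierInv f ψ
  have h2 := hκ.norm.mul_prod h1.norm
  refine h2.mono' (hM.mul h1.aestronglyMeasurable.comp_snd) ?_
  have h3 : ∀ᵐ z ∂(ν.prod (volume : Measure Plane)), ∀ ξ, ‖M z.1 ξ‖ ≤ κ z.1 :=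
    Measure.quasiMeasurePreserving_fst.ae hb
  filter_upwards [h3] with z hz
  rw [Function.uncurry, norm_mul]
  exact mul_le_mul_of_nonneg_right ((hz z.2).trans (Real.le_norm_self _)) (norm_nonneg _)

/-! ### A subharmonic function comparing powers of the modulus with the real part. -/

/-- A smooth subharmonic function on the complex plane that compares powers of `|w|` with
the real part of `w`. -/
noncomputable def gfun (r δ : ℝ) (w : ℂ) : ℝ :=
  2 * (r + 1) ^ 2 * ((w.re ^ 2 + w.im ^ 2 + δ) ^ r * w.re ^ 2)
    - ((w.re ^ 2 + w.im ^ 2 + δ) ^ (r + 1) - δ ^ (r + 1))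

theorem contDiff_gfun (r : ℝ) {δ : ℝ} (hδ : 0 < δ) : ContDiff ℝ 2 (gfun r δ) := by
  have hre : ContDiff ℝ 2 Complex.re := Complex.reCLM.contDiff
  have him : ContDiff ℝ 2 Complex.im := Complex.imCLM.contDiff
  have hρ : ContDiff ℝ 2 fun w : ℂ => w.re ^ 2 + w.im ^ 2 + δ :=
    ((hre.pow 2).add (him.pow 2)).add contDiff_const
  have hρ0 : ∀ w : ℂ, w.re ^ 2 + w.im ^ 2 + δ ≠ 0 := fun w => by positivity
  exact (contDiff_const.mul ((hρ.rpow_const_of_ne hρ0).mul (hre.pow 2))).sub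
    ((hρ.rpow_const_of_ne hρ0).sub contDiff_const)

theorem hasDerivAt_gfun_line {r δ : ℝ} (hδ : 0 < δ) (a b c d : ℝ) (s : ℝ) :
    HasDerivAt (fun s : ℝ => 2 * (r + 1) ^ 2 *
        (((a + s * c) ^ 2 + (b + s * d) ^ 2 + δ) ^ r * (a + s * c) ^ 2)
        - (((a + s * c) ^ 2 + (b + s * d) ^ 2 + δ) ^ (r + 1) - δ ^ (r + 1)))
      (2 * (r + 1) ^ 2 *
        (r * ((a + s * c) ^ 2 + (b + s * d) ^ 2 + δ) ^ (r - 1)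
          * (2 * (a + s * c) * c + 2 * (b + s * d) * d) * (a + s * c) ^ 2
          + ((a + s * c) ^ 2 + (b + s * d) ^ 2 + δ) ^ r * (2 * (a + s * c) * c))
        - (r + 1) * ((a + s * c) ^ 2 + (b + s * d) ^ 2 + δ) ^ r
          * (2 * (a + s * c) * c + 2 * (b + s * d) * d)) s := by
  have hu : ∀ s, HasDerivAt (fun s : ℝ => a + s * c) c s := fun s => by
    simpa using ((hasDerivAt_id s).mul_const c).const_add a
  have hv : ∀ s, HasDerivAt (fun s : ℝ => b + s * d) d s := fun s => by
    simpa using ((hasDerivAt_id s).mul_const d).const_add b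
  have hρ : HasDerivAt (fun s : ℝ => (a + s * c) ^ 2 + (b + s * d) ^ 2 + δ)
      (2 * (a + s * c) * c + 2 * (b + s * d) * d) s := by
    have := (((hu s).pow 2).add ((hv s).pow 2)).add_const δ
    simpa using! this
  have hρ0 : (a + s * c) ^ 2 + (b + s * d) ^ 2 + δ ≠ 0 := by positivity
  have h1 := (hρ.rpow_const (p := r) (Or.inl hρ0)).mul ((hu s).pow 2)
  have h2 := (hρ.rpow_const (p := r + 1) (Or.inl hρ0)).sub_const (δ ^ (r + 1))
  have h3 := (h1.const_mul (2 * (r + 1) ^ 2)).sub h2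
  refine h3.congr_deriv ?_
  simp only [add_sub_cancel_right, Pi.pow_apply]
  push_cast
  ring

theorem hasDerivAt_gfun_line_deriv {r δ : ℝ} (hδ : 0 < δ) (a b c d : ℝ) :
    HasDerivAt (fun s : ℝ => 2 * (r + 1) ^ 2 *
        (r * ((a + s * c) ^ 2 + (b + s * d) ^ 2 + δ) ^ (r - 1)
          * (2 * (a + s * c) * c + 2 * (b + s * d) * d) * (a + s * c) ^ 2
          + ((a + s * c) ^ 2 + (b + s * d) ^ 2 + δ) ^ r * (2 * (a + s * c) * c))
        - (r + 1) * ((a + s * c) ^ 2 + (b + s * d) ^ 2 + δ) ^ r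
          * (2 * (a + s * c) * c + 2 * (b + s * d) * d))
      (2 * (r + 1) ^ 2 *
        (r * (r - 1) * (a ^ 2 + b ^ 2 + δ) ^ (r - 2) * (2 * a * c + 2 * b * d) ^ 2 * a ^ 2
          + r * (a ^ 2 + b ^ 2 + δ) ^ (r - 1) * (2 * c ^ 2 + 2 * d ^ 2) * a ^ 2
          + 2 * (r * (a ^ 2 + b ^ 2 + δ) ^ (r - 1) * (2 * a * c + 2 * b * d) * (2 * a * c))
          + (a ^ 2 + b ^ 2 + δ) ^ r * (2 * c ^ 2))
        - (r + 1) * (r * (a ^ 2 + b ^ 2 + δ) ^ (r - 1) * (2 * a * c + 2 * b * d) ^ 2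
          + (a ^ 2 + b ^ 2 + δ) ^ r * (2 * c ^ 2 + 2 * d ^ 2))) 0 := by
  have hu : HasDerivAt (fun s : ℝ => a + s * c) c 0 := by
    simpa using ((hasDerivAt_id (0 : ℝ)).mul_const c).const_add a
  have hv : HasDerivAt (fun s : ℝ => b + s * d) d 0 := by
    simpa using ((hasDerivAt_id (0 : ℝ)).mul_const d).const_add b
  have hρ : HasDerivAt (fun s : ℝ => (a + s * c) ^ 2 + (b + s * d) ^ 2 + δ)
      (2 * a * c + 2 * b * d) 0 := by
    have := ((hu.pow 2).add (hv.pow 2)).add_const δ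
    simpa using! this
  have hρ' : HasDerivAt (fun s : ℝ => 2 * (a + s * c) * c + 2 * (b + s * d) * d)
      (2 * c ^ 2 + 2 * d ^ 2) 0 := by
    refine (((hu.const_mul 2).mul_const c).add ((hv.const_mul 2).mul_const d)).congr_deriv ?_
    ring
  have hρ0 : (a + 0 * c) ^ 2 + (b + 0 * d) ^ 2 + δ ≠ 0 := by positivity
  have h1 := (hρ.rpow_const (p := r - 1) (Or.inl hρ0))
  have h2 := (hρ.rpow_const (p := r) (Or.inl hρ0))
  have h3 := ((((h1.const_mul r).mul hρ').mul (hu.pow 2)).add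
    (h2.mul ((hu.const_mul 2).mul_const c))).const_mul (2 * (r + 1) ^ 2)
  have h4 := h3.sub ((h2.const_mul (r + 1)).mul hρ')
  refine h4.congr_deriv ?_
  simp only [zero_mul, add_zero]
  rw [show r - 1 - 1 = r - 2 by ring]
  simp only [Pi.pow_apply, Pi.mul_apply]
  push_cast
  simp
  ring

theorem fderiv_fderiv_eq_of_hasDerivAt {G : ℂ → ℝ} (hG : ContDiff ℝ 2 G) {w h : ℂ}
    {E₁ : ℝ → ℝ} {E₂ : ℝ} (h1 : ∀ s : ℝ, HasDerivAt (fun s : ℝ => G (w + s • h)) (E₁ s) s)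
    (h2 : HasDerivAt E₁ E₂ 0) : fderiv ℝ (fderiv ℝ G) w h h = E₂ := by
  have hd : Differentiable ℝ G := hG.differentiable (by norm_num)
  have hd2 : Differentiable ℝ (fderiv ℝ G) :=
    (hG.fderiv_right (m := 1) (by norm_num)).differentiable (by norm_num)
  have hl : ∀ s : ℝ, HasDerivAt (fun s : ℝ => w + s • h) h s := fun s => by
    simpa using ((hasDerivAt_id s).smul_const h).const_add w
  have e1 : E₁ = fun s => fderiv ℝ G (w + s • h) h := by
    ext s
    exact (h1 s).unique ((hd _).hasFDerivAt.comp_hasDerivAt s (hl s))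
  have e2 : HasDerivAt (fun s : ℝ => fderiv ℝ G (w + s • h) h) (fderiv ℝ (fderiv ℝ G) w h h) 0 := by
    have h3 : HasFDerivAt (fderiv ℝ G) (fderiv ℝ (fderiv ℝ G) w) (w + (0 : ℝ) • h) := by
      simpa using (hd2 w).hasFDerivAt
    have h4 := h3.comp_hasDerivAt (0 : ℝ) (hl 0)
    have := h4.clm_apply (hasDerivAt_const (0 : ℝ) h)
    simpa using this
  exact (e1 ▸ e2).unique h2

/-- The left side is |h|² times the Laplacian. With ρ = |w|² + δ, the Laplacian of ρ^r (Re w)² is at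
least 2ρ^r and that of ρ^(r+1) is at most 4(r+1)²ρ^r; the coefficient 2(r+1)² in `gfun` is exactly
what balances the two. The shift δ keeps ρ positive, so that non-integer powers are smooth at the
origin. -/
theorem gfun_subharmonic {r δ : ℝ} (hr : 0 ≤ r) (hδ : 0 < δ) (w h : ℂ) :
    0 ≤ fderiv ℝ (fderiv ℝ (gfun r δ)) w h h
      + fderiv ℝ (fderiv ℝ (gfun r δ)) w (Complex.I * h) (Complex.I * h) := by
  have key : ∀ k : ℂ, fderiv ℝ (fderiv ℝ (gfun r δ)) w k k = _ := fun k =>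
    fderiv_fderiv_eq_of_hasDerivAt (contDiff_gfun r hδ)
    (fun s => (hasDerivAt_gfun_line (r := r) hδ w.re w.im k.re k.im s).congr_of_eventuallyEq
      (Eventually.of_forall fun t => by simp [gfun]))
    (hasDerivAt_gfun_line_deriv hδ w.re w.im k.re k.im)
  rw [key h, key (Complex.I * h)]
  simp only [Complex.mul_re, Complex.I_re, zero_mul, Complex.I_im, one_mul, zero_sub,
    Complex.mul_im, zero_add]
  set a := w.re
  set b := w.im
  set c := h.re
  set d := h.im
  have hρ : 0 < a ^ 2 + b ^ 2 + δ := by positivity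
  set ρ := a ^ 2 + b ^ 2 + δ with hρd
  set T := ρ ^ (r - 2) with hT
  have hT0 : 0 < T := Real.rpow_pos_of_pos hρ _
  have e1 : ρ ^ (r - 1) = T * ρ := by
    rw [hT, ← Real.rpow_add_one hρ.ne']; congr 1; ring
  have e2 : ρ ^ r = T * ρ ^ 2 := by
    rw [hT, ← Real.rpow_natCast, ← Real.rpow_add hρ]; congr 1; push_cast; ring
  rw [e1, e2]
  have hN : a ^ 2 + b ^ 2 ≤ ρ := by rw [hρd]; linarith
  have hfin : 0 ≤ (c ^ 2 + d ^ 2) * T * (2 * (r + 1) ^ 2 *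
      (4 * r * ((r - 1) * (a ^ 2 + b ^ 2) + 3 * ρ) * a ^ 2) +
      4 * (r + 1) * ((r + 1) * ρ ^ 2 - (r * (a ^ 2 + b ^ 2) * ρ + ρ ^ 2))) := by
    have h1 : 0 ≤ (r - 1) * (a ^ 2 + b ^ 2) + 3 * ρ := by
      nlinarith [sq_nonneg a, sq_nonneg b, mul_nonneg hr (add_nonneg (sq_nonneg a) (sq_nonneg b))]
    have h2 : 0 ≤ (r + 1) * ρ ^ 2 - (r * (a ^ 2 + b ^ 2) * ρ + ρ ^ 2) := by
      have : 0 ≤ r * ρ * (ρ - (a ^ 2 + b ^ 2)) :=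
        mul_nonneg (mul_nonneg hr hρ.le) (by linarith)
      nlinarith
    positivity
  refine hfin.trans (le_of_eq ?_)
  ring

theorem gfun_zero (r : ℝ) (δ : ℝ) : gfun r δ 0 = 0 := by simp [gfun]

theorem gfun_neg (r δ : ℝ) (w : ℂ) : gfun r δ (-w) = gfun r δ w := by simp [gfun]

/-- The function is even, so its derivative at the origin is its own negative. Vanishing to first
order makes `gfun` of a square-integrable bounded function integrable. -/
theorem fderiv_gfun_zero (r δ : ℝ) : fderiv ℝ (gfun r δ) 0 = 0 := by
  ext v
  by_cases hd : DifferentiableAt ℝ (gfun r δ) 0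
  · have h2 : HasFDerivAt (gfun r δ) (fderiv ℝ (gfun r δ) 0) (-(0 : ℂ)) := by
      simpa using hd.hasFDerivAt
    have h1 := h2.comp (0 : ℂ) (hasFDerivAt_id (𝕜 := ℝ) (0 : ℂ)).neg
    have h3 : gfun r δ ∘ (fun x : ℂ => -x) = gfun r δ := by ext w; simp [gfun_neg]
    have h4 : HasFDerivAt (gfun r δ) _ 0 := h3 ▸ h1
    have h5 := congrArg (fun L : ℂ →L[ℝ] ℝ => L v) (h4.unique hd.hasFDerivAt)
    simp at h5
    simp; linarith
  · simp [fderiv_zero_of_not_differentiableAt hd]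

/-- A smooth function on the complex plane that vanishes to first order at the origin satisfies
quadratic bounds on bounded sets. -/
theorem exists_quadratic_bound {G : ℂ → ℝ} (hG : ContDiff ℝ 2 G) (h0 : G 0 = 0)
    (h1 : fderiv ℝ G 0 = 0) (B : ℝ) : ∃ C : ℝ, 0 ≤ C ∧ ∀ w : ℂ, ‖w‖ ≤ B →
      ‖fderiv ℝ (fderiv ℝ G) w‖ ≤ C ∧ ‖fderiv ℝ G w‖ ≤ C * ‖w‖ ∧ |G w| ≤ C * ‖w‖ ^ 2 := by
  have hd : Differentiable ℝ G := hG.differentiable (by norm_num)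
  have hc1 : ContDiff ℝ 1 (fderiv ℝ G) := hG.fderiv_right (m := 1) (by norm_num)
  have hd2 : Differentiable ℝ (fderiv ℝ G) := hc1.differentiable (by norm_num)
  have hcn : Continuous fun w => ‖fderiv ℝ (fderiv ℝ G) w‖ :=
    (hc1.fderiv_right (m := 0) (by norm_num)).continuous.norm
  obtain ⟨C, hC0⟩ := (isCompact_closedBall (0 : ℂ) B).bddAbove_image hcn.continuousOn
  have hC : ∀ w ∈ Metric.closedBall (0 : ℂ) B, ‖fderiv ℝ (fderiv ℝ G) w‖ ≤ C := fun w hw =>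
    hC0 (mem_image_of_mem _ hw)
  have hC' : ∀ w : ℂ, ‖w‖ ≤ B → ‖fderiv ℝ (fderiv ℝ G) w‖ ≤ max C 0 := fun w hw =>
    (hC w (by simpa using hw)).trans (le_max_left _ _)
  have h2 : ∀ w : ℂ, ‖w‖ ≤ B → ‖fderiv ℝ G w‖ ≤ max C 0 * ‖w‖ := by
    intro w hw
    have := (convex_closedBall (0 : ℂ) ‖w‖).norm_image_sub_le_of_norm_fderiv_le
      (f := fderiv ℝ G) (C := max C 0) (x := 0) (y := w) (𝕜 := ℝ)
      (fun x _ => hd2 x) (fun x hx => hC' x (by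
        have : ‖x‖ ≤ ‖w‖ := by simpa using hx
        exact this.trans hw)) (by simp) (by simp)
    simpa [h1] using this
  refine ⟨max C 0, le_max_right _ _, fun w hw => ⟨hC' w hw, h2 w hw, ?_⟩⟩
  have := (convex_closedBall (0 : ℂ) ‖w‖).norm_image_sub_le_of_norm_fderiv_le
      (f := G) (C := max C 0 * ‖w‖) (x := 0) (y := w) (𝕜 := ℝ)
      (fun x _ => hd x) (fun x hx => by
        have hx' : ‖x‖ ≤ ‖w‖ := by simpa using hx
        exact (h2 x (hx'.trans hw)).trans (mul_le_mul_of_nonneg_left hx' (le_max_right _ _)))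
      (by simp) (by simp)
  simpa [h0, sq, mul_assoc] using this

/-! ### Holomorphic extension of functions with frequencies in a half plane. -/

/-- By duality this half of Plancherel follows from Plancherel for the Schwartz functions tested
against. It is needed for `h` with a jump along the boundary of a half plane. -/
theorem eLpNorm_fourierInv_two_le {h : Plane → ℂ} (hh : Integrable h) :
    eLpNorm (𝓕⁻ h) 2 ≤ eLpNorm h 2 := by
  refine eLpNorm_le_of_forall_schwartz (q := 2) (by norm_num)
    (continuous_fourierInv_of_integrable hh) fun ψ => ?_
  rw [integral_fourierInv_mul hh]
  refine (enorm_integral_mul_le (p := 2) (q := 2) hh.aestronglyMeasurable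
    (𝓕⁻ ψ).continuous.aestronglyMeasurable).trans (le_of_eq ?_)
  congr 1
  have h1 := SchwartzMap.integral_norm_sq_fourier (𝓕⁻ ψ)
  rw [FourierTransform.fourier_fourierInv_eq] at h1
  rw [MemLp.eLpNorm_eq_integral_rpow_norm (by norm_num) (by norm_num) ((𝓕⁻ ψ).memLp 2 volume),
    MemLp.eLpNorm_eq_integral_rpow_norm (by norm_num) (by norm_num) (ψ.memLp 2 volume)]
  simp [h1]

/-- The open half plane of frequencies `ξ` with `ε < ⟨ξ, e⟩`. -/
def halfPlane (e : Plane) (ε : ℝ) : Set Plane := {ξ | ε < inner ℝ ξ e}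

theorem measurableSet_halfPlane (e : Plane) (ε : ℝ) : MeasurableSet (halfPlane e ε) :=
  (isOpen_lt continuous_const (by fun_prop : Continuous fun ξ : Plane => inner ℝ ξ e)).measurableSet

/-- The extension to complex translations in the direction `e` of the function whose Fourier
transform is `σ`, cut off to a half plane. -/
noncomputable def hol (e : Plane) (ε : ℝ) (σ : 𝓢(Plane, ℂ)) (x : Plane) (z : ℂ) : ℂ :=
  ∫ ξ in halfPlane e ε,
    Complex.exp (2 * Real.pi * Complex.I * ((inner ℝ x ξ : ℝ) + z * (inner ℝ ξ e : ℝ))) * σ ξ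

/-- Multiplication by `2 π i ⟨ξ, e⟩`. -/
noncomputable def dmul (e : Plane) (σ : 𝓢(Plane, ℂ)) : 𝓢(Plane, ℂ) :=
  SchwartzMap.smulLeftCLM ℂ (fun ξ : Plane => 2 * Real.pi * Complex.I * ((inner ℝ ξ e : ℝ) : ℂ)) σ

theorem dmul_apply (e : Plane) (σ : 𝓢(Plane, ℂ)) (ξ : Plane) :
    dmul e σ ξ = 2 * Real.pi * Complex.I * ((inner ℝ ξ e : ℝ) : ℂ) * σ ξ := by
  rw [dmul, SchwartzMap.smulLeftCLM_apply_apply (by fun_prop), smul_eq_mul]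

theorem norm_hol_kernel (x ξ e : Plane) (z : ℂ) :
    ‖Complex.exp (2 * Real.pi * Complex.I * ((inner ℝ x ξ : ℝ) + z * (inner ℝ ξ e : ℝ)))‖
      = Real.exp (-2 * Real.pi * z.im * inner ℝ ξ e) := by
  rw [Complex.norm_exp]
  congr 1
  simp [Complex.mul_re, Complex.mul_im, mul_assoc]

theorem norm_hol_kernel_le {x ξ e : Plane} {z : ℂ} {ε : ℝ} (hξ : ξ ∈ halfPlane e ε)
    (hz : 0 ≤ z.im) :
    ‖Complex.exp (2 * Real.pi * Complex.I * ((inner ℝ x ξ : ℝ) + z * (inner ℝ ξ e : ℝ)))‖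
      ≤ Real.exp (-2 * Real.pi * ε * z.im) := by
  rw [norm_hol_kernel]
  refine Real.exp_le_exp.2 ?_
  have h1 : ε ≤ inner ℝ ξ e := le_of_lt hξ
  have h2 := mul_le_mul_of_nonneg_left h1 (mul_nonneg Real.two_pi_pos.le hz)
  nlinarith

theorem exp_neg_le_one {ε y : ℝ} (hε : 0 ≤ ε) (hy : 0 ≤ y) : Real.exp (-2 * Real.pi * ε * y) ≤ 1 := by
  rw [Real.exp_le_one_iff]
  have := mul_nonneg (mul_nonneg Real.two_pi_pos.le hε) hy
  nlinarith

theorem integrable_hol_kernel {e : Plane} {ε : ℝ} (hε : 0 ≤ ε) (σ : 𝓢(Plane, ℂ)) (x : Plane) {z : ℂ}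
    (hz : 0 ≤ z.im) : IntegrableOn (fun ξ =>
      Complex.exp (2 * Real.pi * Complex.I * ((inner ℝ x ξ : ℝ) + z * (inner ℝ ξ e : ℝ))) * σ ξ)
      (halfPlane e ε) := by
  refine Integrable.mono' (g := fun ξ => ‖σ ξ‖) σ.integrable.norm.integrableOn ?_ ?_
  · exact (Continuous.mul (by fun_prop) σ.continuous).aestronglyMeasurable
  · filter_upwards [ae_restrict_mem (measurableSet_halfPlane e ε)] with ξ hξ
    rw [norm_mul]
    exact mul_le_of_le_one_left (norm_nonneg _)
      ((norm_hol_kernel_le hξ hz).trans (exp_neg_le_one hε hz))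

/-- Every frequency in the half plane has ⟨ξ, e⟩ > ε, so moving up by y damps it by exp(-2πεy). The
gap ε > 0 is what later makes the boundary terms at infinity vanish. -/
theorem norm_hol_le (e : Plane) (ε : ℝ) (σ : 𝓢(Plane, ℂ)) (x : Plane) {z : ℂ}
    (hz : 0 ≤ z.im) : ‖hol e ε σ x z‖ ≤ Real.exp (-2 * Real.pi * ε * z.im) * ∫ ξ, ‖σ ξ‖ := by
  rw [hol]
  refine (norm_integral_le_of_norm_le (g := fun ξ => Real.exp (-2 * Real.pi * ε * z.im) * ‖σ ξ‖)
    (σ.integrable.norm.const_mul _).integrableOn ?_).trans ?_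
  · filter_upwards [ae_restrict_mem (measurableSet_halfPlane e ε)] with ξ hξ
    rw [norm_mul]
    exact mul_le_mul_of_nonneg_right (norm_hol_kernel_le hξ hz) (norm_nonneg _)
  · rw [integral_const_mul]
    refine mul_le_mul_of_nonneg_left ?_ (Real.exp_pos _).le
    exact setIntegral_le_integral σ.integrable.norm (Eventually.of_forall fun _ => norm_nonneg _)

theorem hasDerivAt_hol {e : Plane} {ε : ℝ} (hε : 0 ≤ ε) (σ : 𝓢(Plane, ℂ)) (x : Plane) {z : ℂ}
    (hz : 0 < z.im) : HasDerivAt (hol e ε σ x) (hol e ε (dmul e σ) x z) z := by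
  refine (hasDerivAt_integral_of_dominated_loc_of_deriv_le
    (F := fun z ξ => Complex.exp (2 * Real.pi * Complex.I *
      ((inner ℝ x ξ : ℝ) + z * (inner ℝ ξ e : ℝ))) * σ ξ)
    (F' := fun z ξ => Complex.exp (2 * Real.pi * Complex.I *
      ((inner ℝ x ξ : ℝ) + z * (inner ℝ ξ e : ℝ))) * dmul e σ ξ)
    (s := {w : ℂ | 0 < w.im}) (bound := fun ξ => ‖dmul e σ ξ‖)
    ((isOpen_lt continuous_const Complex.continuous_im).mem_nhds hz) ?_
    (integrable_hol_kernel hε σ x hz.le) ?_ ?_ (dmul e σ).integrable.norm.integrableOn ?_).2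
  · exact Eventually.of_forall fun w =>
      (Continuous.mul (by fun_prop) σ.continuous).aestronglyMeasurable
  · exact (Continuous.mul (by fun_prop) (dmul e σ).continuous).aestronglyMeasurable
  · filter_upwards [ae_restrict_mem (measurableSet_halfPlane e ε)] with ξ hξ w hw
    rw [norm_mul]
    exact mul_le_of_le_one_left (norm_nonneg _)
      ((norm_hol_kernel_le hξ (le_of_lt hw)).trans (exp_neg_le_one hε (le_of_lt hw)))
  · refine Eventually.of_forall fun ξ w _ => ?_
    have h1 : HasDerivAt (fun z : ℂ => 2 * Real.pi * Complex.I *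
        ((inner ℝ x ξ : ℝ) + z * (inner ℝ ξ e : ℝ))) (2 * Real.pi * Complex.I *
        ((inner ℝ ξ e : ℝ) : ℂ)) w := by
      have := (((hasDerivAt_id w).mul_const ((inner ℝ ξ e : ℝ) : ℂ)).const_add
        ((inner ℝ x ξ : ℝ) : ℂ)).const_mul (2 * Real.pi * Complex.I)
      simpa using this
    refine (h1.cexp.mul_const (σ ξ)).congr_deriv ?_
    rw [dmul_apply]; ring

/-- Real shifts of z are translations of x along `e`. Hence derivatives in x along `e` and in the
height y are both expressed by the complex derivative, as in the Cauchy-Riemann equations. -/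
theorem hol_add (e : Plane) (ε : ℝ) (σ : 𝓢(Plane, ℂ)) (x : Plane) (a : ℝ) (z : ℂ) :
    hol e ε σ (x + a • e) z = hol e ε σ x (z + a) := by
  rw [hol, hol]
  congr 1; ext ξ
  congr 3
  rw [inner_add_left, inner_smul_left, real_inner_comm e ξ]
  push_cast
  simp
  ring

theorem continuousOn_hol {e : Plane} {ε : ℝ} (hε : 0 ≤ ε) (σ : 𝓢(Plane, ℂ)) (x : Plane) :
    ContinuousOn (hol e ε σ x) {z | 0 ≤ z.im} := by
  refine continuousOn_of_dominated (bound := fun ξ => ‖σ ξ‖) ?_ ?_ σ.integrable.norm.integrableOn ?_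
  · exact fun z _ => (Continuous.mul (by fun_prop) σ.continuous).aestronglyMeasurable
  · intro z hz
    filter_upwards [ae_restrict_mem (measurableSet_halfPlane e ε)] with ξ hξ
    rw [norm_mul]
    exact mul_le_of_le_one_left (norm_nonneg _)
      ((norm_hol_kernel_le hξ hz).trans (exp_neg_le_one hε hz))
  · refine Eventually.of_forall fun ξ => ?_
    fun_prop

theorem stronglyMeasurable_hol (e : Plane) (ε : ℝ) (σ : 𝓢(Plane, ℂ)) :
    StronglyMeasurable fun p : ℝ × Plane => hol e ε σ p.2 (p.1 * Complex.I) := by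
  refine StronglyMeasurable.integral_prod_right' (f := fun q : (ℝ × Plane) × Plane =>
    Complex.exp (2 * Real.pi * Complex.I * ((inner ℝ q.1.2 q.2 : ℝ) +
      (q.1.1 * Complex.I) * (inner ℝ q.2 e : ℝ))) * σ q.2) ?_
  exact (Continuous.mul (by fun_prop) (σ.continuous.comp continuous_snd)).stronglyMeasurable

theorem hol_eq_fourierInv (e : Plane) (ε : ℝ) (σ : 𝓢(Plane, ℂ)) (y : ℝ) :
    (fun x => hol e ε σ x (y * Complex.I)) = 𝓕⁻ ((halfPlane e ε).indicator fun ξ =>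
      (Real.exp (-2 * Real.pi * y * inner ℝ ξ e) : ℂ) * σ ξ) := by
  ext x
  rw [hol, Real.fourierInv_eq', ← integral_indicator (measurableSet_halfPlane e ε)]
  congr 1; ext ξ
  by_cases hξ : ξ ∈ halfPlane e ε
  · simp only [indicator_of_mem hξ, smul_eq_mul]
    rw [← mul_assoc, Complex.ofReal_exp, ← Complex.exp_add, real_inner_comm x ξ]
    congr 2
    push_cast
    linear_combination (2 * Real.pi * y * ((inner ℝ ξ e : ℝ) : ℂ)) * Complex.I_sq
  · simp [indicator_of_notMem hξ]

theorem integrable_halfPlane_indicator {e : Plane} {ε : ℝ} (hε : 0 ≤ ε) (σ : 𝓢(Plane, ℂ)) {y : ℝ}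
    (hy : 0 ≤ y) : Integrable ((halfPlane e ε).indicator fun ξ =>
      (Real.exp (-2 * Real.pi * y * inner ℝ ξ e) : ℂ) * σ ξ) := by
  rw [integrable_indicator_iff (measurableSet_halfPlane e ε)]
  refine σ.integrable.norm.integrableOn.mono'
    (Continuous.mul (by fun_prop) σ.continuous).aestronglyMeasurable ?_
  filter_upwards [ae_restrict_mem (measurableSet_halfPlane e ε)] with ξ hξ
  rw [norm_mul]
  refine mul_le_of_le_one_left (norm_nonneg _) ?_
  rw [Complex.norm_real, Real.norm_eq_abs, abs_of_pos (Real.exp_pos _), Real.exp_le_one_iff]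
  have h2 : 0 ≤ inner ℝ ξ e := hε.trans (le_of_lt hξ)
  have := mul_nonneg (mul_nonneg Real.two_pi_pos.le hy) h2
  nlinarith

theorem continuous_hol {e : Plane} {ε : ℝ} (hε : 0 ≤ ε) (σ : 𝓢(Plane, ℂ)) {y : ℝ} (hy : 0 ≤ y) :
    Continuous fun x => hol e ε σ x (y * Complex.I) := by
  rw [hol_eq_fourierInv]
  exact continuous_fourierInv_of_integrable (integrable_halfPlane_indicator hε σ hy)

theorem lintegral_hol_sq_le {e : Plane} {ε : ℝ} (hε : 0 ≤ ε) (σ : 𝓢(Plane, ℂ)) {y : ℝ} (hy : 0 ≤ y) :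
    ∫⁻ x, ‖hol e ε σ x (y * Complex.I)‖ₑ ^ 2 ≤
      ENNReal.ofReal (Real.exp (-4 * Real.pi * ε * y)) * ∫⁻ ξ, ‖σ ξ‖ₑ ^ 2 := by
  have h1 := eLpNorm_fourierInv_two_le (integrable_halfPlane_indicator (e := e) hε σ hy)
  rw [← hol_eq_fourierInv] at h1
  have h2 : ∀ f : Plane → ℂ, ∫⁻ x, ‖f x‖ₑ ^ 2 = eLpNorm f 2 ^ (2 : ℝ) := by
    intro f
    rw [eLpNorm_eq_lintegral_rpow_enorm_toReal (by norm_num) (by norm_num), ← ENNReal.rpow_mul]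
    simp
  rw [h2]
  refine (ENNReal.rpow_le_rpow h1 (by norm_num)).trans ?_
  rw [← h2, ← lintegral_const_mul' _ _ ENNReal.ofReal_ne_top]
  refine lintegral_mono fun ξ => ?_
  by_cases hξ : ξ ∈ halfPlane e ε
  · rw [indicator_of_mem hξ, enorm_mul, mul_pow]
    refine mul_le_mul_left ?_ _
    rw [← ofReal_norm, Complex.norm_real, Real.norm_eq_abs, abs_of_pos (Real.exp_pos _),
      ← ENNReal.ofReal_pow (Real.exp_pos _).le, ← Real.exp_nat_mul]
    refine ENNReal.ofReal_le_ofReal (Real.exp_le_exp.2 ?_)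
    have h3 : ε ≤ inner ℝ ξ e := le_of_lt hξ
    have := mul_le_mul_of_nonneg_left h3 (mul_nonneg Real.two_pi_pos.le hy)
    push_cast
    nlinarith
  · rw [indicator_of_notMem hξ]; simp

/-- The integral of a directional derivative vanishes. -/
theorem integral_eq_zero_of_hasDerivAt_line {e : Plane} {f f' : Plane → ℝ} (hf : Integrable f)
    (hf' : Integrable f') (h : ∀ x, HasDerivAt (fun a : ℝ => f (x + a • e)) (f' x) 0) :
    ∫ x, f' x = 0 := by
  have hl : ∀ x, HasLineDerivAt ℝ f (f' x) x e := h
  have h1 : ∀ n : ℕ, ∫ x, f' x * (1 : ℝ) = ∫ x, f' x := fun n => by simp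
  let χ : ContDiffBump (0 : Plane) := ⟨1, 2, by positivity, by norm_num⟩
  have hχd : Differentiable ℝ χ := χ.contDiff.differentiable (n := 1) (by norm_num)
  have hχc : Continuous (fderiv ℝ χ) := (χ.contDiff (n := 1)).continuous_fderiv (by norm_num)
  have hχs : HasCompactSupport (fderiv ℝ χ) := χ.hasCompactSupport.fderiv (𝕜 := ℝ)
  obtain ⟨D, hD⟩ := hχs.exists_bound_of_continuous hχc
  -- Integration by parts against the bump dilated by n + 1: the derivative falls on the bump and
  -- costs a factor 1/(n + 1), which kills the right side in the limit.
  have key : ∀ n : ℕ, ∫ x, χ ((1 / ((n : ℝ) + 1)) • x) * f' x =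
      - ∫ x, (1 / ((n : ℝ) + 1)) * fderiv ℝ χ ((1 / ((n : ℝ) + 1)) • x) e * f x := by
    intro n
    set c : ℝ := 1 / ((n : ℝ) + 1)
    have hcont : Continuous fun x : Plane => c • x := continuous_const_smul c
    have hg : ∀ x, HasLineDerivAt ℝ (fun x => χ (c • x)) (c * fderiv ℝ χ (c • x) e) x e := by
      intro x
      have h2 : HasFDerivAt (fun x : Plane => c • x) (c • ContinuousLinearMap.id ℝ Plane) x :=
        (hasFDerivAt_id x).const_smul c
      have := ((hχd (c • x)).hasFDerivAt.comp x h2).hasLineDerivAt e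
      simpa using! this
    have hb1 : Integrable fun x => c * fderiv ℝ χ (c • x) e * f x := by
      refine hf.bdd_mul (c := |c| * (D * ‖e‖)) ?_ (Eventually.of_forall fun x => ?_)
      · exact (continuous_const.mul ((hχc.comp hcont).clm_apply
          continuous_const)).aestronglyMeasurable
      · rw [norm_mul, Real.norm_eq_abs]
        exact mul_le_mul_of_nonneg_left (((fderiv ℝ χ (c • x)).le_opNorm e).trans
          (mul_le_mul_of_nonneg_right (hD _) (norm_nonneg _))) (abs_nonneg _)
    have hbd : ∀ x, ‖χ (c • x)‖ ≤ 1 := fun x => by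
      rw [Real.norm_eq_abs, abs_of_nonneg χ.nonneg]; exact χ.le_one
    have hb2 : Integrable fun x => χ (c • x) * f' x :=
      hf'.bdd_mul (χ.continuous.comp hcont).aestronglyMeasurable (Eventually.of_forall hbd)
    have hb3 : Integrable fun x => χ (c • x) * f x :=
      hf.bdd_mul (χ.continuous.comp hcont).aestronglyMeasurable (Eventually.of_forall hbd)
    exact integral_bilinear_hasLineDerivAt_right_eq_neg_left_of_integrable
      (B := ContinuousLinearMap.mul ℝ ℝ) hb1 hb2 hb3 (fun x _ => hg x) (fun x _ => hl x)
  have hlim : Tendsto (fun n : ℕ => 1 / ((n : ℝ) + 1)) atTop (𝓝 0) :=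
    tendsto_one_div_add_atTop_nhds_zero_nat
  have t1 : Tendsto (fun n : ℕ => ∫ x, χ ((1 / ((n : ℝ) + 1)) • x) * f' x) atTop
      (𝓝 (∫ x, f' x)) := by
    refine tendsto_integral_of_dominated_convergence (fun x => ‖f' x‖) (fun n => ?_) hf'.norm
      (fun n => Eventually.of_forall fun x => ?_) (Eventually.of_forall fun x => ?_)
    · exact (χ.continuous.comp (continuous_const_smul _)).aestronglyMeasurable.mul
        hf'.aestronglyMeasurable
    · rw [norm_mul, Real.norm_eq_abs, abs_of_nonneg χ.nonneg]
      exact mul_le_of_le_one_left (norm_nonneg _) χ.le_one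
    · have h3 : Tendsto (fun n : ℕ => χ ((1 / ((n : ℝ) + 1)) • x)) atTop (𝓝 (χ ((0 : ℝ) • x))) :=
        (χ.continuous.tendsto _).comp (hlim.smul_const x)
      have h4 : χ ((0 : ℝ) • x) = 1 := by
        rw [zero_smul]; exact χ.one_of_mem_closedBall (by simp [χ])
      rw [h4] at h3
      simpa using h3.mul_const (f' x)
  have t2 : Tendsto (fun n : ℕ => - ∫ x, (1 / ((n : ℝ) + 1)) *
      fderiv ℝ χ ((1 / ((n : ℝ) + 1)) • x) e * f x) atTop (𝓝 0) := by
    have hz : Tendsto (fun n : ℕ => (1 / ((n : ℝ) + 1)) * (D * ‖e‖ * ∫ x, ‖f x‖)) atTop (𝓝 0) := by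
      simpa using hlim.mul_const (D * ‖e‖ * ∫ x, ‖f x‖)
    refine squeeze_zero_norm (fun n => ?_) hz
    rw [norm_neg]
    refine (norm_integral_le_of_norm_le (g := fun x => (1 / ((n : ℝ) + 1)) * (D * ‖e‖) * ‖f x‖)
      (hf.norm.const_mul _) (Eventually.of_forall fun x => ?_)).trans ?_
    · rw [norm_mul, norm_mul, Real.norm_eq_abs, abs_of_nonneg (by positivity)]
      refine mul_le_mul_of_nonneg_right (mul_le_mul_of_nonneg_left ?_ (by positivity))
        (norm_nonneg _)
      exact ((fderiv ℝ χ _).le_opNorm e).trans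
        (mul_le_mul_of_nonneg_right (hD _) (norm_nonneg _))
    · rw [integral_const_mul]; exact le_of_eq (by ring)
  simp only [key] at t1
  exact tendsto_nhds_unique t1 t2

/-- The integral of a subharmonic function of a function with positive frequencies, bounded
away from zero, is nonnegative. -/
theorem integral_subharmonic_hol_nonneg {G : ℂ → ℝ} (hG : ContDiff ℝ 2 G) (hG0 : G 0 = 0)
    (hG1 : fderiv ℝ G 0 = 0)
    (hsub : ∀ w h, 0 ≤ fderiv ℝ (fderiv ℝ G) w h h
      + fderiv ℝ (fderiv ℝ G) w (Complex.I * h) (Complex.I * h))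
    (e : Plane) {ε : ℝ} (hε : 0 < ε) (σ : 𝓢(Plane, ℂ)) :
    0 ≤ ∫ x, G (hol e ε σ x 0) := by
  -- `F j` is the j-th complex derivative in z of the extension.
  set F : ℕ → Plane → ℂ → ℂ := fun j => hol e ε ((dmul e)^[j] σ) with hF
  have hFd : ∀ j x z, 0 < z.im → HasDerivAt (F j x) (F (j + 1) x z) z := fun j x z hz => by
    have := hasDerivAt_hol (e := e) hε.le ((dmul e)^[j] σ) x hz
    simpa only [hF, Function.iterate_succ_apply'] using this
  set S : ℕ → ℝ := fun j => ∫ ξ, ‖(dmul e)^[j] σ ξ‖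
  have hS0 : ∀ j, 0 ≤ S j := fun j => integral_nonneg fun _ => norm_nonneg _
  have hFb : ∀ j x (y : ℝ), 0 ≤ y → ‖F j x (y * Complex.I)‖ ≤ Real.exp (-2 * Real.pi * ε * y) * S j :=
    fun j x y hy => by
      have := norm_hol_le e ε ((dmul e)^[j] σ) x (z := y * Complex.I) (by simpa using hy)
      simpa using this
  set B : ℝ := S 0 + S 1 + S 2
  have hFB : ∀ j x (y : ℝ), 0 ≤ y → j ≤ 2 → ‖F j x (y * Complex.I)‖ ≤ B := fun j x y hy hj => by
    have h1 := (hFb j x y hy).trans (mul_le_of_le_one_left (hS0 j) (exp_neg_le_one hε.le hy))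
    have := hS0 0; have := hS0 1; have := hS0 2
    interval_cases j <;> simp only [B] <;> linarith
  have hB0 : 0 ≤ B := add_nonneg (add_nonneg (hS0 0) (hS0 1)) (hS0 2)
  obtain ⟨C, hC0, hC⟩ := exists_quadratic_bound hG hG0 hG1 B
  have hd : Differentiable ℝ G := hG.differentiable (by norm_num)
  have hc1 : ContDiff ℝ 1 (fderiv ℝ G) := hG.fderiv_right (m := 1) (by norm_num)
  have hd2 : Differentiable ℝ (fderiv ℝ G) := hc1.differentiable (by norm_num)
  have hc2 : ContDiff ℝ 0 (fderiv ℝ (fderiv ℝ G)) := hc1.fderiv_right (m := 0) (by norm_num)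
  have hcont1 : Continuous fun q : ℂ × ℂ => fderiv ℝ G q.1 q.2 :=
    ((hc1.comp contDiff_fst).clm_apply contDiff_snd).continuous
  have hcont2 : Continuous fun q : ℂ × ℂ => fderiv ℝ (fderiv ℝ G) q.1 q.2 q.2 :=
    (((hc2.comp contDiff_fst).clm_apply contDiff_snd).clm_apply contDiff_snd).continuous
  -- `P` is the second derivative of `G ∘ F 0` in the height y, and `Q` the one along `e`. A
  -- derivative in y multiplies by i, so the terms with `F 2` have opposite signs and cancel in P +
  -- Q; what remains is the quantity that `hsub` makes nonnegative.
  set P : ℝ → Plane → ℝ := fun y x =>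
    fderiv ℝ (fderiv ℝ G) (F 0 x (y * Complex.I)) (Complex.I * F 1 x (y * Complex.I))
      (Complex.I * F 1 x (y * Complex.I))
    - fderiv ℝ G (F 0 x (y * Complex.I)) (F 2 x (y * Complex.I)) with hP
  set Q : ℝ → Plane → ℝ := fun y x =>
    fderiv ℝ (fderiv ℝ G) (F 0 x (y * Complex.I)) (F 1 x (y * Complex.I))
      (F 1 x (y * Complex.I))
    + fderiv ℝ G (F 0 x (y * Complex.I)) (F 2 x (y * Complex.I)) with hQ
  have hFm : ∀ j, StronglyMeasurable fun p : ℝ × Plane => F j p.2 (p.1 * Complex.I) := fun j =>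
    stronglyMeasurable_hol e ε _
  have hFc : ∀ j (y : ℝ), 0 ≤ y → Continuous fun x => F j x (y * Complex.I) := fun j y hy =>
    continuous_hol hε.le _ hy
  set N : ℝ → Plane → ℝ := fun y x => ‖F 0 x (y * Complex.I)‖ ^ 2 + ‖F 1 x (y * Complex.I)‖ ^ 2
    + ‖F 2 x (y * Complex.I)‖ ^ 2 with hN
  have hb1 : ∀ x (y : ℝ), 0 ≤ y → ∀ h k : ℂ,
      |fderiv ℝ (fderiv ℝ G) (F 0 x (y * Complex.I)) h k| ≤ C * (‖h‖ * ‖k‖) := by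
    intro x y hy h k
    have h1 := (hC _ (hFB 0 x y hy (by norm_num))).1
    calc |fderiv ℝ (fderiv ℝ G) (F 0 x (y * Complex.I)) h k|
        ≤ ‖fderiv ℝ (fderiv ℝ G) (F 0 x (y * Complex.I)) h‖ * ‖k‖ :=
          by rw [← Real.norm_eq_abs]; exact ContinuousLinearMap.le_opNorm _ k
      _ ≤ (‖fderiv ℝ (fderiv ℝ G) (F 0 x (y * Complex.I))‖ * ‖h‖) * ‖k‖ := by
          gcongr; exact ContinuousLinearMap.le_opNorm _ h
      _ ≤ (C * ‖h‖) * ‖k‖ := by gcongr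
      _ = _ := by ring
  have hb2 : ∀ x (y : ℝ), 0 ≤ y → ∀ h : ℂ,
      |fderiv ℝ G (F 0 x (y * Complex.I)) h| ≤ C * (‖F 0 x (y * Complex.I)‖ * ‖h‖) := by
    intro x y hy h
    have h1 := (hC _ (hFB 0 x y hy (by norm_num))).2.1
    calc |fderiv ℝ G (F 0 x (y * Complex.I)) h|
        ≤ ‖fderiv ℝ G (F 0 x (y * Complex.I))‖ * ‖h‖ := by
          rw [← Real.norm_eq_abs]; exact ContinuousLinearMap.le_opNorm _ h
      _ ≤ (C * ‖F 0 x (y * Complex.I)‖) * ‖h‖ := by gcongr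
      _ = _ := by ring
  have hPb : ∀ x (y : ℝ), 0 ≤ y → |P y x| ≤ C * N y x := by
    intro x y hy
    have h1 := hb1 x y hy (Complex.I * F 1 x (y * Complex.I)) (Complex.I * F 1 x (y * Complex.I))
    have h2 := hb2 x y hy (F 2 x (y * Complex.I))
    rw [norm_mul, Complex.norm_I, one_mul] at h1
    refine (abs_sub _ _).trans ((add_le_add h1 h2).trans ?_)
    rw [← mul_add]
    refine mul_le_mul_of_nonneg_left ?_ hC0
    simp only [hN]
    nlinarith [sq_nonneg (‖F 0 x (y * Complex.I)‖ - ‖F 2 x (y * Complex.I)‖),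
      sq_nonneg (‖F 0 x (y * Complex.I)‖), sq_nonneg (‖F 2 x (y * Complex.I)‖)]
  have hQb : ∀ x (y : ℝ), 0 ≤ y → |Q y x| ≤ C * N y x := by
    intro x y hy
    have h1 := hb1 x y hy (F 1 x (y * Complex.I)) (F 1 x (y * Complex.I))
    have h2 := hb2 x y hy (F 2 x (y * Complex.I))
    refine (abs_add_le _ _).trans ((add_le_add h1 h2).trans ?_)
    rw [← mul_add]
    refine mul_le_mul_of_nonneg_left ?_ hC0
    simp only [hN]
    nlinarith [sq_nonneg (‖F 0 x (y * Complex.I)‖ - ‖F 2 x (y * Complex.I)‖),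
      sq_nonneg (‖F 0 x (y * Complex.I)‖), sq_nonneg (‖F 2 x (y * Complex.I)‖)]
  have hPQ : ∀ y x, 0 ≤ P y x + Q y x := by
    intro y x
    have := hsub (F 0 x (y * Complex.I)) (F 1 x (y * Complex.I))
    simp only [hP, hQ]; linarith
  -- square integrability in space
  have hsq : ∀ j, ∃ K : ℝ, 0 ≤ K ∧ ∀ y : ℝ, 0 ≤ y →
      Integrable (fun x => ‖F j x (y * Complex.I)‖ ^ 2) ∧
      ∫ x, ‖F j x (y * Complex.I)‖ ^ 2 ≤ Real.exp (-4 * Real.pi * ε * y) * K := by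
    intro j
    set K₀ := ∫⁻ ξ, ‖(dmul e)^[j] σ ξ‖ₑ ^ 2 with hK₀
    have hK₀f : K₀ ≠ ⊤ := by
      have h1 : MemLp ((dmul e)^[j] σ) 2 := ((dmul e)^[j] σ).memLp 2 volume
      have h2 := (memLp_two_iff_integrable_sq_norm h1.1).1 h1
      have h3 := h2.2.ne
      simpa [hK₀, HasFiniteIntegral, enorm_pow] using h3
    refine ⟨K₀.toReal, ENNReal.toReal_nonneg, fun y hy => ?_⟩
    have h1 := lintegral_hol_sq_le (e := e) hε.le ((dmul e)^[j] σ) hy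
    have hfin : ∫⁻ x, ‖F j x (y * Complex.I)‖ₑ ^ 2 ≠ ⊤ :=
      (h1.trans_lt (ENNReal.mul_lt_top ENNReal.ofReal_lt_top hK₀f.lt_top)).ne
    have hm : AEStronglyMeasurable (fun x => ‖F j x (y * Complex.I)‖ ^ 2) volume :=
      ((hFc j y hy).norm.pow 2).aestronglyMeasurable
    refine ⟨⟨hm, ?_⟩, ?_⟩
    · simpa [HasFiniteIntegral, enorm_pow] using hfin.lt_top
    · rw [integral_eq_lintegral_of_nonneg_ae (Eventually.of_forall fun x => by positivity) hm]
      have h2 : ∀ x, ENNReal.ofReal (‖F j x (y * Complex.I)‖ ^ 2) = ‖F j x (y * Complex.I)‖ₑ ^ 2 :=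
        fun x => by rw [ENNReal.ofReal_pow (norm_nonneg _), ofReal_norm]
      simp only [h2]
      refine (ENNReal.toReal_mono (ENNReal.mul_ne_top ENNReal.ofReal_ne_top hK₀f) h1).trans ?_
      rw [ENNReal.toReal_mul, ENNReal.toReal_ofReal (Real.exp_pos _).le]
  choose K hK0 hK using hsq
  have hNi : ∀ y : ℝ, 0 ≤ y → Integrable (N y) := fun y hy =>
    (((hK 0 y hy).1.add (hK 1 y hy).1).add (hK 2 y hy).1)
  have hNint : ∀ y : ℝ, 0 ≤ y → ∫ x, N y x ≤
      Real.exp (-4 * Real.pi * ε * y) * (K 0 + K 1 + K 2) := fun y hy => by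
    have h1 : ∫ x, N y x = (∫ x, ‖F 0 x (y * Complex.I)‖ ^ 2) + (∫ x, ‖F 1 x (y * Complex.I)‖ ^ 2)
        + ∫ x, ‖F 2 x (y * Complex.I)‖ ^ 2 := by
      have h01 : Integrable fun x => ‖F 0 x (y * Complex.I)‖ ^ 2 + ‖F 1 x (y * Complex.I)‖ ^ 2 :=
        (hK 0 y hy).1.add (hK 1 y hy).1
      rw [← integral_add (hK 0 y hy).1 (hK 1 y hy).1, ← integral_add h01 (hK 2 y hy).1]
    rw [h1]
    linarith [(hK 0 y hy).2, (hK 1 y hy).2, (hK 2 y hy).2]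
  have hPm : StronglyMeasurable fun p : ℝ × Plane => P p.1 p.2 := by
    have h1 := hcont2.comp_stronglyMeasurable
      ((hFm 0).prodMk ((hFm 1).const_mul Complex.I))
    have h2 := hcont1.comp_stronglyMeasurable ((hFm 0).prodMk (hFm 2))
    exact h1.sub h2
  have hPx : ∀ y : ℝ, 0 ≤ y → Integrable (P y) := fun y hy =>
    ((hNi y hy).const_mul C).mono' (hPm.comp_measurable measurable_prodMk_left).aestronglyMeasurable
      (Eventually.of_forall fun x => hPb x y hy)
  have hQx : ∀ y : ℝ, 0 ≤ y → Integrable (Q y) := fun y hy => by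
    refine ((hNi y hy).const_mul C).mono' ?_ (Eventually.of_forall fun x => hQb x y hy)
    exact ((hcont2.comp ((hFc 0 y hy).prodMk (hFc 1 y hy))).add
      (hcont1.comp ((hFc 0 y hy).prodMk (hFc 2 y hy)))).aestronglyMeasurable
  -- the derivatives in the direction `e` integrate to zero
  have hQ0 : ∀ y : ℝ, 0 < y → ∫ x, Q y x = 0 := by
    intro y hy
    refine integral_eq_zero_of_hasDerivAt_line (e := e)
      (f := fun x => fderiv ℝ G (F 0 x (y * Complex.I)) (F 1 x (y * Complex.I))) ?_ (hQx y hy.le) ?_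
    · refine ((hNi y hy.le).const_mul C).mono'
        (hcont1.comp ((hFc 0 y hy.le).prodMk (hFc 1 y hy.le))).aestronglyMeasurable
        (Eventually.of_forall fun x => ?_)
      refine (hb2 x y hy.le _).trans (mul_le_mul_of_nonneg_left ?_ hC0)
      simp only [hN]
      nlinarith [sq_nonneg (‖F 0 x (y * Complex.I)‖ - ‖F 1 x (y * Complex.I)‖),
        sq_nonneg (‖F 0 x (y * Complex.I)‖), sq_nonneg (‖F 1 x (y * Complex.I)‖),
        sq_nonneg (‖F 2 x (y * Complex.I)‖)]
    · intro x
      have hline : ∀ j, HasDerivAt (fun a : ℝ => F j (x + a • e) (y * Complex.I))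
          (F (j + 1) x (y * Complex.I)) 0 := by
        intro j
        have h1 : ∀ a : ℝ, F j (x + a • e) (y * Complex.I) = F j x (y * Complex.I + a) :=
          fun a => hol_add e ε _ x a _
        simp only [h1]
        have h2 : HasDerivAt (fun a : ℝ => (y * Complex.I + a : ℂ)) 1 0 := by
          simpa using (Complex.ofRealCLM.hasDerivAt (x := (0 : ℝ))).const_add (y * Complex.I : ℂ)
        have h3 := hFd j x (y * Complex.I + (0 : ℝ)) (by simpa using hy)
        have := h3.comp (0 : ℝ) h2
        simpa using! this
      have h0 : F 0 x (y * Complex.I) = F 0 (x + (0 : ℝ) • e) (y * Complex.I) := by simp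
      have h4 : HasDerivAt (fun a : ℝ => fderiv ℝ G (F 0 (x + a • e) (y * Complex.I)))
          (fderiv ℝ (fderiv ℝ G) (F 0 x (y * Complex.I)) (F 1 x (y * Complex.I))) 0 := by
        have h5 : HasFDerivAt (fderiv ℝ G) (fderiv ℝ (fderiv ℝ G) (F 0 x (y * Complex.I)))
            (F 0 (x + (0 : ℝ) • e) (y * Complex.I)) := by
          rw [← h0]; exact (hd2 _).hasFDerivAt
        exact h5.comp_hasDerivAt (0 : ℝ) (hline 0)
      have := h4.clm_apply (hline 1)
      simpa [hQ] using this
  -- integration in the vertical direction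
  have hvert : ∀ x, ∫ y in Ioi (0 : ℝ), y * P y x = G (F 0 x 0) := by
    intro x
    have hl : ∀ j (y : ℝ), 0 < y → HasDerivAt (fun y : ℝ => F j x (y * Complex.I))
        (Complex.I * F (j + 1) x (y * Complex.I)) y := by
      intro j y hy
      have h2 : HasDerivAt (fun y : ℝ => (y * Complex.I : ℂ)) Complex.I y := by
        simpa using (Complex.ofRealCLM.hasDerivAt (x := y)).mul_const Complex.I
      have h3 := hFd j x (y * Complex.I) (by simpa using hy)
      refine (h3.comp y h2).congr_deriv (mul_comm _ _)
    have hcw : ∀ j, ContinuousOn (fun y : ℝ => F j x (y * Complex.I)) (Ici 0) := by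
      intro j
      refine (continuousOn_hol hε.le ((dmul e)^[j] σ) x).comp
        (Continuous.continuousOn (by fun_prop)) ?_
      intro y hy; simpa using hy
    -- This is the antiderivative of y ∂_y² G(F) found by parts. It equals -G(F) at height 0 and
    -- tends to 0 at infinity by the exponential decay.
    set g : ℝ → ℝ := fun y => y * fderiv ℝ G (F 0 x (y * Complex.I))
      (Complex.I * F 1 x (y * Complex.I)) - G (F 0 x (y * Complex.I)) with hg
    have hgc : ContinuousWithinAt g (Ici 0) 0 := by
      have h1 : ContinuousOn (fun y : ℝ => fderiv ℝ G (F 0 x (y * Complex.I))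
          (Complex.I * F 1 x (y * Complex.I))) (Ici 0) :=
        hcont1.comp_continuousOn ((hcw 0).prodMk (continuousOn_const.mul (hcw 1)))
      exact ((continuousOn_id.mul h1).sub (hG.continuous.comp_continuousOn (hcw 0))) 0
        (by simp)
    have hgd : ∀ y ∈ Ioi (0 : ℝ), HasDerivAt g (y * P y x) y := by
      intro y (hy : 0 < y)
      have h1 : HasDerivAt (fun y : ℝ => G (F 0 x (y * Complex.I)))
          (fderiv ℝ G (F 0 x (y * Complex.I)) (Complex.I * F 1 x (y * Complex.I))) y :=
        (hd _).hasFDerivAt.comp_hasDerivAt y (hl 0 y hy)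
      have h2 : HasDerivAt (fun y : ℝ => fderiv ℝ G (F 0 x (y * Complex.I)))
          (fderiv ℝ (fderiv ℝ G) (F 0 x (y * Complex.I)) (Complex.I * F 1 x (y * Complex.I))) y :=
        (hd2 _).hasFDerivAt.comp_hasDerivAt y (hl 0 y hy)
      have h3 := h2.clm_apply ((hl 1 y hy).const_mul Complex.I)
      refine (((hasDerivAt_id y).mul h3).sub h1).congr_deriv ?_
      have h4 : Complex.I * (Complex.I * F (1 + 1) x (y * Complex.I)) = - F 2 x (y * Complex.I) := by
        rw [← mul_assoc, Complex.I_mul_I]; ring_nf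
      rw [h4, map_neg]
      simp only [hP, id]
      ring
    have hyexp : ∀ b : ℝ, 0 < b → IntegrableOn (fun y : ℝ => y * Real.exp (-b * y)) (Ioi 0) := by
      intro b hb
      have := integrableOn_rpow_mul_exp_neg_mul_rpow (s := 1) (p := 1) (b := b) (by norm_num)
        (by norm_num) hb
      simpa using this
    have hNexp : ∀ y : ℝ, 0 ≤ y → N y x ≤ Real.exp (-(2 * Real.pi * ε) * y) *
        (S 0 ^ 2 + S 1 ^ 2 + S 2 ^ 2) := by
      intro y hy
      have hone := exp_neg_le_one hε.le hy
      have hpos := Real.exp_pos (-2 * Real.pi * ε * y)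
      have h1 : ∀ j, ‖F j x (y * Complex.I)‖ ^ 2 ≤ Real.exp (-2 * Real.pi * ε * y) * S j ^ 2 := by
        intro j
        calc ‖F j x (y * Complex.I)‖ ^ 2 ≤ (Real.exp (-2 * Real.pi * ε * y) * S j) ^ 2 := by
              gcongr; exact hFb j x y hy
          _ = Real.exp (-2 * Real.pi * ε * y) * (Real.exp (-2 * Real.pi * ε * y) * S j ^ 2) := by
              ring
          _ ≤ Real.exp (-2 * Real.pi * ε * y) * S j ^ 2 :=
              mul_le_mul_of_nonneg_left (mul_le_of_le_one_left (sq_nonneg _) hone) hpos.le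
      rw [show -(2 * Real.pi * ε) * y = -2 * Real.pi * ε * y by ring]
      simp only [hN]
      linarith [h1 0, h1 1, h1 2]
    have hpe : 0 < 2 * Real.pi * ε := by positivity
    have hgi : IntegrableOn (fun y => y * P y x) (Ioi 0) := by
      refine Integrable.mono' ((hyexp _ hpe).const_mul (C * (S 0 ^ 2 + S 1 ^ 2 + S 2 ^ 2))) ?_ ?_
      · exact (measurable_id.mul (hPm.measurable.comp measurable_prodMk_right)).aestronglyMeasurable
      · filter_upwards [ae_restrict_mem measurableSet_Ioi] with y (hy : 0 < y)
        rw [norm_mul, Real.norm_eq_abs, Real.norm_eq_abs, abs_of_pos hy]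
        calc y * |P y x| ≤ y * (C * (Real.exp (-(2 * Real.pi * ε) * y) *
              (S 0 ^ 2 + S 1 ^ 2 + S 2 ^ 2))) := by
              refine mul_le_mul_of_nonneg_left ((hPb x y hy.le).trans ?_) hy.le
              exact mul_le_mul_of_nonneg_left (hNexp y hy.le) hC0
          _ = _ := by ring
    have hgt : Tendsto g atTop (𝓝 0) := by
      have hz : Tendsto (fun y : ℝ => (C * (S 0 ^ 2 + S 1 ^ 2 + S 2 ^ 2)) *
          ((y + 1) * Real.exp (-(2 * Real.pi * ε) * y))) atTop (𝓝 0) := by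
        have h1 : Tendsto (fun y : ℝ => y ^ (1 : ℝ) * Real.exp (-(2 * Real.pi * ε) * y)) atTop (𝓝 0) :=
          tendsto_rpow_mul_exp_neg_mul_atTop_nhds_zero 1 _ hpe
        have h2 : Tendsto (fun y : ℝ => y ^ (0 : ℝ) * Real.exp (-(2 * Real.pi * ε) * y)) atTop (𝓝 0) :=
          tendsto_rpow_mul_exp_neg_mul_atTop_nhds_zero 0 _ hpe
        have h3 := (h1.add h2).const_mul (C * (S 0 ^ 2 + S 1 ^ 2 + S 2 ^ 2))
        simp only [add_zero, mul_zero] at h3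
        refine h3.congr fun y => ?_
        rw [Real.rpow_one, Real.rpow_zero]; ring
      refine squeeze_zero_norm' ?_ hz
      filter_upwards [eventually_ge_atTop (0 : ℝ)] with y hy
      rw [Real.norm_eq_abs]
      refine (abs_sub _ _).trans ?_
      rw [abs_mul, abs_of_nonneg hy]
      have h1 := hb2 x y hy (Complex.I * F 1 x (y * Complex.I))
      rw [norm_mul, Complex.norm_I, one_mul] at h1
      have h2 := (hC _ (hFB 0 x y hy (by norm_num))).2.2
      have h3 : ‖F 0 x (y * Complex.I)‖ * ‖F 1 x (y * Complex.I)‖ ≤ N y x := by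
        simp only [hN]
        nlinarith [sq_nonneg (‖F 0 x (y * Complex.I)‖ - ‖F 1 x (y * Complex.I)‖),
          sq_nonneg (‖F 0 x (y * Complex.I)‖), sq_nonneg (‖F 1 x (y * Complex.I)‖),
          sq_nonneg (‖F 2 x (y * Complex.I)‖)]
      have h4 : ‖F 0 x (y * Complex.I)‖ ^ 2 ≤ N y x := by
        simp only [hN]
        nlinarith [sq_nonneg (‖F 1 x (y * Complex.I)‖), sq_nonneg (‖F 2 x (y * Complex.I)‖)]
      have h5 := hNexp y hy
      calc _ ≤ y * (C * N y x) + C * N y x :=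
            add_le_add (mul_le_mul_of_nonneg_left (h1.trans (mul_le_mul_of_nonneg_left h3 hC0)) hy)
              (h2.trans (mul_le_mul_of_nonneg_left h4 hC0))
        _ = (y + 1) * C * N y x := by ring
        _ ≤ (y + 1) * C * (Real.exp (-(2 * Real.pi * ε) * y) * (S 0 ^ 2 + S 1 ^ 2 + S 2 ^ 2)) :=
            mul_le_mul_of_nonneg_left h5 (mul_nonneg (by linarith) hC0)
        _ = _ := by ring
    have := integral_Ioi_of_hasDerivAt_of_tendsto hgc hgd hgi hgt
    rw [this, hg]
    simp
  -- Fubini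
  have hint : Integrable (Function.uncurry fun (y : ℝ) (x : Plane) => y * P y x)
      ((volume.restrict (Ioi 0)).prod volume) := by
    rw [integrable_prod_iff]
    · constructor
      · filter_upwards [ae_restrict_mem measurableSet_Ioi] with y (hy : 0 < y)
        exact (hPx y hy.le).const_mul y
      · have hyexp : IntegrableOn (fun y : ℝ => y * Real.exp (-(4 * Real.pi * ε) * y)) (Ioi 0) := by
          have := integrableOn_rpow_mul_exp_neg_mul_rpow (s := 1) (p := 1) (b := 4 * Real.pi * ε)
            (by norm_num) (by norm_num) (by positivity)
          simpa using this
        refine Integrable.mono' (hyexp.const_mul (C * (K 0 + K 1 + K 2))) ?_ ?_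
        · have h1 : StronglyMeasurable fun p : ℝ × Plane => ‖p.1 * P p.1 p.2‖ :=
            (measurable_fst.stronglyMeasurable.mul hPm).norm
          exact h1.integral_prod_right'.aestronglyMeasurable
        · filter_upwards [ae_restrict_mem measurableSet_Ioi] with y (hy : 0 < y)
          rw [Real.norm_eq_abs, abs_of_nonneg (integral_nonneg fun _ => norm_nonneg _)]
          calc ∫ x, ‖Function.uncurry (fun (y : ℝ) (x : Plane) => y * P y x) (y, x)‖
              ≤ ∫ x, y * (C * N y x) := by
                refine integral_mono_of_nonneg (Eventually.of_forall fun _ => norm_nonneg _)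
                  (((hNi y hy.le).const_mul C).const_mul y) (Eventually.of_forall fun x => ?_)
                simp only [Function.uncurry, norm_mul, Real.norm_eq_abs, abs_of_pos hy]
                exact mul_le_mul_of_nonneg_left (hPb x y hy.le) hy.le
            _ = y * (C * ∫ x, N y x) := by rw [integral_const_mul, integral_const_mul]
            _ ≤ y * (C * (Real.exp (-4 * Real.pi * ε * y) * (K 0 + K 1 + K 2))) := by
                refine mul_le_mul_of_nonneg_left ?_ hy.le
                exact mul_le_mul_of_nonneg_left (hNint y hy.le) hC0
            _ = _ := by rw [show -(4 * Real.pi * ε) * y = -4 * Real.pi * ε * y by ring]; ring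
    · exact (measurable_fst.stronglyMeasurable.mul hPm).aestronglyMeasurable
  have h1 : ∫ x, G (hol e ε σ x 0) = ∫ y in Ioi (0 : ℝ), ∫ x, y * P y x := by
    rw [integral_integral_swap hint]
    congr 1; ext x
    rw [hvert x]; rfl
  rw [h1]
  refine setIntegral_nonneg measurableSet_Ioi fun y (hy : 0 < y) => ?_
  rw [integral_const_mul]
  refine mul_nonneg hy.le ?_
  -- Adding `Q` costs nothing, since it is a derivative along `e`, and it completes the Laplacian.
  have h2 : ∫ x, P y x = ∫ x, (P y x + Q y x) := by
    rw [integral_add (hPx y hy.le) (hQx y hy.le), hQ0 y hy, add_zero]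
  rw [h2]
  exact integral_nonneg fun x => hPQ y x

/-! ### Projections to a half plane of frequencies on L^q for q ≥ 2. -/

/-- Multiplication by a character moves the half plane of frequencies. -/
theorem hol_compSubConstCLM {e : Plane} (he : ‖e‖ = 1) (ε : ℝ) (σ : 𝓢(Plane, ℂ)) (x : Plane) :
    hol e ε (SchwartzMap.compSubConstCLM ℂ (ε • e) σ) x 0 = echar (ε • e) x * hol e 0 σ x 0 := by
  rw [hol, hol, ← integral_indicator (measurableSet_halfPlane _ _),
    ← integral_indicator (measurableSet_halfPlane _ _), ← integral_const_mul,
    ← integral_add_right_eq_self _ (ε • e)]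
  congr 1; ext ξ
  have hmem : ξ + ε • e ∈ halfPlane e ε ↔ ξ ∈ halfPlane e 0 := by
    simp only [halfPlane, mem_ofPred_eq, inner_add_left, inner_smul_left,
      real_inner_self_eq_norm_sq, he]
    simp
  by_cases hξ : ξ ∈ halfPlane e 0
  · rw [indicator_of_mem hξ, indicator_of_mem (hmem.2 hξ), echar, ← mul_assoc, ← Complex.exp_add]
    simp only [SchwartzMap.compSubConstCLM_apply, add_sub_cancel_right]
    congr 2
    rw [inner_add_right, real_inner_comm (ε • e) x]
    push_cast
    ring
  · rw [indicator_of_notMem hξ, indicator_of_notMem (mt hmem.1 hξ), mul_zero]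

theorem continuous_hol_zero (e : Plane) (σ : 𝓢(Plane, ℂ)) : Continuous fun x => hol e 0 σ x 0 := by
  simpa using continuous_hol (e := e) le_rfl σ (le_refl (0 : ℝ))

theorem norm_hol_zero_le (e : Plane) (σ : 𝓢(Plane, ℂ)) (x : Plane) :
    ‖hol e 0 σ x 0‖ ≤ ∫ ξ, ‖σ ξ‖ := by
  simpa using norm_hol_le e 0 σ x (z := 0) (by simp)

theorem integrable_norm_sq_hol (e : Plane) (σ : 𝓢(Plane, ℂ)) :
    Integrable fun x => ‖hol e 0 σ x 0‖ ^ 2 := by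
  have h1 := lintegral_hol_sq_le (e := e) le_rfl σ (le_refl (0 : ℝ))
  have hK : ∫⁻ ξ, ‖σ ξ‖ₑ ^ 2 < ⊤ := by
    have h1 : MemLp σ 2 := σ.memLp 2 volume
    have h3 := ((memLp_two_iff_integrable_sq_norm h1.1).1 h1).2
    simpa [HasFiniteIntegral, enorm_pow] using h3
  refine ⟨((continuous_hol_zero e σ).norm.pow 2).aestronglyMeasurable, ?_⟩
  have h2 := h1.trans_lt (ENNReal.mul_lt_top ENNReal.ofReal_lt_top hK)
  simpa [HasFiniteIntegral, enorm_pow] using h2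

/-- The gap is removed here. A character of frequency ε e pushes the spectrum to distance ε from the
boundary without changing the modulus, and ε → 0 by dominated convergence with majorant C |F|². -/
theorem integral_gfun_hol_nonneg {r δ : ℝ} (hr : 0 ≤ r) (hδ : 0 < δ) {e : Plane} (he : ‖e‖ = 1)
    (σ : 𝓢(Plane, ℂ)) : 0 ≤ ∫ x, gfun r δ (hol e 0 σ x 0) := by
  have hG := contDiff_gfun r hδ
  have h0 : ∀ n : ℕ, 0 ≤ ∫ x, gfun r δ (echar ((1 / ((n : ℝ) + 1)) • e) x * hol e 0 σ x 0) := by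
    intro n
    have := integral_subharmonic_hol_nonneg hG (gfun_zero r δ) (fderiv_gfun_zero r δ)
      (gfun_subharmonic hr hδ) e (ε := 1 / ((n : ℝ) + 1)) (by positivity)
      (SchwartzMap.compSubConstCLM ℂ ((1 / ((n : ℝ) + 1)) • e) σ)
    simpa only [hol_compSubConstCLM he] using this
  obtain ⟨C, hC0, hC⟩ := exists_quadratic_bound hG (gfun_zero r δ) (fderiv_gfun_zero r δ)
    (∫ ξ, ‖σ ξ‖)
  refine ge_of_tendsto (f := fun n : ℕ =>
    ∫ x, gfun r δ (echar ((1 / ((n : ℝ) + 1)) • e) x * hol e 0 σ x 0)) (x := atTop) ?_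
    (Eventually.of_forall h0)
  have hlim : Tendsto (fun n : ℕ => 1 / ((n : ℝ) + 1)) atTop (𝓝 0) :=
    tendsto_one_div_add_atTop_nhds_zero_nat
  have hnorm : ∀ (y x : Plane), ‖echar y x * hol e 0 σ x 0‖ = ‖hol e 0 σ x 0‖ := fun y x => by
    rw [norm_mul, norm_echar, one_mul]
  refine tendsto_integral_of_dominated_convergence (fun x => C * ‖hol e 0 σ x 0‖ ^ 2)
    (fun n => ?_) ((integrable_norm_sq_hol e σ).const_mul C)
    (fun n => Eventually.of_forall fun x => ?_) (Eventually.of_forall fun x => ?_)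
  · exact (hG.continuous.comp ((continuous_echar.comp (Continuous.prodMk_right _)).mul
      (continuous_hol_zero e σ))).aestronglyMeasurable
  · have := (hC (echar ((1 / ((n : ℝ) + 1)) • e) x * hol e 0 σ x 0)
      ((hnorm _ _).trans_le (norm_hol_zero_le e σ x))).2.2
    rwa [hnorm] at this
  · have h1 : Tendsto (fun n : ℕ => echar ((1 / ((n : ℝ) + 1)) • e) x) atTop
        (𝓝 (echar ((0 : ℝ) • e) x)) :=
      ((continuous_echar.comp (Continuous.prodMk_left x)).tendsto _).comp (hlim.smul_const e)
    have h2 : echar ((0 : ℝ) • e) x = 1 := by simp [echar]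
    rw [h2] at h1
    have h3 := (hG.continuous.tendsto _).comp (h1.mul_const (hol e 0 σ x 0))
    rw [one_mul] at h3
    exact h3

theorem rpow_add_one_add_le {a δ r : ℝ} (ha : 0 ≤ a) (hδ : 0 < δ) (hr : 0 ≤ r) :
    a ^ (r + 1) ≤ (a + δ) ^ (r + 1) - δ ^ (r + 1) := by
  have := Real.add_rpow_le_rpow_add ha hδ.le (p := r + 1) (by linarith)
  linarith

/-- This is ∫ `gfun` ≥ 0 with the regularization removed: superadditivity of t^(r+1) bounds
|F|^(2r+2) by the subtracted term for every δ, and then δ → 0 in the other term. -/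
theorem integral_hol_rpow_le {r : ℝ} (hr : 0 ≤ r) {e : Plane} (he : ‖e‖ = 1) (σ : 𝓢(Plane, ℂ)) :
    ∫ x, (‖hol e 0 σ x 0‖ ^ 2) ^ (r + 1) ≤
      ∫ x, 2 * (r + 1) ^ 2 * ((‖hol e 0 σ x 0‖ ^ 2) ^ r * (hol e 0 σ x 0).re ^ 2) := by
  set F : Plane → ℂ := fun x => hol e 0 σ x 0 with hF
  set B : ℝ := ∫ ξ, ‖σ ξ‖
  have hFc : Continuous F := continuous_hol_zero e σ
  have hFB : ∀ x, ‖F x‖ ≤ B := norm_hol_zero_le e σ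
  have hB0 : 0 ≤ B := integral_nonneg fun _ => norm_nonneg _
  have hFi : Integrable fun x => ‖F x‖ ^ 2 := integrable_norm_sq_hol e σ
  have hns : ∀ w : ℂ, w.re ^ 2 + w.im ^ 2 = ‖w‖ ^ 2 := fun w => by
    rw [← Complex.normSq_eq_norm_sq, Complex.normSq_apply]; ring
  have hre : ∀ x, (F x).re ^ 2 ≤ ‖F x‖ ^ 2 := fun x => by
    rw [← hns]; nlinarith [sq_nonneg (F x).im]
  have hFB2 : ∀ x, ‖F x‖ ^ 2 ≤ B ^ 2 := fun x => pow_le_pow_left₀ (norm_nonneg _) (hFB x) 2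
  have hbd : ∀ x δ, 0 ≤ δ → δ ≤ 1 → ‖2 * (r + 1) ^ 2 * ((‖F x‖ ^ 2 + δ) ^ r * (F x).re ^ 2)‖ ≤
      2 * (r + 1) ^ 2 * ((B ^ 2 + 1) ^ r * ‖F x‖ ^ 2) := by
    intro x δ h0 h1
    rw [Real.norm_of_nonneg (by positivity)]
    have h2 : (‖F x‖ ^ 2 + δ) ^ r ≤ (B ^ 2 + 1) ^ r :=
      Real.rpow_le_rpow (by positivity) (add_le_add (hFB2 x) h1) hr
    have := hre x
    gcongr
  have hdom : Integrable fun x => 2 * (r + 1) ^ 2 * ((B ^ 2 + 1) ^ r * ‖F x‖ ^ 2) :=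
    (hFi.const_mul _).const_mul _
  have hmeas : ∀ δ, Continuous fun x => 2 * (r + 1) ^ 2 * ((‖F x‖ ^ 2 + δ) ^ r * (F x).re ^ 2) :=
    fun δ => continuous_const.mul ((((hFc.norm.pow 2).add continuous_const).rpow_const
      fun _ => Or.inr hr).mul ((Complex.continuous_re.comp hFc).pow 2))
  have hpowi : Integrable fun x => (‖F x‖ ^ 2) ^ (r + 1) := by
    refine (hFi.const_mul ((B ^ 2) ^ r)).mono'
      ((hFc.norm.pow 2).rpow_const fun _ => Or.inr (by linarith)).aestronglyMeasurable
      (Eventually.of_forall fun x => ?_)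
    rw [Real.norm_of_nonneg (by positivity), Real.rpow_add_one' (by positivity) (by linarith)]
    have := Real.rpow_le_rpow (by positivity) (hFB2 x) hr
    gcongr
  have h1 : ∀ δ, 0 < δ → δ ≤ 1 → ∫ x, (‖F x‖ ^ 2) ^ (r + 1) ≤
      ∫ x, 2 * (r + 1) ^ 2 * ((‖F x‖ ^ 2 + δ) ^ r * (F x).re ^ 2) := by
    intro δ h0 h1
    have h2 := integral_gfun_hol_nonneg hr h0 he σ
    obtain ⟨C, hC0, hC⟩ := exists_quadratic_bound (contDiff_gfun r h0) (gfun_zero r δ)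
      (fderiv_gfun_zero r δ) B
    have hgi : Integrable fun x => gfun r δ (F x) := by
      refine (hFi.const_mul C).mono' ((contDiff_gfun r h0).continuous.comp hFc).aestronglyMeasurable
        (Eventually.of_forall fun x => (hC _ (hFB x)).2.2)
    have hai : Integrable fun x => 2 * (r + 1) ^ 2 * ((‖F x‖ ^ 2 + δ) ^ r * (F x).re ^ 2) :=
      hdom.mono' (hmeas δ).aestronglyMeasurable (Eventually.of_forall fun x => hbd x δ h0.le h1)
    have h3 : ∫ x, (‖F x‖ ^ 2) ^ (r + 1) ≤
        ∫ x, (2 * (r + 1) ^ 2 * ((‖F x‖ ^ 2 + δ) ^ r * (F x).re ^ 2) - gfun r δ (F x)) := by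
      refine integral_mono hpowi (hai.sub hgi) fun x => ?_
      have := rpow_add_one_add_le (a := ‖F x‖ ^ 2) (by positivity) h0 hr
      simp only [gfun, hns]
      linarith
    rw [integral_sub hai hgi] at h3
    linarith
  have hlim : Tendsto (fun n : ℕ => 1 / ((n : ℝ) + 1)) atTop (𝓝 0) :=
    tendsto_one_div_add_atTop_nhds_zero_nat
  have hle : ∀ n : ℕ, 1 / ((n : ℝ) + 1) ≤ 1 := fun n => by
    rw [div_le_one (by positivity)]; linarith [(Nat.cast_nonneg n : (0 : ℝ) ≤ n)]
  refine ge_of_tendsto (f := fun n : ℕ => ∫ x, 2 * (r + 1) ^ 2 *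
    ((‖F x‖ ^ 2 + 1 / ((n : ℝ) + 1)) ^ r * (F x).re ^ 2)) (x := atTop) ?_
    (Eventually.of_forall fun n => h1 _ (by positivity) (hle n))
  refine tendsto_integral_of_dominated_convergence _
    (fun n => (hmeas _).aestronglyMeasurable) hdom
    (fun n => Eventually.of_forall fun x => hbd x _ (by positivity) (hle n))
    (Eventually.of_forall fun x => ?_)
  have h4 : Tendsto (fun n : ℕ => (‖F x‖ ^ 2 + 1 / ((n : ℝ) + 1)) ^ r) atTop
      (𝓝 ((‖F x‖ ^ 2 + 0) ^ r)) :=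
    ((Real.continuous_rpow_const hr).tendsto _).comp (hlim.const_add _)
  rw [add_zero] at h4
  exact (h4.mul_const _).const_mul _

/-- If a ≥ 2Ab, half of a^(r+1) already suffices; otherwise a^r ≤ (2Ab)^r. The coefficient 1/2
allows the first term to be absorbed into the left side of `integral_hol_rpow_le`. -/
theorem rpow_mul_sq_le {a b A r : ℝ} (ha : 0 ≤ a) (hb : 0 ≤ b) (hA : 0 ≤ A) (hr : 0 ≤ r) :
    A * (a ^ r * b) ≤ a ^ (r + 1) / 2 + A * (2 * A) ^ r * b ^ (r + 1) := by
  rw [Real.rpow_add_one' ha (by linarith), Real.rpow_add_one' hb (by linarith)]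
  have har := Real.rpow_nonneg ha r
  have hbr := Real.rpow_nonneg hb r
  rcases le_total (2 * A * b) a with h | h
  · have h1 : 0 ≤ A * (2 * A) ^ r * (b ^ r * b) := by positivity
    nlinarith [mul_le_mul_of_nonneg_left h har]
  · have h2 : a ^ r ≤ (2 * A) ^ r * b ^ r := by
      rw [← Real.mul_rpow (by positivity) hb]
      exact Real.rpow_le_rpow ha h hr
    have h3 : 0 ≤ a ^ r * a := by positivity
    nlinarith [mul_le_mul_of_nonneg_left h2 (mul_nonneg hA hb)]

/-- A function with frequencies in a half plane is controlled by its real part. -/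
theorem eLpNorm_hol_le {q : ℝ} (hq : 2 ≤ q) {e : Plane} (he : ‖e‖ = 1) (σ : 𝓢(Plane, ℂ)) :
    eLpNorm (fun x => hol e 0 σ x 0) (ENNReal.ofReal q) ≤
      ENNReal.ofReal q * eLpNorm (fun x => (hol e 0 σ x 0).re) (ENNReal.ofReal q) := by
  set r : ℝ := q / 2 - 1 with hr'
  have hr : 0 ≤ r := by rw [hr']; linarith
  set F : Plane → ℂ := fun x => hol e 0 σ x 0 with hF
  have hFc : Continuous F := continuous_hol_zero e σ
  set B : ℝ := ∫ ξ, ‖σ ξ‖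
  have hFB : ∀ x, ‖F x‖ ≤ B := norm_hol_zero_le e σ
  have hFB2 : ∀ x, ‖F x‖ ^ 2 ≤ B ^ 2 := fun x => pow_le_pow_left₀ (norm_nonneg _) (hFB x) 2
  have hFi : Integrable fun x => ‖F x‖ ^ 2 := integrable_norm_sq_hol e σ
  have hre : ∀ x, (F x).re ^ 2 ≤ ‖F x‖ ^ 2 := fun x => by
    rw [← sq_abs]; exact pow_le_pow_left₀ (abs_nonneg _) (Complex.abs_re_le_norm _) 2
  have hRc : Continuous fun x => (F x).re := Complex.continuous_re.comp hFc
  have hpowi : Integrable fun x => (‖F x‖ ^ 2) ^ (r + 1) := by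
    refine (hFi.const_mul ((B ^ 2) ^ r)).mono'
      ((hFc.norm.pow 2).rpow_const fun _ => Or.inr (by linarith)).aestronglyMeasurable
      (Eventually.of_forall fun x => ?_)
    rw [Real.norm_of_nonneg (by positivity), Real.rpow_add_one' (by positivity) (by linarith)]
    have := Real.rpow_le_rpow (by positivity) (hFB2 x) hr
    gcongr
  have hrei : Integrable fun x => ((F x).re ^ 2) ^ (r + 1) := by
    refine hpowi.mono' ((hRc.pow 2).rpow_const fun _ => Or.inr (by linarith)).aestronglyMeasurable
      (Eventually.of_forall fun x => ?_)
    rw [Real.norm_of_nonneg (by positivity)]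
    exact Real.rpow_le_rpow (by positivity) (hre x) (by linarith)
  set A : ℝ := 2 * (r + 1) ^ 2 with hA
  have hA0 : 0 ≤ A := by positivity
  have h1 := integral_hol_rpow_le hr he σ
  have h2 : ∫ x, 2 * (r + 1) ^ 2 * ((‖F x‖ ^ 2) ^ r * (F x).re ^ 2) ≤
      ∫ x, ((‖F x‖ ^ 2) ^ (r + 1) / 2 + A * (2 * A) ^ r * ((F x).re ^ 2) ^ (r + 1)) := by
    refine integral_mono_of_nonneg (Eventually.of_forall fun x => by positivity)
      ((hpowi.div_const 2).add (hrei.const_mul _)) (Eventually.of_forall fun x => ?_)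
    exact rpow_mul_sq_le (by positivity) (by positivity) hA0 hr
  rw [integral_add (hpowi.div_const 2) (hrei.const_mul _), integral_div,
    integral_const_mul (A * (2 * A) ^ r)] at h2
  have h3 : ∫ x, (‖F x‖ ^ 2) ^ (r + 1) ≤ q ^ q * ∫ x, ((F x).re ^ 2) ^ (r + 1) := by
    -- Since r + 1 = q/2, the number 2A is q², and the constant after absorption is (q²)^(q/2).
    have h4 : q ^ q = 2 * (A * (2 * A) ^ r) := by
      have h5 : 2 * A = q ^ (2 : ℝ) := by
        rw [Real.rpow_two, hA, hr']; ring
      have h6 : 2 * (A * (2 * A) ^ r) = (2 * A) * (2 * A) ^ r := by ring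
      rw [h6, h5, ← Real.rpow_mul (by linarith), ← Real.rpow_add (by linarith), hr']
      congr 1; ring
    rw [h4]
    linarith
  have hq0 : ENNReal.ofReal q ≠ 0 := by simp; linarith
  have hsq : ∀ a : ℝ, 0 ≤ a → (a ^ 2) ^ (r + 1) = a ^ q := fun a ha => by
    rw [← Real.rpow_two, ← Real.rpow_mul ha, hr']; congr 1; ring
  have hm1 : MemLp F (ENNReal.ofReal q) := by
    rw [← integrable_norm_rpow_iff hFc.aestronglyMeasurable hq0 ENNReal.ofReal_ne_top,
      ENNReal.toReal_ofReal (by linarith)]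
    simpa only [hsq _ (norm_nonneg _)] using hpowi
  have hsq' : ∀ x, ((F x).re ^ 2) ^ (r + 1) = ‖(F x).re‖ ^ q := fun x => by
    rw [← hsq _ (norm_nonneg _), Real.norm_eq_abs, sq_abs]
  have hm2 : MemLp (fun x => (F x).re) (ENNReal.ofReal q) := by
    rw [← integrable_norm_rpow_iff hRc.aestronglyMeasurable hq0 ENNReal.ofReal_ne_top,
      ENNReal.toReal_ofReal (by linarith)]
    simpa only [hsq'] using hrei
  rw [hm1.eLpNorm_eq_integral_rpow_norm hq0 ENNReal.ofReal_ne_top,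
    hm2.eLpNorm_eq_integral_rpow_norm hq0 ENNReal.ofReal_ne_top,
    ENNReal.toReal_ofReal (by linarith), ← ENNReal.ofReal_mul (by linarith)]
  refine ENNReal.ofReal_le_ofReal ?_
  simp only [hsq _ (norm_nonneg _), hsq'] at h3
  have hi0 : 0 ≤ ∫ x, ‖(F x).re‖ ^ q := integral_nonneg fun x => by positivity
  refine (Real.rpow_le_rpow (integral_nonneg fun x => by positivity) h3 (by positivity)).trans ?_
  rw [Real.mul_rpow (by positivity) hi0, ← Real.rpow_mul (by linarith),
    mul_inv_cancel₀ (by linarith), Real.rpow_one]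

theorem hol_zero_eq (e : Plane) (σ : 𝓢(Plane, ℂ)) (x : Plane) :
    hol e 0 σ x 0 = ∫ ξ, (halfPlane e 0).indicator
      (fun ξ => Complex.exp (2 * Real.pi * Complex.I * (inner ℝ x ξ : ℝ)) * σ ξ) ξ := by
  rw [hol, integral_indicator (measurableSet_halfPlane _ _)]
  simp

theorem integrable_exp_mul (σ : 𝓢(Plane, ℂ)) (x : Plane) : Integrable
    (fun ξ => Complex.exp (2 * Real.pi * Complex.I * (inner ℝ x ξ : ℝ)) * σ ξ) := by
  refine σ.integrable.bdd_mul (c := 1)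
    (by fun_prop : Continuous fun ξ : Plane =>
      Complex.exp (2 * Real.pi * Complex.I * (inner ℝ x ξ : ℝ))).aestronglyMeasurable
    (Eventually.of_forall fun ξ => le_of_eq ?_)
  rw [Complex.norm_exp]; simp

theorem hol_zero_lincomb (e : Plane) (σ τ : 𝓢(Plane, ℂ)) (c : ℂ) (x : Plane) :
    hol e 0 (σ + c • τ) x 0 = hol e 0 σ x 0 + c * hol e 0 τ x 0 := by
  rw [hol_zero_eq, hol_zero_eq, hol_zero_eq, ← integral_const_mul, ← integral_add
    ((integrable_exp_mul σ x).indicator (measurableSet_halfPlane _ _))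
    (((integrable_exp_mul τ x).indicator (measurableSet_halfPlane _ _)).const_mul c)]
  congr 1; ext ξ
  by_cases hξ : ξ ∈ halfPlane e 0
  · simp only [indicator_of_mem hξ, add_apply, smul_apply, smul_eq_mul]
    ring
  · simp only [indicator_of_notMem hξ]; simp

theorem hol_fourier_eq_mfun (e : Plane) (f : 𝓢(Plane, ℂ)) :
    (fun x => hol e 0 (𝓕 f) x 0) = mfun ((halfPlane e 0).indicator 1) f := by
  have := hol_eq_fourierInv e 0 (𝓕 f) 0
  simp only [Complex.ofReal_zero, zero_mul, mul_zero] at this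
  rw [this, mfun]
  congr 1; ext ξ
  by_cases hξ : ξ ∈ halfPlane e 0 <;> simp [hξ]

theorem ae_inner_ne_zero {e : Plane} (he : e ≠ 0) : ∀ᵐ ξ : Plane, inner ℝ ξ e ≠ (0 : ℝ) := by
  have h1 : volume ((LinearMap.ker ((innerₗ Plane) e) : Submodule ℝ Plane) : Set Plane) = 0 := by
    refine Measure.addHaar_submodule _ _ fun h => he ?_
    have : e ∈ LinearMap.ker ((innerₗ Plane) e) := by rw [h]; trivial
    simpa using this
  rw [ae_iff]
  convert h1 using 2
  ext ξ
  simp [real_inner_comm e ξ]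

theorem fourier_neg_of_real {f : 𝓢(Plane, ℂ)} (hf : ∀ x, starRingEnd ℂ (f x) = f x) (ξ : Plane) :
    𝓕 f (-ξ) = starRingEnd ℂ (𝓕 f ξ) := by
  rw [SchwartzMap.fourier_coe, Real.fourier_eq', Real.fourier_eq', ← integral_conj]
  congr 1; ext x
  rw [smul_eq_mul, smul_eq_mul, map_mul, hf, ← Complex.exp_conj]
  congr 2
  simp [Complex.conj_ofNat]

/-- A real function is twice the real part of its projection to a half plane of frequencies. -/
theorem two_mul_re_hol {e : Plane} (he : e ≠ 0) {f : 𝓢(Plane, ℂ)}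
    (hf : ∀ x, starRingEnd ℂ (f x) = f x) (x : Plane) :
    2 * (hol e 0 (𝓕 f) x 0).re = (f x).re := by
  set κ : Plane → ℂ := fun ξ => Complex.exp (2 * Real.pi * Complex.I * (inner ℝ x ξ : ℝ)) * 𝓕 f ξ
    with hκ
  have hκi : Integrable κ := integrable_exp_mul _ x
  -- The transform of a real function is Hermitian, so conjugation turns the projection to one half
  -- plane into the projection to the opposite one. The two add up to f because the boundary line is
  -- null.
  have h1 : starRingEnd ℂ (hol e 0 (𝓕 f) x 0) = ∫ ξ, (halfPlane (-e) 0).indicator κ ξ := by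
    rw [hol_zero_eq, ← integral_conj, ← integral_neg_eq_self]
    congr 1; ext ξ
    have hm : -ξ ∈ halfPlane e 0 ↔ ξ ∈ halfPlane (-e) 0 := by simp [halfPlane]
    by_cases hξ : ξ ∈ halfPlane (-e) 0
    · rw [indicator_of_mem hξ, indicator_of_mem (hm.2 hξ), map_mul, fourier_neg_of_real hf,
        Complex.conj_conj, ← Complex.exp_conj]
      simp [hκ, Complex.conj_ofNat]
    · rw [indicator_of_notMem hξ, indicator_of_notMem (mt hm.1 hξ), map_zero]
  have h2 : hol e 0 (𝓕 f) x 0 + starRingEnd ℂ (hol e 0 (𝓕 f) x 0) = f x := by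
    rw [h1, hol_zero_eq, ← integral_add (hκi.indicator (measurableSet_halfPlane _ _))
      (hκi.indicator (measurableSet_halfPlane _ _))]
    have h3 : f x = 𝓕⁻ (𝓕 f) x := by rw [FourierTransform.fourierInv_fourier_eq]
    rw [h3, SchwartzMap.fourierInv_coe, Real.fourierInv_eq']
    refine integral_congr_ae ?_
    filter_upwards [ae_inner_ne_zero he] with ξ hξ
    have h4 : Complex.exp ((2 * Real.pi * inner ℝ ξ x : ℝ) * Complex.I) • (𝓕 f) ξ = κ ξ := by
      simp only [hκ, smul_eq_mul, real_inner_comm x ξ]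
      congr 2; push_cast; ring
    refine Eq.trans ?_ h4.symm
    rcases lt_or_gt_of_ne hξ with h | h
    · rw [indicator_of_notMem (by simp only [halfPlane, mem_ofPred_eq]; linarith),
        indicator_of_mem (by simp only [halfPlane, mem_ofPred_eq, inner_neg_right]; linarith),
        zero_add]
    · rw [indicator_of_mem (by simpa only [halfPlane, mem_ofPred_eq] using h),
        indicator_of_notMem (by simp only [halfPlane, mem_ofPred_eq, inner_neg_right]; linarith),
        add_zero]
  have := congrArg Complex.re h2
  simp at this
  linarith

theorem eLpNorm_hol_fourier_le_of_real {q : ℝ} (hq : 2 ≤ q) {e : Plane} (he : ‖e‖ = 1)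
    {f : 𝓢(Plane, ℂ)} (hf : ∀ x, starRingEnd ℂ (f x) = f x) :
    eLpNorm (fun x => hol e 0 (𝓕 f) x 0) (ENNReal.ofReal q) ≤
      ENNReal.ofReal q * eLpNorm f (ENNReal.ofReal q) := by
  refine (eLpNorm_hol_le hq he _).trans (mul_le_mul_right (eLpNorm_mono fun x => ?_) _)
  have h1 := two_mul_re_hol (e := e) (by rintro rfl; simp at he) hf x
  have h2 := Complex.abs_re_le_norm (f x)
  rw [Real.norm_eq_abs]
  rw [← h1, abs_mul, abs_two] at h2
  linarith [abs_nonneg (hol e 0 (𝓕 f) x 0).re]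

/-- The real part of a Schwartz function. -/
noncomputable def schwartzRe (f : 𝓢(Plane, ℂ)) : 𝓢(Plane, ℂ) :=
  f.postcompCLM (𝕜 := ℝ) (Complex.ofRealCLM ∘L Complex.reCLM)

/-- The imaginary part of a Schwartz function. -/
noncomputable def schwartzIm (f : 𝓢(Plane, ℂ)) : 𝓢(Plane, ℂ) :=
  f.postcompCLM (𝕜 := ℝ) (Complex.ofRealCLM ∘L Complex.imCLM)

theorem schwartzRe_apply (f : 𝓢(Plane, ℂ)) (x : Plane) : schwartzRe f x = ((f x).re : ℂ) := rfl

theorem schwartzIm_apply (f : 𝓢(Plane, ℂ)) (x : Plane) : schwartzIm f x = ((f x).im : ℂ) := rfl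

theorem schwartzRe_add_schwartzIm (f : 𝓢(Plane, ℂ)) :
    schwartzRe f + Complex.I • schwartzIm f = f := by
  ext x
  simp only [add_apply, smul_apply, schwartzRe_apply, schwartzIm_apply,
    smul_eq_mul]
  rw [mul_comm]; exact Complex.re_add_im _

/-- The projection to a half plane of frequencies is bounded on `L^q`. -/
theorem eLpNorm_mfun_halfPlane_le {q : ℝ} (hq : 2 ≤ q) {e : Plane} (he : ‖e‖ = 1)
    (f : 𝓢(Plane, ℂ)) :
    eLpNorm (mfun ((halfPlane e 0).indicator 1) f) (ENNReal.ofReal q) ≤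
      ENNReal.ofReal (2 * q) * eLpNorm f (ENNReal.ofReal q) := by
  have hR : eLpNorm (schwartzRe f) (ENNReal.ofReal q) ≤ eLpNorm f (ENNReal.ofReal q) :=
    eLpNorm_mono fun x => by
      rw [schwartzRe_apply, Complex.norm_real]; exact Complex.abs_re_le_norm _
  have hI : eLpNorm (schwartzIm f) (ENNReal.ofReal q) ≤ eLpNorm f (ENNReal.ofReal q) :=
    eLpNorm_mono fun x => by
      rw [schwartzIm_apply, Complex.norm_real]; exact Complex.abs_im_le_norm _
  have h1 := eLpNorm_hol_fourier_le_of_real hq he (f := schwartzRe f)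
    fun x => by rw [schwartzRe_apply, Complex.conj_ofReal]
  have h2 := eLpNorm_hol_fourier_le_of_real hq he (f := schwartzIm f)
    fun x => by rw [schwartzIm_apply, Complex.conj_ofReal]
  have h3 : (fun x => hol e 0 (𝓕 f) x 0) = (fun x => hol e 0 (𝓕 (schwartzRe f)) x 0) +
      Complex.I • fun x => hol e 0 (𝓕 (schwartzIm f)) x 0 := by
    ext x
    conv_lhs => rw [← schwartzRe_add_schwartzIm f]
    rw [FourierTransform.fourier_add, FourierTransform.fourier_smul, hol_zero_lincomb]
    rfl
  rw [← hol_fourier_eq_mfun, h3]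
  have hq1 : (1 : ℝ≥0∞) ≤ ENNReal.ofReal q := by
    rw [← ENNReal.ofReal_one]; exact ENNReal.ofReal_le_ofReal (by linarith)
  refine (eLpNorm_add_le (continuous_hol_zero e _).aestronglyMeasurable
    ((continuous_hol_zero e _).aestronglyMeasurable.const_smul _) hq1).trans ?_
  have h4 : ‖Complex.I‖ₑ = 1 := by rw [← ofReal_norm]; simp
  rw [eLpNorm_const_smul, h4, one_mul, ENNReal.ofReal_mul (by norm_num), ENNReal.ofReal_ofNat,
    mul_assoc, two_mul]
  exact add_le_add (h1.trans (mul_le_mul_right hR _)) (h2.trans (mul_le_mul_right hI _))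

theorem enorm_mform_halfPlane_le {q : ℝ} (hq : 2 ≤ q) {q' : ℝ≥0∞}
    [(ENNReal.ofReal q).HolderConjugate q'] {e : Plane} (he : ‖e‖ = 1) (f ψ : 𝓢(Plane, ℂ)) :
    ‖mform ((halfPlane e 0).indicator 1) f ψ‖ₑ ≤
      ENNReal.ofReal (2 * q) * eLpNorm f (ENNReal.ofReal q) * eLpNorm ψ q' := by
  have hi : Integrable fun ξ => (halfPlane e 0).indicator (1 : Plane → ℂ) ξ * 𝓕 f ξ :=
    integrable_mul_schwartz_of_bound
      (aestronglyMeasurable_one.indicator (measurableSet_halfPlane e 0)) (B := 1)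
      (fun ξ => by by_cases h : ξ ∈ halfPlane e 0 <;> simp [h]) _
  rw [← integral_mfun_mul hi]
  refine (enorm_integral_mul_le (p := ENNReal.ofReal q) (q := q')
    (continuous_fourierInv_of_integrable hi).aestronglyMeasurable
    ψ.continuous.aestronglyMeasurable).trans (mul_le_mul_left ?_ _)
  exact eLpNorm_mfun_halfPlane_le hq he f

/-! ### Riesz transforms as averages of half plane projections over directions. -/

/-- The unit vector at angle `t`. -/
noncomputable def angleVec (t : ℝ) : Plane := !₂[Real.cos t, Real.sin t]

theorem norm_angleVec (t : ℝ) : ‖angleVec t‖ = 1 := by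
  rw [EuclideanSpace.norm_eq, Fin.sum_univ_two]
  simp [angleVec]

theorem continuous_angleVec : Continuous angleVec := by
  unfold angleVec
  fun_prop

theorem exists_angleVec (ξ : Plane) : ∃ φ, ξ = ‖ξ‖ • angleVec φ := by
  refine ⟨Complex.arg ⟨ξ 0, ξ 1⟩, ?_⟩
  have hn : ‖(⟨ξ 0, ξ 1⟩ : ℂ)‖ = ‖ξ‖ := by
    rw [EuclideanSpace.norm_eq, Fin.sum_univ_two, Complex.norm_def, Complex.normSq_apply]
    simp [sq]
  ext i
  fin_cases i
  · have := Complex.norm_mul_cos_arg ⟨ξ 0, ξ 1⟩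
    rw [hn] at this
    simpa [angleVec] using this.symm
  · have := Complex.norm_mul_sin_arg ⟨ξ 0, ξ 1⟩
    rw [hn] at this
    simpa [angleVec] using this.symm

theorem inner_angleVec (s t : ℝ) : inner ℝ (angleVec s) (angleVec t) = Real.cos (t - s) := by
  rw [Real.cos_sub]
  simp [angleVec, PiLp.inner_apply, Fin.sum_univ_two]

/-- By periodicity the angle is measured from φ, and the half plane condition becomes cos t > 0,
that is |t| < π/2. There cos integrates to 2 and sin to 0, which leaves twice the direction of φ. -/
theorem integral_angleVec_indicator (φ : ℝ) (j : Fin 2) :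
    ∫ t in (-Real.pi)..Real.pi, (halfPlane (angleVec t) 0).indicator (fun _ => angleVec t j)
      (angleVec φ) = 2 * angleVec φ j := by
  set g : ℝ → ℝ := fun t =>
    (halfPlane (angleVec t) 0).indicator (fun _ => angleVec t j) (angleVec φ) with hg
  have hgp : Function.Periodic g (2 * Real.pi) := fun t => by
    have : angleVec (t + 2 * Real.pi) = angleVec t := by simp [angleVec]
    simp only [hg, this]
  have h1 := hgp.intervalIntegral_add_eq (-Real.pi) (-Real.pi + φ)
  rw [show -Real.pi + 2 * Real.pi = Real.pi by ring,
    show -Real.pi + φ + 2 * Real.pi = Real.pi + φ by ring] at h1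
  rw [h1, ← intervalIntegral.integral_comp_add_right]
  have h2 : ∀ t ∈ Ioc (-Real.pi) Real.pi, g (t + φ) =
      (Ioo (-(Real.pi / 2)) (Real.pi / 2)).indicator (fun t => angleVec (t + φ) j) t := by
    intro t ht
    have hiff : angleVec φ ∈ halfPlane (angleVec (t + φ)) 0 ↔
        t ∈ Ioo (-(Real.pi / 2)) (Real.pi / 2) := by
      rw [halfPlane, mem_ofPred_eq, inner_angleVec, add_sub_cancel_right]
      constructor
      · intro h
        by_contra hc
        rw [mem_Ioo, not_and_or, not_lt, not_lt] at hc
        rcases hc with hc | hc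
        · have := Real.cos_nonpos_of_pi_div_two_le_of_le (x := -t) (by linarith)
            (by linarith [ht.1, Real.pi_pos])
          rw [Real.cos_neg] at this
          linarith
        · have := Real.cos_nonpos_of_pi_div_two_le_of_le hc (by linarith [ht.2, Real.pi_pos])
          linarith
      · exact fun h => Real.cos_pos_of_mem_Ioo h
    by_cases h : t ∈ Ioo (-(Real.pi / 2)) (Real.pi / 2)
    · simp only [hg, indicator_of_mem h, indicator_of_mem (hiff.2 h)]
    · simp only [hg, indicator_of_notMem h, indicator_of_notMem (mt hiff.1 h)]
  have hsub : Ioo (-(Real.pi / 2)) (Real.pi / 2) ⊆ Ioc (-Real.pi) Real.pi := fun t ht =>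
    ⟨by linarith [ht.1, Real.pi_pos], by linarith [ht.2, Real.pi_pos]⟩
  rw [intervalIntegral.integral_of_le (by linarith [Real.pi_pos]),
    setIntegral_congr_fun measurableSet_Ioc h2, setIntegral_indicator measurableSet_Ioo,
    inter_eq_self_of_subset_right hsub, ← integral_Ioc_eq_integral_Ioo,
    ← intervalIntegral.integral_of_le (by linarith [Real.pi_pos]),
    intervalIntegral.integral_comp_add_right (fun t => angleVec t j)]
  fin_cases j
  · simp [angleVec, add_comm, Real.sin_add]
    ring
  · simp [angleVec, add_comm]
    simp [sub_eq_add_neg, Real.cos_add]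
    ring

theorem integral_angleVec_halfPlane (ξ : Plane) (hξ : ξ ≠ 0) (j : Fin 2) :
    ((ξ j / ‖ξ‖ : ℝ) : ℂ) = ∫ t in Ioc (-Real.pi) Real.pi,
      ((angleVec t j / 2 : ℝ) : ℂ) * (halfPlane (angleVec t) 0).indicator 1 ξ := by
  obtain ⟨φ, hφ⟩ := exists_angleVec ξ
  have hn : 0 < ‖ξ‖ := norm_pos_iff.2 hξ
  have h1 : ∀ t, ((angleVec t j / 2 : ℝ) : ℂ) * (halfPlane (angleVec t) 0).indicator 1 ξ =
      (((1 / 2) * (halfPlane (angleVec t) 0).indicator (fun _ => angleVec t j)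
        (angleVec φ) : ℝ) : ℂ) := by
    intro t
    have hiff : ξ ∈ halfPlane (angleVec t) 0 ↔ angleVec φ ∈ halfPlane (angleVec t) 0 := by
      rw [halfPlane, mem_ofPred_eq, mem_ofPred_eq, hφ, inner_smul_left]
      simp [hn]
    by_cases h : ξ ∈ halfPlane (angleVec t) 0
    · rw [indicator_of_mem h, indicator_of_mem (hiff.1 h)]; simp; ring
    · rw [indicator_of_notMem h, indicator_of_notMem (mt hiff.2 h)]; simp
  simp only [h1]
  rw [integral_complex_ofReal, integral_const_mul,
    ← intervalIntegral.integral_of_le (by linarith [Real.pi_pos]), integral_angleVec_indicator]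
  congr 1
  have : ξ j = ‖ξ‖ * angleVec φ j := by conv_lhs => rw [hφ]; simp
  rw [this]
  field_simp

/-- The symbol of the Riesz transform. -/
noncomputable def rieszSymbol (j : Fin 2) (ξ : Plane) : ℂ := ((ξ j / ‖ξ‖ : ℝ) : ℂ)

theorem norm_rieszSymbol_le (j : Fin 2) (ξ : Plane) : ‖rieszSymbol j ξ‖ ≤ 1 := by
  rw [rieszSymbol, Complex.norm_real, norm_div, norm_norm]
  exact div_le_one_of_le₀ (PiLp.norm_apply_le ξ j) (norm_nonneg _)

theorem measurable_rieszSymbol (j : Fin 2) : Measurable (rieszSymbol j) := by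
  unfold rieszSymbol
  fun_prop

theorem enorm_mform_rieszSymbol_le_of_two_le {q : ℝ} (hq : 2 ≤ q) {q' : ℝ≥0∞}
    [(ENNReal.ofReal q).HolderConjugate q'] (j : Fin 2) (f ψ : 𝓢(Plane, ℂ)) :
    ‖mform (rieszSymbol j) f ψ‖ₑ ≤
      ENNReal.ofReal (2 * Real.pi * q) * eLpNorm f (ENNReal.ofReal q) * eLpNorm ψ q' := by
  have hm : ∀ᵐ ξ : Plane, rieszSymbol j ξ = ∫ t in Ioc (-Real.pi) Real.pi,
      ((angleVec t j / 2 : ℝ) : ℂ) * (halfPlane (angleVec t) 0).indicator 1 ξ := by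
    filter_upwards [compl_mem_ae_iff.2 (measure_singleton (0 : Plane))] with ξ hξ
    exact integral_angleVec_halfPlane ξ hξ j
  have hset : MeasurableSet {z : ℝ × Plane | (0 : ℝ) < inner ℝ z.2 (angleVec z.1)} :=
    (isOpen_lt continuous_const (continuous_snd.inner
      (continuous_angleVec.comp continuous_fst))).measurableSet
  have hM : AEStronglyMeasurable (Function.uncurry fun t ξ => ((angleVec t j / 2 : ℝ) : ℂ) *
      (halfPlane (angleVec t) 0).indicator (1 : Plane → ℂ) ξ)
      ((volume.restrict (Ioc (-Real.pi) Real.pi)).prod (volume : Measure Plane)) := by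
    have h1 : (Function.uncurry fun t ξ => ((angleVec t j / 2 : ℝ) : ℂ) *
        (halfPlane (angleVec t) 0).indicator (1 : Plane → ℂ) ξ) =
        {z : ℝ × Plane | (0 : ℝ) < inner ℝ z.2 (angleVec z.1)}.indicator
          fun z => ((angleVec z.1 j / 2 : ℝ) : ℂ) := by
      ext z
      by_cases hz : (0 : ℝ) < inner ℝ z.2 (angleVec z.1) <;>
        simp [Function.uncurry, indicator, halfPlane, hz]
    rw [h1]
    have h2 : Continuous fun z : ℝ × Plane => ((angleVec z.1 j / 2 : ℝ) : ℂ) := by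
      have := continuous_angleVec
      fun_prop
    exact h2.aestronglyMeasurable.indicator hset
  have hle : ∀ t, |angleVec t j / 2| ≤ 1 / 2 := fun t => by
    rw [abs_div, abs_two]
    have := PiLp.norm_apply_le (angleVec t) j
    rw [norm_angleVec, Real.norm_eq_abs] at this
    linarith
  have hint := integrable_uncurry_mform hM (κ := fun _ => 1) (integrable_const _)
    (Eventually.of_forall fun t ξ => by
      rw [norm_mul, Complex.norm_real, Real.norm_eq_abs]
      have h2 : ‖(halfPlane (angleVec t) 0).indicator (1 : Plane → ℂ) ξ‖ ≤ 1 := by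
        by_cases h : ξ ∈ halfPlane (angleVec t) 0 <;> simp [h]
      nlinarith [hle t, norm_nonneg ((halfPlane (angleVec t) 0).indicator (1 : Plane → ℂ) ξ),
        abs_nonneg (angleVec t j / 2)]) f ψ
  have hB : ∀ᵐ t ∂(volume.restrict (Ioc (-Real.pi) Real.pi)),
      ‖mform (fun ξ => ((angleVec t j / 2 : ℝ) : ℂ) *
        (halfPlane (angleVec t) 0).indicator 1 ξ) f ψ‖ₑ ≤
      ENNReal.ofReal q * eLpNorm f (ENNReal.ofReal q) * eLpNorm ψ q' := by
    refine Eventually.of_forall fun t => ?_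
    have h1 : mform (fun ξ => ((angleVec t j / 2 : ℝ) : ℂ) *
        (halfPlane (angleVec t) 0).indicator 1 ξ) f ψ =
        ((angleVec t j / 2 : ℝ) : ℂ) * mform ((halfPlane (angleVec t) 0).indicator 1) f ψ := by
      rw [mform, mform, ← integral_const_mul]
      congr 1; ext ξ; ring
    rw [h1, enorm_mul]
    refine (mul_le_mul' (b := ENNReal.ofReal (1 / 2)) ?_
      (enorm_mform_halfPlane_le (q' := q') hq (norm_angleVec t) f ψ)).trans (le_of_eq ?_)
    · rw [← ofReal_norm, Complex.norm_real]
      exact ENNReal.ofReal_le_ofReal (hle t)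
    · rw [← mul_assoc, ← mul_assoc, ← ENNReal.ofReal_mul (by norm_num)]
      congr 3; ring
  refine (enorm_mform_le_lintegral hm hint hB).trans (le_of_eq ?_)
  rw [lintegral_const, Measure.restrict_apply_univ, Real.volume_Ioc, mul_comm, ← mul_assoc,
    ← mul_assoc, ← ENNReal.ofReal_mul (by linarith [Real.pi_pos])]
  congr 3; ring

/-- The reflection ξ ↦ -ξ exchanges 𝓕 and 𝓕⁻. For the odd Riesz symbols this transfers the bounds
with q ≥ 2 to the conjugate exponents. -/
theorem mform_swap_of_odd {m : Plane → ℂ} (hm : ∀ ξ, m (-ξ) = - m ξ) (f ψ : 𝓢(Plane, ℂ)) :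
    mform m f ψ = - mform m ψ f := by
  rw [mform, mform, ← integral_neg_eq_self, ← integral_neg]
  congr 1; ext ξ
  have h1 : ∀ g : 𝓢(Plane, ℂ), 𝓕 g (-ξ) = 𝓕⁻ g ξ := fun g => by
    rw [SchwartzMap.fourier_coe, SchwartzMap.fourierInv_coe, Real.fourierInv_eq_fourier_neg]
  have h2 : ∀ g : 𝓢(Plane, ℂ), 𝓕⁻ g (-ξ) = 𝓕 g ξ := fun g => by
    rw [SchwartzMap.fourier_coe, SchwartzMap.fourierInv_coe, Real.fourierInv_eq_fourier_neg,
      neg_neg]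
  rw [hm, h1, h2]; ring

/-- The Riesz transforms are bounded on `L^p` for `1 < p < ∞`. -/
theorem exists_riesz_bound {p q : ℝ≥0∞} [hpq : p.HolderConjugate q] (hp1 : 1 < p) (hp : p ≠ ⊤) :
    ∃ A : ℝ≥0, ∀ (j : Fin 2) (f ψ : 𝓢(Plane, ℂ)),
      ‖mform (rieszSymbol j) f ψ‖ₑ ≤ A * eLpNorm f p * eLpNorm ψ q := by
  rcases le_total 2 p with h2 | h2
  · have hpr : ENNReal.ofReal p.toReal = p := ENNReal.ofReal_toReal hp
    have h3 : 2 ≤ p.toReal := by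
      have := ENNReal.toReal_mono hp h2
      simpa using this
    refine ⟨(2 * Real.pi * p.toReal).toNNReal, fun j f ψ => ?_⟩
    have : (ENNReal.ofReal p.toReal).HolderConjugate q := by rwa [hpr]
    have := enorm_mform_rieszSymbol_le_of_two_le (q' := q) h3 j f ψ
    rwa [hpr] at this
  · have : q.HolderConjugate p := hpq.symm
    have hq : q ≠ ⊤ := by
      intro h
      have := ENNReal.HolderConjugate.inv_add_inv_eq_one p q
      rw [h] at this
      simp at this
      exact hp1.ne' this
    have hq2 : 2 ≤ q := by
      have h3 := ENNReal.HolderConjugate.inv_add_inv_eq_one p q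
      by_contra hc
      rw [not_le] at hc
      have h4 : (2 : ℝ≥0∞)⁻¹ < q⁻¹ := ENNReal.inv_lt_inv.2 hc
      have h5 : (2 : ℝ≥0∞)⁻¹ ≤ p⁻¹ := ENNReal.inv_le_inv.2 h2
      have h6 := ENNReal.add_lt_add_of_le_of_lt (by simp) h5 h4
      rw [h3, ENNReal.inv_two_add_inv_two] at h6
      exact lt_irrefl _ h6
    have hpr : ENNReal.ofReal q.toReal = q := ENNReal.ofReal_toReal hq
    have h3 : 2 ≤ q.toReal := by
      have := ENNReal.toReal_mono hq hq2
      simpa using this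
    refine ⟨(2 * Real.pi * q.toReal).toNNReal, fun j f ψ => ?_⟩
    have : (ENNReal.ofReal q.toReal).HolderConjugate p := by rwa [hpr]
    have := enorm_mform_rieszSymbol_le_of_two_le (q' := p) h3 j ψ f
    rw [hpr] at this
    rw [mform_swap_of_odd (fun ξ => by simp [rieszSymbol, neg_div]), enorm_neg]
    refine this.trans (le_of_eq ?_)
    rw [mul_right_comm]; rfl

/-! ### Interpolation: |ξ|^s as an average of dilated bumps. -/

/-- Dilations of a Schwartz symbol are multipliers with a uniform bound. -/
theorem enorm_mform_dilation_le {p q : ℝ≥0∞} [hpq : p.HolderConjugate q] (K : 𝓢(Plane, ℂ)) (a : ℝ)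
    (f ψ : 𝓢(Plane, ℂ)) : ‖mform (fun ξ => K (a • ξ)) f ψ‖ₑ ≤
      eLpNorm (𝓕⁻ K : 𝓢(Plane, ℂ)) 1 * eLpNorm f p * eLpNorm ψ q := by
  -- Fourier inversion writes the dilated symbol as an average of characters. The weight `𝓕⁻ K` does
  -- not depend on `a`, hence neither does the bound.
  have hK : ∀ ξ : Plane, K (a • ξ) = ∫ y, 𝓕⁻ K y * echar (-(a • y)) ξ := by
    intro ξ
    have h1 : K = 𝓕 (𝓕⁻ K) := by rw [FourierTransform.fourier_fourierInv_eq]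
    conv_lhs => rw [h1]
    rw [SchwartzMap.fourier_coe, Real.fourier_eq']
    congr 1; ext y
    rw [smul_eq_mul, mul_comm, echar]
    congr 3
    rw [inner_neg_left, inner_smul_left, inner_smul_right]
    simp
  have hM : AEStronglyMeasurable (Function.uncurry fun y ξ => 𝓕⁻ K y * echar (-(a • y)) ξ)
      ((volume : Measure Plane).prod (volume : Measure Plane)) := by
    have h2 : Continuous fun z : Plane × Plane => 𝓕⁻ K z.1 * echar (-(a • z.1)) z.2 :=
      ((𝓕⁻ K).continuous.comp continuous_fst).mul (continuous_echar.comp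
        ((continuous_fst.const_smul a).neg.prodMk continuous_snd))
    exact h2.aestronglyMeasurable
  have hint := integrable_uncurry_mform hM (κ := fun y => ‖𝓕⁻ K y‖) (𝓕⁻ K).integrable.norm
    (Eventually.of_forall fun y ξ => by rw [norm_mul, norm_echar, mul_one]) f ψ
  refine (enorm_mform_le_lintegral (Eventually.of_forall hK) hint
    (B := fun y => ‖𝓕⁻ K y‖ₑ * (eLpNorm f p * eLpNorm ψ q))
    (Eventually.of_forall fun y => ?_)).trans (le_of_eq ?_)
  · have h3 : mform (fun ξ => 𝓕⁻ K y * echar (-(a • y)) ξ) f ψ =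
        𝓕⁻ K y * mform (echar (-(a • y))) f ψ := by
      rw [mform, mform, ← integral_const_mul]
      congr 1; ext ξ; ring
    rw [h3, enorm_mul]
    exact mul_le_mul_right (enorm_mform_echar_le _ f ψ) _
  · rw [lintegral_mul_const _ (𝓕⁻ K).continuous.enorm.measurable, eLpNorm_one_eq_lintegral_enorm,
      mul_assoc]

/-- Averages of dilations of a Schwartz symbol. -/
theorem enorm_mform_dilation_average_le {p q : ℝ≥0∞} [hpq : p.HolderConjugate q] (K : 𝓢(Plane, ℂ))
    {I : Set ℝ} {κ : ℝ → ℝ} (hκ : IntegrableOn κ I) (f ψ : 𝓢(Plane, ℂ)) :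
    Integrable (fun ξ => (∫ t in I, (κ t : ℂ) * K (√t • ξ)) * (𝓕 f ξ * 𝓕⁻ ψ ξ)) ∧
    ‖mform (fun ξ => ∫ t in I, (κ t : ℂ) * K (√t • ξ)) f ψ‖ₑ ≤
      (∫⁻ t in I, ‖κ t‖ₑ) * eLpNorm (𝓕⁻ K : 𝓢(Plane, ℂ)) 1 * eLpNorm f p * eLpNorm ψ q := by
  obtain ⟨C, -, hC⟩ := K.decay 0 0
  have hM : AEStronglyMeasurable (Function.uncurry fun t ξ => (κ t : ℂ) * K (√t • ξ))
      ((volume.restrict I).prod (volume : Measure Plane)) := by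
    have h1 : AEStronglyMeasurable (fun t => (κ t : ℂ)) (volume.restrict I) :=
      Complex.continuous_ofReal.comp_aestronglyMeasurable hκ.1
    exact h1.comp_fst.mul (K.continuous.comp ((Real.continuous_sqrt.comp continuous_fst).smul
      continuous_snd)).aestronglyMeasurable
  have hint := integrable_uncurry_mform hM (κ := fun t => ‖κ t‖ * C) (hκ.norm.mul_const C)
    (Eventually.of_forall fun t ξ => by
      rw [norm_mul, Complex.norm_real]
      exact mul_le_mul_of_nonneg_left (by simpa using hC (√t • ξ)) (norm_nonneg _)) f ψ
  constructor
  · have := hint.integral_prod_right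
    simpa only [Function.uncurry, integral_mul_const] using this
  · refine (enorm_mform_le_lintegral (Eventually.of_forall fun _ => rfl) hint
      (B := fun t => ‖κ t‖ₑ * (eLpNorm (𝓕⁻ K : 𝓢(Plane, ℂ)) 1 * eLpNorm f p * eLpNorm ψ q))
      (Eventually.of_forall fun t => ?_)).trans (le_of_eq ?_)
    · have h3 : mform (fun ξ => (κ t : ℂ) * K (√t • ξ)) f ψ =
          (κ t : ℂ) * mform (fun ξ => K (√t • ξ)) f ψ := by
        rw [mform, mform, ← integral_const_mul]
        congr 1; ext ξ; ring
      rw [h3, enorm_mul]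
      refine mul_le_mul' (le_of_eq ?_) (enorm_mform_dilation_le K _ f ψ)
      rw [← ofReal_norm, Complex.norm_real, ofReal_norm]
    · rw [lintegral_mul_const'' _ hκ.1.enorm]
      ring

/-- A fixed smooth cutoff function on the line. -/
noncomputable def lineBump : ContDiffBump (0 : ℝ) := ⟨1, 2, by norm_num, by norm_num⟩

theorem lineBump_eq_zero {u : ℝ} (hu : 2 ≤ u) : lineBump u = 0 :=
  lineBump.zero_of_le_dist (by simpa [lineBump] using hu.trans (le_abs_self u))

theorem lineBump_eq_one {u : ℝ} (h0 : 0 ≤ u) (hu : u ≤ 1) : lineBump u = 1 :=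
  lineBump.one_of_mem_closedBall (by simpa [lineBump, abs_of_nonneg h0] using hu)

theorem hasCompactSupport_mul_lineBump (P : Plane → ℝ) :
    HasCompactSupport fun ξ : Plane => ((P ξ * lineBump (‖ξ‖ ^ 2) : ℝ) : ℂ) := by
  refine HasCompactSupport.intro (isCompact_closedBall (0 : Plane) 2) fun ξ hξ => ?_
  rw [lineBump_eq_zero]
  · simp
  · have : 2 < ‖ξ‖ := by simpa using hξ
    nlinarith

/-- The product of a smooth function and a radial cutoff. -/
noncomputable def bumpSchwartz (P : Plane → ℝ) (hP : ContDiff ℝ ∞ P) : 𝓢(Plane, ℂ) :=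
  (hasCompactSupport_mul_lineBump P).toSchwartzMap (Complex.ofRealCLM.contDiff.comp
    (hP.mul (lineBump.contDiff.comp (contDiff_norm_sq ℝ))))

theorem bumpSchwartz_apply (P : Plane → ℝ) (hP : ContDiff ℝ ∞ P) (ξ : Plane) :
    bumpSchwartz P hP ξ = ((P ξ * lineBump (‖ξ‖ ^ 2) : ℝ) : ℂ) := rfl

theorem integrableOn_rpow_mul_lineBump {b : ℝ} (hb : 0 < b) :
    IntegrableOn (fun u : ℝ => u ^ (b / 2 - 1) * lineBump u) (Ioi 0) := by
  have h1 : IntegrableOn (fun u : ℝ => u ^ (b / 2 - 1) * lineBump u) (Ioc 0 2) := by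
    have h2 : IntegrableOn (fun u : ℝ => u ^ (b / 2 - 1)) (Ioc 0 2) := by
      have := intervalIntegral.intervalIntegrable_rpow' (a := 0) (b := 2) (r := b / 2 - 1)
        (by linarith)
      rwa [intervalIntegrable_iff_integrableOn_Ioc_of_le (by norm_num)] at this
    exact h2.mul_bdd (c := 1) lineBump.continuous.aestronglyMeasurable
      (Eventually.of_forall fun u => by
        rw [Real.norm_of_nonneg lineBump.nonneg]; exact lineBump.le_one)
  have h3 : IntegrableOn (fun u : ℝ => u ^ (b / 2 - 1) * lineBump u) (Ioi 2) :=
    (integrableOn_zero (α := ℝ) (ε' := ℝ)).congr_fun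
      (fun u hu => by simp [lineBump_eq_zero (le_of_lt hu)]) measurableSet_Ioi
  rw [← Ioc_union_Ioi_eq_Ioi (by norm_num : (0 : ℝ) ≤ 2)]
  exact h1.union h3

theorem integral_rpow_mul_lineBump_pos {b : ℝ} (hb : 0 < b) :
    0 < ∫ u in Ioi (0 : ℝ), u ^ (b / 2 - 1) * lineBump u := by
  have hnn : 0 ≤ᵐ[volume.restrict (Ioi (0 : ℝ))] fun u : ℝ => u ^ (b / 2 - 1) * lineBump u := by
    filter_upwards [ae_restrict_mem measurableSet_Ioi] with u hu
    exact mul_nonneg (Real.rpow_nonneg (le_of_lt hu) _) lineBump.nonneg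
  rw [setIntegral_pos_iff_support_of_nonneg_ae hnn (integrableOn_rpow_mul_lineBump hb)]
  refine lt_of_lt_of_le ?_ (measure_mono (s := Ioo (0 : ℝ) 1) fun u hu => ⟨?_, hu.1⟩)
  · simp
  · rw [Function.mem_support, lineBump_eq_one hu.1.le hu.2.le, mul_one]
    exact (Real.rpow_pos_of_pos hu.1 _).ne'

/-- With a = |ξ|² this represents |ξ|^(-b), up to a positive constant, as an average of dilated
bumps; multiplied by an even power of |ξ|, it yields |ξ|^s. -/
theorem integral_rpow_mul_lineBump_scale {b : ℝ} {a : ℝ} (ha : 0 < a) :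
    ∫ t in Ioi (0 : ℝ), t ^ (b / 2 - 1) * lineBump (t * a) =
      a ^ (-(b / 2)) * ∫ u in Ioi (0 : ℝ), u ^ (b / 2 - 1) * lineBump u := by
  have h1 := integral_comp_mul_left_Ioi (fun u : ℝ => u ^ (b / 2 - 1) * lineBump u) 0 ha
  rw [mul_zero, smul_eq_mul] at h1
  have h2 : ∫ x in Ioi (0 : ℝ), (a * x) ^ (b / 2 - 1) * lineBump (a * x) =
      a ^ (b / 2 - 1) * ∫ t in Ioi (0 : ℝ), t ^ (b / 2 - 1) * lineBump (t * a) := by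
    rw [← integral_const_mul]
    refine setIntegral_congr_fun measurableSet_Ioi fun x hx => ?_
    rw [Real.mul_rpow ha.le (le_of_lt hx), mul_comm x a]; ring
  rw [h2] at h1
  have h3 : a ^ (-(b / 2)) = (a ^ (b / 2 - 1))⁻¹ * a⁻¹ := by
    rw [← Real.rpow_neg ha.le, ← Real.rpow_neg_one a, ← Real.rpow_add ha]; congr 1; ring
  have h4 : a ^ (b / 2 - 1) ≠ 0 := (Real.rpow_pos_of_pos ha _).ne'
  rw [h3, mul_assoc, ← h1, inv_mul_cancel_left₀ h4]

/-- The symbols `|ξ|^k` for even `k` and `ξ_j |ξ|^(k - 1)` for odd `k`. -/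
noncomputable def esym (k : ℕ) (j : Fin 2) (ξ : Plane) : ℂ :=
  (((ξ j) ^ (k % 2) * (‖ξ‖ ^ 2) ^ (k / 2) : ℝ) : ℂ)

theorem hasTemperateGrowth_coord (j : Fin 2) : (fun ξ : Plane => ξ j).HasTemperateGrowth :=
  (EuclideanSpace.proj (𝕜 := ℝ) j).hasTemperateGrowth

theorem hasTemperateGrowth_esym (k : ℕ) (j : Fin 2) : (esym k j).HasTemperateGrowth :=
  Function.HasTemperateGrowth.comp Function.Complex.hasTemperateGrowth_ofReal
    (((hasTemperateGrowth_coord j).pow _).mul ((Function.hasTemperateGrowth_norm_sq Plane).pow _))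

theorem fourier_fourierMultiplierCLM {m : Plane → ℂ} (hm : m.HasTemperateGrowth) (f : 𝓢(Plane, ℂ))
    (ξ : Plane) : 𝓕 (SchwartzMap.fourierMultiplierCLM ℂ m f) ξ = m ξ * 𝓕 f ξ := by
  rw [SchwartzMap.fourierMultiplierCLM_apply, FourierTransform.fourier_fourierInv_eq,
    SchwartzMap.smulLeftCLM_apply_apply hm, smul_eq_mul]

/-- For even k both summands are the same power of |ξ|², whence the factor 1/2. For odd k the sum of
the squares ξ_j² supplies the missing factor |ξ|². -/
theorem sum_coord_pow_mul_esym (k : ℕ) (ξ : Plane) :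
    ((‖ξ‖ ^ 2 : ℝ) : ℂ) ^ ((k + 1) / 2) = ((if k % 2 = 0 then 1 / 2 else 1 : ℝ) : ℂ) *
      ∑ j, (((ξ j) ^ (k % 2) : ℝ) : ℂ) * esym k j ξ := by
  have hn : ‖ξ‖ ^ 2 = ξ 0 ^ 2 + ξ 1 ^ 2 := by
    rw [EuclideanSpace.real_norm_sq_eq, Fin.sum_univ_two]
  rw [Fin.sum_univ_two]
  simp only [esym]
  rcases Nat.mod_two_eq_zero_or_one k with h | h
  · have h1 : (k + 1) / 2 = k / 2 := by omega
    rw [h, h1]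
    push_cast
    simp
    ring
  · have h1 : (k + 1) / 2 = k / 2 + 1 := by omega
    rw [h, h1, hn]
    push_cast
    simp
    ring

/-- The spare factor ξ_j^(k % 2) is moved into the dilated symbol, where it absorbs √t^(k % 2). As
2⌊(k+1)/2⌋ = k + k % 2, the exponent of t is then governed by k itself. -/
theorem integral_dilation_bump_low {k : ℕ} {s t₀ : ℝ} (j : Fin 2) (ξ : Plane)
    (hP : ContDiff ℝ ∞ fun ξ : Plane => (ξ j) ^ (k % 2)) :
    ∫ t in Ioc 0 t₀, ((t ^ ((k - s) / 2 - 1) : ℝ) : ℂ) * bumpSchwartz _ hP (√t • ξ) =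
      (((ξ j) ^ (k % 2) * ∫ t in Ioc 0 t₀, t ^ ((2 * ((k + 1) / 2 : ℕ) - s) / 2 - 1) *
        lineBump (t * ‖ξ‖ ^ 2) : ℝ) : ℂ) := by
  rw [← integral_const_mul, ← integral_complex_ofReal]
  refine setIntegral_congr_fun measurableSet_Ioc fun t ht => ?_
  rw [bumpSchwartz_apply, ← Complex.ofReal_mul, Complex.ofReal_inj]
  have h1 : ‖√t • ξ‖ ^ 2 = t * ‖ξ‖ ^ 2 := by
    rw [norm_smul, mul_pow, Real.norm_eq_abs, sq_abs, Real.sq_sqrt ht.1.le]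
  have h2 : t ^ ((2 * ((k + 1) / 2 : ℕ) - s) / 2 - 1) = t ^ ((k - s) / 2 - 1) * √t ^ (k % 2) := by
    rw [Real.sqrt_eq_rpow, ← Real.rpow_natCast, ← Real.rpow_mul ht.1.le, ← Real.rpow_add ht.1]
    congr 1
    have h3 : 2 * ((k + 1) / 2) = k + k % 2 := by omega
    have h4 : (2 * ((k + 1) / 2 : ℕ) : ℝ) = k + (k % 2 : ℕ) := by exact_mod_cast h3
    rw [h4]; ring
  rw [h1, h2, PiLp.smul_apply, smul_eq_mul, mul_pow]
  ring

theorem integral_dilation_bump_high {l : ℕ} {s t₀ : ℝ} (ht₀ : 0 < t₀) (ξ : Plane)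
    (hP : ContDiff ℝ ∞ fun ξ : Plane => (‖ξ‖ ^ 2) ^ l) :
    ∫ t in Ioi t₀, ((t ^ (-s / 2 - 1) : ℝ) : ℂ) * bumpSchwartz _ hP (√t • ξ) =
      (((‖ξ‖ ^ 2) ^ l * ∫ t in Ioi t₀, t ^ ((2 * l - s) / 2 - 1) *
        lineBump (t * ‖ξ‖ ^ 2) : ℝ) : ℂ) := by
  rw [← integral_const_mul, ← integral_complex_ofReal]
  refine setIntegral_congr_fun measurableSet_Ioi fun t ht => ?_
  have ht0 : 0 < t := ht₀.trans ht
  rw [bumpSchwartz_apply, ← Complex.ofReal_mul, Complex.ofReal_inj]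
  have h1 : ‖√t • ξ‖ ^ 2 = t * ‖ξ‖ ^ 2 := by
    rw [norm_smul, mul_pow, Real.norm_eq_abs, sq_abs, Real.sq_sqrt ht0.le]
  have h2 : t ^ ((2 * l - s) / 2 - 1) = t ^ (-s / 2 - 1) * t ^ l := by
    rw [← Real.rpow_natCast, ← Real.rpow_add ht0]
    congr 1; ring
  rw [h1, h2, mul_pow]
  ring

/-- The integral over all scales t is cut at t₀. On (0, t₀] the symbol will be charged to
derivatives of order k, and on (t₀, ∞) to the function itself. -/
theorem norm_rpow_eq_low_add_high {k : ℕ} {s t₀ : ℝ} (ht₀ : 0 < t₀) (hsk : s < k)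
    {ξ : Plane} (hξ : ξ ≠ 0) :
    (∫ u in Ioi (0 : ℝ), u ^ ((2 * ((k + 1) / 2 : ℕ) - s) / 2 - 1) * lineBump u) * ‖ξ‖ ^ s =
      (‖ξ‖ ^ 2) ^ ((k + 1) / 2) *
        ((∫ t in Ioc 0 t₀, t ^ ((2 * ((k + 1) / 2 : ℕ) - s) / 2 - 1) * lineBump (t * ‖ξ‖ ^ 2)) +
        ∫ t in Ioi t₀, t ^ ((2 * ((k + 1) / 2 : ℕ) - s) / 2 - 1) * lineBump (t * ‖ξ‖ ^ 2)) := by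
  set l := (k + 1) / 2
  have hb : 0 < 2 * (l : ℝ) - s := by
    have h3 : k ≤ 2 * l := by omega
    have h4 : (k : ℝ) ≤ 2 * l := by exact_mod_cast h3
    linarith
  have hn : 0 < ‖ξ‖ ^ 2 := by have := norm_pos_iff.2 hξ; positivity
  have hint : IntegrableOn (fun t : ℝ => t ^ ((2 * l - s) / 2 - 1) * lineBump (t * ‖ξ‖ ^ 2))
      (Ioi 0) := by
    have h1 := (integrableOn_Ioi_comp_mul_left_iff
      (fun u : ℝ => u ^ ((2 * l - s) / 2 - 1) * lineBump u) 0 hn).2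
      (by rw [mul_zero]; exact integrableOn_rpow_mul_lineBump hb)
    have h2 := h1.const_mul (((‖ξ‖ ^ 2) ^ ((2 * l - s) / 2 - 1))⁻¹)
    refine IntegrableOn.congr_fun h2 (fun t ht => ?_) measurableSet_Ioi
    have h3 : (‖ξ‖ ^ 2) ^ ((2 * l - s) / 2 - 1) ≠ 0 := (Real.rpow_pos_of_pos hn _).ne'
    rw [Real.mul_rpow hn.le (le_of_lt ht), mul_comm t, mul_assoc, inv_mul_cancel_left₀ h3]
  have h1 := integral_rpow_mul_lineBump_scale (b := 2 * l - s) hn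
  have h2 : Ioi (0 : ℝ) = Ioc 0 t₀ ∪ Ioi t₀ := (Ioc_union_Ioi_eq_Ioi ht₀.le).symm
  have h5 : Disjoint (Ioc 0 t₀) (Ioi t₀) := by
    rw [Set.disjoint_left]; exact fun t h h' => not_lt.2 h.2 h'
  have h6 := setIntegral_union h5 measurableSet_Ioi
    (hint.mono_set (by rw [h2]; exact subset_union_left))
    (hint.mono_set (by rw [h2]; exact subset_union_right))
  rw [← h2, h1] at h6
  rw [← h6, ← mul_assoc, mul_comm]
  congr 1
  rw [← Real.rpow_natCast (‖ξ‖ ^ 2), ← Real.rpow_add hn, ← Real.rpow_natCast_mul (norm_nonneg _)]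
  congr 1; push_cast; ring

theorem lintegral_low_rpow {a t₀ : ℝ} (ha : 0 < a) (ht₀ : 0 < t₀) :
    IntegrableOn (fun t : ℝ => t ^ (a - 1)) (Ioc 0 t₀) ∧
      ∫⁻ t in Ioc 0 t₀, ‖t ^ (a - 1)‖ₑ = ENNReal.ofReal (a⁻¹ * t₀ ^ a) := by
  have h1 : IntegrableOn (fun t : ℝ => t ^ (a - 1)) (Ioc 0 t₀) := by
    have := intervalIntegral.intervalIntegrable_rpow' (a := 0) (b := t₀) (r := a - 1) (by linarith)
    rwa [intervalIntegrable_iff_integrableOn_Ioc_of_le ht₀.le] at this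
  refine ⟨h1, ?_⟩
  have h2 : ∫ t in Ioc 0 t₀, t ^ (a - 1) = a⁻¹ * t₀ ^ a := by
    rw [← intervalIntegral.integral_of_le ht₀.le, integral_rpow (Or.inl (by linarith))]
    rw [sub_add_cancel, Real.zero_rpow ha.ne']; ring
  rw [← h2, ofReal_integral_eq_lintegral_ofReal h1]
  · refine setLIntegral_congr_fun measurableSet_Ioc fun t ht => ?_
    exact Real.enorm_of_nonneg (Real.rpow_nonneg ht.1.le _)
  · filter_upwards [ae_restrict_mem measurableSet_Ioc] with t ht using Real.rpow_nonneg ht.1.le _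

theorem lintegral_high_rpow {a t₀ : ℝ} (ha : 0 < a) (ht₀ : 0 < t₀) :
    IntegrableOn (fun t : ℝ => t ^ (-a - 1)) (Ioi t₀) ∧
      ∫⁻ t in Ioi t₀, ‖t ^ (-a - 1)‖ₑ = ENNReal.ofReal (a⁻¹ * t₀ ^ (-a)) := by
  have h1 : IntegrableOn (fun t : ℝ => t ^ (-a - 1)) (Ioi t₀) :=
    integrableOn_Ioi_rpow_of_lt (by linarith) ht₀
  refine ⟨h1, ?_⟩
  have h2 : ∫ t in Ioi t₀, t ^ (-a - 1) = a⁻¹ * t₀ ^ (-a) := by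
    rw [integral_Ioi_rpow_of_lt (by linarith) ht₀, sub_add_cancel]
    field_simp
  rw [← h2, ofReal_integral_eq_lintegral_ofReal h1]
  · refine setLIntegral_congr_fun measurableSet_Ioi fun t ht => ?_
    exact Real.enorm_of_nonneg (Real.rpow_nonneg (ht₀.trans ht).le _)
  · filter_upwards [ae_restrict_mem measurableSet_Ioi] with t ht using
      Real.rpow_nonneg (ht₀.trans ht).le _

theorem contDiff_coord_pow (j : Fin 2) (n : ℕ) : ContDiff ℝ ∞ fun ξ : Plane => (ξ j) ^ n :=
  (EuclideanSpace.proj (𝕜 := ℝ) j : Plane →L[ℝ] ℝ).contDiff.pow _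

theorem contDiff_norm_sq_pow (l : ℕ) : ContDiff ℝ ∞ fun ξ : Plane => (‖ξ‖ ^ 2) ^ l :=
  (contDiff_norm_sq ℝ).pow _

/-- The symbol cut off to low frequencies by which `∂_j^(k % 2)` is weighted. -/
noncomputable def lowSym (k : ℕ) (s t₀ : ℝ) (j : Fin 2) (ξ : Plane) : ℂ :=
  ∫ t in Ioc 0 t₀, ((t ^ ((k - s) / 2 - 1) : ℝ) : ℂ) *
    bumpSchwartz _ (contDiff_coord_pow j (k % 2)) (√t • ξ)

/-- The remaining part of the symbol `|ξ|^s`. -/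
noncomputable def highSym (l : ℕ) (s t₀ : ℝ) (ξ : Plane) : ℂ :=
  ∫ t in Ioi t₀, ((t ^ (-s / 2 - 1) : ℝ) : ℂ) *
    bumpSchwartz _ (contDiff_norm_sq_pow l) (√t • ξ)

theorem ofReal_norm_rpow_eq_average {k : ℕ} {s t₀ : ℝ} (ht₀ : 0 < t₀) (hsk : s < k)
    {ξ : Plane} (hξ : ξ ≠ 0) :
    (((∫ u in Ioi (0 : ℝ), u ^ ((2 * ((k + 1) / 2 : ℕ) - s) / 2 - 1) * lineBump u) * ‖ξ‖ ^ s : ℝ)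
      : ℂ) = ((if k % 2 = 0 then 1 / 2 else 1 : ℝ) : ℂ) *
      ∑ j, lowSym k s t₀ j ξ * esym k j ξ + highSym ((k + 1) / 2) s t₀ ξ := by
  rw [norm_rpow_eq_low_add_high (k := k) ht₀ hsk hξ, highSym,
    integral_dilation_bump_high ht₀ ξ]
  simp only [lowSym, integral_dilation_bump_low _ ξ]
  set L : ℝ := ∫ t in Ioc 0 t₀, t ^ ((2 * ((k + 1) / 2 : ℕ) - s) / 2 - 1) * lineBump (t * ‖ξ‖ ^ 2)
  rw [mul_add, Complex.ofReal_add]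
  refine congrArg₂ (· + ·) ?_ rfl
  rw [Complex.ofReal_mul, Complex.ofReal_pow, sum_coord_pow_mul_esym k ξ, mul_assoc,
    Finset.sum_mul]
  refine congrArg₂ (· * ·) rfl (Finset.sum_congr rfl fun j _ => ?_)
  rw [Complex.ofReal_mul]
  ring

/-- The weight t^((k-s)/2-1) is integrable at 0 because s < k, and its mass on (0, t₀] is
proportional to t₀^((k-s)/2). -/
theorem exists_lowSym_bound {p q : ℝ≥0∞} [hpq : p.HolderConjugate q] {s : ℝ} {k : ℕ}
    (hsk : s < k) : ∃ A : ℝ≥0, ∀ t₀ : ℝ, 0 < t₀ → ∀ (j : Fin 2) (f ψ : 𝓢(Plane, ℂ)),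
      Integrable (fun ξ => lowSym k s t₀ j ξ * (𝓕 f ξ * 𝓕⁻ ψ ξ)) ∧
      ‖mform (lowSym k s t₀ j) f ψ‖ₑ ≤
        A * (ENNReal.ofReal (t₀ ^ ((k - s) / 2)) * eLpNorm f p) * eLpNorm ψ q := by
  have h0 : 0 < ((k : ℝ) - s) / 2 := by linarith
  have hL1 : ∀ K : 𝓢(Plane, ℂ), eLpNorm (𝓕⁻ K : 𝓢(Plane, ℂ)) 1 ≠ ⊤ := fun K =>
    ((𝓕⁻ K).memLp 1 volume).2.ne
  set b : Fin 2 → ℝ≥0∞ := fun j =>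
    eLpNorm (𝓕⁻ (bumpSchwartz _ (contDiff_coord_pow j (k % 2))) : 𝓢(Plane, ℂ)) 1
  have hD : ENNReal.ofReal (((k : ℝ) - s) / 2)⁻¹ * ∑ j, b j ≠ ⊤ :=
    ENNReal.mul_ne_top ENNReal.ofReal_ne_top (by rw [ENNReal.sum_ne_top]; exact fun j _ => hL1 _)
  refine ⟨(ENNReal.ofReal (((k : ℝ) - s) / 2)⁻¹ * ∑ j, b j).toNNReal, fun t₀ ht₀ j f ψ => ?_⟩
  rw [ENNReal.coe_toNNReal hD]
  obtain ⟨hi1, hv1⟩ := lintegral_low_rpow h0 ht₀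
  obtain ⟨h1, h2⟩ := enorm_mform_dilation_average_le (p := p) (q := q)
    (bumpSchwartz _ (contDiff_coord_pow j (k % 2))) hi1 f ψ
  refine ⟨h1, h2.trans ?_⟩
  rw [hv1, ENNReal.ofReal_mul (inv_nonneg.2 h0.le), mul_right_comm (ENNReal.ofReal _)
    (ENNReal.ofReal _), mul_assoc (ENNReal.ofReal _ * _) (ENNReal.ofReal _)]
  gcongr
  exact Finset.single_le_sum (f := b) (fun _ _ => zero_le) (Finset.mem_univ j)

/-- The weight t^(-s/2-1) is integrable at infinity because s > 0, and its mass on (t₀, ∞) is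
proportional to t₀^(-s/2). -/
theorem exists_highSym_bound {p q : ℝ≥0∞} [hpq : p.HolderConjugate q] {s : ℝ} (hs : 0 < s)
    (l : ℕ) : ∃ A : ℝ≥0, ∀ t₀ : ℝ, 0 < t₀ → ∀ (f ψ : 𝓢(Plane, ℂ)),
      Integrable (fun ξ => highSym l s t₀ ξ * (𝓕 f ξ * 𝓕⁻ ψ ξ)) ∧
      ‖mform (highSym l s t₀) f ψ‖ₑ ≤
        A * (ENNReal.ofReal (t₀ ^ (-s / 2)) * eLpNorm f p) * eLpNorm ψ q := by
  have h0 : 0 < s / 2 := by linarith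
  set b : ℝ≥0∞ := eLpNorm (𝓕⁻ (bumpSchwartz _ (contDiff_norm_sq_pow l)) : 𝓢(Plane, ℂ)) 1
  have hb : b ≠ ⊤ := ((𝓕⁻ (bumpSchwartz _ (contDiff_norm_sq_pow l))).memLp 1 volume).2.ne
  have hD : ENNReal.ofReal (s / 2)⁻¹ * b ≠ ⊤ := ENNReal.mul_ne_top ENNReal.ofReal_ne_top hb
  refine ⟨(ENNReal.ofReal (s / 2)⁻¹ * b).toNNReal, fun t₀ ht₀ f ψ => ?_⟩
  rw [ENNReal.coe_toNNReal hD]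
  obtain ⟨hi2, hv2⟩ := lintegral_high_rpow h0 ht₀
  rw [← neg_div] at hi2 hv2
  obtain ⟨h1, h2⟩ := enorm_mform_dilation_average_le (p := p) (q := q)
    (bumpSchwartz _ (contDiff_norm_sq_pow l)) hi2 f ψ
  refine ⟨h1, h2.trans ?_⟩
  rw [hv2, ENNReal.ofReal_mul (inv_nonneg.2 h0.le), mul_right_comm (ENNReal.ofReal _)
    (ENNReal.ofReal _), mul_assoc (ENNReal.ofReal _ * _) (ENNReal.ofReal _)]

/-- Interpolation: the fractional derivative is controlled by the function and by its
derivatives of a higher order. -/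
theorem exists_mform_norm_rpow_bound_of_lt {p q : ℝ≥0∞} [hpq : p.HolderConjugate q] {s : ℝ}
    (hs : 0 < s) {k : ℕ} (hsk : s < k) :
    ∃ A : ℝ≥0, ∀ t₀ : ℝ, 0 < t₀ → ∀ f ψ : 𝓢(Plane, ℂ),
      ‖mform (fun ξ => ((‖ξ‖ ^ s : ℝ) : ℂ)) f ψ‖ₑ ≤
        A * (ENNReal.ofReal (t₀ ^ (-s / 2)) * eLpNorm f p + ENNReal.ofReal (t₀ ^ ((k - s) / 2)) *
          ∑ j, eLpNorm (SchwartzMap.fourierMultiplierCLM ℂ (esym k j) f) p) * eLpNorm ψ q := by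
  have hb : 0 < 2 * (((k + 1) / 2 : ℕ) : ℝ) - s := by
    have h3 : k ≤ 2 * ((k + 1) / 2) := by omega
    have h4 : (k : ℝ) ≤ 2 * ((k + 1) / 2 : ℕ) := by exact_mod_cast h3
    linarith
  have hid := fun (t₀ : ℝ) (ht₀ : 0 < t₀) (ξ : Plane) (hξ : ξ ≠ 0) =>
    ofReal_norm_rpow_eq_average ht₀ hsk hξ
  have hc0 := integral_rpow_mul_lineBump_pos hb
  obtain ⟨A₁, hA₁⟩ := exists_lowSym_bound (p := p) (q := q) hsk
  obtain ⟨A₂, hA₂⟩ := exists_highSym_bound (p := p) (q := q) hs ((k + 1) / 2)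
  generalize (∫ u in Ioi (0 : ℝ), u ^ ((2 * ((k + 1) / 2 : ℕ) - s) / 2 - 1) * lineBump u) = c
    at hid hc0
  have hd1 : ‖((if k % 2 = 0 then 1 / 2 else 1 : ℝ) : ℂ)‖ₑ ≤ 1 := by
    rw [← ofReal_norm, Complex.norm_real, ← ENNReal.ofReal_one]
    refine ENNReal.ofReal_le_ofReal ?_
    split_ifs <;> norm_num
  generalize ((if k % 2 = 0 then 1 / 2 else 1 : ℝ) : ℂ) = d at hid hd1
  refine ⟨c⁻¹.toNNReal * (A₁ + A₂), fun t₀ ht₀ f ψ => ?_⟩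
  generalize hT : (fun j => SchwartzMap.fourierMultiplierCLM ℂ (esym k j) f) = T
  have hTj : ∀ j, SchwartzMap.fourierMultiplierCLM ℂ (esym k j) f = T j := fun j => by rw [← hT]
  have hTf : ∀ j ξ, 𝓕 (T j) ξ = esym k j ξ * 𝓕 f ξ := fun j ξ => by
    rw [← hTj, fourier_fourierMultiplierCLM (hasTemperateGrowth_esym k j)]
  simp only [hTj]
  have hlow := fun j => hA₁ t₀ ht₀ j (T j) ψ
  have hhigh := hA₂ t₀ ht₀ f ψ
  have hid' : ∀ᵐ ξ : Plane, ((‖ξ‖ ^ s : ℝ) : ℂ) * (𝓕 f ξ * 𝓕⁻ ψ ξ) =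
      (c⁻¹ : ℝ) * (d * ∑ j, lowSym k s t₀ j ξ * (𝓕 (T j) ξ * 𝓕⁻ ψ ξ) +
        highSym ((k + 1) / 2) s t₀ ξ * (𝓕 f ξ * 𝓕⁻ ψ ξ)) := by
    filter_upwards [compl_mem_ae_iff.2 (measure_singleton (0 : Plane))] with ξ hξ
    have h3 : ((‖ξ‖ ^ s : ℝ) : ℂ) = (c⁻¹ : ℝ) * ((c * ‖ξ‖ ^ s : ℝ) : ℂ) := by
      rw [← Complex.ofReal_mul, inv_mul_cancel_left₀ hc0.ne']
    rw [h3, hid t₀ ht₀ ξ hξ]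
    simp only [hTf, Fin.sum_univ_two]
    ring
  have heq : mform (fun ξ => ((‖ξ‖ ^ s : ℝ) : ℂ)) f ψ =
      (c⁻¹ : ℝ) * (d * ∑ j, mform (lowSym k s t₀ j) (T j) ψ +
        mform (highSym ((k + 1) / 2) s t₀) f ψ) := by
    rw [mform, integral_congr_ae hid', integral_const_mul, integral_add
      ((integrable_finsetSum _ fun j _ => (hlow j).1).const_mul _) hhigh.1, integral_const_mul,
      integral_finsetSum _ fun j _ => (hlow j).1]
    rfl
  have hcn : ‖((c⁻¹ : ℝ) : ℂ)‖ₑ = (c⁻¹.toNNReal : ℝ≥0∞) := by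
    rw [← ofReal_norm, Complex.norm_real, Real.norm_of_nonneg (inv_nonneg.2 hc0.le)]
    rfl
  have e1 : ‖d * ∑ j, mform (lowSym k s t₀ j) (T j) ψ‖ₑ ≤
      A₁ * (ENNReal.ofReal (t₀ ^ ((k - s) / 2)) * ∑ j, eLpNorm (T j) p) * eLpNorm ψ q := by
    rw [enorm_mul]
    refine (mul_le_mul' hd1 ((enorm_sum_le _ _).trans
      (Finset.sum_le_sum fun j _ => (hlow j).2))).trans (le_of_eq ?_)
    rw [one_mul, Finset.mul_sum, Finset.mul_sum, Finset.sum_mul]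
  rw [heq, enorm_mul, hcn]
  refine (mul_le_mul_right ((enorm_add_le _ _).trans (add_le_add e1 hhigh.2)) _).trans ?_
  generalize (ENNReal.ofReal (t₀ ^ ((k - s) / 2)) * ∑ j, eLpNorm (T j) p) = X
  generalize (ENNReal.ofReal (t₀ ^ (-s / 2)) * eLpNorm f p) = Y
  rw [← add_mul, ← mul_assoc]
  refine mul_le_mul_left ?_ _
  push_cast
  rw [mul_assoc]
  refine mul_le_mul_right ?_ _
  calc (A₁ : ℝ≥0∞) * X + A₂ * Y ≤ (A₁ + A₂) * X + (A₁ + A₂) * Y := by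
        gcongr
        · exact le_self_add
        · exact le_add_self
    _ = _ := by rw [← mul_add, add_comm X]

/-- At the endpoint s = k no averaging is available, but |ξ|^k is one of the symbols `esym` for even
k, and the sum of Riesz symbols times `esym` for odd k. This is where p > 1 enters. -/
theorem exists_mform_norm_rpow_bound {p q : ℝ≥0∞} [hpq : p.HolderConjugate q] (hp : p ≠ ⊤) {s : ℝ}
    (hs : 0 < s) {k : ℕ} (hsk : s < k ∨ s = k ∧ 1 < p) :
    ∃ A : ℝ≥0, ∀ t₀ : ℝ, 0 < t₀ → ∀ f ψ : 𝓢(Plane, ℂ),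
      ‖mform (fun ξ => ((‖ξ‖ ^ s : ℝ) : ℂ)) f ψ‖ₑ ≤
        A * (ENNReal.ofReal (t₀ ^ (-s / 2)) * eLpNorm f p + ENNReal.ofReal (t₀ ^ ((k - s) / 2)) *
          ∑ j, eLpNorm (SchwartzMap.fourierMultiplierCLM ℂ (esym k j) f) p) * eLpNorm ψ q := by
  rcases hsk with hsk | ⟨rfl, hp1⟩
  · exact exists_mform_norm_rpow_bound_of_lt hs hsk
  obtain ⟨A, hA⟩ := exists_riesz_bound (q := q) hp1 hp
  refine ⟨A + 1, fun t₀ _ f ψ => ?_⟩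
  generalize hT : (fun j => SchwartzMap.fourierMultiplierCLM ℂ (esym k j) f) = T
  have hTj : ∀ j, SchwartzMap.fourierMultiplierCLM ℂ (esym k j) f = T j := fun j => by rw [← hT]
  have hTf : ∀ j ξ, 𝓕 (T j) ξ = esym k j ξ * 𝓕 f ξ := fun j ξ => by
    rw [← hTj, fourier_fourierMultiplierCLM (hasTemperateGrowth_esym k j)]
  simp only [hTj]
  have key : ‖mform (fun ξ => ((‖ξ‖ ^ (k : ℝ) : ℝ) : ℂ)) f ψ‖ₑ ≤
      (A + 1) * (∑ j, eLpNorm (T j) p) * eLpNorm ψ q := by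
    rcases Nat.mod_two_eq_zero_or_one k with h | h
    · have h1 : mform (fun ξ => ((‖ξ‖ ^ (k : ℝ) : ℝ) : ℂ)) f ψ = mform (fun _ => 1) (T 0) ψ := by
        rw [mform, mform]
        congr 1; ext ξ
        rw [hTf, esym, h, pow_zero, one_mul, ← pow_mul, show 2 * (k / 2) = k by omega,
          Real.rpow_natCast]
        ring_nf
      rw [h1, mform_one]
      have h2 : ‖∫ x, T 0 x * ψ x‖ₑ ≤ eLpNorm (T 0) p * eLpNorm ψ q := enorm_integral_mul_le
        (T 0).continuous.aestronglyMeasurable ψ.continuous.aestronglyMeasurable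
      have h3 : eLpNorm (T 0) p ≤ ∑ j, eLpNorm (T j) p := by
        rw [Fin.sum_univ_two]; exact le_self_add
      have h4 : ∑ j, eLpNorm (T j) p ≤ ((A : ℝ≥0∞) + 1) * ∑ j, eLpNorm (T j) p :=
        le_mul_of_one_le_left' le_add_self
      exact h2.trans (mul_le_mul_left (h3.trans h4) _)
    · have h1 : mform (fun ξ => ((‖ξ‖ ^ (k : ℝ) : ℝ) : ℂ)) f ψ =
          ∑ j, mform (rieszSymbol j) (T j) ψ := by
        simp only [mform]
        rw [← integral_finsetSum]
        · congr 1; ext ξ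
          simp only [hTf, Fin.sum_univ_two, esym, h, rieszSymbol, pow_one]
          have hn : ‖ξ‖ ^ 2 = ξ 0 ^ 2 + ξ 1 ^ 2 := by
            rw [EuclideanSpace.real_norm_sq_eq, Fin.sum_univ_two]
          have h2 : ‖ξ‖ ^ (k : ℝ) = ξ 0 / ‖ξ‖ * (ξ 0 * (‖ξ‖ ^ 2) ^ (k / 2)) +
              ξ 1 / ‖ξ‖ * (ξ 1 * (‖ξ‖ ^ 2) ^ (k / 2)) := by
            have h3 : ξ 0 / ‖ξ‖ * (ξ 0 * (‖ξ‖ ^ 2) ^ (k / 2)) +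
              ξ 1 / ‖ξ‖ * (ξ 1 * (‖ξ‖ ^ 2) ^ (k / 2)) =
                (ξ 0 ^ 2 + ξ 1 ^ 2) / ‖ξ‖ * (‖ξ‖ ^ 2) ^ (k / 2) := by ring
            rw [h3, ← hn, Real.rpow_natCast]
            rcases eq_or_ne ‖ξ‖ 0 with h0 | h0
            · rw [h0, zero_pow (by omega)]; simp
            · rw [pow_two ‖ξ‖, mul_div_assoc, div_self h0, mul_one, ← pow_two, ← pow_mul,
                ← pow_succ']
              congr 1; omega
          rw [h2]
          push_cast
          ring
        · intro j _
          have h4 := integrable_fourier_mul_fourierInv (T j) ψ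
          exact h4.bdd_mul (c := 1) (measurable_rieszSymbol j).aestronglyMeasurable
            (Eventually.of_forall fun ξ => norm_rieszSymbol_le j ξ)
      rw [h1, Finset.mul_sum, Finset.sum_mul]
      refine (enorm_sum_le _ _).trans (Finset.sum_le_sum fun j _ => ?_)
      refine (hA j (T j) ψ).trans ?_
      gcongr
      exact le_self_add
  refine key.trans ?_
  rw [sub_self, zero_div, Real.rpow_zero, ENNReal.ofReal_one, one_mul]
  push_cast
  gcongr
  exact le_add_self

/-- The interpolation estimate for Schwartz functions. -/
theorem exists_eLpNorm_mfun_norm_rpow_le {p : ℝ≥0∞} (hp1 : 1 ≤ p) (hp : p ≠ ⊤) {s : ℝ}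
    (hs : 0 < s) {k : ℕ} (hsk : s < k ∨ s = k ∧ 1 < p) :
    ∃ A : ℝ≥0, ∀ t₀ : ℝ, 0 < t₀ → ∀ f : 𝓢(Plane, ℂ),
      eLpNorm (mfun (fun ξ => ((‖ξ‖ ^ s : ℝ) : ℂ)) f) p ≤
        A * (ENNReal.ofReal (t₀ ^ (-s / 2)) * eLpNorm f p + ENNReal.ofReal (t₀ ^ ((k - s) / 2)) *
          ∑ j, eLpNorm (SchwartzMap.fourierMultiplierCLM ℂ (esym k j) f) p) := by
  have hpq : p.HolderConjugate p.conjExponent := ENNReal.HolderConjugate.conjExponent hp1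
  obtain ⟨A, hA⟩ := exists_mform_norm_rpow_bound (q := p.conjExponent) hp hs hsk
  refine ⟨A, fun t₀ ht₀ f => eLpNorm_mfun_le (q := p.conjExponent) hp ?_ (hA t₀ ht₀ f)⟩
  have h1 := SchwartzMap.integrable_pow_mul (volume : Measure Plane) (𝓕 f) (⌈s⌉₊)
  have h2 := ((𝓕 f).integrable (μ := volume)).norm.add h1
  refine h2.mono' ?_ (Eventually.of_forall fun ξ => ?_)
  · exact ((Complex.continuous_ofReal.comp (continuous_norm.rpow_const fun _ => Or.inr hs.le)).mul
      (𝓕 f).continuous).aestronglyMeasurable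
  · rw [norm_mul, Complex.norm_real, Real.norm_of_nonneg (by positivity)]
    simp only [Pi.add_apply]
    have h3 : ‖ξ‖ ^ s ≤ 1 + ‖ξ‖ ^ ⌈s⌉₊ := by
      rcases le_total ‖ξ‖ 1 with h | h
      · have := Real.rpow_le_one (norm_nonneg ξ) h hs.le
        have := pow_nonneg (norm_nonneg ξ) ⌈s⌉₊
        linarith
      · have := Real.rpow_le_rpow_of_exponent_le h (Nat.le_ceil s)
        rw [Real.rpow_natCast] at this
        linarith
    nlinarith [norm_nonneg (𝓕 f ξ)]

/-! ### Cutoffs, and density of compactly supported Schwartz functions. -/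

/-- A radial cutoff function on the plane. -/
noncomputable def radialBump : 𝓢(Plane, ℂ) := bumpSchwartz (fun _ => 1) contDiff_const

theorem radialBump_apply (ξ : Plane) : radialBump ξ = (lineBump (‖ξ‖ ^ 2) : ℂ) := by
  simp [radialBump, bumpSchwartz_apply]

theorem radialBump_eq_one {ξ : Plane} (hξ : ‖ξ‖ ≤ 1) : radialBump ξ = 1 := by
  rw [radialBump_apply, lineBump_eq_one (by positivity) (by nlinarith [norm_nonneg ξ])]
  simp

theorem radialBump_eq_zero {ξ : Plane} (hξ : 2 ≤ ‖ξ‖) : radialBump ξ = 0 := by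
  rw [radialBump_apply, lineBump_eq_zero (by nlinarith)]
  simp

theorem norm_radialBump_le (ξ : Plane) : ‖radialBump ξ‖ ≤ 1 := by
  rw [radialBump_apply, Complex.norm_real, Real.norm_of_nonneg lineBump.nonneg]
  exact lineBump.le_one

theorem hasTemperateGrowth_radialBump_smul (a : ℝ) :
    (fun ξ : Plane => radialBump (a • ξ)).HasTemperateGrowth :=
  radialBump.hasTemperateGrowth.comp
    ((a • ContinuousLinearMap.id ℝ Plane : Plane →L[ℝ] Plane).hasTemperateGrowth)

/-- Multiplication by a dilated cutoff function. -/
noncomputable def cut (a : ℝ) (φ : 𝓢(Plane, ℂ)) : 𝓢(Plane, ℂ) :=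
  SchwartzMap.smulLeftCLM ℂ (fun ξ : Plane => radialBump (a • ξ)) φ

theorem cut_apply (a : ℝ) (φ : 𝓢(Plane, ℂ)) (ξ : Plane) :
    cut a φ ξ = radialBump (a • ξ) * φ ξ := by
  rw [cut, SchwartzMap.smulLeftCLM_apply_apply (hasTemperateGrowth_radialBump_smul a), smul_eq_mul]

theorem hasCompactSupport_cut {a : ℝ} (ha : a ≠ 0) (φ : 𝓢(Plane, ℂ)) :
    HasCompactSupport (cut a φ) := by
  refine HasCompactSupport.intro (isCompact_closedBall (0 : Plane) (2 / |a|)) fun ξ hξ => ?_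
  rw [cut_apply, radialBump_eq_zero, zero_mul]
  have h1 : 2 / |a| < ‖ξ‖ := by simpa using hξ
  rw [div_lt_iff₀ (abs_pos.2 ha)] at h1
  rw [norm_smul, Real.norm_eq_abs, mul_comm]
  exact h1.le

/-- Compactly supported functions are dense in the Schwartz space. -/
theorem tendsto_cut (φ : 𝓢(Plane, ℂ)) :
    Tendsto (fun n : ℕ => cut (1 / ((n : ℝ) + 1)) φ) atTop (𝓝 φ) := by
  rw [(schwartz_withSeminorms ℝ Plane ℂ).tendsto_nhds]
  rintro ⟨k, n⟩ δ hδ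
  choose C hC0 hC using fun i => radialBump.decay 0 i
  set M : ℝ := ∑ i ∈ Finset.range (n + 1), (n.choose i : ℝ) * (1 + C i) *
    SchwartzMap.seminorm ℝ (k + 1) (n - i) φ with hM
  have hM0 : 0 ≤ M := Finset.sum_nonneg fun i _ => by
    have := (hC0 i).le
    have := apply_nonneg (SchwartzMap.seminorm ℝ (k + 1) (n - i)) φ
    positivity
  have hbound : ∀ a : ℝ, 0 < a → a ≤ 1 → SchwartzMap.seminorm ℝ k n (cut a φ - φ) ≤ a * M := by
    intro a ha0 ha1
    refine SchwartzMap.seminorm_le_bound ℝ k n _ (by positivity) fun x => ?_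
    set b : Plane → ℂ := fun ξ => radialBump (a • ξ) - 1 with hb
    have hfun : ((cut a φ - φ : 𝓢(Plane, ℂ)) : Plane → ℂ) = fun ξ => b ξ * φ ξ := by
      ext ξ
      rw [sub_apply, cut_apply]
      simp only [hb]; ring
    have hsm : ContDiff ℝ ∞ fun ξ : Plane => radialBump (a • ξ) :=
      (radialBump.smooth ⊤).comp (contDiff_id.const_smul a)
    have hbs : ContDiff ℝ ∞ b := hsm.sub contDiff_const
    rw [hfun]
    -- The factor b vanishes near x if ‖a x‖ < 1. Otherwise 1 ≤ a ‖x‖, so one more power of ‖x‖ in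
    -- the seminorm buys a factor a.
    rcases lt_or_ge ‖a • x‖ 1 with h | h
    · have h0 : (fun ξ => b ξ * φ ξ) =ᶠ[𝓝 x] fun _ => 0 := by
        have h1 : ∀ᶠ ξ in 𝓝 x, ‖a • ξ‖ < 1 :=
          (continuous_const_smul a).norm.continuousAt.eventually_lt continuousAt_const h
        filter_upwards [h1] with ξ hξ
        simp only [hb]
        rw [radialBump_eq_one hξ.le, sub_self, zero_mul]
      rw [(h0.iteratedFDeriv ℝ n).eq_of_nhds]
      simp
      positivity
    · have hbi : ∀ i, ‖iteratedFDeriv ℝ i b x‖ ≤ 1 + C i := by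
        intro i
        have h1 : iteratedFDeriv ℝ i b x = iteratedFDeriv ℝ i (fun ξ : Plane => radialBump (a • ξ)) x
            - iteratedFDeriv ℝ i (fun _ => (1 : ℂ)) x :=
          iteratedFDeriv_sub_apply (hsm.of_le (by exact_mod_cast le_top)).contDiffAt
            contDiff_const.contDiffAt
        have h2 : ‖iteratedFDeriv ℝ i (fun ξ : Plane => radialBump (a • ξ)) x‖ ≤ C i := by
          rw [iteratedFDeriv_comp_const_smul a (radialBump.smooth i), norm_smul, norm_pow,
            Real.norm_of_nonneg ha0.le]
          have h3 := hC i (a • x)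
          rw [pow_zero, one_mul] at h3
          exact (mul_le_of_le_one_left (norm_nonneg _) (pow_le_one₀ ha0.le ha1)).trans h3
        have h4 : ‖iteratedFDeriv ℝ i (fun _ : Plane => (1 : ℂ)) x‖ ≤ 1 := by
          rcases Nat.eq_zero_or_pos i with rfl | hi
          · simp
          · rw [iteratedFDeriv_const_of_ne hi.ne']; simp
        rw [h1, add_comm]
        exact (norm_sub_le _ _).trans (add_le_add h2 h4)
      have h5 := norm_iteratedFDeriv_mul_le hbs (φ.smooth ⊤) x (n := n) (by exact_mod_cast le_top)
      have hx : ‖x‖ ^ k ≤ a * ‖x‖ ^ (k + 1) := by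
        rw [norm_smul, Real.norm_of_nonneg ha0.le] at h
        calc ‖x‖ ^ k = 1 * ‖x‖ ^ k := (one_mul _).symm
          _ ≤ (a * ‖x‖) * ‖x‖ ^ k := by gcongr
          _ = _ := by ring
      refine (mul_le_mul hx h5 (norm_nonneg _) (by positivity)).trans ?_
      rw [mul_assoc]
      refine mul_le_mul_of_nonneg_left ?_ ha0.le
      rw [Finset.mul_sum]
      refine Finset.sum_le_sum fun i _ => ?_
      have h6 := SchwartzMap.le_seminorm ℝ (k + 1) (n - i) φ x
      have h7 := hbi i
      have h8 : 0 ≤ 1 + C i := by linarith [hC0 i]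
      calc ‖x‖ ^ (k + 1) * ((n.choose i : ℝ) * ‖iteratedFDeriv ℝ i b x‖ *
            ‖iteratedFDeriv ℝ (n - i) φ x‖)
          = (n.choose i : ℝ) * ‖iteratedFDeriv ℝ i b x‖ *
            (‖x‖ ^ (k + 1) * ‖iteratedFDeriv ℝ (n - i) φ x‖) := by ring
        _ ≤ _ := by gcongr
  have hlim : Tendsto (fun n : ℕ => 1 / ((n : ℝ) + 1) * M) atTop (𝓝 0) := by
    simpa using tendsto_one_div_add_atTop_nhds_zero_nat.mul_const M
  filter_upwards [hlim.eventually_lt_const hδ] with N hN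
  refine (hbound _ (by positivity) ?_).trans_lt hN
  rw [div_le_one (by positivity)]
  linarith [(Nat.cast_nonneg N : (0 : ℝ) ≤ N)]

/-- Tempered distributions that agree on compactly supported functions are equal. -/
theorem apply_eq_of_forall_hasCompactSupport {T U : 𝓢'(Plane, ℂ)}
    (h : ∀ φ : 𝓢(Plane, ℂ), HasCompactSupport φ → T φ = U φ) (φ : 𝓢(Plane, ℂ)) : T φ = U φ := by
  refine tendsto_nhds_unique ((T.continuous.tendsto φ).comp (tendsto_cut φ)) ?_
  exact Tendsto.congr (fun n => (h _ (hasCompactSupport_cut (by positivity) φ)).symm)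
    ((U.continuous.tendsto φ).comp (tendsto_cut φ))

/-- A tempered distribution represented by a function in `L^p` is given by integration. -/
theorem Represents.apply_of_memLp {T : 𝓢'(Plane, ℂ)} {g : Plane → ℂ} (h : Represents T g)
    {p : ℝ≥0∞} (hp : 1 ≤ p) (hg : MemLp g p) (φ : 𝓢(Plane, ℂ)) : T φ = ∫ x, φ x * g x := by
  have : Fact (1 ≤ p) := ⟨hp⟩
  have h1 : ∀ ψ : 𝓢(Plane, ℂ),
      MeasureTheory.Lp.toTemperedDistribution (hg.toLp g) ψ = ∫ x, ψ x * g x := by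
    intro ψ
    rw [Lp.toTemperedDistribution_apply]
    refine integral_congr_ae ?_
    filter_upwards [hg.coeFn_toLp] with x hx
    rw [hx, smul_eq_mul]
  rw [← h1]
  exact apply_eq_of_forall_hasCompactSupport (fun ψ hψ => by rw [h1, h.2 ψ hψ]) φ

/-! ### Homogeneous differential operators and their symbols. -/

/-- Each step of length two prepends a pair of equal indices, which multiplies the symbol by ∑ ξ_i²
= |ξ|²; in terms of operators this is a Laplacian. -/
theorem exists_weight (k : ℕ) (j : Fin 2) : ∃ c : (Fin k → Fin 2) → ℝ, ∀ ξ : Plane,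
    ∑ α, c α * ∏ i, ξ (α i) = (ξ j) ^ (k % 2) * (‖ξ‖ ^ 2) ^ (k / 2) := by
  induction k using Nat.twoStepInduction with
  | zero => exact ⟨fun _ => 1, fun ξ => by simp⟩
  | one =>
    refine ⟨fun α => if α 0 = j then 1 else 0, fun ξ => ?_⟩
    rw [Fintype.sum_equiv (Equiv.funUnique (Fin 1) (Fin 2)) _
      (fun i => (if i = j then (1 : ℝ) else 0) * ξ i)]
    · simp
    · intro α
      simp [Equiv.funUnique]
  | more k ih _ =>
    obtain ⟨c, hc⟩ := ih
    refine ⟨fun α => if α 0 = α 1 then c (Fin.tail (Fin.tail α)) else 0, fun ξ => ?_⟩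
    have hn : ‖ξ‖ ^ 2 = ∑ i, ξ i ^ 2 := EuclideanSpace.real_norm_sq_eq ξ
    have hk : (k + 2) % 2 = k % 2 ∧ (k + 2) / 2 = k / 2 + 1 := by omega
    rw [hk.1, hk.2, pow_succ, ← mul_assoc, ← hc, hn, Finset.sum_mul_sum]
    rw [← (Fin.consEquiv fun _ : Fin (k + 2) => Fin 2).sum_comp, Fintype.sum_prod_type_right]
    rw [← (Fin.consEquiv fun _ : Fin (k + 1) => Fin 2).sum_comp, Fintype.sum_prod_type_right]
    refine Finset.sum_congr rfl fun α _ => Finset.sum_congr rfl fun b _ => ?_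
    have ht : ∀ a, Fin.tail (Fin.tail ((Fin.consEquiv fun _ : Fin (k + 2) => Fin 2)
      (a, (Fin.consEquiv fun _ : Fin (k + 1) => Fin 2) (b, α)))) = α := fun a => rfl
    simp only [ht]
    simp only [Fin.consEquiv_apply, Fin.cons_zero, Fin.cons_one, Fin.prod_univ_succ]
    rw [Finset.sum_eq_single b]
    · simp
      ring
    · intro a _ hab
      simp [hab]
    · simp

/-- Coefficients of the homogeneous differential operators of order `k` with the symbols
`esym k j`. -/
noncomputable def weight (k : ℕ) (j : Fin 2) : (Fin k → Fin 2) → ℝ := (exists_weight k j).choose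

theorem sum_weight (k : ℕ) (j : Fin 2) (ξ : Plane) :
    ((∑ α, weight k j α * ∏ i, ξ (α i) : ℝ) : ℂ) = esym k j ξ := by
  rw [weight, (exists_weight k j).choose_spec ξ, esym]

/-- The differential operator of order `k` with coefficients `c`. -/
noncomputable def wop (k : ℕ) (c : (Fin k → Fin 2) → ℝ) (φ : Plane → ℝ) (x : Plane) : ℝ :=
  ∑ α, c α * partialDeriv k α φ x

/-- The function `G` is the weak derivative of `f` by a homogeneous operator of order `k`. -/
def HasWeak (k : ℕ) (c : (Fin k → Fin 2) → ℝ) (f G : Plane → ℝ) : Prop :=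
  ∀ φ : Plane → ℝ, IsTest φ → ∫ x, f x * wop k c φ x = (-1) ^ k * ∫ x, G x * φ x

/-- The differential operator of order `k` with coefficients `c` on Schwartz functions. -/
noncomputable def wopS (k : ℕ) (c : (Fin k → Fin 2) → ℝ) (ψ : 𝓢(Plane, ℂ)) : 𝓢(Plane, ℂ) :=
  ∑ α, (c α : ℂ) • LineDeriv.iteratedLineDerivOp
    (fun i => (EuclideanSpace.single (α i) 1 : Plane)) ψ

/-- A real test function as a complex Schwartz function. -/
noncomputable def IsTest.toSchwartz {φ : Plane → ℝ} (h : IsTest φ) : 𝓢(Plane, ℂ) :=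
  HasCompactSupport.toSchwartzMap (f := fun x => (φ x : ℂ))
    (h.2.comp_left (g := Complex.ofReal) Complex.ofReal_zero) (Complex.ofRealCLM.contDiff.comp h.1)

theorem IsTest.toSchwartz_apply {φ : Plane → ℝ} (h : IsTest φ) (x : Plane) :
    h.toSchwartz x = (φ x : ℂ) := rfl

theorem partialDeriv_eq {k : ℕ} (α : Fin k → Fin 2) {φ : Plane → ℝ} (h : IsTest φ) (x : Plane) :
    (partialDeriv k α φ x : ℂ) = LineDeriv.iteratedLineDerivOp
      (fun i => (EuclideanSpace.single (α i) 1 : Plane)) h.toSchwartz x := by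
  rw [SchwartzMap.iteratedLineDerivOp_eq_iteratedFDeriv, partialDeriv]
  have h1 : (h.toSchwartz : Plane → ℂ) = Complex.ofRealCLM ∘ φ := rfl
  rw [h1, ContinuousLinearMap.iteratedFDeriv_comp_left _ h.1.contDiffAt
    (by exact_mod_cast le_top)]
  rfl

theorem wop_eq {k : ℕ} (c : (Fin k → Fin 2) → ℝ) {φ : Plane → ℝ} (h : IsTest φ) (x : Plane) :
    (wop k c φ x : ℂ) = wopS k c h.toSchwartz x := by
  rw [wop, wopS, Complex.ofReal_sum, sum_apply]
  refine Finset.sum_congr rfl fun α _ => ?_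
  rw [Complex.ofReal_mul, partialDeriv_eq α h, smul_apply, smul_eq_mul]

theorem hasCompactSupport_partialDeriv {k : ℕ} (α : Fin k → Fin 2) {φ : Plane → ℝ}
    (h : IsTest φ) : HasCompactSupport (partialDeriv k α φ) := by
  have h1 := h.2.iteratedFDeriv (𝕜 := ℝ) (n := k)
  exact h1.comp_left (g := fun L : ContinuousMultilinearMap ℝ (fun _ : Fin k => Plane) ℝ =>
    L fun i => EuclideanSpace.single (α i) 1) (by simp)

theorem contDiff_partialDeriv {k : ℕ} (α : Fin k → Fin 2) {φ : Plane → ℝ}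
    (h : ContDiff ℝ ∞ φ) : ContDiff ℝ ∞ (partialDeriv k α φ) := by
  have h1 : ContDiff ℝ ∞ (iteratedFDeriv ℝ k φ) :=
    h.iteratedFDeriv_right (by exact_mod_cast le_top)
  exact (ContinuousMultilinearMap.apply ℝ (fun _ : Fin k => Plane) ℝ
    (fun i => EuclideanSpace.single (α i) 1)).contDiff.comp h1

theorem isTest_wop {k : ℕ} (c : (Fin k → Fin 2) → ℝ) {φ : Plane → ℝ} (h : IsTest φ) :
    IsTest (wop k c φ) := by
  constructor
  · exact ContDiff.sum fun α _ => contDiff_const.mul (contDiff_partialDeriv α h.1)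
  · have h1 : wop k c φ = ∑ α, fun x => c α * partialDeriv k α φ x := by
      ext x; rw [wop, Finset.sum_apply]
    rw [h1]
    refine Finset.sum_induction _ HasCompactSupport (fun a b ha hb => ha.add hb)
      HasCompactSupport.zero fun α _ => (hasCompactSupport_partialDeriv α h).mul_left

theorem fourier_iteratedLineDerivOp {k : ℕ} (α : Fin k → Fin 2) (ψ : 𝓢(Plane, ℂ)) (ξ : Plane) :
    𝓕 (LineDeriv.iteratedLineDerivOp
      (fun i => (EuclideanSpace.single (α i) 1 : Plane)) ψ) ξ =
      (2 * Real.pi * Complex.I) ^ k * ((∏ i, ξ (α i) : ℝ) : ℂ) * 𝓕 ψ ξ := by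
  induction k with
  | zero => simp
  | succ k ih =>
    rw [LineDeriv.iteratedLineDerivOp_succ_left, SchwartzMap.fourier_lineDerivOp_eq, smul_apply,
      SchwartzMap.smulLeftCLM_apply_apply (by fun_prop)]
    have := ih (Fin.tail α)
    simp only [Fin.tail] at this
    rw [show (Fin.tail fun i : Fin (k + 1) => (EuclideanSpace.single (α i) 1 : Plane)) =
      fun i => EuclideanSpace.single (α i.succ) 1 from rfl, this, Fin.prod_univ_succ]
    have h1 : inner ℝ ξ (EuclideanSpace.single (α 0) (1 : ℝ)) = ξ (α 0) := by
      rw [real_inner_comm, EuclideanSpace.inner_single_left]; simp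
    rw [h1, Complex.real_smul, smul_eq_mul]
    push_cast
    ring

theorem fourierInv_iteratedLineDerivOp {k : ℕ} (α : Fin k → Fin 2) (ψ : 𝓢(Plane, ℂ)) (ξ : Plane) :
    𝓕⁻ (LineDeriv.iteratedLineDerivOp
      (fun i => (EuclideanSpace.single (α i) 1 : Plane)) ψ) ξ =
      (-(2 * Real.pi * Complex.I)) ^ k * ((∏ i, ξ (α i) : ℝ) : ℂ) * 𝓕⁻ ψ ξ := by
  have h := fourier_iteratedLineDerivOp α ψ (-ξ)
  have h1 : ∀ g : 𝓢(Plane, ℂ), 𝓕 g (-ξ) = 𝓕⁻ g ξ := fun g => by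
    rw [SchwartzMap.fourier_coe, SchwartzMap.fourierInv_coe, Real.fourierInv_eq_fourier_neg]
  rw [h1, h1] at h
  rw [h, neg_pow, Complex.ofReal_prod, Complex.ofReal_prod]
  simp only [PiLp.neg_apply, Complex.ofReal_neg]
  rw [Finset.prod_neg, Finset.card_univ, Fintype.card_fin]
  ring

theorem fourier_wopS (k : ℕ) (j : Fin 2) (ψ : 𝓢(Plane, ℂ)) (ξ : Plane) :
    𝓕 (wopS k (weight k j) ψ) ξ = (2 * Real.pi * Complex.I) ^ k * esym k j ξ * 𝓕 ψ ξ := by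
  rw [wopS, FourierTransform.fourier_sum, sum_apply, ← sum_weight, Complex.ofReal_sum,
    Finset.mul_sum, Finset.sum_mul]
  refine Finset.sum_congr rfl fun α _ => ?_
  rw [FourierTransform.fourier_smul, smul_apply, fourier_iteratedLineDerivOp, smul_eq_mul,
    Complex.ofReal_mul]
  ring

theorem fourierInv_wopS (k : ℕ) (j : Fin 2) (ψ : 𝓢(Plane, ℂ)) (ξ : Plane) :
    𝓕⁻ (wopS k (weight k j) ψ) ξ = (-(2 * Real.pi * Complex.I)) ^ k * esym k j ξ * 𝓕⁻ ψ ξ := by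
  rw [wopS, FourierTransform.fourierInv_sum, sum_apply, ← sum_weight, Complex.ofReal_sum,
    Finset.mul_sum, Finset.sum_mul]
  refine Finset.sum_congr rfl fun α _ => ?_
  rw [FourierTransform.fourierInv_smul, smul_apply, fourierInv_iteratedLineDerivOp, smul_eq_mul,
    Complex.ofReal_mul]
  ring

/-- The multiplier operator with symbol `esym k j` is a differential operator. -/
theorem wopS_eq (k : ℕ) (j : Fin 2) (ψ : 𝓢(Plane, ℂ)) : wopS k (weight k j) ψ =
    (2 * Real.pi * Complex.I) ^ k • SchwartzMap.fourierMultiplierCLM ℂ (esym k j) ψ := by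
  have h : wopS k (weight k j) ψ = 𝓕⁻ (𝓕 (wopS k (weight k j) ψ) : 𝓢(Plane, ℂ)) :=
    (FourierTransform.fourierInv_fourier_eq _).symm
  rw [h, SchwartzMap.fourierMultiplierCLM_apply, ← FourierTransform.fourierInv_smul]
  congr 1
  ext ξ
  rw [fourier_wopS, smul_apply, SchwartzMap.smulLeftCLM_apply_apply (hasTemperateGrowth_esym k j),
    smul_eq_mul, smul_eq_mul, mul_assoc]

/-! ### Extension of bounded multipliers to L^p. -/

theorem exists_schwartz_eLpNorm_sub_le {p : ℝ≥0∞} (hp1 : 1 ≤ p) (hp : p ≠ ⊤) {g : Plane → ℂ}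
    (hg : MemLp g p) {ε : ℝ} (hε : 0 < ε) :
    ∃ φ : 𝓢(Plane, ℂ), eLpNorm (g - ⇑φ) p ≤ ENNReal.ofReal ε := by
  obtain ⟨φ, h1, h2, h3⟩ := hg.exist_eLpNorm_sub_le hp hp1 hε
  exact ⟨h1.toSchwartzMap h2, h3⟩

theorem exists_schwartz_seq_eLpNorm_sub_le {p : ℝ≥0∞} (hp1 : 1 ≤ p) (hp : p ≠ ⊤)
    {g : Plane → ℂ} (hg : MemLp g p) :
    ∃ (φ : ℕ → 𝓢(Plane, ℂ)) (δ : ℕ → ℝ≥0∞),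
      (∀ n, eLpNorm (g - ⇑(φ n)) p ≤ δ n) ∧ Tendsto δ atTop (𝓝 0) := by
  choose φ hφ using fun n : ℕ => exists_schwartz_eLpNorm_sub_le hp1 hp hg
    (ε := 1 / ((n : ℝ) + 1)) (by positivity)
  refine ⟨φ, _, hφ, ?_⟩
  have := ENNReal.tendsto_ofReal (tendsto_one_div_add_atTop_nhds_zero_nat (𝕜 := ℝ))
  rwa [ENNReal.ofReal_zero] at this

theorem exists_limit_eLpNorm {p : ℝ≥0∞} (hp1 : 1 ≤ p) {u : ℕ → Plane → ℂ}
    (hu : ∀ n, MemLp (u n) p) {b : ℕ → ℝ≥0∞} (hb : Tendsto b atTop (𝓝 0))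
    (h : ∀ n m, eLpNorm (u n - u m) p ≤ b n + b m) :
    ∃ G : Plane → ℂ, MemLp G p ∧ Tendsto (fun n => eLpNorm (u n - G) p) atTop (𝓝 0) := by
  have : Fact (1 ≤ p) := ⟨hp1⟩
  have hc : CauchySeq fun n => (hu n).toLp (u n) := by
    rw [EMetric.cauchySeq_iff]
    intro ε hε
    have h2 : (0 : ℝ≥0∞) < ε / 2 := ENNReal.half_pos hε.ne'
    obtain ⟨N, hN⟩ := (hb.eventually_lt_const h2).exists_forall_of_atTop
    refine ⟨N, fun m hm n hn => ?_⟩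
    rw [Lp.edist_toLp_toLp]
    refine (h m n).trans_lt ?_
    calc b m + b n < ε / 2 + ε / 2 := ENNReal.add_lt_add (hN m hm) (hN n hn)
      _ = ε := ENNReal.add_halves ε
  obtain ⟨G, hG⟩ := cauchySeq_tendsto_of_complete hc
  refine ⟨G, Lp.memLp G, ?_⟩
  rw [Lp.tendsto_Lp_iff_tendsto_eLpNorm'] at hG
  refine hG.congr fun n => eLpNorm_congr_ae ?_
  filter_upwards [(hu n).coeFn_toLp] with x hx
  simp [hx]

theorem tendsto_integral_mul_of_eLpNorm {p q : ℝ≥0∞} [hpq : p.HolderConjugate q]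
    {u : ℕ → Plane → ℂ} {G θ : Plane → ℂ} (hu : ∀ n, MemLp (u n) p) (hG : MemLp G p)
    (hθ : MemLp θ q) (h : Tendsto (fun n => eLpNorm (u n - G) p) atTop (𝓝 0)) :
    Tendsto (fun n => ∫ x, u n x * θ x) atTop (𝓝 (∫ x, G x * θ x)) := by
  rw [tendsto_iff_edist_tendsto_0]
  have hz : Tendsto (fun n => eLpNorm (u n - G) p * eLpNorm θ q) atTop (𝓝 0) := by
    simpa using ENNReal.Tendsto.mul_const h (Or.inr hθ.2.ne)
  refine tendsto_of_tendsto_of_tendsto_of_le_of_le tendsto_const_nhds hz (fun _ => zero_le)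
    fun n => ?_
  have hi : ∀ v : Plane → ℂ, MemLp v p → Integrable fun x => v x * θ x := fun v hv =>
    hv.integrable_mul hθ
  rw [edist_eq_enorm_sub, ← integral_sub (hi _ (hu n)) (hi _ hG)]
  refine le_trans (le_of_eq ?_) (enorm_integral_mul_le (p := p) (q := q)
    ((hu n).1.sub hG.1) hθ.1)
  congr 2
  ext x
  simp [sub_mul]

theorem integrable_mform {m : Plane → ℂ} (hm : AEStronglyMeasurable m) (hm1 : ∀ ξ, ‖m ξ‖ ≤ 1)
    (f ψ : 𝓢(Plane, ℂ)) : Integrable fun ξ => m ξ * (𝓕 f ξ * 𝓕⁻ ψ ξ) :=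
  (integrable_fourier_mul_fourierInv f ψ).bdd_mul hm (Eventually.of_forall hm1)

theorem mform_sub_left {m : Plane → ℂ} (hm : AEStronglyMeasurable m) (hm1 : ∀ ξ, ‖m ξ‖ ≤ 1)
    (f g ψ : 𝓢(Plane, ℂ)) : mform m (f - g) ψ = mform m f ψ - mform m g ψ := by
  rw [mform, mform, mform, ← integral_sub (integrable_mform hm hm1 f ψ)
    (integrable_mform hm hm1 g ψ)]
  congr 1; ext ξ
  have h1 : 𝓕 (f - g) = 𝓕 f - 𝓕 g := map_sub (FourierTransform.fourierCLM ℂ 𝓢(Plane, ℂ)) f g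
  rw [h1, sub_apply]; ring

theorem eLpNorm_le_add_eLpNorm_sub {p : ℝ≥0∞} (hp1 : 1 ≤ p) {u G : Plane → ℂ}
    (hu : AEStronglyMeasurable u) (hG : AEStronglyMeasurable G) :
    eLpNorm G p ≤ eLpNorm u p + eLpNorm (u - G) p := by
  have h := eLpNorm_sub_le (f := u) (g := u - G) (μ := volume) hu (hu.sub hG) hp1
  rwa [sub_sub_cancel] at h

theorem eLpNorm_le_of_tendsto {p : ℝ≥0∞} (hp1 : 1 ≤ p) {u : ℕ → Plane → ℂ} {G : Plane → ℂ}
    (hu : ∀ n, AEStronglyMeasurable (u n)) (hG : AEStronglyMeasurable G)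
    (h : Tendsto (fun n => eLpNorm (u n - G) p) atTop (𝓝 0)) {a : ℝ≥0∞} {b : ℕ → ℝ≥0∞}
    (hb : ∀ n, eLpNorm (u n) p ≤ a + b n) (hb0 : Tendsto b atTop (𝓝 0)) :
    eLpNorm G p ≤ a := by
  have h2 : Tendsto (fun n => a + b n + eLpNorm (u n - G) p) atTop (𝓝 a) := by
    simpa using (hb0.const_add a).add h
  exact ge_of_tendsto' h2 fun n =>
    (eLpNorm_le_add_eLpNorm_sub hp1 (hu n) hG).trans (add_le_add (hb n) le_rfl)

/-- The extension of a bounded multiplier to `L^p`. -/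
theorem exists_multiplier_image {p q : ℝ≥0∞} [hpq : p.HolderConjugate q] (hp1 : 1 ≤ p)
    (hp : p ≠ ⊤) {m : Plane → ℂ} (hm : AEStronglyMeasurable m) (hm1 : ∀ ξ, ‖m ξ‖ ≤ 1) {A : ℝ≥0}
    (hA : ∀ f ψ : 𝓢(Plane, ℂ), ‖mform m f ψ‖ₑ ≤ A * eLpNorm f p * eLpNorm ψ q)
    {g : Plane → ℂ} (hg : MemLp g p) :
    ∃ G : Plane → ℂ, MemLp G p ∧ eLpNorm G p ≤ A * eLpNorm g p ∧
      ∀ η η' : 𝓢(Plane, ℂ), (∀ ξ, η' ξ = m ξ * η ξ) →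
        ∫ x, G x * 𝓕 η x = ∫ x, g x * 𝓕 η' x := by
  obtain ⟨φ, δ, hφ, hδ0⟩ := exists_schwartz_seq_eLpNorm_sub_le hp1 hp hg
  have hφm : ∀ n, MemLp (φ n) p := fun n => (φ n).memLp p volume
  have hmi : ∀ f : 𝓢(Plane, ℂ), Integrable fun ξ => m ξ * 𝓕 f ξ := fun f =>
    integrable_mul_schwartz_of_bound hm hm1 _
  have hmc : ∀ f : 𝓢(Plane, ℂ), Continuous (mfun m f) := fun f =>
    continuous_fourierInv_of_integrable (hmi f)
  have hmle : ∀ f : 𝓢(Plane, ℂ), eLpNorm (mfun m f) p ≤ A * eLpNorm f p := fun f =>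
    eLpNorm_mfun_le (q := q) hp (hmi f) (hA f)
  have hmem : ∀ f : 𝓢(Plane, ℂ), MemLp (mfun m f) p := fun f =>
    ⟨(hmc f).aestronglyMeasurable, (hmle f).trans_lt
      (ENNReal.mul_lt_top ENNReal.coe_lt_top (f.memLp p volume).2)⟩
  -- Linearity is used inside the form, so the Cauchy property of the images follows from the same
  -- bound `hA` applied to differences.
  have hsub : ∀ f f' : 𝓢(Plane, ℂ), eLpNorm (mfun m f - mfun m f') p ≤
      A * eLpNorm (f - f' : 𝓢(Plane, ℂ)) p := by
    intro f f'
    refine eLpNorm_le_of_forall_schwartz (q := q) hp ((hmc f).sub (hmc f')) fun ψ => ?_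
    have hi : ∀ f : 𝓢(Plane, ℂ), Integrable fun x => mfun m f x * ψ x := fun f =>
      (hmem f).integrable_mul (q := q) (ψ.memLp q volume)
    have h1 : ∫ x, (mfun m f - mfun m f') x * ψ x = mform m (f - f') ψ := by
      rw [mform_sub_left hm hm1, ← integral_mfun_mul (hmi f), ← integral_mfun_mul (hmi f'),
        ← integral_sub (hi f) (hi f')]
      congr 1; ext x
      simp [sub_mul]
    rw [h1]
    exact hA _ _
  have hcau : ∀ n k, eLpNorm (mfun m (φ n) - mfun m (φ k)) p ≤ A * δ n + A * δ k := by
    intro n k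
    refine (hsub _ _).trans ?_
    rw [← mul_add]
    refine mul_le_mul_right ?_ _
    have h1 : ((φ n - φ k : 𝓢(Plane, ℂ)) : Plane → ℂ) = (g - ⇑(φ k)) - (g - ⇑(φ n)) := by
      ext x; simp
    rw [h1]
    refine (eLpNorm_sub_le (hg.1.sub (hφm k).1) (hg.1.sub (hφm n).1) hp1).trans ?_
    rw [add_comm]
    exact add_le_add (hφ n) (hφ k)
  have hAδ : Tendsto (fun n => A * δ n) atTop (𝓝 0) := by
    simpa using ENNReal.Tendsto.const_mul hδ0 (Or.inr ENNReal.coe_ne_top)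
  obtain ⟨G, hG, hlim⟩ := exists_limit_eLpNorm hp1 (fun n => hmem (φ n)) hAδ hcau
  refine ⟨G, hG, ?_, fun η η' hη => ?_⟩
  · refine eLpNorm_le_of_tendsto hp1 (fun n => (hmem (φ n)).1) hG.1 hlim (fun n => ?_) hAδ
    have e2 := eLpNorm_le_add_eLpNorm_sub hp1 hg.1 (hφm n).1
    rw [← mul_add]
    exact (hmle _).trans (mul_le_mul' le_rfl (e2.trans (add_le_add le_rfl (hφ n))))
  -- The function η lives on the frequency side. The identity is the weak form of 𝓕G = m 𝓕g,
  -- restricted to those η for which mη is again a Schwartz function.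
  · have h1 := tendsto_integral_mul_of_eLpNorm (q := q) (fun n => hmem (φ n)) hG
      ((𝓕 η : 𝓢(Plane, ℂ)).memLp q volume) hlim
    have hlim2 : Tendsto (fun n => eLpNorm (⇑(φ n) - g) p) atTop (𝓝 0) := by
      refine tendsto_of_tendsto_of_tendsto_of_le_of_le tendsto_const_nhds hδ0
        (fun _ => zero_le) fun n => ?_
      rw [eLpNorm_sub_comm]
      exact hφ n
    have h2 := tendsto_integral_mul_of_eLpNorm (q := q) hφm hg
      ((𝓕 η' : 𝓢(Plane, ℂ)).memLp q volume) hlim2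
    refine tendsto_nhds_unique h1 (h2.congr fun n => ?_)
    rw [integral_mfun_mul (hmi _), mform, ← SchwartzMap.integral_fourier_mul_eq]
    congr 1; ext ξ
    rw [FourierTransform.fourierInv_fourier_eq, hη]; ring

/-- The part of low frequencies of a test function is negligible. -/
theorem tendsto_integral_mul_fourier_cut {p q : ℝ≥0∞} [hpq : p.HolderConjugate q] (hp1 : 1 ≤ p)
    (hp : p ≠ ⊤) (hq : q ≠ ⊤) {G : Plane → ℂ} (hG : MemLp G p) (η : 𝓢(Plane, ℂ)) :
    Tendsto (fun n : ℕ => ∫ x, G x * 𝓕 (cut ((n : ℝ) + 1) η) x) atTop (𝓝 0) := by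
  have hqp : q.HolderConjugate p := hpq.symm
  set D : ℝ≥0∞ := eLpNorm (𝓕⁻ radialBump : 𝓢(Plane, ℂ)) 1 * eLpNorm (𝓕 η : 𝓢(Plane, ℂ)) q
  have hD : D ≠ ⊤ := ENNReal.mul_ne_top ((𝓕⁻ radialBump).memLp 1 volume).2.ne
    ((𝓕 η).memLp q volume).2.ne
  have hpair : ∀ (a : ℝ) (ψ : 𝓢(Plane, ℂ)),
      ∫ x, ψ x * 𝓕 (cut a η) x = mform (fun ξ => radialBump (a • ξ)) ψ (𝓕 η) := by
    intro a ψ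
    rw [mform, ← SchwartzMap.integral_fourier_mul_eq]
    congr 1; ext ξ
    rw [FourierTransform.fourierInv_fourier_eq, cut_apply]; ring
  -- Dilated cutoffs are uniformly bounded multipliers, so by density it suffices to replace `G` by
  -- a Schwartz function; for that, the support of the cutoff shrinks to the origin and dominated
  -- convergence applies.
  have hbd : ∀ a : ℝ, eLpNorm (𝓕 (cut a η) : 𝓢(Plane, ℂ)) q ≤ D := by
    intro a
    refine eLpNorm_le_of_forall_schwartz (p := q) (q := p) hq (SchwartzMap.continuous _)
      fun ψ => ?_
    have h1 : ∫ x, 𝓕 (cut a η) x * ψ x = ∫ x, ψ x * 𝓕 (cut a η) x := by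
      congr 1; ext x; ring
    rw [h1, hpair]
    refine (enorm_mform_dilation_le (p := p) (q := q) radialBump a ψ (𝓕 η)).trans (le_of_eq ?_)
    rw [mul_right_comm]
  have hsch : ∀ ψ : 𝓢(Plane, ℂ),
      Tendsto (fun n : ℕ => ∫ x, ψ x * 𝓕 (cut ((n : ℝ) + 1) η) x) atTop (𝓝 0) := by
    intro ψ
    simp only [hpair]
    have h0 : (0 : ℂ) = ∫ _ : Plane, (0 : ℂ) := by simp
    rw [h0]
    refine tendsto_integral_of_dominated_convergence (fun ξ => ‖𝓕 ψ ξ * 𝓕⁻ (𝓕 η) ξ‖)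
      (fun n => ?_) (integrable_fourier_mul_fourierInv ψ (𝓕 η)).norm
      (fun n => Eventually.of_forall fun ξ => ?_) ?_
    · exact ((radialBump.continuous.comp (continuous_const_smul _)).mul
        ((𝓕 ψ).continuous.mul (𝓕⁻ (𝓕 η)).continuous)).aestronglyMeasurable
    · rw [norm_mul]
      exact mul_le_of_le_one_left (norm_nonneg _) (norm_radialBump_le _)
    · filter_upwards [compl_mem_ae_iff.2 (measure_singleton (0 : Plane))] with ξ hξ
      refine tendsto_const_nhds.congr' ?_
      have hn : 0 < ‖ξ‖ := norm_pos_iff.2 hξ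
      obtain ⟨N, hN⟩ := exists_nat_gt (2 / ‖ξ‖)
      filter_upwards [eventually_ge_atTop N] with n hnN
      rw [radialBump_eq_zero, zero_mul]
      rw [norm_smul, Real.norm_of_nonneg (by positivity)]
      have h1 : (N : ℝ) ≤ n := by exact_mod_cast hnN
      rw [div_lt_iff₀ hn] at hN
      nlinarith
  rw [Metric.tendsto_atTop]
  intro ε hε
  set ε' : ℝ := ε / 2 / (D.toReal + 1) with hε'
  have hε'0 : 0 < ε' := by positivity
  obtain ⟨ψ, hψ⟩ := exists_schwartz_eLpNorm_sub_le hp1 hp hG hε'0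
  obtain ⟨N, hN⟩ := (Metric.tendsto_atTop.1 (hsch ψ)) (ε / 2) (by positivity)
  refine ⟨N, fun n hn => ?_⟩
  have h1 := hN n hn
  rw [dist_zero_right] at h1 ⊢
  set θ : 𝓢(Plane, ℂ) := 𝓕 (cut ((n : ℝ) + 1) η)
  have hθ : MemLp θ q := θ.memLp q volume
  have hψp : MemLp ψ p := ψ.memLp p volume
  have h2 : ∫ x, G x * θ x = (∫ x, (G - ⇑ψ) x * θ x) + ∫ x, ψ x * θ x := by
    have i1 : Integrable fun x => (G - ⇑ψ) x * θ x := (hG.sub hψp).integrable_mul (q := q) hθ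
    have i2 : Integrable fun x => ψ x * θ x := hψp.integrable_mul (q := q) hθ
    rw [← integral_add i1 i2]
    congr 1; ext x
    simp
    ring
  have h3 : ‖∫ x, (G - ⇑ψ) x * θ x‖ₑ ≤ ENNReal.ofReal (ε / 2) := by
    refine (enorm_integral_mul_le (p := p) (q := q) (hG.1.sub hψp.1) hθ.1).trans ?_
    refine (mul_le_mul' hψ (hbd _)).trans ?_
    rw [← ENNReal.ofReal_toReal hD, ← ENNReal.ofReal_mul hε'0.le]
    refine ENNReal.ofReal_le_ofReal ?_
    rw [hε', div_mul_eq_mul_div, div_le_iff₀ (by positivity)]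
    have := ENNReal.toReal_nonneg (a := D)
    nlinarith
  have h4 : ‖∫ x, (G - ⇑ψ) x * θ x‖ ≤ ε / 2 := by
    rw [← ofReal_norm] at h3
    exact (ENNReal.ofReal_le_ofReal_iff (by positivity)).1 h3
  rw [h2]
  refine (norm_add_le _ _).trans_lt ?_
  linarith

/-! ### Weak derivatives from either definition of the space of integer order. -/

/-- The symbol of order `0` whose product with `|ξ|^k` is the polynomial `esym k j`. -/
noncomputable def dirSymbol (k : ℕ) (j : Fin 2) (ξ : Plane) : ℂ :=
  if Even k then 1 else rieszSymbol j ξ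

theorem norm_dirSymbol_le (k : ℕ) (j : Fin 2) (ξ : Plane) : ‖dirSymbol k j ξ‖ ≤ 1 := by
  rw [dirSymbol]
  split_ifs
  · simp
  · exact norm_rieszSymbol_le j ξ

theorem measurable_dirSymbol (k : ℕ) (j : Fin 2) : Measurable (dirSymbol k j) := by
  unfold dirSymbol
  split_ifs
  · exact measurable_const
  · exact measurable_rieszSymbol j

theorem dirSymbol_mul_norm_pow (k : ℕ) (j : Fin 2) (ξ : Plane) :
    dirSymbol k j ξ * ((‖ξ‖ ^ (k : ℝ) : ℝ) : ℂ) = esym k j ξ := by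
  rw [dirSymbol, esym, Real.rpow_natCast]
  rcases Nat.even_or_odd k with h | h
  · rw [if_pos h, one_mul, Nat.even_iff.1 h, pow_zero, one_mul, ← pow_mul,
      Nat.two_mul_div_two_of_even h]
  · rw [if_neg (Nat.not_even_iff_odd.2 h), Nat.odd_iff.1 h, pow_one, rieszSymbol,
      ← Complex.ofReal_mul]
    congr 1
    have h2 : k = 2 * (k / 2) + 1 := (Nat.two_mul_div_two_add_one_of_odd h).symm
    rcases eq_or_ne ξ 0 with rfl | hξ
    · simp
    · have hn : ‖ξ‖ ≠ 0 := norm_ne_zero_iff.2 hξ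
      conv_lhs => rw [h2, pow_succ, pow_mul]
      field_simp

theorem contDiffAt_dirSymbol (k : ℕ) (j : Fin 2) {ξ : Plane} (hξ : ξ ≠ 0) :
    ContDiffAt ℝ ∞ (dirSymbol k j) ξ := by
  unfold dirSymbol
  split_ifs
  · exact contDiffAt_const
  · have h1 : ContDiffAt ℝ ∞ (fun ξ : Plane => ξ j / ‖ξ‖) ξ :=
      ((EuclideanSpace.proj (𝕜 := ℝ) j).contDiff.contDiffAt).div (contDiffAt_norm ℝ hξ)
        (norm_ne_zero_iff.2 hξ)
    exact Complex.ofRealCLM.contDiff.contDiffAt.comp ξ h1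

theorem exists_dirSymbol_bound {p q : ℝ≥0∞} [hpq : p.HolderConjugate q] (hp1 : 1 < p)
    (hp : p ≠ ⊤) : ∃ A : ℝ≥0, ∀ (k : ℕ) (j : Fin 2) (f ψ : 𝓢(Plane, ℂ)),
      ‖mform (dirSymbol k j) f ψ‖ₑ ≤ A * eLpNorm f p * eLpNorm ψ q := by
  obtain ⟨A, hA⟩ := exists_riesz_bound (p := p) (q := q) hp1 hp
  refine ⟨A + 1, fun k j f ψ => ?_⟩
  rcases Nat.even_or_odd k with h | h
  · have h1 : dirSymbol k j = fun _ => 1 := by ext ξ; rw [dirSymbol, if_pos h]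
    rw [h1, mform_one]
    refine (enorm_integral_mul_le (p := p) (q := q) f.continuous.aestronglyMeasurable
      ψ.continuous.aestronglyMeasurable).trans ?_
    exact mul_le_mul' (le_mul_of_one_le_left zero_le (by simp)) le_rfl
  · have h1 : dirSymbol k j = rieszSymbol j := by
      ext ξ; rw [dirSymbol, if_neg (Nat.not_even_iff_odd.2 h)]
    rw [h1]
    refine (hA j f ψ).trans ?_
    refine mul_le_mul' (mul_le_mul' (by simp) le_rfl) le_rfl

/-- The order-zero symbol may fail to be smooth only at the origin, so its product with an η
vanishing near 0 is an admissible test function for `S`. There 𝓕G = `dirSymbol` · |ξ|^k h = `esym` ·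
h. -/
theorem integral_mul_esym_of_eventually_zero {p : ℝ≥0∞}
    (hp1 : 1 ≤ p) {k : ℕ} {j : Fin 2} {S : 𝓢'(Plane, ℂ)} {h g G : Plane → ℂ}
    (hS : Represents S fun ξ => ((‖ξ‖ ^ (k : ℝ) : ℝ) : ℂ) * h ξ) (hg : Represents (𝓕⁻ S) g)
    (hgp : MemLp g p)
    (hG : ∀ η η' : 𝓢(Plane, ℂ), (∀ ξ, η' ξ = dirSymbol k j ξ * η ξ) →
        ∫ x, G x * 𝓕 η x = ∫ x, g x * 𝓕 η' x)
    (η : 𝓢(Plane, ℂ)) (hη : HasCompactSupport η) (hη0 : ∀ᶠ ξ in 𝓝 (0 : Plane), η ξ = 0) :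
    ∫ ξ, η ξ * (esym k j ξ * h ξ) = ∫ x, G x * 𝓕 η x := by
  have hsm : ContDiff ℝ ∞ fun ξ => dirSymbol k j ξ * η ξ := by
    rw [contDiff_iff_contDiffAt]
    intro ξ
    rcases eq_or_ne ξ 0 with rfl | hξ
    · refine contDiffAt_const (c := (0 : ℂ)) |>.congr_of_eventuallyEq ?_
      filter_upwards [hη0] with ξ hξ
      rw [hξ, mul_zero]
    · exact (contDiffAt_dirSymbol k j hξ).mul (η.smooth ⊤).contDiffAt
  have hcs : HasCompactSupport fun ξ => dirSymbol k j ξ * η ξ := hη.mul_left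
  have h1 := hG η (hcs.toSchwartzMap hsm) fun ξ => rfl
  rw [h1]
  generalize hη' : hcs.toSchwartzMap hsm = η'
  have hη'a : ∀ ξ, η' ξ = dirSymbol k j ξ * η ξ := fun ξ => by rw [← hη']; rfl
  have h2 := hS.2 η' (by rw [← hη']; exact hcs)
  have h3 : (𝓕⁻ S) (𝓕 η') = S η' := by
    rw [TemperedDistribution.fourierInv_apply, FourierTransform.fourierInv_fourier_eq]
  rw [hg.apply_of_memLp hp1 hgp, h2] at h3
  calc ∫ ξ, η ξ * (esym k j ξ * h ξ) = ∫ x, η' x * (((‖x‖ ^ (k : ℝ) : ℝ) : ℂ) * h x) := by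
        congr 1; ext ξ
        rw [hη'a, ← dirSymbol_mul_norm_pow]; ring
    _ = _ := by
        rw [← h3]
        congr 1; ext ξ; ring

/-- The low frequencies of η are subtracted and the cutoff shrinks to the origin. On the frequency
side nothing is lost because h is locally integrable, and on the space side by
`tendsto_integral_mul_fourier_cut`. Thus no term concentrated at frequency zero appears. -/
theorem integral_mul_esym {p q : ℝ≥0∞} [hpq : p.HolderConjugate q]
    (hp1 : 1 ≤ p) (hp : p ≠ ⊤) (hq : q ≠ ⊤) {k : ℕ} {j : Fin 2} {S : 𝓢'(Plane, ℂ)}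
    {h g G : Plane → ℂ} (hh : LocallyIntegrable h)
    (hS : Represents S fun ξ => ((‖ξ‖ ^ (k : ℝ) : ℝ) : ℂ) * h ξ) (hg : Represents (𝓕⁻ S) g)
    (hgp : MemLp g p) (hGp : MemLp G p)
    (hG : ∀ η η' : 𝓢(Plane, ℂ), (∀ ξ, η' ξ = dirSymbol k j ξ * η ξ) →
        ∫ x, G x * 𝓕 η x = ∫ x, g x * 𝓕 η' x)
    (η : 𝓢(Plane, ℂ)) (hη : HasCompactSupport η) :
    ∫ ξ, η ξ * (esym k j ξ * h ξ) = ∫ x, G x * 𝓕 η x := by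
  have hec : Continuous (esym k j) := (hasTemperateGrowth_esym k j).1.continuous
  have hint : Integrable fun ξ => η ξ * (esym k j ξ * h ξ) := by
    have := hh.integrable_smul_left_of_hasCompactSupport
      (g := fun ξ => η ξ * esym k j ξ) (η.continuous.mul hec) hη.mul_right
    refine this.congr (Eventually.of_forall fun ξ => ?_)
    simp only [smul_eq_mul]; ring
  have hcutc : ∀ n : ℕ, HasCompactSupport (cut ((n : ℝ) + 1) η) := fun n =>
    hasCompactSupport_cut (by positivity) η
  have h1 : ∀ n : ℕ, ∫ ξ, (1 - radialBump (((n : ℝ) + 1) • ξ)) * (η ξ * (esym k j ξ * h ξ)) =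
      (∫ x, G x * 𝓕 η x) - ∫ x, G x * 𝓕 (cut ((n : ℝ) + 1) η) x := by
    intro n
    have h2 := integral_mul_esym_of_eventually_zero hp1 hS hg hgp hG
      (η - cut ((n : ℝ) + 1) η) (hη.sub (hcutc n)) ?_
    · have i1 : Integrable fun x => G x * 𝓕 η x :=
        hGp.integrable_mul (q := q) ((𝓕 η).memLp q volume)
      have i2 : Integrable fun x => G x * 𝓕 (cut ((n : ℝ) + 1) η) x :=
        hGp.integrable_mul (q := q) ((𝓕 (cut ((n : ℝ) + 1) η)).memLp q volume)
      have h3 : 𝓕 (η - cut ((n : ℝ) + 1) η) = 𝓕 η - 𝓕 (cut ((n : ℝ) + 1) η) :=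
        map_sub (FourierTransform.fourierCLM ℂ 𝓢(Plane, ℂ)) _ _
      rw [← integral_sub i1 i2]
      rw [h3] at h2
      refine Eq.trans (integral_congr_ae (Eventually.of_forall fun ξ => ?_)) (h2.trans
        (integral_congr_ae (Eventually.of_forall fun ξ => ?_)))
      · simp only [sub_apply, cut_apply]; ring
      · simp only [sub_apply]; ring
    · filter_upwards [Metric.ball_mem_nhds (0 : Plane) (ε := 1 / ((n : ℝ) + 1)) (by positivity)]
        with ξ hξ
      rw [sub_apply, cut_apply, radialBump_eq_one, one_mul, sub_self]
      rw [mem_ball_zero_iff, lt_div_iff₀ (by positivity)] at hξ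
      rw [norm_smul, Real.norm_of_nonneg (by positivity)]
      linarith
  have h2 : Tendsto (fun n : ℕ =>
      ∫ ξ, (1 - radialBump (((n : ℝ) + 1) • ξ)) * (η ξ * (esym k j ξ * h ξ))) atTop
      (𝓝 (∫ ξ, η ξ * (esym k j ξ * h ξ))) := by
    refine tendsto_integral_of_dominated_convergence
      (fun ξ => 2 * ‖η ξ * (esym k j ξ * h ξ)‖) (fun n => ?_) (hint.norm.const_mul 2)
      (fun n => Eventually.of_forall fun ξ => ?_) ?_
    · exact ((continuous_const.sub (radialBump.continuous.comp
        (continuous_const_smul _))).aestronglyMeasurable).mul hint.1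
    · rw [norm_mul]
      refine mul_le_mul_of_nonneg_right ?_ (norm_nonneg _)
      refine (norm_sub_le _ _).trans ?_
      have := norm_radialBump_le (((n : ℝ) + 1) • ξ)
      rw [norm_one]; linarith
    · filter_upwards [compl_mem_ae_iff.2 (measure_singleton (0 : Plane))] with ξ hξ
      refine tendsto_const_nhds.congr' ?_
      have hn : 0 < ‖ξ‖ := norm_pos_iff.2 hξ
      obtain ⟨N, hN⟩ := exists_nat_gt (2 / ‖ξ‖)
      filter_upwards [eventually_ge_atTop N] with n hnN
      rw [radialBump_eq_zero, sub_zero, one_mul]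
      rw [norm_smul, Real.norm_of_nonneg (by positivity)]
      have h1 : (N : ℝ) ≤ n := by exact_mod_cast hnN
      rw [div_lt_iff₀ hn] at hN
      nlinarith
  have h3 := (tendsto_const_nhds (x := ∫ x, G x * 𝓕 η x)).sub
    (tendsto_integral_mul_fourier_cut (q := q) hp1 hp hq hGp η)
  rw [sub_zero] at h3
  exact tendsto_nhds_unique h2 (h3.congr fun n => (h1 n).symm)

theorem tendsto_integral_mul_schwartz {p : ℝ≥0∞} (hp1 : 1 ≤ p) {G : Plane → ℂ} (hG : MemLp G p)
    {ψ : ℕ → 𝓢(Plane, ℂ)} {φ : 𝓢(Plane, ℂ)} (h : Tendsto ψ atTop (𝓝 φ)) :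
    Tendsto (fun n => ∫ x, G x * ψ n x) atTop (𝓝 (∫ x, G x * φ x)) := by
  have : Fact (1 ≤ p) := ⟨hp1⟩
  have h1 : ∀ ψ : 𝓢(Plane, ℂ),
      MeasureTheory.Lp.toTemperedDistribution (hG.toLp G) ψ = ∫ x, G x * ψ x := by
    intro ψ
    rw [Lp.toTemperedDistribution_apply]
    refine integral_congr_ae ?_
    filter_upwards [hG.coeFn_toLp] with x hx
    rw [hx, smul_eq_mul, mul_comm]
  simp only [← h1]
  exact ((MeasureTheory.Lp.toTemperedDistribution (hG.toLp G)).continuous.tendsto φ).comp h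

/-- The transform of F is given by h only against compactly supported functions, while the inverse
transform of a test function need not have compact support. It is therefore cut at high frequencies,
and both sides pass to the limit by continuity of the distributions. -/
theorem integral_mul_wop_eq {p q : ℝ≥0∞} [hpq : p.HolderConjugate q]
    (hp1 : 1 ≤ p) (hp : p ≠ ⊤) (hq : q ≠ ⊤) {k : ℕ} {j : Fin 2} {F S : 𝓢'(Plane, ℂ)}
    {f : Plane → ℝ} {h g G : Plane → ℂ} (hF : Represents F fun x => (f x : ℂ))
    (hh : Represents (𝓕 F) h)
    (hS : Represents S fun ξ => ((‖ξ‖ ^ (k : ℝ) : ℝ) : ℂ) * h ξ) (hg : Represents (𝓕⁻ S) g)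
    (hgp : MemLp g p) (hGp : MemLp G p)
    (hG : ∀ η η' : 𝓢(Plane, ℂ), (∀ ξ, η' ξ = dirSymbol k j ξ * η ξ) →
        ∫ x, G x * 𝓕 η x = ∫ x, g x * 𝓕 η' x)
    {φ : Plane → ℝ} (hφ : IsTest φ) :
    ((∫ x, f x * wop k (weight k j) φ x : ℝ) : ℂ) =
      (-(2 * Real.pi * Complex.I)) ^ k * ∫ x, G x * (φ x : ℂ) := by
  set c : ℂ := (-(2 * Real.pi * Complex.I)) ^ k
  set ψ := wopS k (weight k j) hφ.toSchwartz with hψ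
  have hψe : ∀ x, ψ x = (wop k (weight k j) φ x : ℂ) := fun x => (wop_eq _ hφ x).symm
  have hψc : HasCompactSupport ψ := by
    have h1 : (ψ : Plane → ℂ) = fun x => (wop k (weight k j) φ x : ℂ) := funext hψe
    rw [h1]
    exact (isTest_wop (weight k j) hφ).2.comp_left (g := Complex.ofReal) Complex.ofReal_zero
  have h1 : ((∫ x, f x * wop k (weight k j) φ x : ℝ) : ℂ) = F ψ := by
    rw [hF.2 ψ hψc, ← integral_complex_ofReal]
    congr 1; ext x
    rw [hψe]; push_cast; ring
  have h2 : F ψ = (𝓕 F) (𝓕⁻ ψ) := by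
    rw [TemperedDistribution.fourier_apply, FourierTransform.fourier_fourierInv_eq]
  have h3 : ∀ n : ℕ, (𝓕 F) (cut (1 / ((n : ℝ) + 1)) (𝓕⁻ ψ)) =
      c * ∫ x, G x * 𝓕 (cut (1 / ((n : ℝ) + 1)) (𝓕⁻ hφ.toSchwartz)) x := by
    intro n
    have ha : (1 / ((n : ℝ) + 1)) ≠ 0 := by positivity
    rw [hh.2 _ (hasCompactSupport_cut ha _),
      ← integral_mul_esym (q := q) hp1 hp hq hh.1 hS hg hgp hGp hG _ (hasCompactSupport_cut ha _),
      ← integral_const_mul]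
    congr 1; ext ξ
    rw [cut_apply, cut_apply, hψ, fourierInv_wopS]
    ring
  have h4 : Tendsto (fun n : ℕ => (𝓕 F) (cut (1 / ((n : ℝ) + 1)) (𝓕⁻ ψ))) atTop
      (𝓝 ((𝓕 F) (𝓕⁻ ψ))) := ((𝓕 F).continuous.tendsto _).comp (tendsto_cut _)
  have h5 : Tendsto (fun n : ℕ => 𝓕 (cut (1 / ((n : ℝ) + 1)) (𝓕⁻ hφ.toSchwartz))) atTop
      (𝓝 hφ.toSchwartz) := by
    have := ((FourierTransform.fourierCLM ℂ 𝓢(Plane, ℂ)).continuous.tendsto _).comp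
      (tendsto_cut (𝓕⁻ hφ.toSchwartz))
    have h6 : (FourierTransform.fourierCLM ℂ 𝓢(Plane, ℂ)) (𝓕⁻ hφ.toSchwartz) = hφ.toSchwartz := by
      rw [FourierTransform.fourierCLM_apply, FourierTransform.fourier_fourierInv_eq]
    rw [h6] at this
    exact this
  have h7 := (tendsto_integral_mul_schwartz hp1 hGp h5).const_mul c
  rw [h1, h2]
  exact tendsto_nhds_unique h4 (h7.congr fun n => (h3 n).symm)

/-- The bounded symbol `dirSymbol` turns the given function with symbol |ξ|^k into one with the
polynomial symbol `esym`; the constant (2πi)^k then makes it a derivative, and the real part is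
taken because f is real. As p > 1, the conjugate exponent is finite, as the removal of the origin
requires. -/
theorem exists_hasWeak_of_fourierSobolevBound {p : ℝ≥0∞} (hp1 : 1 < p) (hp : p ≠ ⊤) (k : ℕ) :
    ∃ A : ℝ≥0, ∀ (f : Plane → ℝ) (C : ℝ≥0), FourierSobolevBound k p f C → ∀ j : Fin 2,
      ∃ G : Plane → ℝ, MemLp G p ∧ eLpNorm G p ≤ A * C ∧ HasWeak k (weight k j) f G := by
  have hpq : p.HolderConjugate p.conjExponent := ENNReal.HolderConjugate.conjExponent hp1.le
  have hq : p.conjExponent ≠ ⊤ := by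
    intro h
    have h1 := ENNReal.HolderConjugate.inv_add_inv_eq_one p p.conjExponent
    rw [h, ENNReal.inv_top, add_zero, ENNReal.inv_eq_one] at h1
    exact hp1.ne' h1
  generalize p.conjExponent = q at hpq hq
  obtain ⟨A, hA⟩ := exists_dirSymbol_bound (p := p) (q := q) hp1 hp
  refine ⟨‖(2 * Real.pi * Complex.I : ℂ) ^ k‖₊ * A, fun f C hf j => ?_⟩
  obtain ⟨F, S, h, g, hF, hh, hS, hg, hgp, hgC⟩ := hf
  obtain ⟨G, hGp, hGC, hG⟩ := exists_multiplier_image (q := q) hp1.le hp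
    (measurable_dirSymbol k j).aestronglyMeasurable (norm_dirSymbol_le k j) (hA k j) hgp
  generalize hc : (2 * Real.pi * Complex.I : ℂ) ^ k = c
  have hcG : MemLp (fun x => c * G x) p := hGp.const_mul c
  refine ⟨fun x => (c * G x).re, hcG.re, ?_, fun φ hφ => ?_⟩
  · have e1 : eLpNorm (fun x => (c * G x).re) p ≤ eLpNorm (c • G) p :=
      eLpNorm_mono fun x => by simpa using Complex.abs_re_le_norm (c * G x)
    rw [eLpNorm_const_smul] at e1
    refine e1.trans ?_
    rw [ENNReal.coe_mul, mul_assoc]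
    exact mul_le_mul' le_rfl (hGC.trans (mul_le_mul' le_rfl hgC))
  · have h1 := integral_mul_wop_eq (q := q) hp1.le hp hq hF hh hS hg hgp hGp hG hφ
    have hi : Integrable fun x => c * G x * (φ x : ℂ) :=
      hcG.integrable_mul (q := q) (hφ.toSchwartz.memLp q volume)
    have h2 : (-(2 * Real.pi * Complex.I)) ^ k * ∫ x, G x * (φ x : ℂ) =
        ((-1) ^ k : ℝ) * ∫ x, c * G x * (φ x : ℂ) := by
      rw [neg_pow, mul_assoc, ← integral_const_mul]
      push_cast
      congr 2; ext x; rw [← hc]; ring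
    rw [h2] at h1
    have h3 := congrArg Complex.re h1
    rw [Complex.ofReal_re, Complex.re_ofReal_mul] at h3
    rw [h3]
    congr 1
    have h4 := integral_re (𝕜 := ℂ) hi
    simp only [RCLike.re_to_complex] at h4
    rw [← h4]
    congr 1; ext x
    rw [Complex.re_mul_ofReal]

theorem eLpNorm_sum_mul_le {ι : Type*} [Fintype ι] (w : ι → ℝ) {g : ι → Plane → ℝ}
    (hg : ∀ i, AEStronglyMeasurable (g i)) {C : ℝ≥0∞} (hC : ∀ i, eLpNorm (g i) 1 ≤ C) :
    eLpNorm (fun x => ∑ i, w i * g i x) 1 ≤ ((∑ i, ‖w i‖₊ : ℝ≥0) : ℝ≥0∞) * C := by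
  have h1 : (fun x => ∑ i, w i * g i x) = ∑ i, w i • g i := by
    ext x; simp
  rw [h1]
  refine (eLpNorm_sum_le (f := fun i => w i • g i) (fun i _ => ((hg i).const_smul _))
    le_rfl).trans ?_
  rw [ENNReal.ofNNReal_finsetSum, Finset.sum_mul]
  refine Finset.sum_le_sum fun i _ => ?_
  rw [eLpNorm_const_smul]
  exact mul_le_mul' le_rfl (hC i)

/-- A field of weak derivatives gives each weak derivative by a homogeneous operator. -/
theorem exists_hasWeak_of_weakDerivBound (k : ℕ) :
    ∃ A : ℝ≥0, ∀ (f : Plane → ℝ) (C : ℝ≥0), WeakDerivBound k 1 f C → ∀ j : Fin 2,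
      ∃ G : Plane → ℝ, MemLp G 1 ∧ eLpNorm G 1 ≤ A * C ∧ HasWeak k (weight k j) f G := by
  refine ⟨∑ j, ∑ α, ‖weight k j α‖₊, fun f C hf j => ?_⟩
  obtain ⟨hfl, G, hG, hGC, hw⟩ := hf
  have hGα : ∀ α, MemLp (fun x => G x α) 1 := fun α =>
    (EuclideanSpace.proj (𝕜 := ℝ) α).comp_memLp' hG
  have hGn : ∀ α, eLpNorm (fun x => G x α) 1 ≤ C := fun α =>
    (eLpNorm_mono fun x => PiLp.norm_apply_le (G x) α).trans hGC
  refine ⟨fun x => ∑ α, weight k j α * G x α, ?_, ?_, fun φ hφ => ?_⟩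
  · exact memLp_finsetSum _ fun α _ => (hGα α).const_mul _
  · refine (eLpNorm_sum_mul_le (weight k j) (fun α => (hGα α).1) hGn).trans ?_
    refine mul_le_mul' (ENNReal.coe_le_coe.2 ?_) le_rfl
    exact Finset.single_le_sum (f := fun j => ∑ α, ‖weight k j α‖₊)
      (fun _ _ => zero_le) (Finset.mem_univ j)
  · have i1 : ∀ α, Integrable fun x => G x α * φ x := fun α =>
      ((hGα α).locallyIntegrable le_rfl).integrable_smul_right_of_hasCompactSupport
        hφ.1.continuous hφ.2
    have i2 : ∀ α, Integrable fun x => f x * partialDeriv k α φ x := fun α =>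
      hfl.integrable_smul_right_of_hasCompactSupport (contDiff_partialDeriv α hφ.1).continuous
        (hasCompactSupport_partialDeriv α hφ)
    have e1 : ∫ x, f x * wop k (weight k j) φ x =
        ∑ α, weight k j α * ∫ x, f x * partialDeriv k α φ x := by
      simp only [← integral_const_mul]
      rw [← integral_finsetSum _ fun α _ => (i2 α).const_mul _]
      congr 1; ext x
      rw [wop, Finset.mul_sum]
      exact Finset.sum_congr rfl fun α _ => by ring
    have e2 : ∫ x, (∑ α, weight k j α * G x α) * φ x =
        ∑ α, weight k j α * ∫ x, G x α * φ x := by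
      simp only [← integral_const_mul]
      rw [← integral_finsetSum _ fun α _ => (i1 α).const_mul _]
      congr 1; ext x
      rw [Finset.sum_mul]
      exact Finset.sum_congr rfl fun α _ => by ring
    rw [e1, e2, Finset.mul_sum]
    refine Finset.sum_congr rfl fun α _ => ?_
    rw [hw α φ hφ]; ring

/-! ### Smooth approximation by truncation of frequencies. -/

/-- The low frequency part of a Schwartz function. -/
noncomputable def lowPass (a : ℝ) (ψ : 𝓢(Plane, ℂ)) : 𝓢(Plane, ℂ) := 𝓕 (cut a (𝓕⁻ ψ))

theorem integral_mul_lowPass (a : ℝ) (φ ψ : 𝓢(Plane, ℂ)) :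
    ∫ x, φ x * lowPass a ψ x = mform (fun ξ => radialBump (a • ξ)) φ ψ := by
  rw [lowPass, mform, ← SchwartzMap.integral_fourier_mul_eq]
  congr 1; ext ξ
  rw [cut_apply]; ring

/-- For Schwartz functions this is the bound for dilated symbols, which does not depend on `a`;
density extends it to L^p. -/
theorem enorm_integral_mul_lowPass_le {p q : ℝ≥0∞} [hpq : p.HolderConjugate q] (hp1 : 1 ≤ p)
    (hp : p ≠ ⊤) {G : Plane → ℂ} (hG : MemLp G p) (a : ℝ) (ψ : 𝓢(Plane, ℂ)) :
    ‖∫ x, G x * lowPass a ψ x‖ₑ ≤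
      eLpNorm (𝓕⁻ radialBump : 𝓢(Plane, ℂ)) 1 * eLpNorm G p * eLpNorm ψ q := by
  have hD : eLpNorm (𝓕⁻ radialBump : 𝓢(Plane, ℂ)) 1 ≠ ⊤ :=
    ((𝓕⁻ radialBump).memLp 1 volume).2.ne
  generalize hDe : eLpNorm (𝓕⁻ radialBump : 𝓢(Plane, ℂ)) 1 = D at hD ⊢
  obtain ⟨φ, δ, hφ, hδ0⟩ := exists_schwartz_seq_eLpNorm_sub_le hp1 hp hG
  have hφm : ∀ n, MemLp (φ n) p := fun n => (φ n).memLp p volume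
  have hlim : Tendsto (fun n => eLpNorm (⇑(φ n) - G) p) atTop (𝓝 0) := by
    refine tendsto_of_tendsto_of_tendsto_of_le_of_le tendsto_const_nhds hδ0
      (fun _ => zero_le) fun n => ?_
    rw [eLpNorm_sub_comm]
    exact hφ n
  have h1 := (tendsto_integral_mul_of_eLpNorm (q := q) hφm hG
    ((lowPass a ψ).memLp q volume) hlim).enorm
  have h2 : ∀ n, ‖∫ x, φ n x * lowPass a ψ x‖ₑ ≤
      D * (eLpNorm G p + δ n) * eLpNorm ψ q := by
    intro n
    rw [integral_mul_lowPass]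
    refine (enorm_mform_dilation_le (p := p) (q := q) radialBump a (φ n) ψ).trans ?_
    rw [hDe]
    have e2 := eLpNorm_le_add_eLpNorm_sub hp1 hG.1 (hφm n).1
    exact mul_le_mul' (mul_le_mul' le_rfl (e2.trans (add_le_add le_rfl (hφ n)))) le_rfl
  have h3 : Tendsto (fun n => D * (eLpNorm G p + δ n) * eLpNorm ψ q) atTop
      (𝓝 (D * eLpNorm G p * eLpNorm ψ q)) := by
    have := ENNReal.Tendsto.mul_const (ENNReal.Tendsto.const_mul (hδ0.const_add (eLpNorm G p))
      (Or.inr hD)) (Or.inr (ψ.memLp q volume).2.ne)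
    rwa [add_zero] at this
  exact le_of_tendsto_of_tendsto' h1 h3 h2

theorem tendsto_eLpNorm_schwartz {p : ℝ≥0∞} (hp1 : 1 ≤ p) {u : ℕ → 𝓢(Plane, ℂ)}
    {φ : 𝓢(Plane, ℂ)} (h : Tendsto u atTop (𝓝 φ)) :
    Tendsto (fun n => eLpNorm (⇑(u n) - ⇑φ) p) atTop (𝓝 0) := by
  have : Fact (1 ≤ p) := ⟨hp1⟩
  have h1 := ((SchwartzMap.toLpCLM ℝ ℂ p (volume : Measure Plane)).continuous.tendsto φ).comp h
  rw [Lp.tendsto_Lp_iff_tendsto_eLpNorm'] at h1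
  refine h1.congr fun n => eLpNorm_congr_ae ?_
  filter_upwards [SchwartzMap.coeFn_toLp (u n) p volume, SchwartzMap.coeFn_toLp φ p volume]
    with x hx hy
  simp only [Function.comp_apply, SchwartzMap.toLpCLM_apply, Pi.sub_apply, hx, hy]

/-- Convergence in `L^p` of the low frequency parts. -/
theorem tendsto_eLpNorm_of_lowPass {p : ℝ≥0∞} (hp1 : 1 ≤ p)
    (hp : p ≠ ⊤) {G : Plane → ℂ} (hG : MemLp G p) {u : ℕ → 𝓢(Plane, ℂ)}
    (hu : ∀ n ψ, ∫ x, u n x * ψ x = ∫ x, G x * lowPass (1 / ((n : ℝ) + 1)) ψ x) :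
    Tendsto (fun n => eLpNorm (⇑(u n) - G) p) atTop (𝓝 0) := by
  have hpq : p.HolderConjugate p.conjExponent := ENNReal.HolderConjugate.conjExponent hp1
  generalize p.conjExponent = q at hpq
  have hD : eLpNorm (𝓕⁻ radialBump : 𝓢(Plane, ℂ)) 1 ≠ ⊤ :=
    ((𝓕⁻ radialBump).memLp 1 volume).2.ne
  have hle := fun (G : Plane → ℂ) (hG : MemLp G p) =>
    enorm_integral_mul_lowPass_le (q := q) hp1 hp hG
  generalize eLpNorm (𝓕⁻ radialBump : 𝓢(Plane, ℂ)) 1 = D at hD hle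
  obtain ⟨χ, δ, hχ, hδ0⟩ := exists_schwartz_seq_eLpNorm_sub_le hp1 hp hG
  set S : ℕ → 𝓢(Plane, ℂ) → 𝓢(Plane, ℂ) := fun n χ => 𝓕⁻ (cut (1 / ((n : ℝ) + 1)) (𝓕 χ))
    with hS
  have hSi : ∀ n χ ψ, ∫ x, S n χ x * ψ x = ∫ x, χ x * lowPass (1 / ((n : ℝ) + 1)) ψ x := by
    intro n χ ψ
    rw [integral_mul_lowPass, hS, SchwartzMap.integral_fourierInv_mul_eq, mform]
    congr 1; ext ξ
    rw [cut_apply]; ring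
  have hSt : ∀ χ, Tendsto (fun n => eLpNorm (⇑(S n χ) - ⇑χ) p) atTop (𝓝 0) := by
    intro χ
    refine tendsto_eLpNorm_schwartz hp1 ?_
    have := ((FourierTransform.fourierInvCLM ℂ 𝓢(Plane, ℂ)).continuous.tendsto _).comp
      (tendsto_cut (𝓕 χ))
    rw [FourierTransform.fourierInvCLM_apply, FourierTransform.fourierInv_fourier_eq] at this
    exact this
  -- Three errors: the truncation applied to G - χ_m, controlled uniformly in n; the truncation
  -- error of the Schwartz function χ_m, which tends to 0 with n; and G - χ_m itself.
  have h1 : ∀ m n, eLpNorm (⇑(u n) - G) p ≤ D * δ m + eLpNorm (⇑(S n (χ m)) - ⇑(χ m)) p + δ m := by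
    intro m n
    have hχm : MemLp (χ m) p := (χ m).memLp p volume
    have hGm : MemLp (G - ⇑(χ m)) p := hG.sub hχm
    have e1 : eLpNorm (⇑(u n) - ⇑(S n (χ m))) p ≤ D * δ m := by
      refine eLpNorm_le_of_forall_schwartz (q := q) hp
        ((u n).continuous.sub (S n (χ m)).continuous) fun ψ => ?_
      have i1 : Integrable fun x => u n x * ψ x :=
        ((u n).memLp p volume).integrable_mul (q := q) (ψ.memLp q volume)
      have i2 : Integrable fun x => S n (χ m) x * ψ x :=
        ((S n (χ m)).memLp p volume).integrable_mul (q := q) (ψ.memLp q volume)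
      have i3 : Integrable fun x => G x * lowPass (1 / ((n : ℝ) + 1)) ψ x :=
        hG.integrable_mul (q := q) ((lowPass _ ψ).memLp q volume)
      have i4 : Integrable fun x => χ m x * lowPass (1 / ((n : ℝ) + 1)) ψ x :=
        hχm.integrable_mul (q := q) ((lowPass _ ψ).memLp q volume)
      have e2 : ∫ x, (⇑(u n) - ⇑(S n (χ m))) x * ψ x =
          ∫ x, (G - ⇑(χ m)) x * lowPass (1 / ((n : ℝ) + 1)) ψ x := by
        simp only [Pi.sub_apply, sub_mul]
        rw [integral_sub i1 i2, integral_sub i3 i4, hu, hSi]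
      rw [e2]
      exact (hle _ hGm _ ψ).trans (mul_le_mul' (mul_le_mul' le_rfl (hχ m)) le_rfl)
    have e3 : ⇑(u n) - G = (⇑(u n) - ⇑(S n (χ m))) + (⇑(S n (χ m)) - ⇑(χ m)) - (G - ⇑(χ m)) := by
      ext x; simp
    rw [e3]
    have hum : MemLp (u n) p := (u n).memLp p volume
    have hSm : MemLp (S n (χ m)) p := (S n (χ m)).memLp p volume
    refine (eLpNorm_sub_le ((hum.1.sub hSm.1).add (hSm.1.sub hχm.1)) hGm.1 hp1).trans ?_
    refine add_le_add ((eLpNorm_add_le (hum.1.sub hSm.1) (hSm.1.sub hχm.1) hp1).trans ?_) (hχ m)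
    exact add_le_add e1 le_rfl
  rw [ENNReal.tendsto_nhds_zero]
  intro ε hε
  have hz : Tendsto (fun m => D * δ m + δ m) atTop (𝓝 0) := by
    simpa using (ENNReal.Tendsto.const_mul hδ0 (Or.inr hD)).add hδ0
  have hε2 : 0 < ε / 2 := ENNReal.half_pos hε.ne'
  obtain ⟨m, hm⟩ := (hz.eventually_le_const hε2).exists
  filter_upwards [(hSt (χ m)).eventually_le_const hε2] with n hn
  refine (h1 m n).trans ?_
  rw [add_right_comm, ← ENNReal.add_halves ε]
  exact add_le_add hm hn

theorem continuous_wopS (k : ℕ) (j : Fin 2) : Continuous (wopS k (weight k j)) := by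
  have : wopS k (weight k j) = fun ψ => (2 * Real.pi * Complex.I : ℂ) ^ k •
      SchwartzMap.fourierMultiplierCLM ℂ (esym k j) ψ := funext (wopS_eq k j)
  rw [this]
  exact (SchwartzMap.fourierMultiplierCLM ℂ (esym k j)).continuous.const_smul (_ : ℂ)

/-- Weak derivatives can be tested against Schwartz functions. -/
theorem HasWeak.integral_mul_wopS {p : ℝ≥0∞} (hp1 : 1 ≤ p) {k : ℕ} {j : Fin 2} {f G : Plane → ℝ}
    (h : HasWeak k (weight k j) f G) (hf : Integrable f) (hG : MemLp G p) (ψ : 𝓢(Plane, ℂ)) :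
    ∫ x, (f x : ℂ) * wopS k (weight k j) ψ x = (-1) ^ k * ∫ x, (G x : ℂ) * ψ x := by
  have hfC : MemLp (fun x => (f x : ℂ)) 1 := (memLp_one_iff_integrable.2 hf).ofReal
  have hGC : MemLp (fun x => (G x : ℂ)) p := hG.ofReal
  have hreal : ∀ {φ : Plane → ℝ} (hφ : IsTest φ),
      ∫ x, (f x : ℂ) * wopS k (weight k j) hφ.toSchwartz x =
        (-1) ^ k * ∫ x, (G x : ℂ) * hφ.toSchwartz x := by
    intro φ hφ
    have h1 := congrArg Complex.ofReal (h φ hφ)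
    rw [Complex.ofReal_mul, ← integral_complex_ofReal, ← integral_complex_ofReal] at h1
    simp only [← wop_eq, IsTest.toSchwartz_apply]
    simpa using h1
  have hq : (1 : ℝ≥0∞).HolderConjugate ⊤ := inferInstance
  have hcs : ∀ ψ : 𝓢(Plane, ℂ), HasCompactSupport ψ →
      ∫ x, (f x : ℂ) * wopS k (weight k j) ψ x = (-1) ^ k * ∫ x, (G x : ℂ) * ψ x := by
    intro ψ hψ
    have hre : IsTest fun x => (ψ x).re := ⟨Complex.reCLM.contDiff.comp (ψ.smooth ⊤),
      hψ.comp_left (g := Complex.re) Complex.zero_re⟩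
    have him : IsTest fun x => (ψ x).im := ⟨Complex.imCLM.contDiff.comp (ψ.smooth ⊤),
      hψ.comp_left (g := Complex.im) Complex.zero_im⟩
    have e1 : ψ = hre.toSchwartz + Complex.I • him.toSchwartz := by
      ext x
      rw [add_apply, smul_apply, IsTest.toSchwartz_apply, IsTest.toSchwartz_apply, smul_eq_mul,
        mul_comm, Complex.re_add_im]
    have e2 : wopS k (weight k j) ψ = wopS k (weight k j) hre.toSchwartz +
        Complex.I • wopS k (weight k j) him.toSchwartz := by
      have e0 := congrArg (SchwartzMap.fourierMultiplierCLM ℂ (esym k j)) e1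
      rw [map_add, map_smul] at e0
      rw [wopS_eq, wopS_eq, wopS_eq, e0, smul_add, smul_comm]
    have i1 : ∀ ψ : 𝓢(Plane, ℂ), Integrable fun x => (f x : ℂ) * ψ x := fun ψ =>
      hfC.integrable_mul (q := ⊤) (ψ.memLp ⊤ volume)
    have hpq : p.HolderConjugate p.conjExponent := ENNReal.HolderConjugate.conjExponent hp1
    have i2 : ∀ ψ : 𝓢(Plane, ℂ), Integrable fun x => (G x : ℂ) * ψ x := fun ψ =>
      hGC.integrable_mul (q := p.conjExponent) (ψ.memLp _ volume)
    have e3 : ∀ (u : Plane → ℂ) (χ₁ χ₂ : 𝓢(Plane, ℂ)), (Integrable fun x => u x * χ₁ x) →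
        (Integrable fun x => u x * χ₂ x) → ∫ x, u x * (χ₁ + Complex.I • χ₂) x =
          (∫ x, u x * χ₁ x) + Complex.I * ∫ x, u x * χ₂ x := by
      intro u χ₁ χ₂ j1 j2
      rw [← integral_const_mul, ← integral_add j1 (j2.const_mul _)]
      congr 1; ext x
      rw [add_apply, smul_apply, smul_eq_mul]; ring
    rw [e2, e3 _ _ _ (i1 _) (i1 _), hreal, hreal]
    conv_rhs => rw [e1]
    rw [e3 _ _ _ (i2 _) (i2 _)]
    ring
  have l1 := tendsto_integral_mul_schwartz le_rfl hfC
    (((continuous_wopS k j).tendsto ψ).comp (tendsto_cut ψ))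
  have l2 := (tendsto_integral_mul_schwartz hp1 hGC (tendsto_cut ψ)).const_mul ((-1 : ℂ) ^ k)
  exact tendsto_nhds_unique l1
    (l2.congr fun n => (hcs _ (hasCompactSupport_cut (by positivity) ψ)).symm)

theorem integrable_of_bounded_of_support {f : Plane → ℝ} (hf : AEStronglyMeasurable f) {M R : ℝ}
    (hM : ∀ᵐ x, |f x| ≤ M) (hR : ∀ x, R < ‖x‖ → f x = 0) (n : ℕ) :
    Integrable fun x => ‖x‖ ^ n * ‖(f x : ℂ)‖ := by
  have h1 : IntegrableOn (fun _ : Plane => |R| ^ n * M) (Metric.closedBall 0 |R|) :=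
    integrableOn_const (measure_closedBall_lt_top (x := (0 : Plane))).ne
  have h2 : Integrable ((Metric.closedBall (0 : Plane) |R|).indicator
      fun _ : Plane => |R| ^ n * M) := h1.integrable_indicator measurableSet_closedBall
  refine h2.mono' ?_ ?_
  · exact (continuous_norm.pow n).aestronglyMeasurable.mul
      (Complex.continuous_ofReal.comp_aestronglyMeasurable hf).norm
  · filter_upwards [hM] with x hx
    rw [Complex.norm_real, Real.norm_eq_abs, Real.norm_eq_abs, abs_mul, abs_pow, abs_norm, abs_abs]
    by_cases hxR : ‖x‖ ≤ |R|
    · rw [indicator_of_mem (by simpa using hxR)]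
      exact mul_le_mul (pow_le_pow_left₀ (norm_nonneg _) hxR n) hx (abs_nonneg _) (by positivity)
    · rw [indicator_of_notMem (by simpa using hxR),
        hR x ((le_abs_self R).trans_lt (not_le.1 hxR))]
      simp

theorem memLp_of_bounded_of_support {f : Plane → ℝ} (hf : AEStronglyMeasurable f) {M R : ℝ}
    (hM : ∀ᵐ x, |f x| ≤ M) (hR : ∀ x, R < ‖x‖ → f x = 0) (p : ℝ≥0∞) : MemLp f p := by
  have h1 : f = (Metric.closedBall (0 : Plane) |R|).indicator f := by
    ext x
    by_cases hx : x ∈ Metric.closedBall (0 : Plane) |R|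
    · rw [indicator_of_mem hx]
    · rw [indicator_of_notMem hx]
      exact hR x ((le_abs_self R).trans_lt (by simpa using hx))
  rw [h1, memLp_indicator_iff_restrict measurableSet_closedBall]
  have : IsFiniteMeasure (volume.restrict (Metric.closedBall (0 : Plane) |R|)) :=
    ⟨by rw [Measure.restrict_apply_univ]; exact measure_closedBall_lt_top⟩
  exact MemLp.of_bound hf.restrict M (ae_restrict_of_ae hM)

/-- Smooth approximation, in all the norms at once, of a bounded function of compact support. -/
theorem exists_schwartz_approx {p : ℝ≥0∞} (hp1 : 1 ≤ p) (hp : p ≠ ⊤) {k : ℕ} {f : Plane → ℝ}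
    (hf : AEStronglyMeasurable f) {M R : ℝ} (hM : ∀ᵐ x, |f x| ≤ M)
    (hR : ∀ x, R < ‖x‖ → f x = 0) {G : Fin 2 → Plane → ℝ} (hG : ∀ j, MemLp (G j) p)
    (hw : ∀ j, HasWeak k (weight k j) f (G j)) :
    ∃ φ : ℕ → 𝓢(Plane, ℂ),
      Tendsto (fun n => eLpNorm (⇑(φ n) - fun x => (f x : ℂ)) p) atTop (𝓝 0) ∧
      Tendsto (fun n => eLpNorm (⇑(φ n) - fun x => (f x : ℂ)) 1) atTop (𝓝 0) ∧
      ∀ j, Tendsto (fun n => eLpNorm (⇑(SchwartzMap.fourierMultiplierCLM ℂ (esym k j) (φ n)) -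
        fun x => (2 * Real.pi * Complex.I)⁻¹ ^ k * (G j x : ℂ)) p) atTop (𝓝 0) := by
  have hfi : Integrable f := memLp_one_iff_integrable.1 (memLp_of_bounded_of_support hf hM hR 1)
  have hfC : Integrable fun x => (f x : ℂ) := hfi.ofReal
  have hfp : MemLp (fun x => (f x : ℂ)) p := (memLp_of_bounded_of_support hf hM hR p).ofReal
  -- Compact support of f makes its transform smooth, so the truncated transform is smooth with
  -- compact support and its inverse transform is a Schwartz function.
  have hsm : ContDiff ℝ ∞ (𝓕 fun x => (f x : ℂ)) :=
    Real.contDiff_fourier (N := ⊤) fun n _ => integrable_of_bounded_of_support hf hM hR n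
  have hcs : ∀ n : ℕ, HasCompactSupport fun ξ : Plane =>
      radialBump ((1 / ((n : ℝ) + 1)) • ξ) * (𝓕 fun x => (f x : ℂ)) ξ := by
    intro n
    refine HasCompactSupport.intro (isCompact_closedBall (0 : Plane) (2 * ((n : ℝ) + 1)))
      fun ξ hξ => ?_
    rw [radialBump_eq_zero, zero_mul]
    have h1 : 2 * ((n : ℝ) + 1) < ‖ξ‖ := by simpa using hξ
    rw [norm_smul, Real.norm_of_nonneg (by positivity), div_mul_eq_mul_div, one_mul,
      le_div_iff₀ (by positivity)]
    exact h1.le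
  have hsm2 : ∀ n : ℕ, ContDiff ℝ ∞ fun ξ : Plane =>
      radialBump ((1 / ((n : ℝ) + 1)) • ξ) * (𝓕 fun x => (f x : ℂ)) ξ := fun n =>
    ((radialBump.smooth ⊤).comp (contDiff_const_smul _)).mul hsm
  obtain ⟨φ, hφ⟩ : ∃ φ : ℕ → 𝓢(Plane, ℂ), ∀ n ξ, 𝓕 (φ n) ξ =
      radialBump ((1 / ((n : ℝ) + 1)) • ξ) * (𝓕 fun x => (f x : ℂ)) ξ := by
    refine ⟨fun n => 𝓕⁻ ((hcs n).toSchwartzMap (hsm2 n)), fun n ξ => ?_⟩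
    rw [FourierTransform.fourier_fourierInv_eq]; rfl
  have key : ∀ n ψ, ∫ x, φ n x * ψ x =
      ∫ x, (f x : ℂ) * lowPass (1 / ((n : ℝ) + 1)) ψ x := by
    intro n ψ
    rw [lowPass, ← integral_fourier_mul hfC, ← mform_one, mform]
    congr 1; ext ξ
    rw [hφ, cut_apply]; ring
  have hc : (2 * Real.pi * Complex.I : ℂ) ≠ 0 := Complex.two_pi_I_ne_zero
  refine ⟨φ, tendsto_eLpNorm_of_lowPass hp1 hp hfp key, tendsto_eLpNorm_of_lowPass le_rfl
    ENNReal.one_ne_top (memLp_one_iff_integrable.2 hfC) key, fun j => ?_⟩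
  have hGC : MemLp (fun x => (G j x : ℂ)) p := (hG j).ofReal
  refine tendsto_eLpNorm_of_lowPass hp1 hp (hGC.const_mul _) fun n ψ => ?_
  -- Truncation commutes with operators of constant coefficients. Hence the derivatives of the
  -- approximations are the truncations of the weak derivatives, and they converge too.
  have h1 : wopS k (weight k j) (lowPass (1 / ((n : ℝ) + 1)) ψ) =
      lowPass (1 / ((n : ℝ) + 1)) (wopS k (weight k j) ψ) := by
    have e1 : 𝓕⁻ (wopS k (weight k j) (lowPass (1 / ((n : ℝ) + 1)) ψ)) =
        𝓕⁻ (lowPass (1 / ((n : ℝ) + 1)) (wopS k (weight k j) ψ)) := by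
      ext ξ
      rw [fourierInv_wopS, lowPass, lowPass, FourierTransform.fourierInv_fourier_eq,
        FourierTransform.fourierInv_fourier_eq, cut_apply, cut_apply, fourierInv_wopS]
      ring
    have e2 := congrArg (fun g : 𝓢(Plane, ℂ) => (𝓕 g : 𝓢(Plane, ℂ))) e1
    simpa only [FourierTransform.fourier_fourierInv_eq] using e2
  have h2 := (hw j).integral_mul_wopS hp1 hfi (hG j) (lowPass (1 / ((n : ℝ) + 1)) ψ)
  rw [h1, ← key] at h2
  have h3 : ∫ x, φ n x * wopS k (weight k j) ψ x = (-(2 * Real.pi * Complex.I)) ^ k *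
      ∫ x, SchwartzMap.fourierMultiplierCLM ℂ (esym k j) (φ n) x * ψ x := by
    rw [integral_fourierMultiplierCLM_mul (hasTemperateGrowth_esym k j), mform,
      ← integral_const_mul, ← mform_one, mform]
    congr 1; ext ξ
    rw [fourierInv_wopS]; ring
  rw [h3, neg_pow, mul_assoc] at h2
  have h4 := mul_left_cancel₀ (pow_ne_zero k (neg_ne_zero.2 one_ne_zero)) h2
  generalize 2 * (Real.pi : ℂ) * Complex.I = c at hc h4 ⊢
  simp only [mul_assoc]
  rw [integral_const_mul, ← h4, ← mul_assoc, ← mul_pow, inv_mul_cancel₀ hc, one_pow, one_mul]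

/-! ### Fractional regularity of compactly supported functions. -/

theorem integrable_norm_rpow_mul {s : ℝ} (hs : 0 < s) (φ : 𝓢(Plane, ℂ)) :
    Integrable fun ξ => ((‖ξ‖ ^ s : ℝ) : ℂ) * φ ξ := by
  have h1 := SchwartzMap.integrable_pow_mul (volume : Measure Plane) φ (⌈s⌉₊)
  have h2 : Integrable fun ξ : Plane => ‖φ ξ‖ + ‖ξ‖ ^ ⌈s⌉₊ * ‖φ ξ‖ := φ.integrable.norm.add h1
  refine h2.mono' ?_ (Eventually.of_forall fun ξ => ?_)
  · exact ((Complex.continuous_ofReal.comp (continuous_norm.rpow_const fun _ =>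
      Or.inr hs.le)).mul φ.continuous).aestronglyMeasurable
  · rw [norm_mul, Complex.norm_real, Real.norm_of_nonneg (by positivity), ← one_add_mul]
    refine mul_le_mul_of_nonneg_right ?_ (norm_nonneg _)
    rcases le_total ‖ξ‖ 1 with h | h
    · have := Real.rpow_le_one (norm_nonneg ξ) h hs.le
      have : 0 ≤ ‖ξ‖ ^ ⌈s⌉₊ := by positivity
      linarith
    · have h3 : ‖ξ‖ ^ s ≤ ‖ξ‖ ^ (⌈s⌉₊ : ℝ) := Real.rpow_le_rpow_of_exponent_le h (Nat.le_ceil s)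
      rw [Real.rpow_natCast] at h3
      linarith

/-- A continuous function of polynomial growth as a tempered distribution. -/
theorem exists_distribution_of_bound {r B : ℝ} {b : Plane → ℂ} (hb : Continuous b)
    (hB : ∀ ξ, ‖b ξ‖ ≤ B * (1 + ‖ξ‖ ^ 2) ^ r) :
    ∃ S : 𝓢'(Plane, ℂ), ∀ φ : 𝓢(Plane, ℂ), S φ = ∫ ξ, φ ξ * b ξ := by
  set w : Plane → ℝ := fun ξ => (1 + ‖ξ‖ ^ 2) ^ r with hw
  have hwpos : ∀ ξ, 0 < w ξ := fun ξ => Real.rpow_pos_of_pos (by positivity) r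
  have hwt : (fun ξ : Plane => (w ξ : ℂ)).HasTemperateGrowth :=
    Function.HasTemperateGrowth.comp Function.Complex.hasTemperateGrowth_ofReal
      (Function.hasTemperateGrowth_one_add_norm_sq_rpow Plane r)
  have hwc : Continuous fun ξ : Plane => (w ξ : ℂ) := hwt.1.continuous
  -- Division by a weight of temperate growth gives a bounded function, which is a tempered
  -- distribution; the weight is then multiplied back.
  have hmem : MemLp (fun ξ => b ξ / w ξ) ⊤ := by
    refine memLp_top_of_bound (hb.div hwc fun ξ => ?_).aestronglyMeasurable B
      (Eventually.of_forall fun ξ => ?_)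
    · exact_mod_cast (hwpos ξ).ne'
    · rw [norm_div, Complex.norm_real, Real.norm_of_nonneg (hwpos ξ).le, div_le_iff₀ (hwpos ξ)]
      exact hB ξ
  refine ⟨TemperedDistribution.smulLeftCLM ℂ (fun ξ : Plane => (w ξ : ℂ))
    (MeasureTheory.Lp.toTemperedDistribution (hmem.toLp _)), fun φ => ?_⟩
  rw [TemperedDistribution.smulLeftCLM_apply_apply, Lp.toTemperedDistribution_apply]
  refine integral_congr_ae ?_
  filter_upwards [hmem.coeFn_toLp] with ξ hξ
  rw [hξ, SchwartzMap.smulLeftCLM_apply_apply hwt, smul_eq_mul, smul_eq_mul]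
  have : (w ξ : ℂ) ≠ 0 := by exact_mod_cast (hwpos ξ).ne'
  field_simp

theorem fourier_sub_of_integrable {f g : Plane → ℂ} (hf : Integrable f) (hg : Integrable g) :
    𝓕 (f - g) = 𝓕 f - 𝓕 g := by
  ext ξ
  rw [Pi.sub_apply, Real.fourier_eq, Real.fourier_eq, Real.fourier_eq,
    ← integral_sub ((Real.fourierIntegral_convergent_iff ξ).2 hf)
      ((Real.fourierIntegral_convergent_iff ξ).2 hg)]
  simp only [Pi.sub_apply, smul_sub]

theorem mfun_norm_rpow_sub {s : ℝ} (hs : 0 < s) (f g : 𝓢(Plane, ℂ)) :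
    mfun (fun ξ => ((‖ξ‖ ^ s : ℝ) : ℂ)) (f - g) =
      mfun (fun ξ => ((‖ξ‖ ^ s : ℝ) : ℂ)) f - mfun (fun ξ => ((‖ξ‖ ^ s : ℝ) : ℂ)) g := by
  have h1 : 𝓕 (f - g) = 𝓕 f - 𝓕 g := map_sub (FourierTransform.fourierCLM ℂ 𝓢(Plane, ℂ)) f g
  have h2 := fun f : 𝓢(Plane, ℂ) => integrable_norm_rpow_mul hs (𝓕 f)
  ext x
  rw [mfun, mfun, mfun, Pi.sub_apply, Real.fourierInv_eq_fourier_neg,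
    Real.fourierInv_eq_fourier_neg, Real.fourierInv_eq_fourier_neg, ← Pi.sub_apply,
    ← fourier_sub_of_integrable (h2 f) (h2 g)]
  have e : (fun ξ : Plane => ((‖ξ‖ ^ s : ℝ) : ℂ) * 𝓕 (f - g) ξ) =
      (fun ξ => ((‖ξ‖ ^ s : ℝ) : ℂ) * 𝓕 f ξ) - fun ξ => ((‖ξ‖ ^ s : ℝ) : ℂ) * 𝓕 g ξ := by
    ext ξ
    rw [h1, sub_apply, Pi.sub_apply, mul_sub]
  rw [e]

/-- Convergence in L^1 gives uniform convergence of the transforms. This identifies the L^p limit of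
the fractional derivatives of the approximations with the distribution |ξ|^s 𝓕f. -/
theorem tendsto_mform_of_tendsto_one {m : Plane → ℂ} (hm : Continuous m)
    (hmi : ∀ φ : 𝓢(Plane, ℂ), Integrable fun ξ => m ξ * φ ξ) {f : Plane → ℂ}
    (hf : Integrable f) {φ : ℕ → 𝓢(Plane, ℂ)}
    (h : Tendsto (fun n => eLpNorm (⇑(φ n) - f) 1) atTop (𝓝 0)) (ψ : 𝓢(Plane, ℂ)) :
    Tendsto (fun n => mform m (φ n) ψ) atTop (𝓝 (∫ ξ, m ξ * (𝓕 f ξ * 𝓕⁻ ψ ξ))) := by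
  have hcf : Continuous (𝓕 f) := VectorFourier.fourierIntegral_continuous
    Real.continuous_fourierChar (by exact continuous_inner) hf
  have hbd : ∀ (n : ℕ) (ξ : Plane), ‖𝓕 (φ n) ξ - 𝓕 f ξ‖ ≤ ∫ x, ‖φ n x - f x‖ := by
    intro n ξ
    have e1 : 𝓕 (φ n) ξ - 𝓕 f ξ = 𝓕 (⇑(φ n) - f) ξ := by
      rw [fourier_sub_of_integrable (φ n).integrable hf, SchwartzMap.fourier_coe, Pi.sub_apply]
    rw [e1]
    exact VectorFourier.norm_fourierIntegral_le_integral_norm _ _ _ _ _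
  have hz : Tendsto (fun n => ∫ x, ‖φ n x - f x‖) atTop (𝓝 0) := by
    have h1 := (ENNReal.tendsto_toReal ENNReal.zero_ne_top).comp h
    rw [ENNReal.toReal_zero] at h1
    refine h1.congr fun n => ?_
    rw [Function.comp_apply, eLpNorm_one_eq_lintegral_enorm]
    exact (integral_norm_eq_lintegral_enorm ((φ n).integrable.1.sub hf.1)).symm
  obtain ⟨B, hB⟩ := hz.bddAbove_range
  have hB' : ∀ n, ∫ x, ‖φ n x - f x‖ ≤ B := fun n => hB ⟨n, rfl⟩
  have hψ : Integrable fun ξ => ‖m ξ * 𝓕⁻ ψ ξ‖ := (hmi (𝓕⁻ ψ)).norm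
  have hfb : ∀ ξ, ‖𝓕 f ξ‖ ≤ ∫ x, ‖f x‖ := fun ξ =>
    VectorFourier.norm_fourierIntegral_le_integral_norm _ _ _ _ _
  refine tendsto_integral_of_dominated_convergence
    (fun ξ => (B + ∫ x, ‖f x‖) * ‖m ξ * 𝓕⁻ ψ ξ‖) (fun n => ?_) (hψ.const_mul _)
    (fun n => Eventually.of_forall fun ξ => ?_) (Eventually.of_forall fun ξ => ?_)
  · exact (hm.mul ((𝓕 (φ n)).continuous.mul (𝓕⁻ ψ).continuous)).aestronglyMeasurable
  · rw [norm_mul, norm_mul, norm_mul, mul_left_comm]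
    refine mul_le_mul_of_nonneg_right ?_ (by positivity)
    calc ‖𝓕 (φ n) ξ‖ = ‖(𝓕 (φ n) ξ - 𝓕 f ξ) + 𝓕 f ξ‖ := by rw [sub_add_cancel]
      _ ≤ _ := (norm_add_le _ _).trans (add_le_add ((hbd n ξ).trans (hB' n)) (hfb ξ))
  · refine (Tendsto.mul_const _ ?_).const_mul _
    rw [tendsto_iff_norm_sub_tendsto_zero]
    exact squeeze_zero (fun _ => norm_nonneg _) (fun n => hbd n ξ) hz

/-- Fractional regularity of a bounded function of compact support from its weak derivatives. -/
theorem exists_fourierSobolevBound {p : ℝ≥0∞} (hp1 : 1 ≤ p) (hp : p ≠ ⊤) {s : ℝ} (hs : 0 < s)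
    {k : ℕ} (hsk : s < k ∨ s = k ∧ 1 < p) :
    ∃ A : ℝ≥0, ∀ t₀ : ℝ, 0 < t₀ → ∀ (f : Plane → ℝ) (M R : ℝ), AEStronglyMeasurable f →
      (∀ᵐ x, |f x| ≤ M) → (∀ x, R < ‖x‖ → f x = 0) →
      ∀ G : Fin 2 → Plane → ℝ, (∀ j, MemLp (G j) p) → (∀ j, HasWeak k (weight k j) f (G j)) →
      ∀ C : ℝ≥0, A * (ENNReal.ofReal (t₀ ^ (-s / 2)) * eLpNorm f p +
        ENNReal.ofReal (t₀ ^ ((k - s) / 2)) * ∑ j, eLpNorm (G j) p) ≤ C →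
      FourierSobolevBound s p f C := by
  obtain ⟨A, hA⟩ := exists_eLpNorm_mfun_norm_rpow_le hp1 hp hs hsk
  refine ⟨A, fun t₀ ht₀ f M R hf hM hR G hG hw C hC => ?_⟩
  obtain ⟨φ, hφp, hφ1, hφG⟩ := exists_schwartz_approx hp1 hp hf hM hR hG hw
  have hfi : Integrable f := memLp_one_iff_integrable.1 (memLp_of_bounded_of_support hf hM hR 1)
  have hfC : Integrable fun x => (f x : ℂ) := hfi.ofReal
  have hf1 : MemLp (fun x => (f x : ℂ)) 1 := memLp_one_iff_integrable.2 hfC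
  have hfp : MemLp (fun x => (f x : ℂ)) p := (memLp_of_bounded_of_support hf hM hR p).ofReal
  have hfn : eLpNorm (fun x => (f x : ℂ)) p = eLpNorm f p :=
    eLpNorm_congr_norm_ae (Eventually.of_forall fun x => by simp)
  set g' : Plane → ℂ := fun x => (f x : ℂ) with hg'
  obtain ⟨H, hHp, hHn, hHt⟩ : ∃ H : Fin 2 → Plane → ℂ, (∀ j, MemLp (H j) p) ∧
      (∀ j, eLpNorm (H j) p ≤ eLpNorm (G j) p) ∧
      ∀ j, Tendsto (fun n => eLpNorm (⇑(SchwartzMap.fourierMultiplierCLM ℂ (esym k j) (φ n)) -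
        H j) p) atTop (𝓝 0) := by
    -- As |2πi| ≥ 1, passing from derivatives to the multiplier `esym` does not increase norms.
    have hc : ‖(2 * Real.pi * Complex.I : ℂ)⁻¹ ^ k‖ ≤ 1 := by
      rw [norm_pow, norm_inv]
      refine pow_le_one₀ (by positivity) (inv_le_one_of_one_le₀ ?_)
      rw [norm_mul, norm_mul, Complex.norm_I, Complex.norm_real, Real.norm_of_nonneg Real.pi_nonneg]
      norm_num
      linarith [Real.pi_gt_three]
    refine ⟨_, fun j => (hG j).ofReal.const_mul _, fun j => ?_, hφG⟩
    refine eLpNorm_mono fun x => ?_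
    rw [norm_mul, RCLike.norm_ofReal]
    exact mul_le_of_le_one_left (abs_nonneg _) hc
  set E : Fin 2 → 𝓢(Plane, ℂ) → 𝓢(Plane, ℂ) :=
    fun j φ => SchwartzMap.fourierMultiplierCLM ℂ (esym k j) φ with hE
  set m : Plane → ℂ := fun ξ => ((‖ξ‖ ^ s : ℝ) : ℂ) with hm
  have hmc : Continuous m := Complex.continuous_ofReal.comp (continuous_norm.rpow_const fun _ =>
      Or.inr hs.le)
  have hmi : ∀ φ : 𝓢(Plane, ℂ), Integrable fun ξ => m ξ * φ ξ := integrable_norm_rpow_mul hs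
  have hvc : ∀ φ : 𝓢(Plane, ℂ), Continuous (mfun m φ) := fun φ =>
    continuous_fourierInv_of_integrable (hmi _)
  set a := ENNReal.ofReal (t₀ ^ (-s / 2))
  set b := ENNReal.ofReal (t₀ ^ ((k - s) / 2))
  have hA' : ∀ φ : 𝓢(Plane, ℂ), eLpNorm (mfun m φ) p ≤
      A * (a * eLpNorm φ p + b * ∑ j, eLpNorm (E j φ) p) := hA t₀ ht₀
  have hvm : ∀ φ : 𝓢(Plane, ℂ), MemLp (mfun m φ) p := by
    intro φ
    refine ⟨(hvc φ).aestronglyMeasurable, (hA' φ).trans_lt ?_⟩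
    refine ENNReal.mul_lt_top ENNReal.coe_lt_top (ENNReal.add_lt_top.2
      ⟨ENNReal.mul_lt_top ENNReal.ofReal_lt_top (φ.memLp p volume).2,
      ENNReal.mul_lt_top ENNReal.ofReal_lt_top (ENNReal.sum_lt_top.2 fun j _ =>
        ((E j φ).memLp p volume).2)⟩)
  -- The interpolation estimate is linear in the zeroth and k-th order norms, so applied to
  -- differences it turns the two known convergences into a Cauchy bound for the fractional
  -- derivatives.
  set β : ℕ → ℝ≥0∞ := fun n => A * (a * eLpNorm (⇑(φ n) - g') p +
    b * ∑ j, eLpNorm (⇑(E j (φ n)) - H j) p) with hβ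
  have hβ0 : Tendsto β atTop (𝓝 0) := by
    have h1 : Tendsto (fun n => ∑ j, eLpNorm (⇑(E j (φ n)) - H j) p) atTop (𝓝 0) := by
      have := tendsto_finsetSum Finset.univ fun j (_ : j ∈ Finset.univ) => hHt j
      simpa using this
    have h2 := ENNReal.Tendsto.const_mul (a := (A : ℝ≥0∞)) ((ENNReal.Tendsto.const_mul (a := a) hφp
      (Or.inr ENNReal.ofReal_ne_top)).add (ENNReal.Tendsto.const_mul (a := b) h1
      (Or.inr ENNReal.ofReal_ne_top))) (Or.inr ENNReal.coe_ne_top)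
    rw [mul_zero, mul_zero, add_zero, mul_zero] at h2
    exact h2
  have hsub : ∀ (u v w : Plane → ℂ), MemLp u p → MemLp v p → MemLp w p →
      eLpNorm (u - v) p ≤ eLpNorm (u - w) p + eLpNorm (v - w) p := by
    intro u v w hu hv hw
    have h1 : u - v = (u - w) - (v - w) := by rw [sub_sub_sub_cancel_right]
    rw [h1]
    exact eLpNorm_sub_le (hu.1.sub hw.1) (hv.1.sub hw.1) hp1
  have hcau : ∀ n l, eLpNorm (mfun m (φ n) - mfun m (φ l)) p ≤ β n + β l := by
    intro n l
    rw [← mfun_norm_rpow_sub hs]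
    refine (hA' _).trans ?_
    rw [hβ, ← mul_add]
    refine mul_le_mul' le_rfl ?_
    rw [add_add_add_comm, ← mul_add, ← mul_add, ← Finset.sum_add_distrib]
    refine add_le_add (mul_le_mul' le_rfl ?_) (mul_le_mul' le_rfl (Finset.sum_le_sum fun j _ => ?_))
    · exact hsub _ _ _ ((φ n).memLp p volume) ((φ l).memLp p volume) hfp
    · have h1 : (⇑(E j (φ n - φ l)) : Plane → ℂ) = ⇑(E j (φ n)) - ⇑(E j (φ l)) := by
        rw [hE]; ext x; simp only [map_sub, sub_apply, Pi.sub_apply]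
      rw [h1]
      exact hsub _ _ _ ((E j (φ n)).memLp p volume) ((E j (φ l)).memLp p volume) (hHp j)
  obtain ⟨g, hg, hlim⟩ := exists_limit_eLpNorm hp1 (fun n => hvm (φ n)) hβ0 hcau
  have hgC : eLpNorm g p ≤ C := by
    refine (eLpNorm_le_of_tendsto hp1 (fun n => (hvm (φ n)).1) hg.1 hlim (b := β)
      (fun n => ?_) hβ0).trans hC
    refine (hA' _).trans ?_
    rw [hβ, ← mul_add]
    refine mul_le_mul' le_rfl ?_
    rw [add_add_add_comm, ← mul_add, ← mul_add, ← Finset.sum_add_distrib, ← hfn]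
    have htri : ∀ u w : Plane → ℂ, MemLp u p → MemLp w p →
        eLpNorm u p ≤ eLpNorm w p + eLpNorm (u - w) p := by
      intro u w hu hw
      have h1 := eLpNorm_le_add_eLpNorm_sub hp1 hw.1 hu.1
      rwa [eLpNorm_sub_comm] at h1
    refine add_le_add (mul_le_mul' le_rfl ?_) (mul_le_mul' le_rfl (Finset.sum_le_sum fun j _ => ?_))
    · exact htri _ _ ((φ n).memLp p volume) hfp
    · exact (htri _ _ ((E j (φ n)).memLp p volume) (hHp j)).trans (add_le_add (hHn j) le_rfl)
  have hh : Continuous (𝓕 g') := VectorFourier.fourierIntegral_continuous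
    Real.continuous_fourierChar (by exact continuous_inner) hfC
  have hhb : ∀ ξ, ‖𝓕 g' ξ‖ ≤ ∫ x, ‖g' x‖ := fun ξ =>
    VectorFourier.norm_fourierIntegral_le_integral_norm _ _ _ _ _
  have hF : ∀ ψ : 𝓢(Plane, ℂ),
      MeasureTheory.Lp.toTemperedDistribution (hf1.toLp g') ψ = ∫ x, ψ x * g' x := by
    intro ψ
    rw [Lp.toTemperedDistribution_apply]
    refine integral_congr_ae ?_
    filter_upwards [hf1.coeFn_toLp] with x hx
    rw [hx, smul_eq_mul]
  obtain ⟨S, hS⟩ := exists_distribution_of_bound (r := s / 2) (B := ∫ x, ‖g' x‖) (hmc.mul hh)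
    fun ξ => by
      rw [Pi.mul_apply, norm_mul, mul_comm]
      refine mul_le_mul (hhb ξ) ?_ (norm_nonneg _) (integral_nonneg fun _ => norm_nonneg _)
      rw [hm, Complex.norm_real, Real.norm_of_nonneg (by positivity)]
      calc ‖ξ‖ ^ s = (‖ξ‖ ^ 2) ^ (s / 2) := by
            rw [← Real.rpow_natCast, ← Real.rpow_mul (norm_nonneg _)]; congr 1; push_cast; ring
        _ ≤ _ := Real.rpow_le_rpow (by positivity) (by linarith) (by positivity)
  -- All the data are explicit: F is f as an element of L^1, h its continuous transform, S the
  -- function |ξ|^s h of polynomial growth, and g the L^p limit found above.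
  refine ⟨_, S, 𝓕 g', g, ⟨hfC.locallyIntegrable, fun ψ _ => hF ψ⟩,
    ⟨hh.locallyIntegrable, fun ψ _ => ?_⟩, ⟨(hmc.mul hh).locallyIntegrable, fun ψ _ => hS ψ⟩,
    ⟨hg.locallyIntegrable hp1, fun ψ _ => ?_⟩, hg, hgC⟩
  · rw [TemperedDistribution.fourier_apply, hF]
    have h1 := integral_fourier_mul hfC ψ
    calc ∫ x, 𝓕 ψ x * g' x = ∫ x, g' x * 𝓕 ψ x := by congr 1; ext x; ring
      _ = _ := by rw [← h1]; congr 1; ext x; ring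
  · rw [TemperedDistribution.fourierInv_apply, hS]
    have hpq : p.HolderConjugate p.conjExponent := ENNReal.HolderConjugate.conjExponent hp1
    have h1 := tendsto_integral_mul_of_eLpNorm (q := p.conjExponent) (fun n => hvm (φ n)) hg
      (ψ.memLp _ volume) hlim
    have h2 := tendsto_mform_of_tendsto_one hmc hmi hfC hφ1 ψ
    have h3 := tendsto_nhds_unique h2 (h1.congr fun n => integral_mfun_mul (hmi _) ψ)
    calc ∫ ξ, 𝓕⁻ ψ ξ * (m ξ * 𝓕 g' ξ) = ∫ ξ, m ξ * (𝓕 g' ξ * 𝓕⁻ ψ ξ) := by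
          congr 1; ext ξ; ring
      _ = ∫ x, g x * ψ x := h3
      _ = _ := by congr 1; ext x; ring

/-! ### Tilings, patched functions and their divergence. -/

theorem map_smul_sub {a : ℝ} (ha : a ≠ 0) (r : Plane) :
    Measure.map (fun x : Plane => a • (x - r)) volume =
      ENNReal.ofReal ((a ^ 2)⁻¹) • (volume : Measure Plane) := by
  have h1 : (fun x : Plane => a • (x - r)) = (fun x => a • x) ∘ fun x => x - r := rfl
  rw [h1, ← Measure.map_map (measurable_const_smul a) (measurable_sub_const r),
    (measurePreserving_sub_right volume r).map_eq, Measure.map_addHaar_smul _ ha]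
  simp

theorem quasiMeasurePreserving_smul_sub {a : ℝ} (ha : a ≠ 0) (r : Plane) :
    Measure.QuasiMeasurePreserving (fun x : Plane => a • (x - r)) volume volume :=
  ⟨by fun_prop, by rw [map_smul_sub ha]; exact Measure.smul_absolutelyContinuous⟩

theorem integral_comp_smul_sub {E : Type*} [NormedAddCommGroup E] [NormedSpace ℝ E] (a : ℝ)
    (r : Plane) (F : Plane → E) :
    ∫ x, F (a • (x - r)) = (a ^ 2)⁻¹ • ∫ y, F y := by
  rw [integral_sub_right_eq_self (fun x => F (a • x)), Measure.integral_comp_smul]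
  simp

theorem lintegral_comp_smul_sub {a : ℝ} (ha : a ≠ 0) (r : Plane) {F : Plane → ℝ≥0∞}
    (hF : AEMeasurable F) :
    ∫⁻ x, F (a • (x - r)) = ENNReal.ofReal ((a ^ 2)⁻¹) * ∫⁻ y, F y := by
  have h1 := lintegral_map' (μ := volume) (f := F) (g := fun x : Plane => a • (x - r))
    (by rw [map_smul_sub ha]; exact hF.smul_measure _) (by fun_prop)
  rw [← h1, map_smul_sub ha, lintegral_smul_measure, smul_eq_mul]

/-- Patching of rescaled copies on the tiles of side `1 / K`. -/
noncomputable def snap {E : Type*} [AddCommGroup E] [Module ℝ E] (K : ℕ) (c : ℝ)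
    (w : (Fin 2 → Fin K) → Plane → E) (x : Plane) : E :=
  ∑ Q, (tile K Q).indicator (fun x' => c • w Q ((K : ℝ) • (x' - tileCenter K Q))) x

theorem isOpen_unitSquare : IsOpen unitSquare := by
  have : unitSquare = ⋂ i, {x : Plane | -1 / 2 < x i ∧ x i < 1 / 2} := by
    ext x; simp [unitSquare]
  rw [this]
  refine isOpen_iInter_of_finite fun i => ?_
  have hc : Continuous fun x : Plane => x i := by fun_prop
  exact (isOpen_lt continuous_const hc).inter (isOpen_lt hc continuous_const)

theorem isOpen_tile (K : ℕ) (Q : Fin 2 → Fin K) : IsOpen (tile K Q) := by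
  have : tile K Q = ⋂ i, {x : Plane | -1 / 2 + (Q i : ℝ) / K < x i ∧
      x i < -1 / 2 + ((Q i : ℝ) + 1) / K} := by
    ext x; simp [tile]
  rw [this]
  refine isOpen_iInter_of_finite fun i => ?_
  have hc : Continuous fun x : Plane => x i := by fun_prop
  exact (isOpen_lt continuous_const hc).inter (isOpen_lt hc continuous_const)

theorem mem_tile_iff_floor {K : ℕ} (hK : 0 < K) {Q : Fin 2 → Fin K} {x : Plane} :
    x ∈ tile K Q ↔ ∀ i, (Q i : ℝ) < K * (x i + 1 / 2) ∧ K * (x i + 1 / 2) < (Q i : ℝ) + 1 := by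
  have hK' : (0 : ℝ) < K := by exact_mod_cast hK
  refine forall_congr' fun i => and_congr ?_ ?_
  · rw [← div_lt_iff₀' hK']
    constructor <;> intro h <;> linarith
  · rw [← lt_div_iff₀' hK']
    constructor <;> intro h <;> linarith

theorem mem_tile_iff {K : ℕ} (hK : 0 < K) {Q : Fin 2 → Fin K} {x : Plane} :
    x ∈ tile K Q ↔ (K : ℝ) • (x - tileCenter K Q) ∈ unitSquare := by
  have hK' : (0 : ℝ) < K := by exact_mod_cast hK
  rw [mem_tile_iff_floor hK]
  refine forall_congr' fun i => ?_
  have h1 : ((K : ℝ) • (x - tileCenter K Q)) i = K * (x i + 1 / 2) - ((Q i : ℝ) + 1 / 2) := by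
    simp only [tileCenter, PiLp.smul_apply, PiLp.sub_apply, smul_eq_mul]
    field_simp
    ring
  rw [h1]
  constructor <;> rintro ⟨h2, h3⟩ <;> constructor <;> linarith

theorem tile_unique {K : ℕ} (hK : 0 < K) {Q Q' : Fin 2 → Fin K} {x : Plane} (h : x ∈ tile K Q)
    (h' : x ∈ tile K Q') : Q' = Q := by
  rw [mem_tile_iff_floor hK] at h h'
  ext i
  have h1 : (Q i : ℝ) < (Q' i : ℝ) + 1 := (h i).1.trans (h' i).2
  have h2 : (Q' i : ℝ) < (Q i : ℝ) + 1 := (h' i).1.trans (h i).2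
  have h3 : (Q i : ℕ) < (Q' i : ℕ) + 1 := by exact_mod_cast h1
  have h4 : (Q' i : ℕ) < (Q i : ℕ) + 1 := by exact_mod_cast h2
  omega

theorem tile_subset_unitSquare {K : ℕ} (hK : 0 < K) (Q : Fin 2 → Fin K) :
    tile K Q ⊆ unitSquare := by
  intro x hx
  rw [mem_tile_iff_floor hK] at hx
  intro i
  have hK' : (0 : ℝ) < K := by exact_mod_cast hK
  have h1 : (0 : ℝ) ≤ (Q i : ℝ) := by positivity
  have h2 : (Q i : ℝ) + 1 ≤ K := by exact_mod_cast (Q i).2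
  obtain ⟨h3, h4⟩ := hx i
  have h5 : 0 < x i + 1 / 2 := by
    by_contra h
    have := mul_nonpos_of_nonneg_of_nonpos hK'.le (not_lt.1 h)
    linarith
  have h6 : x i + 1 / 2 < 1 := by
    by_contra h
    have := mul_le_mul_of_nonneg_left (not_lt.1 h) hK'.le
    linarith
  constructor <;> linarith

theorem snap_of_mem {E : Type*} [AddCommGroup E] [Module ℝ E] {K : ℕ} (hK : 0 < K) (c : ℝ)
    (w : (Fin 2 → Fin K) → Plane → E) {Q : Fin 2 → Fin K} {x : Plane} (hx : x ∈ tile K Q) :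
    snap K c w x = c • w Q ((K : ℝ) • (x - tileCenter K Q)) := by
  rw [snap, Finset.sum_eq_single Q, indicator_of_mem hx]
  · intro Q' _ hQ'
    exact indicator_of_notMem (fun h => hQ' (tile_unique hK hx h)) _
  · intro h; exact absurd (Finset.mem_univ Q) h

theorem snap_of_forall_notMem {E : Type*} [AddCommGroup E] [Module ℝ E] {K : ℕ} (c : ℝ)
    (w : (Fin 2 → Fin K) → Plane → E) {x : Plane} (hx : ∀ Q, x ∉ tile K Q) :
    snap K c w x = 0 :=
  Finset.sum_eq_zero fun Q _ => indicator_of_notMem (hx Q) _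

theorem snap_eq_zero {E : Type*} [AddCommGroup E] [Module ℝ E] {K : ℕ} (hK : 0 < K) (c : ℝ)
    (w : (Fin 2 → Fin K) → Plane → E) {x : Plane} (hx : x ∉ unitSquare) :
    snap K c w x = 0 :=
  snap_of_forall_notMem c w fun Q h => hx (tile_subset_unitSquare hK Q h)

theorem norm_le_one_of_mem_unitSquare {x : Plane} (hx : x ∈ unitSquare) : ‖x‖ ≤ 1 := by
  have h0 := hx 0
  have h1 := hx 1
  have h : ‖x‖ ^ 2 ≤ 1 := by
    rw [EuclideanSpace.real_norm_sq_eq, Fin.sum_univ_two]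
    nlinarith
  nlinarith [norm_nonneg x]

theorem ae_apply_ne (i : Fin 2) (a : ℝ) : ∀ᵐ x : Plane, x i ≠ a := by
  have h1 : Measure.QuasiMeasurePreserving (fun x : Plane => x i) volume volume :=
    (Measure.quasiMeasurePreserving_eval (fun _ : Fin 2 => (volume : Measure ℝ)) i).comp
      (EuclideanSpace.volume_preserving_symm_measurableEquiv_toLp (Fin 2)).quasiMeasurePreserving
  exact h1.ae (compl_mem_ae_iff.2 (measure_singleton a))

/-- The closed unit square. -/
def closedSquare : Set Plane := {x | ∀ i, -1 / 2 ≤ x i ∧ x i ≤ 1 / 2}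

theorem isClosed_closedSquare : IsClosed closedSquare := by
  have : closedSquare = ⋂ i, {x : Plane | -1 / 2 ≤ x i ∧ x i ≤ 1 / 2} := by
    ext x; simp [closedSquare]
  rw [this]
  refine isClosed_iInter fun i => ?_
  have hc : Continuous fun x : Plane => x i := by fun_prop
  exact (isClosed_le continuous_const hc).inter (isClosed_le hc continuous_const)

theorem unitSquare_subset_closedSquare : unitSquare ⊆ closedSquare :=
  fun _ hx i => ⟨(hx i).1.le, (hx i).2.le⟩

theorem exists_mem_tile {K : ℕ} (hK : 0 < K) {x : Plane} (hx : x ∈ closedSquare)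
    (h : ∀ (i : Fin 2) (n : Fin (K + 1)), x i ≠ -1 / 2 + (n : ℝ) / K) : ∃ Q, x ∈ tile K Q := by
  have hK' : (0 : ℝ) < K := by exact_mod_cast hK
  have h0 : ∀ i, 0 ≤ K * (x i + 1 / 2) := fun i =>
    mul_nonneg hK'.le (by linarith [(hx i).1])
  have h1 : ∀ i, K * (x i + 1 / 2) < K := fun i => by
    have h2 : x i ≠ 1 / 2 := by
      have := h i (Fin.last K)
      rw [Fin.val_last, div_self hK'.ne'] at this
      intro h3; apply this; rw [h3]; norm_num
    have h3 : x i < 1 / 2 := lt_of_le_of_ne (hx i).2 h2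
    nlinarith
  have h2 : ∀ i, ⌊K * (x i + 1 / 2)⌋₊ < K := fun i => (Nat.floor_lt (h0 i)).2 (h1 i)
  refine ⟨fun i => ⟨⌊K * (x i + 1 / 2)⌋₊, h2 i⟩, (mem_tile_iff_floor hK).2 fun i => ⟨?_, ?_⟩⟩
  · refine lt_of_le_of_ne (Nat.floor_le (h0 i)) fun h3 => ?_
    refine h i ⟨⌊K * (x i + 1 / 2)⌋₊, (h2 i).trans (Nat.lt_succ_self K)⟩ ?_
    simp only at h3 ⊢
    rw [h3]
    field_simp
    ring
  · exact Nat.lt_floor_add_one _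

/-- The exceptional points of the closed square lie on finitely many grid lines. -/
theorem ae_mem_tile_or {K : ℕ} (hK : 0 < K) :
    ∀ᵐ x : Plane, (∃ Q, x ∈ tile K Q) ∨ x ∉ closedSquare := by
  have h1 : ∀ᵐ x : Plane, ∀ (i : Fin 2) (n : Fin (K + 1)), x i ≠ -1 / 2 + (n : ℝ) / K :=
    ae_all_iff.2 fun i => ae_all_iff.2 fun n => ae_apply_ne i _
  filter_upwards [h1] with x hx
  by_cases h : x ∈ closedSquare
  · exact Or.inl (exists_mem_tile hK h hx)
  · exact Or.inr h

theorem aestronglyMeasurable_snap {E : Type*} [NormedAddCommGroup E] [NormedSpace ℝ E] {K : ℕ}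
    (hK : 0 < K) (c : ℝ) {w : (Fin 2 → Fin K) → Plane → E}
    (hw : ∀ Q, AEStronglyMeasurable (w Q)) : AEStronglyMeasurable (snap K c w) := by
  have hK' : (K : ℝ) ≠ 0 := by exact_mod_cast hK.ne'
  have h1 : snap K c w = ∑ Q, (tile K Q).indicator
      (fun x' => c • w Q ((K : ℝ) • (x' - tileCenter K Q))) := by
    ext x; rw [snap, Finset.sum_apply]
  rw [h1]
  refine Finset.aestronglyMeasurable_sum _ fun Q _ => ?_
  refine AEStronglyMeasurable.indicator ?_ (isOpen_tile K Q).measurableSet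
  exact ((hw Q).comp_quasiMeasurePreserving (quasiMeasurePreserving_smul_sub hK' _)).const_smul c

theorem ae_norm_snap_le {E : Type*} [NormedAddCommGroup E] [NormedSpace ℝ E] {K : ℕ}
    (hK : 0 < K) (c : ℝ) {w : (Fin 2 → Fin K) → Plane → E} {M : ℝ} (hM0 : 0 ≤ M)
    (hw : ∀ Q, ∀ᵐ x, ‖w Q x‖ ≤ M) : ∀ᵐ x, ‖snap K c w x‖ ≤ |c| * M := by
  have hK' : (K : ℝ) ≠ 0 := by exact_mod_cast hK.ne'
  have h1 : ∀ᵐ x : Plane, ∀ Q, ‖w Q ((K : ℝ) • (x - tileCenter K Q))‖ ≤ M :=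
    ae_all_iff.2 fun Q => (quasiMeasurePreserving_smul_sub hK' _).ae (hw Q)
  filter_upwards [h1] with x hx
  by_cases h : ∃ Q, x ∈ tile K Q
  · obtain ⟨Q, hQ⟩ := h
    rw [snap_of_mem hK c w hQ, norm_smul, Real.norm_eq_abs]
    exact mul_le_mul_of_nonneg_left (hx Q) (abs_nonneg c)
  · rw [snap_of_forall_notMem c w (not_exists.1 h), norm_zero]
    positivity

/-- Each of the K² disjoint tiles contributes K^(-2) times the integral of one unscaled copy, so the
bound is that of a single copy and K drops out. -/
theorem eLpNorm_snap_le {E : Type*} [NormedAddCommGroup E] [NormedSpace ℝ E] {K : ℕ}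
    (hK : 0 < K) (c : ℝ) {w : (Fin 2 → Fin K) → Plane → E} {p : ℝ≥0∞} (hp1 : 1 ≤ p) (hp : p ≠ ⊤)
    (hw : ∀ Q, AEStronglyMeasurable (w Q)) {B : ℝ≥0∞} (hB : ∀ Q, eLpNorm (w Q) p ≤ B) :
    eLpNorm (snap K c w) p ≤ ‖c‖ₑ * B := by
  have hK' : (K : ℝ) ≠ 0 := by exact_mod_cast hK.ne'
  have hp0 : p ≠ 0 := (zero_lt_one.trans_le hp1).ne'
  have hpr : 0 < p.toReal := ENNReal.toReal_pos hp0 hp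
  rw [← ENNReal.rpow_le_rpow_iff hpr, eLpNorm_eq_lintegral_rpow_enorm_toReal hp0 hp,
    one_div, ENNReal.rpow_inv_rpow hpr.ne']
  have h1 : ∀ Q, ∫⁻ x, ‖c • w Q ((K : ℝ) • (x - tileCenter K Q))‖ₑ ^ p.toReal ≤
      ENNReal.ofReal (((K : ℝ) ^ 2)⁻¹) * (‖c‖ₑ * B) ^ p.toReal := by
    intro Q
    have h2 := lintegral_comp_smul_sub hK' (tileCenter K Q)
      (F := fun y => ‖c • w Q y‖ₑ ^ p.toReal) (((hw Q).const_smul c).enorm.pow_const _)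
    rw [h2]
    refine mul_le_mul' le_rfl ?_
    have h3 : eLpNorm (c • w Q) p ≤ ‖c‖ₑ * B := by
      rw [eLpNorm_const_smul]; exact mul_le_mul' le_rfl (hB Q)
    rw [← ENNReal.rpow_le_rpow_iff hpr, eLpNorm_eq_lintegral_rpow_enorm_toReal hp0 hp,
      one_div, ENNReal.rpow_inv_rpow hpr.ne'] at h3
    exact h3
  calc ∫⁻ x, ‖snap K c w x‖ₑ ^ p.toReal
      ≤ ∫⁻ x, ∑ Q, ‖c • w Q ((K : ℝ) • (x - tileCenter K Q))‖ₑ ^ p.toReal := by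
        refine lintegral_mono fun x => ?_
        by_cases h : ∃ Q, x ∈ tile K Q
        · obtain ⟨Q, hQ⟩ := h
          rw [snap_of_mem hK c w hQ]
          exact Finset.single_le_sum
            (f := fun Q => ‖c • w Q ((K : ℝ) • (x - tileCenter K Q))‖ₑ ^ p.toReal)
            (fun _ _ => zero_le) (Finset.mem_univ Q)
        · rw [snap_of_forall_notMem c w (not_exists.1 h), enorm_zero, ENNReal.zero_rpow_of_pos hpr]
          exact zero_le
    _ = ∑ Q, ∫⁻ x, ‖c • w Q ((K : ℝ) • (x - tileCenter K Q))‖ₑ ^ p.toReal := by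
        refine lintegral_finsetSum' _ fun Q _ => ?_
        exact (((hw Q).comp_quasiMeasurePreserving
          (quasiMeasurePreserving_smul_sub hK' _)).const_smul c).enorm.pow_const _
    _ ≤ ∑ _Q : Fin 2 → Fin K, ENNReal.ofReal (((K : ℝ) ^ 2)⁻¹) * (‖c‖ₑ * B) ^ p.toReal :=
        Finset.sum_le_sum fun Q _ => h1 Q
    _ = (‖c‖ₑ * B) ^ p.toReal := by
        rw [Finset.sum_const, Finset.card_univ, Fintype.card_fun, Fintype.card_fin, Fintype.card_fin,
          nsmul_eq_mul, ← mul_assoc]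
        have h2 : ((K ^ 2 : ℕ) : ℝ≥0∞) = ENNReal.ofReal ((K : ℝ) ^ 2) := by
          rw [ENNReal.ofReal_pow (by positivity), ENNReal.ofReal_natCast]; push_cast; rfl
        rw [h2, ← ENNReal.ofReal_mul (by positivity), mul_inv_cancel₀ (pow_ne_zero 2 hK'),
          ENNReal.ofReal_one, one_mul]

/-- A patched field of bounded, divergence-free and tangent fields is divergence-free. -/
theorem isDivFree_snap {K : ℕ} (hK : 0 < K) (c : ℝ) {w : (Fin 2 → Fin K) → Plane → Plane} {M : ℝ}
    (hM : 0 ≤ M) (hw : ∀ Q, AEStronglyMeasurable (w Q)) (hb : ∀ Q, ∀ᵐ x, ‖w Q x‖ ≤ M)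
    (ht : ∀ Q, IsTangentToUnitSquare (w Q)) : IsDivFree (snap K c w) := by
  have hK' : (K : ℝ) ≠ 0 := by exact_mod_cast hK.ne'
  have hbs := ae_norm_snap_le hK c hM hb
  have hms := aestronglyMeasurable_snap hK c hw
  refine ⟨?_, fun φ hφ => ?_⟩
  · refine (locallyIntegrable_const (|c| * M)).mono hms ?_
    filter_upwards [hbs] with x hx
    exact hx.trans (le_abs_self _)
  have hφ1 : Differentiable ℝ φ := hφ.1.differentiable (by simp)
  have hφc : Continuous (fderiv ℝ φ) := hφ.1.continuous_fderiv (by simp)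
  have hφs : HasCompactSupport (fderiv ℝ φ) := hφ.2.fderiv ℝ
  have hint : ∀ Q, Integrable fun x => (tile K Q).indicator
      (fun x => fderiv ℝ φ x (c • w Q ((K : ℝ) • (x - tileCenter K Q)))) x := by
    intro Q
    refine Integrable.indicator ?_ (isOpen_tile K Q).measurableSet
    have hm : AEStronglyMeasurable fun x => c • w Q ((K : ℝ) • (x - tileCenter K Q)) :=
      ((hw Q).comp_quasiMeasurePreserving (quasiMeasurePreserving_smul_sub hK' _)).const_smul c
    have hi : Integrable fun x => ‖fderiv ℝ φ x‖ * (|c| * M) :=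
      ((hφc.integrable_of_hasCompactSupport hφs).norm).mul_const _
    refine hi.mono' ?_ ?_
    · exact (isBoundedBilinearMap_apply (𝕜 := ℝ) (E := Plane) (F := ℝ)).continuous
        |>.comp_aestronglyMeasurable₂ hφc.aestronglyMeasurable hm
    · filter_upwards [(quasiMeasurePreserving_smul_sub hK' (tileCenter K Q)).ae (hb Q)] with x hx
      refine (ContinuousLinearMap.le_opNorm _ _).trans ?_
      rw [norm_smul, Real.norm_eq_abs]
      exact mul_le_mul_of_nonneg_left (mul_le_mul_of_nonneg_left hx (abs_nonneg c)) (norm_nonneg _)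
  have h1 : ∀ x, fderiv ℝ φ x (snap K c w x) = ∑ Q, (tile K Q).indicator
      (fun x => fderiv ℝ φ x (c • w Q ((K : ℝ) • (x - tileCenter K Q)))) x := by
    intro x
    rw [snap, map_sum]
    refine Finset.sum_congr rfl fun Q _ => ?_
    by_cases hx : x ∈ tile K Q
    · rw [indicator_of_mem hx, indicator_of_mem hx]
    · rw [indicator_of_notMem hx, indicator_of_notMem hx, map_zero]
  simp only [h1]
  rw [integral_finsetSum _ fun Q _ => hint Q]
  refine Finset.sum_eq_zero fun Q _ => ?_
  -- `A` maps the unit square onto the tile `Q`. The integral over the tile becomes a multiple of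
  -- the integral of `w Q` against the gradient of φ ∘ A over the unit square, which is zero by
  -- tangency.
  set A : Plane → Plane := fun y => tileCenter K Q + (K : ℝ)⁻¹ • y with hA
  have hA' : ∀ y, HasFDerivAt A ((K : ℝ)⁻¹ • ContinuousLinearMap.id ℝ Plane) y := fun y =>
    ((hasFDerivAt_id y).const_smul (K : ℝ)⁻¹).const_add _
  have hψ : IsTest (φ ∘ A) := by
    have hAe : Topology.IsClosedEmbedding A :=
      ((Homeomorph.smulOfNeZero (K : ℝ)⁻¹ (inv_ne_zero hK')).trans
        (Homeomorph.addLeft (tileCenter K Q))).isClosedEmbedding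
    refine ⟨hφ.1.comp ?_, hφ.2.comp_isClosedEmbedding hAe⟩
    exact contDiff_const.add (contDiff_id.const_smul _)
  have h2 := ht Q _ hψ
  rw [← integral_indicator isOpen_unitSquare.measurableSet] at h2
  have h3 : ∀ x, (tile K Q).indicator
      (fun x => fderiv ℝ φ x (c • w Q ((K : ℝ) • (x - tileCenter K Q)))) x =
      (c * K) * unitSquare.indicator (fun y => fderiv ℝ (φ ∘ A) y (w Q y))
        ((K : ℝ) • (x - tileCenter K Q)) := by
    intro x
    have hAx : A ((K : ℝ) • (x - tileCenter K Q)) = x := by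
      rw [hA]; simp only; rw [smul_smul, inv_mul_cancel₀ hK', one_smul, add_sub_cancel]
    by_cases hx : x ∈ tile K Q
    · rw [indicator_of_mem hx, indicator_of_mem ((mem_tile_iff hK).1 hx),
        ((hφ1 _).hasFDerivAt.comp _ (hA' _)).fderiv, hAx]
      simp
      field_simp
    · rw [indicator_of_notMem hx, indicator_of_notMem (fun h => hx ((mem_tile_iff hK).2 h)),
        mul_zero]
  simp only [h3]
  rw [integral_const_mul, integral_comp_smul_sub (K : ℝ) (tileCenter K Q), h2]
  simp

/-! ### Weak derivatives of patched functions. -/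

/-- Derivatives of the composition with a dilation and a translation. -/
theorem iteratedFDeriv_comp_smul_add {F : Type*} [NormedAddCommGroup F] [NormedSpace ℝ F]
    {k : ℕ} {φ : Plane → F} (hφ : ContDiff ℝ k φ) (b : ℝ) (r y : Plane) (v : Fin k → Plane) :
    iteratedFDeriv ℝ k (fun y => φ (r + b • y)) y v =
      b ^ k • iteratedFDeriv ℝ k φ (r + b • y) v := by
  have h1 : (fun y => φ (r + b • y)) =
      (fun z => φ (r + z)) ∘ (b • ContinuousLinearMap.id ℝ Plane) := by
    ext y; simp
  have h2 : ContDiff ℝ k fun z => φ (r + z) := hφ.comp (contDiff_const.add contDiff_id)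
  rw [h1, ContinuousLinearMap.iteratedFDeriv_comp_right _ h2 _ le_rfl,
    iteratedFDeriv_comp_add_left]
  simp only [ContinuousMultilinearMap.compContinuousLinearMap_apply]
  have h3 : (fun i => (b • ContinuousLinearMap.id ℝ Plane) (v i)) = fun i => b • v i := by
    ext i; simp
  rw [h3, ContinuousMultilinearMap.map_smul_univ]
  simp

theorem wop_comp_smul_add {k : ℕ} (c : (Fin k → Fin 2) → ℝ) {φ : Plane → ℝ} (hφ : IsTest φ)
    (b : ℝ) (r y : Plane) :
    wop k c (fun y => φ (r + b • y)) y = b ^ k * wop k c φ (r + b • y) := by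
  rw [wop, wop, Finset.mul_sum]
  refine Finset.sum_congr rfl fun α _ => ?_
  rw [partialDeriv, partialDeriv, iteratedFDeriv_comp_smul_add
    (hφ.1.of_le (by exact_mod_cast le_top)), smul_eq_mul]
  ring

theorem IsTest.comp_smul_add {φ : Plane → ℝ} (hφ : IsTest φ) {b : ℝ} (hb : b ≠ 0) (r : Plane) :
    IsTest fun y => φ (r + b • y) := by
  have hAe : Topology.IsClosedEmbedding fun y : Plane => r + b • y :=
    ((Homeomorph.smulOfNeZero b hb).trans (Homeomorph.addLeft r)).isClosedEmbedding
  exact ⟨hφ.1.comp (contDiff_const.add (contDiff_id.const_smul _)),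
    hφ.2.comp_isClosedEmbedding hAe⟩

theorem HasWeak.comp_smul_sub {k : ℕ} {c : (Fin k → Fin 2) → ℝ} {f G : Plane → ℝ}
    (h : HasWeak k c f G) (a : ℝ) {b : ℝ} (hb : b ≠ 0) (r : Plane) :
    HasWeak k c (fun x => a * f (b • (x - r))) fun x => a * b ^ k * G (b • (x - r)) := by
  intro φ hφ
  have hA : ∀ x : Plane, r + b⁻¹ • b • (x - r) = x := fun x => by
    rw [smul_smul, inv_mul_cancel₀ hb, one_smul, add_sub_cancel]
  have h1 := h _ (hφ.comp_smul_add (inv_ne_zero hb) r)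
  have h2 := integral_comp_smul_sub b r fun y => a * f y * wop k c φ (r + b⁻¹ • y)
  have h3 := integral_comp_smul_sub b r fun y => a * b ^ k * G y * φ (r + b⁻¹ • y)
  simp only [hA] at h2 h3
  rw [h2, h3]
  have e1 : ∫ y, a * f y * wop k c φ (r + b⁻¹ • y) =
      a * b ^ k * ∫ y, f y * wop k c (fun y => φ (r + b⁻¹ • y)) y := by
    rw [← integral_const_mul]
    congr 1; ext y
    rw [wop_comp_smul_add c hφ, inv_pow]
    field_simp
  have e2 : ∫ y, a * b ^ k * G y * φ (r + b⁻¹ • y) =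
      a * b ^ k * ∫ y, G y * φ (r + b⁻¹ • y) := by
    rw [← integral_const_mul]
    congr 1; ext y; ring
  rw [e1, e2, h1]
  simp only [smul_eq_mul]
  ring

theorem wop_eq_zero {k : ℕ} (c : (Fin k → Fin 2) → ℝ) {φ : Plane → ℝ} {x : Plane}
    (hx : x ∉ tsupport φ) : wop k c φ x = 0 := by
  refine Finset.sum_eq_zero fun α _ => ?_
  have h1 : iteratedFDeriv ℝ k φ x = 0 := by
    by_contra h
    exact hx (support_iteratedFDeriv_subset k h)
  rw [partialDeriv, h1]
  simp

/-- Weak derivatives are local. -/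
theorem HasWeak.ae_eq_on {k : ℕ} {c : (Fin k → Fin 2) → ℝ} {f f' G G' : Plane → ℝ}
    (h : HasWeak k c f G) (h' : HasWeak k c f' G') (hG : LocallyIntegrable G)
    (hG' : LocallyIntegrable G') {U : Set Plane} (hU : IsOpen U) (hf : ∀ x ∈ U, f x = f' x) :
    ∀ᵐ x, x ∈ U → G x = G' x := by
  have h1 : ∀ᵐ x, x ∈ U → (G - G') x = 0 := by
    refine hU.ae_eq_zero_of_integral_contDiff_smul_eq_zero
      ((hG.sub hG').locallyIntegrableOn U) fun φ hφ hφc hφU => ?_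
    have i1 : Integrable fun x => G x * φ x :=
      hG.integrable_smul_right_of_hasCompactSupport hφ.continuous hφc
    have i2 : Integrable fun x => G' x * φ x :=
      hG'.integrable_smul_right_of_hasCompactSupport hφ.continuous hφc
    have h2 : ∫ x, f x * wop k c φ x = ∫ x, f' x * wop k c φ x := by
      congr 1; ext x
      by_cases hx : x ∈ U
      · rw [hf x hx]
      · rw [wop_eq_zero c fun h => hx (hφU h), mul_zero, mul_zero]
    rw [h φ ⟨hφ, hφc⟩, h' φ ⟨hφ, hφc⟩] at h2
    have h3 := mul_left_cancel₀ (pow_ne_zero k (neg_ne_zero.2 one_ne_zero)) h2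
    calc ∫ x, φ x • (G - G') x = ∫ x, (G x * φ x - G' x * φ x) := by
          congr 1; ext x; simp only [Pi.sub_apply, smul_eq_mul]; ring
      _ = 0 := by rw [integral_sub i1 i2, h3, sub_self]
  filter_upwards [h1] with x hx hxU
  exact sub_eq_zero.1 (hx hxU)

theorem hasWeak_zero (k : ℕ) (c : (Fin k → Fin 2) → ℝ) : HasWeak k c (fun _ => 0) fun _ => 0 := by
  intro φ _
  simp

theorem memLp_comp_smul_sub {E : Type*} [NormedAddCommGroup E] {p : ℝ≥0∞} {g : Plane → E}
    (hg : MemLp g p) {a : ℝ} (ha : a ≠ 0) (r : Plane) : MemLp (fun x => g (a • (x - r))) p := by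
  refine MemLp.comp_of_map (f := fun x : Plane => a • (x - r)) ?_ (by fun_prop)
  rw [map_smul_sub ha]
  exact hg.smul_measure ENNReal.ofReal_ne_top

/-- The weak derivatives of a patched function are the patched weak derivatives, provided that they
are functions. -/
theorem HasWeak.ae_eq_snap {k : ℕ} {c : (Fin k → Fin 2) → ℝ} {K : ℕ} (hK : 0 < K) {a : ℝ}
    {f G : (Fin 2 → Fin K) → Plane → ℝ} {p : ℝ≥0∞} (hp1 : 1 ≤ p) (hG : ∀ Q, MemLp (G Q) p)
    (h : ∀ Q, HasWeak k c (f Q) (G Q)) {H : Plane → ℝ} (hH : MemLp H p)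
    (hu : HasWeak k c (snap K a f) H) : H =ᵐ[volume] snap K (a * K ^ k) G := by
  have hK' : (K : ℝ) ≠ 0 := by exact_mod_cast hK.ne'
  have h1 : ∀ᵐ x : Plane, ∀ Q, x ∈ tile K Q →
      H x = a * K ^ k * G Q ((K : ℝ) • (x - tileCenter K Q)) := by
    refine ae_all_iff.2 fun Q => ?_
    refine hu.ae_eq_on ((h Q).comp_smul_sub a hK' (tileCenter K Q)) (hH.locallyIntegrable hp1)
      (((memLp_comp_smul_sub (hG Q) hK' _).const_mul _).locallyIntegrable hp1) (isOpen_tile K Q)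
      fun x hx => ?_
    rw [snap_of_mem hK a f hx, smul_eq_mul]
  -- The derivative is now known on the open tiles and on the exterior. Only a null set is left, and
  -- it is harmless because `H` is a function.
  have h2 : ∀ᵐ x : Plane, x ∈ closedSquareᶜ → H x = 0 := by
    refine hu.ae_eq_on (hasWeak_zero k c) (hH.locallyIntegrable hp1)
      (locallyIntegrable_const 0) isClosed_closedSquare.isOpen_compl fun x hx => ?_
    exact snap_eq_zero hK a f fun h => hx (unitSquare_subset_closedSquare h)
  filter_upwards [h1, h2, ae_mem_tile_or hK] with x hx1 hx2 hx
  rcases hx with ⟨Q, hQ⟩ | hx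
  · rw [hx1 Q hQ, snap_of_mem hK _ G hQ, smul_eq_mul]
  · rw [hx2 hx, snap_eq_zero hK _ G fun h => hx (unitSquare_subset_closedSquare h)]

theorem exists_hasWeak_of_sobolevBound {p : ℝ≥0∞} (hp1 : 1 ≤ p) (hp : p ≠ ⊤) (k : ℕ) :
    ∃ A : ℝ≥0, ∀ (f : Plane → ℝ) (C : ℝ≥0), SobolevBound k p f C → ∀ j : Fin 2,
      ∃ G : Plane → ℝ, MemLp G p ∧ eLpNorm G p ≤ A * C ∧ HasWeak k (weight k j) f G := by
  rcases hp1.eq_or_lt with rfl | h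
  · obtain ⟨A, hA⟩ := exists_hasWeak_of_weakDerivBound k
    refine ⟨A, fun f C hf => hA f C ?_⟩
    rw [SobolevBound, if_neg hp, if_pos ⟨rfl, by rw [Nat.ceil_natCast]⟩, Nat.ceil_natCast] at hf
    exact hf
  · obtain ⟨A, hA⟩ := exists_hasWeak_of_fourierSobolevBound h hp k
    refine ⟨A, fun f C hf => hA f C ?_⟩
    rwa [SobolevBound, if_neg hp, if_neg fun h' => h.ne' h'.1] at hf

/-- For p = 1 and integer order the norm is itself that of the derivatives, so no interpolation is
needed. The assumed field `H` serves as derivative; only its norm is recomputed, entry by entry,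
from the patched form. -/
theorem weakDerivBound_snap {k : ℕ} {K : ℕ} (hK : 0 < K) {a : ℝ}
    {f : (Fin 2 → Fin K) → Plane → ℝ} {C C₁ C' : ℝ≥0} (hf : ∀ Q, WeakDerivBound k 1 (f Q) C)
    (hu : WeakDerivBound k 1 (snap K a f) C₁) (hC : |a| * K ^ k * C ≤ C') :
    WeakDerivBound k 1 (snap K a f) C' := by
  obtain ⟨hl, H, hH, -, hw⟩ := hu
  choose hfl G hG hGC hGw using hf
  have hcoord : ∀ {α : Fin k → Fin 2} {f : Plane → ℝ} {G : Plane → EuclideanSpace ℝ (Fin k → Fin 2)},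
      (∀ φ : Plane → ℝ, IsTest φ →
        ∫ x, f x * partialDeriv k α φ x = (-1) ^ k * ∫ x, G x α * φ x) →
      HasWeak k (Pi.single α 1) f fun x => G x α := by
    intro α f G h φ hφ
    rw [← h φ hφ]
    congr 1; ext x
    rw [wop, Finset.sum_eq_single α]
    · simp
    · intro β _ hβ; simp [hβ]
    · intro h; exact absurd (Finset.mem_univ α) h
  have hproj : ∀ {G : Plane → EuclideanSpace ℝ (Fin k → Fin 2)}, MemLp G 1 → ∀ α,
      MemLp (fun x => G x α) 1 := fun hG α => (EuclideanSpace.proj (𝕜 := ℝ) α).comp_memLp' hG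
  have h1 : H =ᵐ[volume] snap K (a * K ^ k) G := by
    have h2 : ∀ᵐ x, ∀ α, H x α = snap K (a * K ^ k) (fun Q x => G Q x α) x := by
      refine ae_all_iff.2 fun α => ?_
      exact HasWeak.ae_eq_snap hK le_rfl (fun Q => hproj (hG Q) α)
        (fun Q => hcoord (hGw Q α)) (hproj hH α) (hcoord (hw α))
    filter_upwards [h2] with x hx
    ext α
    rw [hx α]
    by_cases h : ∃ Q, x ∈ tile K Q
    · obtain ⟨Q, hQ⟩ := h
      rw [snap_of_mem hK _ _ hQ, snap_of_mem hK _ _ hQ, PiLp.smul_apply]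
    · rw [snap_of_forall_notMem _ _ (not_exists.1 h), snap_of_forall_notMem _ _ (not_exists.1 h),
        PiLp.zero_apply]
  refine ⟨hl, H, hH, ?_, hw⟩
  rw [eLpNorm_congr_ae h1]
  refine (eLpNorm_snap_le hK _ le_rfl ENNReal.one_ne_top (fun Q => (hG Q).1) hGC).trans ?_
  rw [← ofReal_norm, norm_mul, norm_pow, Real.norm_eq_abs, Real.norm_natCast,
    ← ENNReal.ofReal_coe_nnreal (p := C), ← ENNReal.ofReal_mul (by positivity),
    ← ENNReal.ofReal_coe_nnreal (p := C')]
  exact ENNReal.ofReal_le_ofReal hC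

/-! ### Uniform bounds for patched functions: finite p. -/

/-- Uniform regularity of patched functions, for finite `p`. -/
theorem exists_sobolevBound_snap_of_ne_top {s : ℝ} (hs : 0 < s) {p : ℝ≥0∞} (hp1 : 1 ≤ p)
    (hp : p ≠ ⊤) (C : ℝ≥0) {M : ℝ} (hM : 0 ≤ M) (D : ℝ) :
    ∃ C' : ℝ≥0, ∀ K : ℕ, 0 < K → ∀ a : ℝ, |a| * (K : ℝ) ^ s ≤ D →
      ∀ f : (Fin 2 → Fin K) → Plane → ℝ, (∀ Q, AEStronglyMeasurable (f Q)) →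
      (∀ Q, ∀ᵐ x, |f Q x| ≤ M) → (∀ Q, SobolevBound (⌈s⌉₊ : ℝ) p (f Q) C) →
      (∃ C₁, SobolevBound (⌈s⌉₊ : ℝ) p (snap K a f) C₁) → SobolevBound s p (snap K a f) C' := by
  have hsk : s ≤ (⌈s⌉₊ : ℝ) := Nat.le_ceil s
  by_cases hcase : p = 1 ∧ s = ⌈s⌉₊
  · obtain ⟨rfl, hs'⟩ := hcase
    refine ⟨(D * C).toNNReal, fun K hK a hD f _ _ hf ⟨C₁, hu⟩ => ?_⟩
    rw [SobolevBound, if_neg hp, if_pos ⟨rfl, hs'⟩]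
    have hS : ∀ {f : Plane → ℝ} {C : ℝ≥0}, SobolevBound (⌈s⌉₊ : ℝ) 1 f C →
        WeakDerivBound ⌈s⌉₊ 1 f C := by
      intro f C h
      rwa [SobolevBound, if_neg hp, if_pos ⟨rfl, by rw [Nat.ceil_natCast]⟩, Nat.ceil_natCast] at h
    refine weakDerivBound_snap hK (fun Q => hS (hf Q)) (hS hu) ?_
    refine le_trans (mul_le_mul_of_nonneg_right ?_ C.2) (Real.le_coe_toNNReal _)
    refine le_trans (le_of_eq ?_) hD
    conv_rhs => rw [hs', Real.rpow_natCast]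
  · have hsk' : s < (⌈s⌉₊ : ℝ) ∨ s = (⌈s⌉₊ : ℝ) ∧ 1 < p := by
      rcases hsk.lt_or_eq with h | h
      · exact Or.inl h
      · exact Or.inr ⟨h, lt_of_le_of_ne hp1 fun h' => hcase ⟨h'.symm, h⟩⟩
    obtain ⟨A, hA⟩ := exists_fourierSobolevBound hp1 hp hs hsk'
    obtain ⟨A', hA'⟩ := exists_hasWeak_of_sobolevBound hp1 hp ⌈s⌉₊
    generalize hk : ⌈s⌉₊ = k at *
    set V : ℝ≥0∞ := volume (Metric.closedBall (0 : Plane) 1) ^ (1 / p.toReal) with hV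
    have hV' : V ≠ ⊤ := ENNReal.rpow_ne_top_of_nonneg (by positivity) measure_closedBall_lt_top.ne
    refine ⟨A * (D.toNNReal * (V.toNNReal * M.toNNReal) + 2 * (D.toNNReal * (A' * C))),
      fun K hK a hD f hfm hfb hf ⟨C₁, hu⟩ => ?_⟩
    have hKR : (0 : ℝ) < K := by exact_mod_cast hK
    rw [SobolevBound, if_neg hp, if_neg (by rw [hk]; exact hcase)]
    choose H hHp hHC hHw using hA' _ _ hu
    choose G hGp hGC hGw using fun Q => hA' _ _ (hf Q)
    have hu0 : ∀ x, (1 : ℝ) < ‖x‖ → snap K a f x = 0 := fun x hx =>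
      snap_eq_zero hK a f fun h => hx.not_ge (norm_le_one_of_mem_unitSquare h)
    have hub := ae_norm_snap_le (w := f) hK a hM hfb
    -- The choice t₀ = K^(-2) is frequency K. The weights become K^s for the norm O(|a|) of order 0
    -- and K^(s-k) for the norm O(|a| K^k) of order k, so both terms are O(|a| K^s), hence O(D).
    refine hA ((K : ℝ) ^ (-2 : ℝ)) (by positivity) (snap K a f) (|a| * M) 1
      (aestronglyMeasurable_snap hK a hfm) hub hu0 H hHp hHw _ ?_
    have e1 : ENNReal.ofReal (((K : ℝ) ^ (-2 : ℝ)) ^ (-s / 2)) * eLpNorm (snap K a f) p ≤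
        D.toNNReal * (V.toNNReal * M.toNNReal) := by
      have h1 : eLpNorm (snap K a f) p ≤ V * ENNReal.ofReal (|a| * M) := by
        have h2 : snap K a f = (Metric.closedBall (0 : Plane) 1).indicator (snap K a f) := by
          ext x
          by_cases hx : x ∈ Metric.closedBall (0 : Plane) 1
          · rw [indicator_of_mem hx]
          · rw [indicator_of_notMem hx]; exact hu0 x (by simpa using hx)
        rw [h2, eLpNorm_indicator_eq_eLpNorm_restrict measurableSet_closedBall]
        refine (eLpNorm_le_of_ae_bound (ae_restrict_of_ae hub)).trans (le_of_eq ?_)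
        rw [Measure.restrict_apply_univ, hV, one_div]
      have h2 : ((K : ℝ) ^ (-2 : ℝ)) ^ (-s / 2) = (K : ℝ) ^ s := by
        rw [← Real.rpow_mul hKR.le]; congr 1; ring
      rw [h2]
      have hD0 : 0 ≤ D := le_trans (by positivity) hD
      calc _ ≤ ENNReal.ofReal ((K : ℝ) ^ s) * (V * ENNReal.ofReal (|a| * M)) :=
            mul_le_mul' le_rfl h1
        _ = V * ENNReal.ofReal (|a| * (K : ℝ) ^ s * M) := by
            rw [mul_left_comm, ← ENNReal.ofReal_mul (by positivity)]
            congr 2; ring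
        _ ≤ V * ENNReal.ofReal (D * M) :=
            mul_le_mul' le_rfl (ENNReal.ofReal_le_ofReal (mul_le_mul_of_nonneg_right hD hM))
        _ = _ := by
            rw [ENNReal.coe_toNNReal hV', ENNReal.ofReal_mul hD0, mul_left_comm]
            rfl
    have e2 : ENNReal.ofReal (((K : ℝ) ^ (-2 : ℝ)) ^ ((k - s) / 2)) * ∑ j, eLpNorm (H j) p ≤
        2 * (D.toNNReal * (A' * C)) := by
      have h1 : ∀ j, eLpNorm (H j) p ≤ ENNReal.ofReal (|a| * K ^ k) * (A' * C) := by
        intro j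
        have h2 := HasWeak.ae_eq_snap hK hp1 (fun Q => hGp Q j) (fun Q => hGw Q j) (hHp j) (hHw j)
        rw [eLpNorm_congr_ae h2]
        refine (eLpNorm_snap_le hK _ hp1 hp (fun Q => (hGp Q j).1) (fun Q => hGC Q j)).trans
          (le_of_eq ?_)
        rw [← ofReal_norm, norm_mul, norm_pow, Real.norm_eq_abs, Real.norm_natCast]
      have h2 : ((K : ℝ) ^ (-2 : ℝ)) ^ (((k : ℝ) - s) / 2) = (K : ℝ) ^ (s - k) := by
        rw [← Real.rpow_mul hKR.le]; congr 1; ring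
      rw [h2]
      calc _ ≤ ENNReal.ofReal ((K : ℝ) ^ (s - k)) *
            ∑ _j : Fin 2, ENNReal.ofReal (|a| * K ^ k) * (A' * C) :=
            mul_le_mul' le_rfl (Finset.sum_le_sum fun j _ => h1 j)
        _ = 2 * (ENNReal.ofReal ((K : ℝ) ^ (s - k) * (|a| * K ^ k)) * (A' * C)) := by
            rw [ENNReal.ofReal_mul (p := (K : ℝ) ^ (s - k)) (q := |a| * K ^ k) (by positivity),
              Finset.sum_const, Finset.card_univ,
              Fintype.card_fin, nsmul_eq_mul]
            push_cast; ring
        _ ≤ _ := by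
            refine mul_le_mul' le_rfl (mul_le_mul' (ENNReal.ofReal_le_ofReal ?_) le_rfl)
            rw [Real.rpow_sub hKR, Real.rpow_natCast]
            refine le_trans (le_of_eq ?_) hD
            field_simp
    push_cast
    exact mul_le_mul' le_rfl (add_le_add e1 e2)

/-! ### Uniform bounds for patched functions: Hölder classes. -/

/-- A continuous function that is Lipschitz on each of finitely many closed sets which cover the
space is Lipschitz. -/
theorem norm_sub_le_of_finite_closed_cover {E F ι : Type*} [NormedAddCommGroup E]
    [NormedSpace ℝ E] [NormedAddCommGroup F] [Finite ι] {g : E → F}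
    (hg : Continuous g) {S : ι → Set E} (hS : ∀ i, IsClosed (S i)) (hcov : ∀ x, ∃ i, x ∈ S i)
    {L : ℝ} (hL : ∀ i, ∀ x ∈ S i, ∀ y ∈ S i, ‖g x - g y‖ ≤ L * ‖x - y‖) (x y : E) :
    ‖g x - g y‖ ≤ L * ‖x - y‖ := by
  set γ : ℝ → E := fun t => x + t • (y - x) with hγ
  have hγc : Continuous γ := by fun_prop
  have key := image_le_of_liminf_slope_right_le_deriv_boundary (a := 0) (b := 1)
    (f := fun t => ‖g (γ t) - g x‖) (B := fun t => L * ‖y - x‖ * t) (B' := fun _ => L * ‖y - x‖)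
    (by fun_prop) (by simp [hγ]) (by fun_prop)
    (fun t _ => by simpa using ((hasDerivAt_id t).const_mul (L * ‖y - x‖)).hasDerivWithinAt) ?_
    (right_mem_Icc.2 zero_le_one)
  · have h1 : γ 1 = y := by simp [hγ]
    rw [h1, mul_one] at key
    rwa [norm_sub_rev, norm_sub_rev x y]
  · intro t _ r hr
    -- With finitely many sets, one of them is visited by the segment at times arbitrarily close to
    -- t from the right, and being closed it contains the point at t as well. This bounds the lower
    -- right derivative of the distance travelled.
    obtain ⟨i, hi⟩ : ∃ i, ∃ᶠ z in 𝓝[>] t, γ z ∈ S i := by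
      by_contra! h
      obtain ⟨z, hz⟩ := (eventually_all.2 h).exists
      obtain ⟨i, hi⟩ := hcov (γ z)
      exact hz i hi
    have ht : γ t ∈ S i := by
      by_contra h
      have h1 : ∀ᶠ z in 𝓝 t, γ z ∈ (S i)ᶜ :=
        hγc.continuousAt.eventually ((hS i).isOpen_compl.mem_nhds h)
      exact hi (h1.filter_mono nhdsWithin_le_nhds)
    refine (hi.and_eventually self_mem_nhdsWithin).mono fun z ⟨hz, htz⟩ => ?_
    have htz' : 0 < z - t := sub_pos.2 htz
    refine lt_of_le_of_lt ?_ hr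
    rw [slope_def_field, div_le_iff₀ htz']
    have h2 : γ z - γ t = (z - t) • (y - x) := by
      rw [hγ]; simp only; rw [add_sub_add_left_eq_sub, ← sub_smul]
    calc ‖g (γ z) - g x‖ - ‖g (γ t) - g x‖ ≤ ‖(g (γ z) - g x) - (g (γ t) - g x)‖ :=
          norm_sub_norm_le _ _
      _ = ‖g (γ z) - g (γ t)‖ := by rw [sub_sub_sub_cancel_right]
      _ ≤ L * ‖γ z - γ t‖ := hL i _ hz _ ht
      _ = _ := by rw [h2, norm_smul, Real.norm_of_nonneg htz'.le]; ring

theorem norm_fderiv_iteratedFDeriv_sub {E F : Type*} [NormedAddCommGroup E] [NormedSpace ℝ E]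
    [NormedAddCommGroup F] [NormedSpace ℝ F] (n : ℕ) (f : E → F) (x y : E) :
    ‖fderiv ℝ (iteratedFDeriv ℝ n f) x - fderiv ℝ (iteratedFDeriv ℝ n f) y‖ =
      ‖iteratedFDeriv ℝ (n + 1) f x - iteratedFDeriv ℝ (n + 1) f y‖ := by
  have h := (continuousMultilinearCurryLeftEquiv ℝ (fun _ : Fin (n + 1) => E) F).symm.dist_map
    (fderiv ℝ (iteratedFDeriv ℝ n f) x) (fderiv ℝ (iteratedFDeriv ℝ n f) y)
  exact (dist_eq_norm _ _).symm.trans (h.symm.trans (dist_eq_norm _ _))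

/-- A bounded function whose derivative of order `n` is Lipschitz has a bounded derivative of order
`n`. -/
theorem norm_iteratedFDeriv_le_of_bounded {E F : Type*} [NormedAddCommGroup E] [NormedSpace ℝ E]
    [NormedAddCommGroup F] [NormedSpace ℝ F] {C : ℝ} (hC : 0 ≤ C) (n : ℕ) {f : E → F} {M : ℝ}
    (hM0 : 0 ≤ M) (hf : ContDiff ℝ n f) (hM : ∀ x, ‖f x‖ ≤ M)
    (hL : ∀ x y, ‖iteratedFDeriv ℝ n f x - iteratedFDeriv ℝ n f y‖ ≤ C * ‖x - y‖) (x : E) :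
    ‖iteratedFDeriv ℝ n f x‖ ≤ 2 ^ n * M + n * C := by
  induction n generalizing f M x with
  | zero => simpa using hM x
  | succ n ih =>
    have hfn : ContDiff ℝ n f := hf.of_le (by exact_mod_cast Nat.le_succ n)
    have hd : Differentiable ℝ (iteratedFDeriv ℝ n f) :=
      hf.differentiable_iteratedFDeriv (by exact_mod_cast Nat.lt_succ_self n)
    have hL' : ∀ x y, ‖fderiv ℝ (iteratedFDeriv ℝ n f) x - fderiv ℝ (iteratedFDeriv ℝ n f) y‖ ≤
        C * ‖x - y‖ := fun x y => (norm_fderiv_iteratedFDeriv_sub n f x y).trans_le (hL x y)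
    rw [← norm_fderiv_iteratedFDeriv]
    refine ContinuousLinearMap.opNorm_le_of_unit_norm (by positivity) fun h hh => ?_
    -- A unit difference of f is bounded by 2M, and its derivative of order n is again C-Lipschitz
    -- because the next derivative of f varies by at most C over a unit step. So the induction
    -- hypothesis applies to it.
    set φ : E → F := (fun y => f (y + h)) - f with hφ
    have hfh : ContDiff ℝ n fun y => f (y + h) := hfn.comp (contDiff_id.add contDiff_const)
    have hφn : ∀ y, iteratedFDeriv ℝ n φ y =
        iteratedFDeriv ℝ n f (y + h) - iteratedFDeriv ℝ n f y := by
      intro y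
      rw [hφ, iteratedFDeriv_sub_apply hfh.contDiffAt hfn.contDiffAt, iteratedFDeriv_comp_add_right]
    have h1 : ‖iteratedFDeriv ℝ n φ x‖ ≤ 2 ^ n * (2 * M) + n * C := by
      refine ih (by positivity) (hfh.sub hfn) (fun y => ?_) (fun y z => ?_) x
      · refine (norm_sub_le _ _).trans ?_
        linarith [hM (y + h), hM y]
      · have hder : ∀ y, HasFDerivAt (iteratedFDeriv ℝ n φ)
            (fderiv ℝ (iteratedFDeriv ℝ n f) (y + h) - fderiv ℝ (iteratedFDeriv ℝ n f) y) y := by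
          intro y
          rw [funext hφn]
          refine HasFDerivAt.sub ?_ (hd y).hasFDerivAt
          exact (hasFDerivAt_comp_add_right h).2 (hd (y + h)).hasFDerivAt
        refine (convex_univ (𝕜 := ℝ) (E := E)).norm_image_sub_le_of_norm_hasFDerivWithin_le
          (fun y _ => (hder y).hasFDerivWithinAt) (fun y _ => ?_) (mem_univ z) (mem_univ y)
        refine (hL' _ _).trans (le_of_eq ?_)
        rw [add_sub_cancel_left, hh, mul_one]
    -- The unit difference of the n-th derivative differs from the next derivative in the direction
    -- h by at most C; this is the additional C in the bound at each step.
    have h2 : ‖iteratedFDeriv ℝ n f (x + h) - iteratedFDeriv ℝ n f x -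
        fderiv ℝ (iteratedFDeriv ℝ n f) x (x + h - x)‖ ≤ C * ‖x + h - x‖ := by
      refine (convex_closedBall x 1).norm_image_sub_le_of_norm_hasFDerivWithin_le'
        (fun y _ => (hd y).hasFDerivAt.hasFDerivWithinAt) (fun y hy => ?_)
        (Metric.mem_closedBall_self zero_le_one) (by simp [hh])
      refine (hL' _ _).trans (mul_le_of_le_one_right hC ?_)
      rwa [← dist_eq_norm]
    rw [add_sub_cancel_left, hh, mul_one, ← hφn] at h2
    have h3 : ‖fderiv ℝ (iteratedFDeriv ℝ n f) x h‖ ≤ ‖iteratedFDeriv ℝ n φ x‖ +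
        ‖iteratedFDeriv ℝ n φ x - fderiv ℝ (iteratedFDeriv ℝ n f) x h‖ := by
      have := norm_sub_le (iteratedFDeriv ℝ n φ x)
        (iteratedFDeriv ℝ n φ x - fderiv ℝ (iteratedFDeriv ℝ n f) x h)
      rwa [sub_sub_cancel] at this
    push_cast
    rw [pow_succ]
    linarith

/-- This interpolates between a Lipschitz bound, good for small t, and a uniform bound, good for
large t. -/
theorem min_le_rpow {t σ : ℝ} (ht : 0 ≤ t) (hσ : 0 < σ) (hσ1 : σ ≤ 1) : min t 1 ≤ t ^ σ := by
  rcases le_total t 1 with h | h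
  · rcases ht.eq_or_lt with rfl | ht
    · simp [Real.zero_rpow hσ.ne']
    · exact (min_le_left _ _).trans (Real.self_le_rpow_of_le_one ht.le h hσ1)
  · exact (min_le_right _ _).trans (Real.one_le_rpow h hσ.le)

theorem forall_mem_of_ae_mem {S : Set Plane} (hS : IsClosed S) (h : ∀ᵐ x, x ∈ S) (x : Plane) :
    x ∈ S := by
  have := (Measure.dense_of_ae h).closure_eq
  rw [show {x | x ∈ S} = S from rfl, hS.closure_eq] at this
  rw [this]; trivial

/-- Uniform regularity of patched functions in the Hölder classes. -/
theorem exists_holderBound_snap {s : ℝ} (hs : 0 < s) (C : ℝ≥0) {M : ℝ} (hM : 0 ≤ M) (D : ℝ) :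
    ∃ C' : ℝ≥0, ∀ K : ℕ, 0 < K → ∀ a : ℝ, |a| * (K : ℝ) ^ s ≤ D →
      ∀ f : (Fin 2 → Fin K) → Plane → ℝ,
      (∀ Q, ∀ᵐ x, |f Q x| ≤ M) → (∀ Q, HolderBound (⌈s⌉₊ : ℝ) (f Q) C) →
      (∃ C₁, HolderBound (⌈s⌉₊ : ℝ) (snap K a f) C₁) → HolderBound s (snap K a f) C' := by
  obtain ⟨n, hn⟩ : ∃ n : ℕ, ⌈s⌉₊ = n + 1 :=
    Nat.exists_eq_add_one_of_ne_zero (Nat.ceil_pos.2 hs).ne'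
  have hsn : (n : ℝ) < s := Nat.lt_ceil.1 (by omega)
  have hsn1 : s ≤ n + 1 := by have := Nat.le_ceil s; rw [hn] at this; exact_mod_cast this
  set B : ℝ := 2 ^ n * M + n * C with hB
  have hB0 : 0 ≤ B := by positivity
  refine ⟨(D * (C + 2 * B)).toNNReal, fun K hK a hD f hfb hf ⟨C₁, hu⟩ => ?_⟩
  have hKR : (0 : ℝ) < K := by exact_mod_cast hK
  -- At the integer n + 1 the class uses derivatives of order n with Hölder exponent (n + 1) - n =
  -- 1, that is, Lipschitz ones.
  have hhol : ∀ {f : Plane → ℝ} {C : ℝ≥0}, HolderBound (⌈s⌉₊ : ℝ) f C → ∃ f' : Plane → ℝ,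
      f' =ᵐ[volume] f ∧ ContDiff ℝ n f' ∧
        ∀ x y, ‖iteratedFDeriv ℝ n f' x - iteratedFDeriv ℝ n f' y‖ ≤ C * ‖x - y‖ := by
    rintro f C ⟨f', h1, h2, h3⟩
    rw [Nat.ceil_natCast, hn, Nat.add_sub_cancel] at h2 h3
    refine ⟨f', h1, h2, fun x y => ?_⟩
    have := h3 x y
    rwa [Nat.cast_add_one, add_sub_cancel_left, Real.rpow_one] at this
  obtain ⟨u', hu1, hu2, -⟩ := hhol hu
  choose f' hf1 hf2 hf3 using fun Q => hhol (hf Q)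
  have hf'b : ∀ Q x, ‖f' Q x‖ ≤ M := by
    intro Q x
    refine forall_mem_of_ae_mem (S := {x | ‖f' Q x‖ ≤ M})
      (isClosed_le (hf2 Q).continuous.norm continuous_const) ?_ x
    filter_upwards [hf1 Q, hfb Q] with y h1 h2
    rw [h1]; exact h2
  have hf'n : ∀ Q x, ‖iteratedFDeriv ℝ n (f' Q) x‖ ≤ B := fun Q =>
    norm_iteratedFDeriv_le_of_bounded C.2 n hM (hf2 Q) (hf'b Q) (hf3 Q)
  set g := iteratedFDeriv ℝ n u' with hg
  have hgc : Continuous g := hu2.continuous_iteratedFDeriv le_rfl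
  -- The identity holds on the open tile and extends to its closure since both sides are continuous.
  -- The continuity of g across the edges comes from the assumed qualitative regularity.
  have htile : ∀ Q, ∀ x ∈ closure (tile K Q), g x =
      (a * K ^ n) • iteratedFDeriv ℝ n (f' Q) ((K : ℝ) • (x - tileCenter K Q)) := by
    intro Q
    have hcd : ContDiff ℝ n fun x => f' Q (-((K : ℝ) • tileCenter K Q) + (K : ℝ) • x) :=
      (hf2 Q).comp (contDiff_const.add (contDiff_id.const_smul _))
    have haff : ∀ x : Plane, -((K : ℝ) • tileCenter K Q) + (K : ℝ) • x =
        (K : ℝ) • (x - tileCenter K Q) := fun x => by rw [smul_sub]; abel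
    have h1 : EqOn u' (a • fun x => f' Q (-((K : ℝ) • tileCenter K Q) + (K : ℝ) • x))
        (tile K Q) := by
      refine Measure.eqOn_open_of_ae_eq (μ := volume) ?_ (isOpen_tile K Q)
        hu2.continuous.continuousOn (hcd.const_smul a).continuous.continuousOn
      refine (ae_restrict_iff' (isOpen_tile K Q).measurableSet).2 ?_
      filter_upwards [hu1,
        (quasiMeasurePreserving_smul_sub hKR.ne' (tileCenter K Q)).ae (hf1 Q)] with x h2 h3 hx
      rw [h2, snap_of_mem hK a f hx, Pi.smul_apply, haff, h3]
    have hA : Continuous fun x : Plane => (K : ℝ) • (x - tileCenter K Q) := by fun_prop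
    have hfA : Continuous fun x : Plane =>
        iteratedFDeriv ℝ n (f' Q) ((K : ℝ) • (x - tileCenter K Q)) :=
      ((hf2 Q).continuous_iteratedFDeriv le_rfl).comp hA
    refine EqOn.closure (fun x hx => ?_) hgc (hfA.const_smul (a * (K : ℝ) ^ n))
    have h2 : u' =ᶠ[𝓝 x] a • fun x => f' Q (-((K : ℝ) • tileCenter K Q) + (K : ℝ) • x) :=
      h1.eventuallyEq_of_mem ((isOpen_tile K Q).mem_nhds hx)
    rw [hg, (h2.iteratedFDeriv ℝ n).eq_of_nhds, iteratedFDeriv_const_smul_apply hcd.contDiffAt]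
    ext v
    rw [smul_apply, smul_apply,
      iteratedFDeriv_comp_smul_add (hf2 Q), haff, smul_smul]
  have hout : ∀ x ∈ closure closedSquareᶜ, g x = 0 := by
    have h1 : EqOn u' 0 closedSquareᶜ := by
      refine Measure.eqOn_open_of_ae_eq (μ := volume) ?_ isClosed_closedSquare.isOpen_compl
        hu2.continuous.continuousOn continuousOn_const
      refine (ae_restrict_iff' isClosed_closedSquare.isOpen_compl.measurableSet).2 ?_
      filter_upwards [hu1] with x h2 hx
      rw [h2]
      exact snap_eq_zero hK a f fun h => hx (unitSquare_subset_closedSquare h)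
    refine EqOn.closure (fun x hx => ?_) hgc continuous_const
    have h2 : u' =ᶠ[𝓝 x] 0 :=
      h1.eventuallyEq_of_mem (isClosed_closedSquare.isOpen_compl.mem_nhds hx)
    rw [hg, (h2.iteratedFDeriv ℝ n).eq_of_nhds]
    simp
  set S : Option (Fin 2 → Fin K) → Set Plane := fun o =>
    o.elim (closure closedSquareᶜ) fun Q => closure (tile K Q) with hS
  have hSc : ∀ o, IsClosed (S o) := by
    rintro (_ | Q) <;> exact isClosed_closure
  have hcov : ∀ x, ∃ o, x ∈ S o := by
    have h1 : IsClosed (⋃ o, S o) := isClosed_iUnion_of_finite hSc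
    intro x
    refine mem_iUnion.1 (forall_mem_of_ae_mem h1 ?_ x)
    filter_upwards [ae_mem_tile_or hK] with y hy
    rcases hy with ⟨Q, hQ⟩ | hy
    · exact mem_iUnion.2 ⟨some Q, subset_closure hQ⟩
    · exact mem_iUnion.2 ⟨none, subset_closure hy⟩
  have hnorm : ‖a * (K : ℝ) ^ n‖ = |a| * K ^ n := by
    rw [norm_mul, norm_pow, Real.norm_eq_abs, Real.norm_natCast]
  -- The closed tiles and the closed exterior form a finite closed cover, and on each of them g is
  -- Lipschitz with this constant.
  have hlip : ∀ x y, ‖g x - g y‖ ≤ |a| * K ^ n * (C * K) * ‖x - y‖ := by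
    refine norm_sub_le_of_finite_closed_cover hgc hSc hcov ?_
    rintro (_ | Q) x hx y hy
    · rw [hout x hx, hout y hy, sub_zero, norm_zero]; positivity
    · rw [htile Q x hx, htile Q y hy, ← smul_sub, norm_smul, hnorm, mul_assoc (|a| * (K : ℝ) ^ n)]
      refine mul_le_mul_of_nonneg_left ((hf3 Q _ _).trans (le_of_eq ?_)) (by positivity)
      rw [← smul_sub, sub_sub_sub_cancel_right, norm_smul, Real.norm_natCast, mul_assoc]
  have hbd : ∀ x, ‖g x‖ ≤ |a| * K ^ n * B := by
    intro x
    obtain ⟨_ | Q, hx⟩ := hcov x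
    · rw [hout x hx, norm_zero]; positivity
    · rw [htile Q x hx, norm_smul, hnorm]
      exact mul_le_mul_of_nonneg_left (hf'n Q _) (by positivity)
  refine ⟨u', hu1, ?_, fun x y => ?_⟩
  · rw [hn, Nat.add_sub_cancel]; exact hu2
  rw [hn, Nat.add_sub_cancel]
  set r := ‖x - y‖ with hr
  have hr0 : 0 ≤ r := norm_nonneg _
  -- The Lipschitz bound is used at distances below 1/K and the uniform bound above. Then K^n from
  -- the derivative and K^(s-n) from the interpolation combine to K^s.
  have h1 : ‖g x - g y‖ ≤ |a| * K ^ n * ((C + 2 * B) * min (K * r) 1) := by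
    rcases le_total ((K : ℝ) * r) 1 with h | h
    · rw [min_eq_left h]
      refine (hlip x y).trans ?_
      rw [mul_assoc]
      refine mul_le_mul_of_nonneg_left ?_ (by positivity)
      have : 0 ≤ 2 * B * (K * r) := by positivity
      nlinarith
    · rw [min_eq_right h, mul_one]
      refine (norm_sub_le _ _).trans ((add_le_add (hbd x) (hbd y)).trans ?_)
      rw [← mul_add]
      refine mul_le_mul_of_nonneg_left ?_ (by positivity)
      linarith [C.2]
  have h2 := min_le_rpow (σ := s - n) (by positivity : 0 ≤ (K : ℝ) * r) (by linarith) (by linarith)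
  calc ‖g x - g y‖ ≤ |a| * K ^ n * ((C + 2 * B) * ((K : ℝ) * r) ^ (s - n)) := by
        refine h1.trans (mul_le_mul_of_nonneg_left (mul_le_mul_of_nonneg_left h2 ?_) ?_) <;>
          positivity
    _ = |a| * (K : ℝ) ^ s * (C + 2 * B) * r ^ (s - n) := by
        rw [Real.mul_rpow hKR.le hr0, Real.rpow_sub hKR, Real.rpow_natCast]
        field_simp
    _ ≤ D * (C + 2 * B) * r ^ (s - n) := by gcongr
    _ ≤ _ := mul_le_mul_of_nonneg_right (Real.le_coe_toNNReal _) (by positivity)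

/-- Uniform regularity of patched functions. -/
theorem exists_sobolevBound_snap {s : ℝ} (hs : 0 < s) {p : ℝ≥0∞} (hp1 : 1 ≤ p)
    (C : ℝ≥0) {M : ℝ} (hM : 0 ≤ M) (D : ℝ) :
    ∃ C' : ℝ≥0, ∀ K : ℕ, 0 < K → ∀ a : ℝ, |a| * (K : ℝ) ^ s ≤ D →
      ∀ f : (Fin 2 → Fin K) → Plane → ℝ, (∀ Q, AEStronglyMeasurable (f Q)) →
      (∀ Q, ∀ᵐ x, |f Q x| ≤ M) → (∀ Q, SobolevBound (⌈s⌉₊ : ℝ) p (f Q) C) →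
      (∃ C₁, SobolevBound (⌈s⌉₊ : ℝ) p (snap K a f) C₁) → SobolevBound s p (snap K a f) C' := by
  by_cases hp : p = ⊤
  · obtain ⟨C', hC'⟩ := exists_holderBound_snap hs C hM D
    refine ⟨C', fun K hK a hD f _ hfb hf hu => ?_⟩
    simp only [SobolevBound, if_pos hp] at hf hu ⊢
    exact hC' K hK a hD f hfb hf hu
  · exact exists_sobolevBound_snap_of_ne_top hs hp1 hp C hM D

/-! ### Time steps, and passage to almost every time. -/

theorem FourierSobolevBound.mono {s : ℝ} {p : ℝ≥0∞} {f : Plane → ℝ} {C C' : ℝ≥0} (h : C ≤ C')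
    (hf : FourierSobolevBound s p f C) : FourierSobolevBound s p f C' := by
  obtain ⟨F, S, k, g, h1, h2, h3, h4, h5, h6⟩ := hf
  exact ⟨F, S, k, g, h1, h2, h3, h4, h5, h6.trans (ENNReal.coe_le_coe.2 h)⟩

theorem SobolevBound.mono {s : ℝ} {p : ℝ≥0∞} {f : Plane → ℝ} {C C' : ℝ≥0} (h : C ≤ C')
    (hf : SobolevBound s p f C) : SobolevBound s p f C' := by
  rw [SobolevBound] at hf ⊢
  split_ifs at hf ⊢
  · obtain ⟨f', h1, h2, h3⟩ := hf
    refine ⟨f', h1, h2, fun x y => (h3 x y).trans ?_⟩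
    exact mul_le_mul_of_nonneg_right (NNReal.coe_le_coe.2 h) (Real.rpow_nonneg (norm_nonneg _) _)
  · obtain ⟨hl, G, h1, h2, h3⟩ := hf
    exact ⟨hl, G, h1, h2.trans (ENNReal.coe_le_coe.2 h), h3⟩
  · exact hf.mono h

theorem switchTime_succ (τ : ℝ) (n : ℕ) : switchTime τ (n + 1) = switchTime τ n + τ ^ n :=
  Finset.sum_range_succ _ _

theorem strictMono_switchTime {τ : ℝ} (hτ : 0 < τ) : StrictMono (switchTime τ) :=
  strictMono_nat_of_lt_succ fun n => by
    rw [switchTime_succ]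
    linarith [pow_pos hτ n]

theorem mem_stage_bounds {τ : ℝ} {n : ℕ} {t : ℝ} (h : t ∈ stage τ n) :
    switchTime τ n ≤ t ∧ t ≤ switchTime τ (n + 1) := by
  cases n with
  | zero => exact ⟨by simpa [switchTime] using h.1, h.2⟩
  | succ n => exact ⟨h.1.le, h.2⟩

theorem stage_unique {τ : ℝ} (hτ : 0 < τ) {n n' : ℕ} {t : ℝ} (h : t ∈ stage τ n)
    (h' : t ∈ stage τ n') : n = n' := by
  have key : ∀ {n n' : ℕ}, t ∈ stage τ n → t ∈ stage τ n' → ¬ n < n' := by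
    intro n n' h h' hlt
    obtain ⟨k, rfl⟩ : ∃ k, n' = k + 1 := ⟨n' - 1, by omega⟩
    have h1 : switchTime τ (n + 1) ≤ switchTime τ (k + 1) :=
      (strictMono_switchTime hτ).monotone (by omega)
    have h2 := (mem_stage_bounds h).2
    have h3 : switchTime τ (k + 1) < t := h'.1
    linarith
  exact le_antisymm (not_lt.1 (key h' h)) (not_lt.1 (key h h'))

theorem exists_mem_stage {τ t : ℝ} (ht : t ∈ timeDomain τ) : ∃ n, t ∈ stage τ n := by
  classical
  obtain ⟨h0, hex⟩ := ht
  have h1 : ∃ n, t ≤ switchTime τ (n + 1) := by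
    obtain ⟨n, hn⟩ := hex
    cases n with
    | zero => simp [switchTime] at hn; linarith
    | succ n => exact ⟨n, hn.le⟩
  refine ⟨Nat.find h1, ?_⟩
  have h2 := Nat.find_spec h1
  rcases h : Nat.find h1 with _ | n
  · rw [h] at h2
    exact ⟨h0, h2⟩
  · rw [h] at h2
    exact ⟨not_le.1 (Nat.find_min h1 (by omega : n < Nat.find h1)), h2⟩

/-- At a time of step `n` the patched field is a field patched on the corresponding tiling. -/
theorem patched_eq_snap {E : Type*} [AddCommGroup E] [Module ℝ E] {N : ℕ} {m ℓ : ℕ} {τ : ℝ}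
    (hτ : 0 < τ) (c : ℕ → ℝ) (w : Fin N → ℝ → Plane → E) (J : Choice m ℓ N) {n : ℕ} {t : ℝ}
    (ht : t ∈ stage τ n) : patched m ℓ τ c w J t =
      snap (m * ℓ ^ n) (c n) fun Q => w (J n Q) ((t - switchTime τ n) / τ ^ n) := by
  ext x
  rw [patched, finsum_eq_single _ n]
  · rw [indicator_of_mem ht, snap]
    push_cast
    rfl
  · intro n' hn'
    exact indicator_of_notMem (fun h => hn' (stage_unique hτ h ht)) _

theorem snap_apply {K : ℕ} (hK : 0 < K) (c : ℝ) (w : (Fin 2 → Fin K) → Plane → Plane) (i : Fin 2) :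
    (fun x => snap K c w x i) = snap K c fun Q x => w Q x i := by
  ext x
  by_cases h : ∃ Q, x ∈ tile K Q
  · obtain ⟨Q, hQ⟩ := h
    rw [snap_of_mem hK _ _ hQ, snap_of_mem hK _ _ hQ, PiLp.smul_apply]
  · rw [snap_of_forall_notMem _ _ (not_exists.1 h), snap_of_forall_notMem _ _ (not_exists.1 h),
      PiLp.zero_apply]

/-- An affine change of time with nonzero slope pulls null sets back to null sets, so the
exceptional times of a basic field give a null set of exceptional times in each step. -/
theorem ae_rescaled_time {P : ℝ → Prop} (hP : ∀ᵐ t ∂volume.restrict (Icc (0 : ℝ) 1), P t) (a : ℝ)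
    {b : ℝ} (hb : b ≠ 0) : ∀ᵐ t : ℝ, (t - a) / b ∈ Icc (0 : ℝ) 1 → P ((t - a) / b) := by
  rw [ae_restrict_iff' measurableSet_Icc] at hP
  have hq : Measure.QuasiMeasurePreserving (fun t : ℝ => (t - a) / b) volume volume := by
    have h1 : (fun t : ℝ => (t - a) / b) = (fun t => t * b⁻¹) ∘ fun t => t - a := by
      ext t; simp [div_eq_mul_inv]
    have h2 : Measure.QuasiMeasurePreserving (fun t : ℝ => t * b⁻¹) volume volume := by
      refine ⟨by fun_prop, ?_⟩
      rw [Real.map_volume_mul_right (inv_ne_zero hb)]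
      exact Measure.smul_absolutelyContinuous
    rw [h1]
    exact h2.comp (measurePreserving_sub_right volume a).quasiMeasurePreserving
  exact hq.ae hP

theorem div_mem_Icc_of_mem_stage {τ : ℝ} (hτ : 0 < τ) {n : ℕ} {t : ℝ} (ht : t ∈ stage τ n) :
    (t - switchTime τ n) / τ ^ n ∈ Icc (0 : ℝ) 1 := by
  obtain ⟨h1, h2⟩ := mem_stage_bounds ht
  rw [switchTime_succ] at h2
  refine ⟨div_nonneg (by linarith) (by positivity), (div_le_one (by positivity)).2 (by linarith)⟩

theorem measurableSet_timeDomain (τ : ℝ) : MeasurableSet (timeDomain τ) := by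
  have : timeDomain τ = Ici 0 ∩ ⋃ n, Iio (switchTime τ n) := by
    ext t; simp [timeDomain]
  rw [this]
  exact measurableSet_Ici.inter (MeasurableSet.iUnion fun _ => measurableSet_Iio)

/-- At almost every time the patched field is a field patched from slices with a property that
holds at almost every time. -/
theorem ae_exists_patched_eq_snap {E : Type*} [AddCommGroup E] [Module ℝ E] {N : ℕ} {m ℓ : ℕ}
    {τ : ℝ} (hτ : 0 < τ) (c : ℕ → ℝ) {w : Fin N → ℝ → Plane → E} (J : Choice m ℓ N)
    {P : (Plane → E) → Prop} (hP : ∀ j, ∀ᵐ t ∂volume.restrict (Icc (0 : ℝ) 1), P (w j t)) :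
    ∀ᵐ t ∂volume.restrict (timeDomain τ), ∃ (n : ℕ) (W : (Fin 2 → Fin (m * ℓ ^ n)) → Plane → E),
      (∀ Q, P (W Q)) ∧ patched m ℓ τ c w J t = snap (m * ℓ ^ n) (c n) W := by
  rw [ae_restrict_iff' (measurableSet_timeDomain τ)]
  -- There are countably many steps and finitely many basic fields, so one null set of times serves
  -- for all of them, whatever the choice `J`.
  have h1 : ∀ᵐ t : ℝ, ∀ (n : ℕ) (j : Fin N), (t - switchTime τ n) / τ ^ n ∈ Icc (0 : ℝ) 1 →
      P (w j ((t - switchTime τ n) / τ ^ n)) :=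
    ae_all_iff.2 fun n => ae_all_iff.2 fun j =>
      ae_rescaled_time (P := fun t => P (w j t)) (hP j) _ (pow_ne_zero n hτ.ne')
  filter_upwards [h1] with t ht htd
  obtain ⟨n, hn⟩ := exists_mem_stage htd
  exact ⟨n, _, fun Q => ht n (J n Q) (div_mem_Icc_of_mem_stage hτ hn), patched_eq_snap hτ c w J hn⟩

/-- The properties of the velocity fields that hold at almost every time. -/
structure IsSlice (s : ℝ) (p : ℝ≥0∞) (M : ℝ) (C : ℝ≥0) (w : Plane → Plane) : Prop where
  measurable : AEStronglyMeasurable w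
  bounded : ∀ᵐ x, ‖w x‖ ≤ M
  tangent : IsTangentToUnitSquare w
  sobolev : FieldSobolevBound (⌈s⌉₊ : ℝ) p w C

/-- This is where the time scale τ = ℓ^(s-1) is used: from one step to the next the amplitude is
multiplied by 1/(ℓτ) = ℓ^(-s), while K^s is multiplied by ℓ^s. -/
theorem amplitude_mul_rpow {m ℓ : ℕ} (hm : 1 ≤ m) (hℓ : 2 ≤ ℓ) {s τ : ℝ}
    (hτ : τ = (1 / (ℓ : ℝ)) ^ (1 - s)) (n : ℕ) :
    |(1 / (m : ℝ)) * (1 / (ℓ : ℝ)) ^ n / τ ^ n| * ((m * ℓ ^ n : ℕ) : ℝ) ^ s = (m : ℝ) ^ (s - 1) := by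
  have hm0 : (0 : ℝ) < m := by exact_mod_cast hm
  have hl0 : (0 : ℝ) < ℓ := by exact_mod_cast (by omega : 0 < ℓ)
  have hτ' : τ = (ℓ : ℝ) ^ s / ℓ := by
    rw [hτ, one_div, Real.inv_rpow hl0.le, Real.rpow_sub hl0, Real.rpow_one, inv_div]
  have hls : (0 : ℝ) < (ℓ : ℝ) ^ s := Real.rpow_pos_of_pos hl0 s
  rw [abs_of_pos (by rw [hτ']; positivity)]
  push_cast
  rw [Real.mul_rpow hm0.le (by positivity), ← Real.rpow_natCast (ℓ : ℝ) n, ← Real.rpow_mul hl0.le,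
    mul_comm (n : ℝ) s, Real.rpow_mul hl0.le, Real.rpow_natCast, hτ', Real.rpow_sub hm0,
    Real.rpow_one, div_pow, div_pow, one_pow]
  field_simp

end QuasiSelfSimilar

theorem lemmal (s : ℝ) (hs : 0 < s) (p : ℝ≥0∞) (hp : 1 ≤ p) (N ℓ m : ℕ) (hm : 1 ≤ m)
    (v : Fin N → ℝ → QuasiSelfSimilar.Plane → QuasiSelfSimilar.Plane)
    (θ : Fin N → ℝ → QuasiSelfSimilar.Plane → ℝ)
    (hfam : QuasiSelfSimilar.IsBasicFamily s p ℓ v θ)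
    (τ : ℝ) (hτ : τ = (1 / (ℓ : ℝ)) ^ (1 - s))
    (J : QuasiSelfSimilar.Choice m ℓ N)
    (hJ : QuasiSelfSimilar.IsAdmissible m ℓ τ θ J)
    (hreg : ∀ᵐ t ∂volume.restrict (QuasiSelfSimilar.timeDomain τ),
      ∃ C : ℝ≥0, QuasiSelfSimilar.FieldSobolevBound (⌈s⌉₊ : ℝ) p
        (QuasiSelfSimilar.velocity m ℓ τ v J t) C) :
    (∀ᵐ t ∂volume.restrict (QuasiSelfSimilar.timeDomain τ),
      QuasiSelfSimilar.IsDivFree (QuasiSelfSimilar.velocity m ℓ τ v J t)) ∧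
    ∃ C : ℝ≥0, ∀ᵐ t ∂volume.restrict (QuasiSelfSimilar.timeDomain τ),
      QuasiSelfSimilar.FieldSobolevBound s p (QuasiSelfSimilar.velocity m ℓ τ v J t) C := by
  have hℓ := hfam.two_le
  have hτ0 : 0 < τ := by
    rw [hτ]
    have : (0 : ℝ) < ℓ := by exact_mod_cast (by omega : 0 < ℓ)
    positivity
  have hK : ∀ n, 0 < m * ℓ ^ n := fun n => Nat.mul_pos hm (pow_pos (by omega) n)
  choose C₀ hC₀ using hfam.velocity_sobolev
  choose M₀ hM₀ using hfam.velocity_bounded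
  obtain ⟨C, hC⟩ : ∃ C : ℝ≥0, ∀ j, C₀ j ≤ C := Finite.exists_le C₀
  obtain ⟨M, hM, hM'⟩ : ∃ M : ℝ, 0 ≤ M ∧ ∀ j, M₀ j ≤ M := by
    obtain ⟨M, hM⟩ := Finite.exists_le M₀
    exact ⟨max M 0, le_max_right _ _, fun j => (hM j).trans (le_max_left _ _)⟩
  -- The family is finite, so one M and one C serve for all basic fields; the measurability of a
  -- slice is part of its being divergence-free.
  have hP : ∀ j, ∀ᵐ t ∂volume.restrict (Icc (0 : ℝ) 1),
      QuasiSelfSimilar.IsSlice s p M C (v j t) := by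
    intro j
    filter_upwards [hC₀ j, hM₀ j, hfam.velocity_divFree j, hfam.velocity_tangent j]
      with t h1 h2 h3 h4
    refine ⟨h3.1.aestronglyMeasurable, ?_, h4, fun i => (h1 i).mono (hC j)⟩
    filter_upwards [h2] with x hx
    exact hx.trans (hM' j)
  have hsnap := QuasiSelfSimilar.ae_exists_patched_eq_snap hτ0
    (fun n => (1 / (m : ℝ)) * (1 / (ℓ : ℝ)) ^ n / τ ^ n) J hP
  constructor
  · filter_upwards [hsnap] with t ⟨n, W, hW, hu⟩
    rw [QuasiSelfSimilar.velocity, hu]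
    exact QuasiSelfSimilar.isDivFree_snap (hK n) _ hM (fun Q => (hW Q).measurable)
      (fun Q => (hW Q).bounded) fun Q => (hW Q).tangent
  -- The constant is fixed before the time: it depends on the step only through a K^s, which is
  -- m^(s-1) at every step. The regularity at the given time enters only qualitatively, through
  -- `C₁`.
  · obtain ⟨C', hC'⟩ := QuasiSelfSimilar.exists_sobolevBound_snap hs hp C hM ((m : ℝ) ^ (s - 1))
    refine ⟨C', ?_⟩
    filter_upwards [hsnap, hreg] with t ⟨n, W, hW, hu⟩ ⟨C₁, hC₁⟩ i
    have h1 := hC₁ i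
    rw [QuasiSelfSimilar.velocity, hu, QuasiSelfSimilar.snap_apply (hK n)] at h1 ⊢
    refine hC' _ (hK n) _ (QuasiSelfSimilar.amplitude_mul_rpow hm hℓ hτ n).le _ (fun Q => ?_)
      (fun Q => ?_) (fun Q => (hW Q).sobolev i) ⟨C₁, h1⟩
    · exact (EuclideanSpace.proj (𝕜 := ℝ) i).continuous.comp_aestronglyMeasurable (hW Q).measurable
    · filter_upwards [(hW Q).bounded] with x hx
      exact (PiLp.norm_apply_le (W Q x) i).trans hx
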